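/- **Setting.** Let $\omega=e^{2\pi i/3}$, $J=\mathrm{diag}(1,\omega^2,\omega)$, and for $k\in\mathbb C$ let $l_j(k)$ and $z_j(k)$ ($j=1,2,3$) be the diagonal entries of $\mathcal L=kJ$ and $\mathcal Z=-k^2J^2$. For a diagonal matrix $D$ write $e^{\hat D}X=e^DXe^{-D}$. Let $$V_1=\begin{pmatrix}0&q&r\\ r&0&q\\ q&r&0\end{pmatrix},\qquad V_2=k\begin{pmatrix}0&\omega q&\omega^2r\\ \omega r&0&q\\ \omega^2q&r&0\end{pmatrix} +\frac{i}{\sqrt3}\begin{pmatrix}0&q_x&-r_x\\-r_x&0&q_x\\ q_x&-r_x&0\end{pmatrix} -\begin{pmatrix}0&r^2&q^2\\ q^2&0&r^2\\ r^2&q^2&0\end{pmatrix}.$$ Let $0<T<\infty$ and let $q(x,t),r(x,t)$ be complex-valued solutions of $$iq_t+\tfrac1{\sqrt3}q_{xx}+2irr_x=0,\qquad ir_t-\tfrac1{\sqrt3}r_{xx}+2iqq_x=0,\qquad 0<x<\infty,\ 0<t<T.$$ Write $q_0=q(\cdot,0)$, $r_0=r(\cdot,0)$, $g_0=q(0,\cdot)$,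 $h_0=r(0,\cdot)$, $g_1=q_x(0,\cdot)$, $h_1=r_x(0,\cdot)$. *Spectral functions.* Let $\mathcal S=\{0<\arg k<2\pi/3\}$ and $\hat{\mathcal S}=-\mathcal S$. For $k\in\bar{\mathcal S}$, $(s_{13},s_{23},s_{33})(k)$ is the value at $x=0$ of the bounded continuous solution $w$ on $[0,\infty)$ of $$w_i(x)=\delta_{i3}-\int_x^\infty e^{(l_i-l_3)(x-x')}\bigl(V_1(x',0)w(x')\bigr)_i\,dx',\qquad i=1,2,3.$$ For $k\in\mathbb C$ and $0\le t\le T$, let $\mu_1(0,t,k)$ and $\mu_2(0,t,k)$ be the continuous solutions of $$\mu_j(0,t,k)=I+\int_{t_j}^te^{(t-t')\hat{\mathcal Z}(k)}\bigl(V_2\,\mu_j\bigr)(0,t',k)\,dt',\qquad t_1=T,\ t_2=0.$$ Set $S(k)=\mu_1(0,0,k)$, and let $(\Phi_1,\Phi_2,\Phi_3)^T(t,k)$ be the third column of $\mu_2(0,t,k)$. Write $\hat s_{ij}(k)=s_{ij}(-k)$ and $f_\pm(k)=f(k)\pm f(-k)$. Orient $\partial\hat{\mathcal S}$ so that $\hat{\mathcal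 S}$ lies to its left; $\int_{\partial\hat{\mathcal S}}$ means the limit as $R\to\infty$ of the integral over $\partial\hat{\mathcal S}\cap\{|k|\le R\}$. **Theorem.** There is an absolute integer $N$ such that the following holds. Suppose that $q,r$ are $N$ times continuously differentiable on $[0,\infty)\times[0,T]$, that their derivatives of order at most $N$ are $O((1+x)^{-N})$ uniformly in $t\in[0,T]$, that $q_0,r_0$ are of Schwartz class on $[0,\infty)$, and that $s_{33}$ has no zeros in $\bar{\mathcal S}$. Then: For each $k\in\mathbb C$, $(\Phi_1,\Phi_2,\Phi_3)(\cdot,k)$ is the unique continuous solution on $[0,T]$ of the Volterra system $$\Phi_1(t,k)=\int_0^te^{(z_1-z_3)(t-t')}\Bigl[\bigl(k\omega g_0+\tfrac{ig_1}{\sqrt3}-h_0^2\bigr)\Phi_2+\bigl(k\omega^2h_0-g_0^2-\tfrac{ih_1}{\sqrt3}\bigr)\Phi_3\Bigr](t',k)\,dt',$$ $$\Phi_2(t,k)=\int_0^te^{(z_2-z_3)(t-t')}\Bigl[\bigl(k\omega h_0-g_0^2-\tfrac{ih_1}{\sqrt3}\bigr)\Phi_1+\bigl(kg_0+\tfrac{ig_1}{\sqrt3}-h_0^2\bigr)\Phi_3\Bigr](t',k)\,dt',$$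 $$\Phi_3(t,k)=1+\int_0^t\Bigl[\bigl(k\omega^2g_0+\tfrac{ig_1}{\sqrt3}-h_0^2\bigr)\Phi_1+\bigl(kh_0-g_0^2-\tfrac{ih_1}{\sqrt3}\bigr)\Phi_2\Bigr](t',k)\,dt'.$$ For all $k\in\mathbb C$, $$S(k)=\begin{pmatrix}A(\omega^2k)&B(\omega k)&C(k)\\ C(\omega^2k)&A(\omega k)&B(k)\\ B(\omega^2k)&C(\omega k)&A(k)\end{pmatrix},$$ where $$A(k)=\Phi_3(T,\omega^2k)\Phi_3(T,\omega k)-\Phi_1(T,\omega^2k)\Phi_2(T,\omega k),$$ $$B(k)=-\bigl[\Phi_3(T,\omega^2k)\Phi_2(T,k)-\Phi_1(T,\omega^2k)\Phi_1(T,k)\bigr]e^{(z_3(k)-z_2(k))T},$$ $$C(k)=\bigl[\Phi_2(T,\omega k)\Phi_2(T,k)-\Phi_3(T,\omega k)\Phi_1(T,k)\bigr]e^{(z_3(k)-z_1(k))T}.$$ Put $$G_1(t,k)=\Phi_3(t,-\omega^2k)e^{(z_1-z_3)t}\frac{\hat s_{13}}{\hat s_{33}}+\Phi_2(t,-\omega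 k)e^{(z_2-z_3)t}\frac{\hat s_{23}}{\hat s_{33}},\qquad G_2(t,k)=\Phi_1(t,-\omega^2k)e^{(z_1-z_3)t}\frac{\hat s_{13}}{\hat s_{33}}+\Phi_3(t,-\omega k)e^{(z_2-z_3)t}\frac{\hat s_{23}}{\hat s_{33}}.$$ (a) (Dirichlet problem.) For $0<t<T$ the following integrals converge and the unknown Neumann values are $$g_1(t)=\frac3{2\pi i}\int_{\partial\hat{\mathcal S}}\Bigl[k\Phi_{2-}-\frac{2g_0(t)}{i\sqrt3}\Bigr]dk-\omega h_0^2(t)+\frac{3\sqrt3g_0(t)}{2\pi}\int_{\partial\hat{\mathcal S}}\Phi_{3-}\,dk-\frac3{\pi i}\int_{\partial\hat{\mathcal S}}kG_2\,dk,$$ $$h_1(t)=\frac{3\omega}{2\pi i}\int_{\partial\hat{\mathcal S}}\Bigl[k\Phi_{1-}+\frac{2\omega h_0(t)}{i\sqrt3}\Bigr]dk-\omega^2g_0^2(t)-\frac{3\sqrt3\omega^2h_0(t)}{2\pi}\int_{\partial\hat{\mathcal S}}\Phi_{3-}\,dk-\frac{3\omega}{\pi i}\int_{\partial\hat{\mathcal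 S}}kG_1\,dk.$$ (b) (Neumann problem.) For $0<t<T$ the following integrals converge and the unknown Dirichlet values are $$g_0(t)=\frac{\sqrt3}{2\pi}\int_{\partial\hat{\mathcal S}}\Phi_{2+}\,dk+\frac{\sqrt3}{\pi}\int_{\partial\hat{\mathcal S}}G_2\,dk,\qquad h_0(t)=-\frac{\omega^2\sqrt3}{2\pi}\int_{\partial\hat{\mathcal S}}\Phi_{1+}\,dk-\frac{\omega^2\sqrt3}{\pi}\int_{\partial\hat{\mathcal S}}G_1\,dk.$$ -/

import Mathlib

open Set Filter Topology MeasureTheory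

namespace LaxIBV

noncomputable section

/-- The primitive cube root of unity `ω = e^{2πi/3}`. -/
def ω : ℂ := Complex.exp (2 * (Real.pi : ℂ) * Complex.I / 3)

/-- The diagonal of the matrix `J = diag(1, ω², ω)`. -/
def Jdiag : Fin 3 → ℂ := ![1, ω ^ 2, ω]

/-- The diagonal entries `l₁, l₂, l₃` of `𝓛 = k J` (indexed by `0, 1, 2`). -/
def l (k : ℂ) : Fin 3 → ℂ := fun i => k * Jdiag i

/-- The diagonal entries `z₁, z₂, z₃` of `𝓩 = -k² J²` (indexed by `0, 1, 2`). -/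
def z (k : ℂ) : Fin 3 → ℂ := fun i => -(k ^ 2 * Jdiag i ^ 2)

/-- The coefficient `V₁` of the `x`-part of the Lax pair, as a function of the values of `q, r`. -/
def V₁ (q r : ℂ) : Matrix (Fin 3) (Fin 3) ℂ :=
  !![0, q, r;
     r, 0, q;
     q, r, 0]

/-- The coefficient `V₂ = k V₂⁽¹⁾ + V₂⁽⁰⁾` of the `t`-part of the Lax pair, as a function of the
values of `q, r, q_x, r_x` (the last two are called `q'` and `r'`). -/
def V₂ (k q r q' r' : ℂ) : Matrix (Fin 3) (Fin 3) ℂ :=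
  k • !![0, ω * q, ω ^ 2 * r;
         ω * r, 0, q;
         ω ^ 2 * q, r, 0]
  + ((Complex.I / (Real.sqrt 3 : ℂ)) • !![0, q', -r';
                                          -r', 0, q';
                                          q', -r', 0]
    - !![0, r ^ 2, q ^ 2;
         q ^ 2, 0, r ^ 2;
         r ^ 2, q ^ 2, 0])

/-- The four boundary functions: the Dirichlet values `g₀, h₀` of `q, r` at `x = 0`, and the
Neumann values `g₁, h₁`, the values of `q_x, r_x` at `x = 0`. -/
structure BoundaryValues where
  g₀ : ℝ → ℂ
  h₀ : ℝ → ℂ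
  g₁ : ℝ → ℂ
  h₁ : ℝ → ℂ

/-- The closed half-strip `{0 ≤ x < ∞, 0 ≤ t ≤ T}`. -/
def closedStrip (T : ℝ) : Set (ℝ × ℝ) := Ici 0 ×ˢ Icc 0 T

/-- `u(x,t)` is `N` times continuously differentiable up to the boundary of the half-strip, and
its derivatives of order at most `N` are `O(x^{-N})` as `x → ∞`, uniformly in `t`. -/
structure SmoothDecaying (N : ℕ) (T : ℝ) (u : ℝ → ℝ → ℂ) : Prop where
  contDiffOn : ContDiffOn ℝ N (fun p : ℝ × ℝ => u p.1 p.2) (closedStrip T)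
  decay : ∀ n ≤ N, ∃ C : ℝ, ∀ p ∈ closedStrip T,
    (1 + p.1) ^ N *
      ‖iteratedFDerivWithin ℝ n (fun p : ℝ × ℝ => u p.1 p.2) (closedStrip T) p‖ ≤ C

/-- `{q, r}` satisfies
`i q_t + q_xx / √3 + 2 i r r_x = 0`, `i r_t - r_xx / √3 + 2 i q q_x = 0`
for `0 < x < ∞`, `0 < t < T`. -/
def SolvesSystem (T : ℝ) (q r : ℝ → ℝ → ℂ) : Prop :=
  ∀ x t : ℝ, 0 < x → 0 < t → t < T →
    (Complex.I * deriv (fun t' => q x t') t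
        + 1 / (Real.sqrt 3 : ℂ) * iteratedDeriv 2 (fun x' => q x' t) x
        + 2 * Complex.I * r x t * deriv (fun x' => r x' t) x = 0) ∧
    (Complex.I * deriv (fun t' => r x t') t
        - 1 / (Real.sqrt 3 : ℂ) * iteratedDeriv 2 (fun x' => r x' t) x
        + 2 * Complex.I * q x t * deriv (fun x' => q x' t) x = 0)

/-- For a diagonal matrix `D = diag(d₁, d₂, d₃)`, the operator `e^{D̂}` acting on `3 × 3` matrices
by `X ↦ e^D X e^{-D}`; here `D̂ X = [D, X]`. -/
def expHat (d : Fin 3 → ℂ) (X : Matrix (Fin 3) (Fin 3) ℂ) : Matrix (Fin 3) (Fin 3) ℂ :=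
  Matrix.diagonal (fun i => Complex.exp (d i)) * X * Matrix.diagonal (fun i => Complex.exp (-d i))

/-- The Volterra equation on the boundary `x = 0`, `0 ≤ t ≤ T`, with base point `(0, τ)`:
`μ(t) = I + ∫_τ^t e^{(t-t') 𝓩̂(k)} (V₂ μ)(t') dt'`. -/
def IsTimeEigenfunction (T : ℝ) (b : BoundaryValues) (τ : ℝ) (k : ℂ)
    (μ : ℝ → Matrix (Fin 3) (Fin 3) ℂ) : Prop :=
  (∀ i j, ContinuousOn (fun t => μ t i j) (Icc 0 T)) ∧
  ∀ t ∈ Icc 0 T, ∀ i j, μ t i j = (1 : Matrix (Fin 3) (Fin 3) ℂ) i j +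
    ∫ t' in τ..t, expHat (fun m => ((t - t' : ℝ) : ℂ) * z k m)
      (V₂ k (b.g₀ t') (b.h₀ t') (b.g₁ t') (b.h₁ t') * μ t') i j

/-- The solution of the Volterra equation on the boundary `x = 0` with base point `(0, τ)`. -/
def timeEigenfunction (T : ℝ) (b : BoundaryValues) (τ t : ℝ) (k : ℂ) :
    Matrix (Fin 3) (Fin 3) ℂ :=
  Classical.epsilon (IsTimeEigenfunction T b τ k) t

/-- `μ₁(0,t,k)`, normalized at `(0, T)`. -/
def μ₁ (T : ℝ) (b : BoundaryValues) (t : ℝ) (k : ℂ) : Matrix (Fin 3) (Fin 3) ℂ :=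
  timeEigenfunction T b T t k

/-- `μ₂(0,t,k)`, normalized at `(0, 0)`. -/
def μ₂ (T : ℝ) (b : BoundaryValues) (t : ℝ) (k : ℂ) : Matrix (Fin 3) (Fin 3) ℂ :=
  timeEigenfunction T b 0 t k

/-- The spectral function `S(k) = μ₁(0,0,k)`. -/
def S (T : ℝ) (b : BoundaryValues) (k : ℂ) : Matrix (Fin 3) (Fin 3) ℂ := μ₁ T b 0 k

/-- The first entry `Φ₁` of the third column of `μ₂(0,t,k)`. -/
def Φ₁ (T : ℝ) (b : BoundaryValues) (t : ℝ) (k : ℂ) : ℂ := μ₂ T b t k 0 2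

/-- The second entry `Φ₂` of the third column of `μ₂(0,t,k)`. -/
def Φ₂ (T : ℝ) (b : BoundaryValues) (t : ℝ) (k : ℂ) : ℂ := μ₂ T b t k 1 2

/-- The third entry `Φ₃` of the third column of `μ₂(0,t,k)`. -/
def Φ₃ (T : ℝ) (b : BoundaryValues) (t : ℝ) (k : ℂ) : ℂ := μ₂ T b t k 2 2

/-- The Volterra equation for the `j`th column `w` of `μ₃` on the half-line `t = 0`, with base
point `x = ∞`:
`w_i(x) = δ_ij - ∫_x^∞ e^{(l_i - l_j)(x - x')} (V₁ w)_i(x') dx'`, with `w` bounded. -/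
def IsSpaceColumn (q₀ r₀ : ℝ → ℂ) (j : Fin 3) (k : ℂ) (w : ℝ → Fin 3 → ℂ) : Prop :=
  ContinuousOn w (Ici 0) ∧ (∃ C : ℝ, ∀ x ∈ Ici (0 : ℝ), ‖w x‖ ≤ C) ∧
  ∀ x ∈ Ici (0 : ℝ), ∀ i, w x i = (1 : Matrix (Fin 3) (Fin 3) ℂ) i j -
    ∫ x' in Ioi x, Complex.exp ((l k i - l k j) * ((x - x' : ℝ) : ℂ)) *
      (V₁ (q₀ x') (r₀ x')).mulVec (w x') i

/-- The `(i,j)` entry of the spectral function `s(k) = μ₃(0,0,k)`. The `j`th column is meaningful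
for those `k` with `Re l_j(k) ≤ Re l_i(k)` for all `i`. -/
def s (q₀ r₀ : ℝ → ℂ) (i j : Fin 3) (k : ℂ) : ℂ :=
  Classical.epsilon (IsSpaceColumn q₀ r₀ j k) 0 i

/-- The closure of the sector `𝓢 = {0 < arg k < 2π/3}`, on which the third column of `s(k)` is
defined. It is the set where `Re l₃ ≤ Re l₁` and `Re l₃ ≤ Re l₂`. -/
def closedSector : Set ℂ := {k | ∀ i, (l k 2).re ≤ (l k i).re}

/-- `∫_{∂𝓢̂} f(k) dk = c`, where `∂𝓢̂` is the boundary of the sector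
`𝓢̂ = -𝓢 = {π < arg k < 5π/3}`, oriented so that `𝓢̂` lies to its left: it comes in from `∞` to
`0` along the ray `k = -ωρ` (`arg k = 5π/3`), and goes out to `∞` along the ray `k = -ρ`
(`arg k = π`). The integral is the limit as `R → ∞` of the integrals over the part of the contour
in `|k| ≤ R`. -/
def HasContourIntegral (f : ℂ → ℂ) (c : ℂ) : Prop :=
  (∀ R : ℝ, 0 < R → IntervalIntegrable (fun ρ : ℝ => f (-(ρ : ℂ))) volume 0 R) ∧
  (∀ R : ℝ, 0 < R → IntervalIntegrable (fun ρ : ℝ => f (-ω * (ρ : ℂ))) volume 0 R) ∧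
  Tendsto (fun R : ℝ =>
      -(∫ ρ in (0 : ℝ)..R, f (-ω * (ρ : ℂ)) * (-ω)) + ∫ ρ in (0 : ℝ)..R, f (-(ρ : ℂ)) * (-1))
    atTop (𝓝 c)

/-- The triple `φ₁, φ₂, φ₃` of continuous functions on `[0,T]` solves, for the given `k`, the
linear Volterra system of integral equations
`φ₁(t) = ∫₀ᵗ e^{(z₁-z₃)(t-t')} [(kωg₀ + i g₁/√3 - h₀²) φ₂ + (kω²h₀ - g₀² - i h₁/√3) φ₃](t') dt'`,
`φ₂(t) = ∫₀ᵗ e^{(z₂-z₃)(t-t')} [(kωh₀ - g₀² - i h₁/√3) φ₁ + (k g₀ + i g₁/√3 - h₀²) φ₃](t') dt'`,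
`φ₃(t) = 1 + ∫₀ᵗ [(kω²g₀ + i g₁/√3 - h₀²) φ₁ + (k h₀ - g₀² - i h₁/√3) φ₂](t') dt'`. -/
structure SolvesVolterra (T : ℝ) (b : BoundaryValues) (k : ℂ) (φ₁ φ₂ φ₃ : ℝ → ℂ) : Prop where
  continuousOn₁ : ContinuousOn φ₁ (Icc 0 T)
  continuousOn₂ : ContinuousOn φ₂ (Icc 0 T)
  continuousOn₃ : ContinuousOn φ₃ (Icc 0 T)
  eq₁ : ∀ t ∈ Icc 0 T, φ₁ t = ∫ t' in (0 : ℝ)..t,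
    Complex.exp ((z k 0 - z k 2) * ((t - t' : ℝ) : ℂ)) *
      ((k * ω * b.g₀ t' + Complex.I * b.g₁ t' / (Real.sqrt 3 : ℂ) - b.h₀ t' ^ 2) * φ₂ t'
        + (k * ω ^ 2 * b.h₀ t' - b.g₀ t' ^ 2 - Complex.I * b.h₁ t' / (Real.sqrt 3 : ℂ)) * φ₃ t')
  eq₂ : ∀ t ∈ Icc 0 T, φ₂ t = ∫ t' in (0 : ℝ)..t,
    Complex.exp ((z k 1 - z k 2) * ((t - t' : ℝ) : ℂ)) *
      ((k * ω * b.h₀ t' - b.g₀ t' ^ 2 - Complex.I * b.h₁ t' / (Real.sqrt 3 : ℂ)) * φ₁ t'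
        + (k * b.g₀ t' + Complex.I * b.g₁ t' / (Real.sqrt 3 : ℂ) - b.h₀ t' ^ 2) * φ₃ t')
  eq₃ : ∀ t ∈ Icc 0 T, φ₃ t = 1 + ∫ t' in (0 : ℝ)..t,
      ((k * ω ^ 2 * b.g₀ t' + Complex.I * b.g₁ t' / (Real.sqrt 3 : ℂ) - b.h₀ t' ^ 2) * φ₁ t'
        + (k * b.h₀ t' - b.g₀ t' ^ 2 - Complex.I * b.h₁ t' / (Real.sqrt 3 : ℂ)) * φ₂ t')

/-- The even combination `f₊(k) = f(k) + f(-k)`. -/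
def evenPart (f : ℂ → ℂ) (k : ℂ) : ℂ := f k + f (-k)

/-- The odd combination `f₋(k) = f(k) - f(-k)`. -/
def oddPart (f : ℂ → ℂ) (k : ℂ) : ℂ := f k - f (-k)

/-- The combination
`Φ₃(t,-ω²k) e^{(z₁-z₃)t} ŝ₁₃/ŝ₃₃ + Φ₂(t,-ωk) e^{(z₂-z₃)t} ŝ₂₃/ŝ₃₃`, where `f̂(k) = f(-k)`. -/
def G₁ (T : ℝ) (q₀ r₀ : ℝ → ℂ) (b : BoundaryValues) (t : ℝ) (k : ℂ) : ℂ :=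
  Φ₃ T b t (-ω ^ 2 * k) * Complex.exp ((z k 0 - z k 2) * (t : ℂ))
      * (s q₀ r₀ 0 2 (-k) / s q₀ r₀ 2 2 (-k))
    + Φ₂ T b t (-ω * k) * Complex.exp ((z k 1 - z k 2) * (t : ℂ))
      * (s q₀ r₀ 1 2 (-k) / s q₀ r₀ 2 2 (-k))

/-- The combination
`Φ₁(t,-ω²k) e^{(z₁-z₃)t} ŝ₁₃/ŝ₃₃ + Φ₃(t,-ωk) e^{(z₂-z₃)t} ŝ₂₃/ŝ₃₃`, where `f̂(k) = f(-k)`. -/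
def G₂ (T : ℝ) (q₀ r₀ : ℝ → ℂ) (b : BoundaryValues) (t : ℝ) (k : ℂ) : ℂ :=
  Φ₁ T b t (-ω ^ 2 * k) * Complex.exp ((z k 0 - z k 2) * (t : ℂ))
      * (s q₀ r₀ 0 2 (-k) / s q₀ r₀ 2 2 (-k))
    + Φ₃ T b t (-ω * k) * Complex.exp ((z k 1 - z k 2) * (t : ℂ))
      * (s q₀ r₀ 1 2 (-k) / s q₀ r₀ 2 2 (-k))

end

end LaxIBV

namespace LaxIBV

/-! ### Arithmetic of the cube root of unity -/

noncomputable section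

/-! The system for `q, r` is the compatibility condition of the Lax pair, and the formulas come from
comparing two solutions of its `t`-part on `x = 0`. One is the third column of `μ₂`, entire in `k`.
The other is the boundary value of the column that solves the `x`-part and tends to `e₃` as `x → ∞`
(`stripSol`), holomorphic in the sector. Zero curvature (`hasDerivAt_laxB`) shows that the second
one also solves the `t`-part (`LaxData.hasDerivAt_stripSol_zero`), so it equals `μ₂` applied to its
initial value with exponential factors. This is the global relation, `LaxBdry.global_relation`.
Divided by `s₃₃` it reads `G(k) = c(-k)/s₃₃(-k) - Φ(-k)`, where `c` is the first or second entry of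
the space column (`InitialData.G₁_eq`, `InitialData.G₂_eq`).

Both terms on the right are expanded as `a/k + β/k²` with the same `a` and `β`. For the space column
this is a truncated formal series with a Volterra estimate of the error (`PotJet.asymptotics`). For
the time column it is a gauge transformation removing the coefficients of the `t`-part up to order
`k⁻²`, valid where the exponentials are bounded (`SmoothBdry.asymptotics`). The third entry of the
space column has a coefficient `m(t)` of `1/k` that is an integral over the whole half-line, but its
increment is determined by the boundary values (`LaxBdry.thirdCoeff_eq`) and division by `s₃₃`
removes `m(0)` (`InitialData.ratio_asymptotics`). Here `a` is a multiple of a Dirichlet value, and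
`β` is a Neumann value up to a factor and Dirichlet terms.

The contour integrals then extract `a` and `β`. The quotient `c/s₃₃` is holomorphic in the sector,
so Cauchy's theorem leaves an arc of angle `2π/3` at infinity, one third of a full residue
(`hasContourIntegral_of_sector`). For an entire `h` with `h ~ A/k`, rotating the rays to the middle
of the two wedges of decay shows that the integrals of `h(k)` and `h(-k)` both converge, to values
that are not explicit but differ by `2πiA/3` (`exists_hasContourIntegral`). In the combinations of
the theorem the unknown value cancels and the thirds add up to `2πi a` or `2πi β`
(`exists_contour_integrals`); solving for the boundary values is algebra.

Existence, bounds and parameter dependence all rest on one Volterra operator on a half-line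
(`exists_volterra_solution`, `norm_volterra_solution_le`, `volterra_taylor`); the interval `[0,T]`
is reduced to it by time reversal. The expression for `S` follows from the cyclic symmetry `k ↦ ωk`,
which rebuilds `μ₂` from its third column, and from `det μ₂ = 1`, which makes its inverse an
adjugate. -/

lemma ω_eq : ω = -1 / 2 + (Real.sqrt 3 : ℂ) / 2 * Complex.I := by
  have h : (2 * (Real.pi : ℂ) * Complex.I / 3) = ((Real.pi - Real.pi / 3 : ℝ) : ℂ) * Complex.I := by
    push_cast; ring
  rw [ω, h, Complex.exp_mul_I, ← Complex.ofReal_cos, ← Complex.ofReal_sin, Real.cos_pi_sub,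
    Real.sin_pi_sub, Real.cos_pi_div_three, Real.sin_pi_div_three]
  push_cast; ring

lemma sqrt3_sq : (Real.sqrt 3 : ℂ) ^ 2 = 3 := by
  rw [← Complex.ofReal_pow, Real.sq_sqrt (by norm_num)]; norm_num

lemma ω_sq : ω ^ 2 = -1 - ω := by
  rw [ω_eq]
  linear_combination (-1 / 4 : ℂ) * sqrt3_sq + (Real.sqrt 3 : ℂ) ^ 2 / 4 * Complex.I_sq

lemma ω_cube : ω ^ 3 = 1 := by
  linear_combination (ω - 1) * ω_sq

lemma I_mul_sqrt3 : Complex.I * (Real.sqrt 3 : ℂ) = 2 * ω + 1 := by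
  rw [ω_eq]; ring

lemma sqrt3_ne : (Real.sqrt 3 : ℂ) ≠ 0 := by
  intro h; have := sqrt3_sq; rw [h] at this; norm_num at this

lemma sqrt3_eq : (Real.sqrt 3 : ℂ) = -Complex.I * (2 * ω + 1) := by
  linear_combination (-Complex.I) * I_mul_sqrt3 + (Real.sqrt 3 : ℂ) * Complex.I_sq

/-- Eliminates `i` and `√3`, so that the later coefficient identities become polynomial identities
modulo `ω² + ω + 1 = 0`. -/
lemma I_div_sqrt3 : Complex.I / (Real.sqrt 3 : ℂ) = (2 * ω + 1) / 3 := by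
  rw [div_eq_div_iff sqrt3_ne (by norm_num), sqrt3_eq]
  linear_combination (4 * Complex.I) * ω_sq

lemma ω_re : ω.re = -1 / 2 := by
  rw [ω_eq]; simp [Complex.add_re, Complex.mul_re]

lemma ω_im : ω.im = Real.sqrt 3 / 2 := by
  rw [ω_eq]; simp [Complex.add_im, Complex.mul_im]

lemma ω_ne : ω ≠ 0 := Complex.exp_ne_zero _

lemma norm_ω : ‖ω‖ = 1 := by
  have h : (2 * (Real.pi : ℂ) * Complex.I / 3) = ((2 * Real.pi / 3 : ℝ) : ℂ) * Complex.I := by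
    push_cast; ring
  rw [ω, h, Complex.norm_exp_ofReal_mul_I]

@[simp] lemma l_zero (k : ℂ) : l k 0 = k := by simp [l, Jdiag]
@[simp] lemma l_one (k : ℂ) : l k 1 = k * ω ^ 2 := by simp [l, Jdiag]
@[simp] lemma l_two (k : ℂ) : l k 2 = k * ω := by simp [l, Jdiag]
@[simp] lemma z_zero (k : ℂ) : z k 0 = -k ^ 2 := by simp [z, Jdiag]
@[simp] lemma z_one (k : ℂ) : z k 1 = -(k ^ 2 * ω) := by
  simp only [z, Jdiag, Matrix.cons_val_one, Matrix.cons_val_zero]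
  linear_combination (-k ^ 2 * ω) * ω_cube
@[simp] lemma z_two (k : ℂ) : z k 2 = -(k ^ 2 * ω ^ 2) := by simp [z, Jdiag]

end

noncomputable section

/-! ### Volterra equations on a half-line -/

/-- A matrix kernel `N(x,y)`, `0 ≤ x < y`, that decays like `(1+y)⁻²`. -/
structure IsVolterraKernel (N : ℝ → ℝ → Matrix (Fin 3) (Fin 3) ℂ) (M : ℝ) : Prop where
  meas : ∀ x i j, Measurable fun y => N x y i j
  cont : ∀ y i j, Continuous fun x => N x y i j
  bound : ∀ x y, 0 ≤ x → x < y → ∀ i j, ‖N x y i j‖ ≤ M / (1 + y) ^ 2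

/-- The Volterra operator `(K f)(x) = ∫_x^∞ N(x,y) f(y) dy`, extended to `x < 0` by its value
at `0`. -/
def volterraOp (N : ℝ → ℝ → Matrix (Fin 3) (Fin 3) ℂ) (f : ℝ → Fin 3 → ℂ) (x : ℝ) : Fin 3 → ℂ :=
  fun i => ∫ y in Ioi (max x 0), (N (max x 0) y).mulVec (f y) i

/-- Continuous bounded vector functions. -/
def IsBC (f : ℝ → Fin 3 → ℂ) : Prop := Continuous f ∧ ∃ B, ∀ x, ‖f x‖ ≤ B

lemma IsBC.const (v : Fin 3 → ℂ) : IsBC fun _ => v := ⟨continuous_const, ‖v‖, fun _ => le_rfl⟩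

lemma IsBC.add {f g : ℝ → Fin 3 → ℂ} (hf : IsBC f) (hg : IsBC g) : IsBC fun x => f x + g x := by
  obtain ⟨hf, A, hA⟩ := hf
  obtain ⟨hg, B, hB⟩ := hg
  exact ⟨hf.add hg, A + B, fun x => (norm_add_le _ _).trans (add_le_add (hA x) (hB x))⟩

lemma IsBC.sub {f g : ℝ → Fin 3 → ℂ} (hf : IsBC f) (hg : IsBC g) : IsBC fun x => f x - g x := by
  obtain ⟨hf, A, hA⟩ := hf
  obtain ⟨hg, B, hB⟩ := hg
  exact ⟨hf.sub hg, A + B, fun x => (norm_sub_le _ _).trans (add_le_add (hA x) (hB x))⟩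

lemma norm_mulVec_le {A : Matrix (Fin 3) (Fin 3) ℂ} {v : Fin 3 → ℂ} {a b : ℝ}
    (hA : ∀ i j, ‖A i j‖ ≤ a) (hv : ‖v‖ ≤ b) (i : Fin 3) : ‖A.mulVec v i‖ ≤ 3 * a * b := by
  have ha : 0 ≤ a := (norm_nonneg _).trans (hA 0 0)
  have h : ∀ j, ‖A i j * v j‖ ≤ a * b := fun j => by
    rw [norm_mul]
    exact mul_le_mul (hA i j) ((norm_le_pi_norm v j).trans hv) (norm_nonneg _) ha
  simp only [Matrix.mulVec, dotProduct, Fin.sum_univ_three]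
  calc _ ≤ ‖A i 0 * v 0‖ + ‖A i 1 * v 1‖ + ‖A i 2 * v 2‖ := norm_add₃_le
    _ ≤ _ := by linarith [h 0, h 1, h 2]

/-- The weight `e^{L/(1+y)}`. -/
def expWeight (L y : ℝ) : ℝ := Real.exp (L * (1 + max y 0)⁻¹)

lemma expWeight_pos (L y : ℝ) : 0 < expWeight L y := Real.exp_pos _

lemma continuous_expWeight (L : ℝ) : Continuous (expWeight L) := by
  have h : ∀ y : ℝ, 1 + max y 0 ≠ 0 := fun y => by
    have := le_max_right y 0; positivity
  unfold expWeight
  have : Continuous fun y : ℝ => 1 + max y 0 := by fun_prop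
  have := this.inv₀ h
  fun_prop

lemma one_le_expWeight {L : ℝ} (hL : 0 ≤ L) (y : ℝ) : 1 ≤ expWeight L y := by
  apply Real.one_le_exp
  have := le_max_right y 0
  positivity

lemma expWeight_le {L : ℝ} (hL : 0 ≤ L) (y : ℝ) : expWeight L y ≤ Real.exp L := by
  apply Real.exp_le_exp.2
  have h := le_max_right y 0
  have : (1 + max y 0)⁻¹ ≤ 1 := inv_le_one_of_one_le₀ (by linarith)
  nlinarith

lemma hasDerivAt_weight (L : ℝ) {y : ℝ} (hy : 0 ≤ y) :
    HasDerivAt (fun y => -Real.exp (L * (1 + y)⁻¹)) (L * (1 / (1 + y) ^ 2 * Real.exp (L * (1 + y)⁻¹)))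
      y := by
  have h0 : (1 + y) ≠ 0 := by positivity
  have h := ((((hasDerivAt_id y).const_add 1).inv h0).const_mul L).exp.neg
  refine h.congr_deriv ?_
  simp only [id, Pi.inv_apply]
  ring

lemma tendsto_weight (L : ℝ) :
    Tendsto (fun y : ℝ => -Real.exp (L * (1 + y)⁻¹)) atTop (𝓝 (-1)) := by
  have : Tendsto (fun y : ℝ => (1 + y)⁻¹) atTop (𝓝 0) :=
    tendsto_inv_atTop_zero.comp (tendsto_atTop_add_const_left _ 1 tendsto_id)
  have h := (Real.continuous_exp.tendsto _).comp (this.const_mul L)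
  simp only [mul_zero, Real.exp_zero] at h
  exact h.neg

/-- The weight is the exponential of `L` times the tail integral of `(1+y)⁻²`, so the integrand is
an exact derivative up to the factor `L`; the gain `1/L` is what makes the Volterra operator
contract. -/
lemma integral_weight {L : ℝ} (hL : 0 < L) {x : ℝ} (hx : 0 ≤ x) :
    IntegrableOn (fun y => 1 / (1 + y) ^ 2 * Real.exp (L * (1 + y)⁻¹)) (Ioi x) ∧
    ∫ y in Ioi x, 1 / (1 + y) ^ 2 * Real.exp (L * (1 + y)⁻¹) =
      (Real.exp (L * (1 + x)⁻¹) - 1) / L := by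
  have hd : ∀ y ∈ Ici x, HasDerivAt (fun y => -Real.exp (L * (1 + y)⁻¹))
      (L * (1 / (1 + y) ^ 2 * Real.exp (L * (1 + y)⁻¹))) y :=
    fun y hy => hasDerivAt_weight L (hx.trans hy)
  have hi := integrableOn_Ioi_deriv_of_nonneg' hd (fun y _ => by positivity) (tendsto_weight L)
  refine ⟨?_, ?_⟩
  · have := hi.const_mul L⁻¹
    refine this.congr (Eventually.of_forall fun y => ?_)
    field_simp
  · have := integral_Ioi_of_hasDerivAt_of_tendsto' hd hi (tendsto_weight L)
    rw [integral_const_mul] at this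
    rw [eq_div_iff hL.ne', mul_comm, this]; ring

lemma integrableOn_inv_sq {x : ℝ} (hx : 0 ≤ x) :
    IntegrableOn (fun y : ℝ => 1 / (1 + y) ^ 2) (Ioi x) := by
  refine (integral_weight one_pos hx).1.mono' ?_ ?_
  · exact (by fun_prop : Measurable fun y : ℝ => 1 / (1 + y) ^ 2).aestronglyMeasurable
  · filter_upwards [ae_restrict_mem measurableSet_Ioi] with y hy
    have hy : 0 < y := hx.trans_lt hy
    rw [Real.norm_of_nonneg (by positivity)]
    exact le_mul_of_one_le_right (by positivity) (Real.one_le_exp (by positivity))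

section

variable {N : ℝ → ℝ → Matrix (Fin 3) (Fin 3) ℂ} {M : ℝ}

lemma IsVolterraKernel.nonneg (hN : IsVolterraKernel N M) : 0 ≤ M := by
  have := (norm_nonneg _).trans (hN.bound 0 1 le_rfl one_pos 0 0)
  norm_num at this; linarith

lemma IsVolterraKernel.mono (hN : IsVolterraKernel N M) {M' : ℝ} (h : M ≤ M') :
    IsVolterraKernel N M' :=
  ⟨hN.meas, hN.cont, fun x y hx hy i j => (hN.bound x y hx hy i j).trans (by gcongr)⟩

lemma IsVolterraKernel.measurable_mulVec (hN : IsVolterraKernel N M) {f : ℝ → Fin 3 → ℂ}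
    (hf : Continuous f) (x : ℝ) (i : Fin 3) : Measurable fun y => (N x y).mulVec (f y) i := by
  have hf' : ∀ j, Measurable fun y => f y j := fun j => ((continuous_apply j).comp hf).measurable
  simp only [Matrix.mulVec, dotProduct, Fin.sum_univ_three]
  exact ((((hN.meas x i 0).mul (hf' 0)).add ((hN.meas x i 1).mul (hf' 1))).add
    ((hN.meas x i 2).mul (hf' 2)))

lemma IsVolterraKernel.integrable (hN : IsVolterraKernel N M) {f : ℝ → Fin 3 → ℂ}
    (hf : IsBC f) {x : ℝ} (hx : 0 ≤ x) (i : Fin 3) :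
    IntegrableOn (fun y => (N x y).mulVec (f y) i) (Ioi x) := by
  obtain ⟨hc, B, hB⟩ := hf
  refine ((integrableOn_inv_sq hx).const_mul (3 * M * B)).mono'
    (hN.measurable_mulVec hc x i).aestronglyMeasurable ?_
  filter_upwards [ae_restrict_mem measurableSet_Ioi] with y hy
  refine (norm_mulVec_le (hN.bound x y hx hy) (hB y) i).trans (le_of_eq ?_)
  ring

/-- Dominated convergence on the fixed domain `(0,∞)`: the moving lower limit is put into an
indicator, which is locally constant in the limit except when it equals `y`, a null set. -/
lemma continuous_volterraOp (hN : IsVolterraKernel N M) {f : ℝ → Fin 3 → ℂ} (hf : IsBC f) :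
    Continuous (volterraOp N f) := by
  obtain ⟨hc, B, hB⟩ := hf
  refine continuous_pi fun i => ?_
  have h1 : Continuous fun a : ℝ => ∫ y in Ioi (0 : ℝ),
      (Ioi (max a 0)).indicator (fun y => (N (max a 0) y).mulVec (f y) i) y := by
    refine continuous_iff_continuousAt.2 fun a => ?_
    refine continuousAt_of_dominated (bound := fun y => 3 * M * B * (1 / (1 + y) ^ 2)) ?_ ?_ ?_ ?_
    · refine Eventually.of_forall fun a => ?_
      exact ((hN.measurable_mulVec hc _ i).indicator measurableSet_Ioi).aestronglyMeasurable
    · refine Eventually.of_forall fun a => ?_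
      filter_upwards [ae_restrict_mem measurableSet_Ioi] with y hy
      have hB0 : 0 ≤ B := (norm_nonneg _).trans (hB 0)
      have hM0 := hN.nonneg
      by_cases h : y ∈ Ioi (max a 0)
      · rw [indicator_of_mem h]
        refine (norm_mulVec_le (hN.bound _ y (le_max_right _ _) h) (hB y) i).trans (le_of_eq ?_)
        ring
      · rw [indicator_of_notMem h, norm_zero]; positivity
    · exact (integrableOn_inv_sq le_rfl).const_mul _
    · have : ∀ᵐ y ∂(volume.restrict (Ioi (0 : ℝ))), y ≠ max a 0 :=
        ae_restrict_of_ae (Measure.ae_ne volume _)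
      filter_upwards [this] with y hy
      have hcont : Continuous fun a : ℝ => (N (max a 0) y).mulVec (f y) i := by
        simp only [Matrix.mulVec, dotProduct, Fin.sum_univ_three]
        have hh : ∀ j, Continuous fun a : ℝ => N (max a 0) y i j := fun j =>
          (hN.cont y i j).comp (by fun_prop : Continuous fun a : ℝ => max a 0)
        exact (((hh 0).mul continuous_const).add ((hh 1).mul continuous_const)).add
          ((hh 2).mul continuous_const)
      have hmax : Continuous fun a : ℝ => max a 0 := by fun_prop
      rcases lt_or_gt_of_ne hy with h | h
      · have : ∀ᶠ b in 𝓝 a, y < max b 0 := hmax.continuousAt.eventually_const_lt h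
        refine ContinuousAt.congr (f := fun _ => (0 : ℂ)) continuousAt_const ?_
        filter_upwards [this] with b hb
        exact (indicator_of_notMem (s := Ioi (max b 0)) (fun h => lt_asymm hb h) _).symm
      · have : ∀ᶠ b in 𝓝 a, max b 0 < y := hmax.continuousAt.eventually_lt_const h
        refine ContinuousAt.congr hcont.continuousAt ?_
        filter_upwards [this] with b hb
        rw [indicator_of_mem (by simpa using hb)]
  refine h1.congr fun a => ?_
  rw [setIntegral_indicator measurableSet_Ioi, volterraOp, Ioi_inter_Ioi]
  simp

/-- A weighted norm of Bielecki type: three terms per row give `3M`, the weight gives `1/L`, and `L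
≥ 6M` makes the product at most `1/2` however large the kernel is. -/
lemma norm_volterraOp_le (hN : IsVolterraKernel N M) {f : ℝ → Fin 3 → ℂ} {B L : ℝ}
    (hL : 0 < L) (hLM : 6 * M ≤ L) (hB : ∀ x, ‖f x‖ ≤ B * expWeight L x) (x : ℝ) :
    ‖volterraOp N f x‖ ≤ B / 2 * expWeight L x := by
  have hM0 := hN.nonneg
  have hB0 : 0 ≤ B := by
    have := (norm_nonneg _).trans (hB 0)
    exact nonneg_of_mul_nonneg_left this (expWeight_pos _ _)
  refine (pi_norm_le_iff_of_nonneg (mul_nonneg (by positivity) (expWeight_pos _ _).le)).2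
    fun i => ?_
  have hx : 0 ≤ max x 0 := le_max_right _ _
  obtain ⟨h1, h2⟩ := integral_weight hL hx
  have h3 : ‖volterraOp N f x i‖ ≤ ∫ y in Ioi (max x 0),
      3 * M * B * (1 / (1 + y) ^ 2 * Real.exp (L * (1 + y)⁻¹)) := by
    refine norm_integral_le_of_norm_le (h1.const_mul _) ?_
    filter_upwards [ae_restrict_mem measurableSet_Ioi] with y hy
    have hy0 : 0 < y := hx.trans_lt hy
    refine (norm_mulVec_le (hN.bound _ y hx hy) (hB y) i).trans (le_of_eq ?_)
    rw [expWeight, max_eq_left hy0.le]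
    ring
  refine h3.trans ?_
  rw [integral_const_mul, h2, expWeight]
  have hE := Real.exp_pos (L * (1 + max x 0)⁻¹)
  rw [mul_div_assoc', div_le_iff₀ hL]
  have : 3 * M * B * (Real.exp (L * (1 + max x 0)⁻¹) - 1) ≤ 3 * M * B * Real.exp (L * (1 + max x 0)⁻¹) := by
    apply mul_le_mul_of_nonneg_left _ (by positivity); linarith
  have h5 : 6 * M * (B * Real.exp (L * (1 + max x 0)⁻¹)) ≤ L * (B * Real.exp (L * (1 + max x 0)⁻¹)) :=
    mul_le_mul_of_nonneg_right hLM (by positivity)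
  nlinarith

lemma IsBC.volterraOp (hN : IsVolterraKernel N M) {f : ℝ → Fin 3 → ℂ} (hf : IsBC f) :
    IsBC (volterraOp N f) := by
  obtain ⟨B, hB⟩ := hf.2
  have hB0 : 0 ≤ B := (norm_nonneg _).trans (hB 0)
  have hM0 := hN.nonneg
  have hL : 0 < 6 * M + 1 := by positivity
  refine ⟨continuous_volterraOp hN hf, B / 2 * Real.exp (6 * M + 1), fun x => ?_⟩
  refine (norm_volterraOp_le hN hL (by linarith) (B := B) (fun y => ?_) x).trans ?_
  · exact (hB y).trans (le_mul_of_one_le_right hB0 (one_le_expWeight hL.le y))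
  · exact mul_le_mul_of_nonneg_left (expWeight_le hL.le x) (by positivity)

lemma volterraOp_sub (hN : IsVolterraKernel N M) {f g : ℝ → Fin 3 → ℂ} (hf : IsBC f)
    (hg : IsBC g) (x : ℝ) :
    volterraOp N (fun y => f y - g y) x = volterraOp N f x - volterraOp N g x := by
  ext i
  simp only [volterraOp, Matrix.mulVec_sub, Pi.sub_apply]
  exact integral_sub (hN.integrable hf (le_max_right _ _) i) (hN.integrable hg (le_max_right _ _) i)

lemma volterraOp_smul (c : ℂ) (f : ℝ → Fin 3 → ℂ) (x : ℝ) :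
    volterraOp N (fun y => c • f y) x = c • volterraOp N f x := by
  ext i
  simp only [volterraOp, Matrix.mulVec_smul, Pi.smul_apply, smul_eq_mul]
  exact integral_const_mul _ _

/-- Banach's fixed point theorem on bounded continuous functions. Conjugation by the weight `W`
turns the sup norm into the weighted norm, for which the operator has Lipschitz constant `1/2`. -/
lemma exists_volterra_solution (hN : IsVolterraKernel N M) {g : ℝ → Fin 3 → ℂ} (hg : IsBC g) :
    ∃ f, IsBC f ∧ ∀ x, f x = g x + volterraOp N f x := by
  have hM0 := hN.nonneg
  set L := 6 * M + 1 with hLdef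
  have hL : 0 < L := by positivity
  let W : ℝ → ℂ := fun x => (expWeight L x : ℂ)
  have hWc : Continuous W := Complex.continuous_ofReal.comp (continuous_expWeight L)
  have hW0 : ∀ x, W x ≠ 0 := fun x => Complex.ofReal_ne_zero.2 (expWeight_pos L x).ne'
  have hWn : ∀ x, ‖W x‖ = expWeight L x := fun x => by
    simp [W, abs_of_pos (expWeight_pos L x)]
  have hW1 : ∀ x, ‖(W x)⁻¹‖ ≤ 1 := fun x => by
    rw [norm_inv, hWn]; exact inv_le_one_of_one_le₀ (one_le_expWeight hL.le x)
  have hmulBC : ∀ f : BoundedContinuousFunction ℝ (Fin 3 → ℂ), IsBC fun x => W x • f x :=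
    fun f => ⟨hWc.smul f.continuous, Real.exp L * ‖f‖, fun x => by
      rw [norm_smul, hWn]
      exact mul_le_mul (expWeight_le hL.le x) (f.norm_coe_le_norm x) (norm_nonneg _)
        (Real.exp_pos _).le⟩
  have hdivBC : ∀ f, IsBC f → IsBC fun x => (W x)⁻¹ • f x := fun f hf =>
    ⟨(hWc.inv₀ hW0).smul hf.1, by
      obtain ⟨B, hB⟩ := hf.2
      refine ⟨B, fun x => ?_⟩
      rw [norm_smul]
      calc _ ≤ 1 * B := mul_le_mul (hW1 x) (hB x) (norm_nonneg _) zero_le_one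
        _ = B := one_mul B⟩
  have hex : ∀ f : BoundedContinuousFunction ℝ (Fin 3 → ℂ),
      ∃ F : BoundedContinuousFunction ℝ (Fin 3 → ℂ),
        ∀ x, F x = (W x)⁻¹ • (g x + volterraOp N (fun y => W y • f y) x) := fun f => by
    obtain ⟨hc, B, hB⟩ := hdivBC _ (hg.add (IsBC.volterraOp hN (hmulBC f)))
    exact ⟨BoundedContinuousFunction.ofNormedAddCommGroup _ hc B hB, fun _ => rfl⟩
  choose Tm hTm using hex
  have hT : ContractingWith (1 / 2) Tm := by
    refine ⟨by rw [← NNReal.coe_lt_coe]; norm_num, LipschitzWith.of_dist_le_mul fun f₁ f₂ => ?_⟩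
    rw [dist_eq_norm, dist_eq_norm]
    refine (BoundedContinuousFunction.norm_le (by positivity)).2 fun x => ?_
    have e : (Tm f₁ - Tm f₂) x = (W x)⁻¹ • volterraOp N (fun y => W y • f₁ y - W y • f₂ y) x := by
      rw [volterraOp_sub hN (hmulBC f₁) (hmulBC f₂)]
      rw [BoundedContinuousFunction.sub_apply, hTm, hTm, ← smul_sub]; congr 1; abel
    rw [e, norm_smul, norm_inv, hWn, inv_mul_le_iff₀ (expWeight_pos _ _)]
    refine (norm_volterraOp_le hN hL (by linarith) (B := ‖f₁ - f₂‖) (fun y => ?_) x).trans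
      (le_of_eq ?_)
    · rw [← smul_sub, norm_smul, hWn, mul_comm]
      exact mul_le_mul_of_nonneg_right ((f₁ - f₂).norm_coe_le_norm y) (expWeight_pos _ _).le
    · push_cast; ring
  obtain ⟨F, hF⟩ : ∃ F, Tm F = F := ⟨hT.fixedPoint, hT.fixedPoint_isFixedPt⟩
  refine ⟨fun x => W x • F x, hmulBC F, fun x => ?_⟩
  have hx := hTm F x
  rw [hF] at hx
  simp only
  rw [hx, smul_inv_smul₀ (hW0 x)]

/-- Each use of the equation halves the contribution of the crude bound `B` and leaves at most `2G`
from the source; in the limit `B` disappears. The constant depends on `M` only, which gives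
uniformity in all parameters. -/
lemma norm_volterra_solution_le (hN : IsVolterraKernel N M) {f g : ℝ → Fin 3 → ℂ} (hf : IsBC f)
    {G : ℝ} (hG : ∀ x, ‖g x‖ ≤ G) (h : ∀ x, f x = g x + volterraOp N f x) (x : ℝ) :
    ‖f x‖ ≤ 2 * Real.exp (6 * M + 1) * G := by
  have hM0 := hN.nonneg
  obtain ⟨hc, B, hB⟩ := hf
  have hG0 : 0 ≤ G := (norm_nonneg _).trans (hG 0)
  set L := 6 * M + 1 with hLdef
  have hL : 0 < L := by positivity
  have hB0 : 0 ≤ B := (norm_nonneg _).trans (hB 0)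
  have key : ∀ n : ℕ, ∀ x, ‖f x‖ ≤ (2 * G + B / 2 ^ n) * expWeight L x := by
    intro n
    induction n with
    | zero =>
      intro x
      have := one_le_expWeight hL.le x
      refine (hB x).trans ?_
      rw [pow_zero, div_one]
      nlinarith
    | succ n ih =>
      intro x
      have h1 := norm_volterraOp_le hN hL (by linarith) ih x
      have h2 := one_le_expWeight hL.le x
      rw [h x]
      refine (norm_add_le _ _).trans ((add_le_add (hG x) h1).trans ?_)
      have : G ≤ G * expWeight L x := le_mul_of_one_le_right hG0 h2
      calc _ ≤ G * expWeight L x + (2 * G + B / 2 ^ n) / 2 * expWeight L x := by linarith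
        _ = _ := by rw [pow_succ]; field_simp; ring
  have hlim : Tendsto (fun n : ℕ => (2 * G + B / 2 ^ n) * expWeight L x) atTop
      (𝓝 ((2 * G + 0) * expWeight L x)) := by
    refine (tendsto_const_nhds.add ?_).mul_const _
    have : Tendsto (fun n : ℕ => B * (1 / 2 : ℝ) ^ n) atTop (𝓝 (B * 0)) :=
      (tendsto_pow_atTop_nhds_zero_of_lt_one (by norm_num) (by norm_num)).const_mul B
    simpa [div_eq_mul_inv] using this
  have h1 := ge_of_tendsto' hlim fun n => key n x
  have h2 := expWeight_le hL.le x
  refine h1.trans ?_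
  rw [add_zero]
  nlinarith

lemma volterra_solution_unique (hN : IsVolterraKernel N M) {f₁ f₂ g : ℝ → Fin 3 → ℂ}
    (hf₁ : IsBC f₁) (hf₂ : IsBC f₂) (h₁ : ∀ x, f₁ x = g x + volterraOp N f₁ x)
    (h₂ : ∀ x, f₂ x = g x + volterraOp N f₂ x) : f₁ = f₂ := by
  funext x
  have := norm_volterra_solution_le hN (hf₁.sub hf₂) (g := fun _ => 0) (G := 0) (by simp)
    (fun x => by rw [volterraOp_sub hN hf₁ hf₂, zero_add]; nth_rewrite 1 [h₁ x, h₂ x]; abel) x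
  rw [mul_zero] at this
  exact sub_eq_zero.1 (norm_le_zero_iff.1 this)

end

/-- Linear in the size `a` of the kernel and vanishing at infinity, unlike the weighted bound. Only
the pointwise bound is used, so it applies to differences of kernels. -/
lemma norm_volterraOp_le_tail {N : ℝ → ℝ → Matrix (Fin 3) (Fin 3) ℂ} {f : ℝ → Fin 3 → ℂ}
    {a B : ℝ} (hN : ∀ x y, 0 ≤ x → x < y → ∀ i j, ‖N x y i j‖ ≤ a / (1 + y) ^ 2)
    (hB : ∀ x, ‖f x‖ ≤ B) (x : ℝ) :
    ‖volterraOp N f x‖ ≤ 3 * a * B * (Real.exp ((1 + max x 0)⁻¹) - 1) := by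
  have hB0 : 0 ≤ B := (norm_nonneg _).trans (hB 0)
  have ha : 0 ≤ a := by
    have := (norm_nonneg _).trans (hN 0 1 le_rfl one_pos 0 0)
    norm_num at this; linarith
  have hx : 0 ≤ max x 0 := le_max_right _ _
  have hE : 0 ≤ Real.exp ((1 + max x 0)⁻¹) - 1 :=
    sub_nonneg.2 (Real.one_le_exp (by positivity))
  refine (pi_norm_le_iff_of_nonneg (by positivity)).2 fun i => ?_
  obtain ⟨h1, h2⟩ := integral_weight one_pos hx
  have h3 : ‖volterraOp N f x i‖ ≤ ∫ y in Ioi (max x 0),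
      3 * a * B * (1 / (1 + y) ^ 2 * Real.exp (1 * (1 + y)⁻¹)) := by
    refine norm_integral_le_of_norm_le (h1.const_mul _) ?_
    filter_upwards [ae_restrict_mem measurableSet_Ioi] with y hy
    have hy0 : 0 < y := hx.trans_lt hy
    refine (norm_mulVec_le (hN _ y hx hy) (hB y) i).trans ?_
    have : 1 ≤ Real.exp (1 * (1 + y)⁻¹) := Real.one_le_exp (by positivity)
    calc 3 * (a / (1 + y) ^ 2) * B = 3 * a * B * (1 / (1 + y) ^ 2) * 1 := by ring
      _ ≤ 3 * a * B * (1 / (1 + y) ^ 2) * Real.exp (1 * (1 + y)⁻¹) := by gcongr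
      _ = _ := by ring
  refine h3.trans (le_of_eq ?_)
  rw [integral_const_mul, h2, div_one, one_mul]

lemma norm_volterraOp_le_of_kernel {N : ℝ → ℝ → Matrix (Fin 3) (Fin 3) ℂ} {f : ℝ → Fin 3 → ℂ}
    {a B : ℝ} (hN : ∀ x y, 0 ≤ x → x < y → ∀ i j, ‖N x y i j‖ ≤ a / (1 + y) ^ 2)
    (hB : ∀ x, ‖f x‖ ≤ B) (x : ℝ) : ‖volterraOp N f x‖ ≤ 3 * a * B * Real.exp 1 := by
  have hB0 : 0 ≤ B := (norm_nonneg _).trans (hB 0)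
  have ha : 0 ≤ a := by
    have := (norm_nonneg _).trans (hN 0 1 le_rfl one_pos 0 0)
    norm_num at this; linarith
  refine (norm_volterraOp_le_tail hN hB x).trans (mul_le_mul_of_nonneg_left ?_ (by positivity))
  have : Real.exp ((1 + max x 0)⁻¹) ≤ Real.exp 1 :=
    Real.exp_le_exp.2 (inv_le_one_of_one_le₀ (by linarith [le_max_right x 0]))
  linarith

lemma tendsto_volterraOp {N : ℝ → ℝ → Matrix (Fin 3) (Fin 3) ℂ} {M : ℝ}
    (hN : IsVolterraKernel N M) {f : ℝ → Fin 3 → ℂ} (hf : IsBC f) :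
    Tendsto (volterraOp N f) atTop (𝓝 0) := by
  obtain ⟨-, B, hB⟩ := hf
  refine squeeze_zero_norm (norm_volterraOp_le_tail hN.bound hB) ?_
  have h1 : Tendsto (fun x : ℝ => (1 + max x 0)⁻¹) atTop (𝓝 0) :=
    tendsto_inv_atTop_zero.comp (tendsto_atTop_add_const_left _ 1
      (tendsto_atTop_mono (fun x => le_max_left x 0) tendsto_id))
  have h2 := (((Real.continuous_exp.tendsto _).comp h1).sub_const 1).const_mul (3 * M * B)
  simpa using h2

/-- Linear combinations of Volterra operators applied to one function. -/
lemma volterraOp_taylor {N₁ N₂ N₃ : ℝ → ℝ → Matrix (Fin 3) (Fin 3) ℂ} {M : ℝ}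
    (h₁ : IsVolterraKernel N₁ M) (h₂ : IsVolterraKernel N₂ M) (h₃ : IsVolterraKernel N₃ M)
    {f : ℝ → Fin 3 → ℂ} (hf : IsBC f) (c : ℂ) (x : ℝ) :
    volterraOp (fun x y => N₁ x y - N₂ x y - c • N₃ x y) f x =
      volterraOp N₁ f x - volterraOp N₂ f x - c • volterraOp N₃ f x := by
  ext i
  have hx := le_max_right x 0
  simp only [volterraOp, Matrix.sub_mulVec, Matrix.smul_mulVec, Pi.sub_apply, Pi.smul_apply,
    smul_eq_mul]
  have h₁₂ : IntegrableOn (fun y => (N₁ (max x 0) y).mulVec (f y) i -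
      (N₂ (max x 0) y).mulVec (f y) i) (Ioi (max x 0)) :=
    (h₁.integrable hf hx i).sub (h₂.integrable hf hx i)
  rw [integral_sub h₁₂ ((h₃.integrable hf hx i).const_mul c),
    integral_sub (h₁.integrable hf hx i) (h₂.integrable hf hx i), integral_const_mul]

/-- Quantitative differentiability of the solution of a Volterra equation in a parameter:
if the kernels satisfy `N₁ = N₀ + c N' + O(|c|²)`, the solutions satisfy
`f₁ = f₀ + c f' + O(|c|²)`. -/
lemma volterra_taylor {N₀ N' : ℝ → ℝ → Matrix (Fin 3) (Fin 3) ℂ} {M : ℝ}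
    (h₀ : IsVolterraKernel N₀ M) (h' : IsVolterraKernel N' M) {g f₀ : ℝ → Fin 3 → ℂ}
    (hf₀ : IsBC f₀) (e₀ : ∀ x, f₀ x = g x + volterraOp N₀ f₀ x) :
    ∃ f', IsBC f' ∧ (∀ x, f' x = volterraOp N' f₀ x + volterraOp N₀ f' x) ∧
      ∃ C, ∀ (c : ℂ) (N₁ : ℝ → ℝ → Matrix (Fin 3) (Fin 3) ℂ) (f₁ : ℝ → Fin 3 → ℂ),
        ‖c‖ ≤ 1 → IsVolterraKernel N₁ M → IsBC f₁ → (∀ x, f₁ x = g x + volterraOp N₁ f₁ x) →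
        (∀ x y, 0 ≤ x → x < y → ∀ i j,
          ‖N₁ x y i j - N₀ x y i j - c * N' x y i j‖ ≤ M * ‖c‖ ^ 2 / (1 + y) ^ 2) →
        ∀ x, ‖f₁ x - f₀ x - c • f' x‖ ≤ C * ‖c‖ ^ 2 := by
  have hM0 := h₀.nonneg
  obtain ⟨f', hf', e'⟩ := exists_volterra_solution h₀ (IsBC.volterraOp h' hf₀)
  refine ⟨f', hf', e', ?_⟩
  obtain ⟨B, hB⟩ := hf₀.2
  obtain ⟨B', hB'⟩ := hf'.2
  have hB0 : 0 ≤ B := (norm_nonneg _).trans (hB 0)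
  have hB'0 : 0 ≤ B' := (norm_nonneg _).trans (hB' 0)
  refine ⟨2 * Real.exp (6 * M + 1) * (3 * M * B * Real.exp 1 + 3 * (2 * M) * B' * Real.exp 1), ?_⟩
  intro c N₁ f₁ hc h₁ hf₁ e₁ hT x
  have hcf : IsBC fun x => c • f' x := by
    refine ⟨hf'.1.const_smul c, ‖c‖ * B', fun x => ?_⟩
    rw [norm_smul]; gcongr; exact hB' x
  -- The remainder `f₁ - f₀ - c f'` solves the Volterra equation with kernel `N₁` and this source.
  -- Its first term is quadratic by hypothesis; the second is `c` times a difference of kernels of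
  -- size `|c|`. The coefficient `0` only gives `N₁ - N₀` the shape of `volterraOp_taylor`.
  let r : ℝ → Fin 3 → ℂ := fun x =>
    volterraOp (fun x y => N₁ x y - N₀ x y - c • N' x y) f₀ x +
      c • volterraOp (fun x y => N₁ x y - N₀ x y - (0 : ℂ) • N' x y) f' x
  have hr : ∀ x, ‖r x‖ ≤
      (3 * M * B * Real.exp 1 + 3 * (2 * M) * B' * Real.exp 1) * ‖c‖ ^ 2 := by
    intro x
    have i1 := norm_volterraOp_le_of_kernel (N := fun x y => N₁ x y - N₀ x y - c • N' x y)
      (a := M * ‖c‖ ^ 2) (fun x y hx hy i j => by simpa using hT x y hx hy i j) hB x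
    have i2 := norm_volterraOp_le_of_kernel
      (N := fun x y => N₁ x y - N₀ x y - (0 : ℂ) • N' x y)
      (a := 2 * M * ‖c‖) (fun x y hx hy i j => by
        have a1 := hT x y hx hy i j
        have a2 := h'.bound x y hx hy i j
        have hy0 : 0 < 1 + y := by linarith
        simp only [zero_smul, Matrix.sub_apply, Matrix.zero_apply, sub_zero]
        calc ‖N₁ x y i j - N₀ x y i j‖
            = ‖(N₁ x y i j - N₀ x y i j - c * N' x y i j) + c * N' x y i j‖ := by congr 1; ring
          _ ≤ M * ‖c‖ ^ 2 / (1 + y) ^ 2 + ‖c‖ * (M / (1 + y) ^ 2) := by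
              refine (norm_add_le _ _).trans (add_le_add a1 ?_)
              rw [norm_mul]; gcongr
          _ ≤ M * ‖c‖ / (1 + y) ^ 2 + ‖c‖ * (M / (1 + y) ^ 2) := by
              gcongr
              nlinarith [norm_nonneg c]
          _ = _ := by ring) hB' x
    refine (norm_add_le _ _).trans ?_
    rw [norm_smul]
    calc _ ≤ 3 * (M * ‖c‖ ^ 2) * B * Real.exp 1 + ‖c‖ * (3 * (2 * M * ‖c‖) * B' * Real.exp 1) := by
          gcongr
      _ = _ := by ring
  have hd := norm_volterra_solution_le h₁ ((hf₁.sub hf₀).sub hcf) hr (fun x => by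
    rw [volterraOp_sub h₁ (hf₁.sub hf₀) hcf, volterraOp_sub h₁ hf₁ hf₀, volterraOp_smul]
    simp only [r]
    rw [volterraOp_taylor h₁ h₀ h' hf₀, volterraOp_taylor h₁ h₀ h' hf']
    nth_rewrite 1 [e₁ x]
    nth_rewrite 1 [e₀ x]
    nth_rewrite 1 [e' x]
    ext i
    simp only [Pi.add_apply, Pi.sub_apply, Pi.smul_apply, smul_eq_mul]
    ring) x
  refine hd.trans (le_of_eq ?_)
  ring

/-- A function with a quadratic first-order Taylor remainder is differentiable. -/
lemma hasDerivWithinAt_of_quadratic {𝕜 : Type*} [RCLike 𝕜] {F : Type*} [NormedAddCommGroup F]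
    [NormedSpace 𝕜 F] {f : 𝕜 → F} {f' : F} {P : Set 𝕜} {p : 𝕜} {C : ℝ}
    (h : ∀ p' ∈ P, ‖p' - p‖ ≤ 1 → ‖f p' - f p - (p' - p) • f'‖ ≤ C * ‖p' - p‖ ^ 2) :
    HasDerivWithinAt f f' P p := by
  rw [hasDerivWithinAt_iff_isLittleO]
  have h1 : (fun p' => f p' - f p - (p' - p) • f') =O[𝓝[P] p] fun p' => ‖p' - p‖ ^ 2 := by
    refine Asymptotics.IsBigO.of_bound C ?_
    have h2 : ∀ᶠ p' in 𝓝[P] p, p' ∈ Metric.closedBall p 1 :=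
      nhdsWithin_le_nhds (Metric.closedBall_mem_nhds p one_pos)
    filter_upwards [h2, self_mem_nhdsWithin] with p' hp' hp
    rw [norm_pow, norm_norm]
    exact h p' hp (by simpa [dist_eq_norm] using hp')
  refine h1.trans_isLittleO ?_
  have h3 : Tendsto (fun p' => p' - p) (𝓝[P] p) (𝓝 0) := by
    have : Tendsto (fun p' => p' - p) (𝓝 p) (𝓝 (p - p)) := tendsto_id.sub_const p
    rw [sub_self] at this
    exact this.mono_left nhdsWithin_le_nhds
  exact (Asymptotics.isLittleO_norm_pow_id (E' := 𝕜) one_lt_two).comp_tendsto h3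

/-- Second-order Taylor bound on a convex set. -/
lemma taylor_two {𝕜 : Type*} [RCLike 𝕜] {F : Type*} [NormedAddCommGroup F]
    [NormedSpace 𝕜 F] {f f' f'' : 𝕜 → F} {P : Set 𝕜} (hP : Convex ℝ P) {C : ℝ}
    (h1 : ∀ p ∈ P, HasDerivWithinAt f (f' p) P p) (h2 : ∀ p ∈ P, HasDerivWithinAt f' (f'' p) P p)
    (hC : ∀ p ∈ P, ‖f'' p‖ ≤ C) {p p' : 𝕜} (hp : p ∈ P) (hp' : p' ∈ P) :
    ‖f p' - f p - (p' - p) • f' p‖ ≤ C * ‖p' - p‖ ^ 2 := by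
  have hC0 : 0 ≤ C := (norm_nonneg _).trans (hC p hp)
  -- On this ball the first-order remainder has derivative `f' y - f' p`, of norm at most `C ‖p' -
  -- p‖`, and the mean value inequality gives the second factor.
  let Q := P ∩ Metric.closedBall p ‖p' - p‖
  have hQ : Convex ℝ Q := hP.inter (convex_closedBall _ _)
  have hpQ : p ∈ Q := ⟨hp, Metric.mem_closedBall_self (norm_nonneg _)⟩
  have hp'Q : p' ∈ Q := ⟨hp', by simp [dist_eq_norm]⟩
  have key := hQ.norm_image_sub_le_of_norm_hasDerivWithin_le
    (f := fun y => f y - f p - (y - p) • f' p) (f' := fun y => f' y - f' p)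
    (C := C * ‖p' - p‖) (fun y hy => by
      have e1 := ((h1 y hy.1).mono (inter_subset_left : Q ⊆ P)).sub_const (f p)
      have e2 := ((hasDerivWithinAt_id y Q).sub_const p).smul_const (f' p)
      have e3 := e1.sub e2
      rw [one_smul] at e3
      exact e3) (fun y hy => by
      have := hP.norm_image_sub_le_of_norm_hasDerivWithin_le h2 hC hp hy.1
      refine this.trans (mul_le_mul_of_nonneg_left ?_ hC0)
      simpa [dist_eq_norm] using hy.2) hpQ hp'Q
  simp only [sub_self, zero_smul, sub_zero] at key
  refine key.trans (le_of_eq ?_)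
  ring

end

noncomputable section

/-! ### Regularity and decay on the half-strip -/

/-- `f` is `C^n` up to the boundary of the half-strip, and its derivatives of order at most `n`
are `O((1+x)⁻⁴)`. -/
structure StripReg (T : ℝ) (n : ℕ) (f : ℝ × ℝ → ℂ) : Prop where
  contDiffOn : ContDiffOn ℝ n f (closedStrip T)
  decay : ∀ j ≤ n, ∃ C : ℝ, ∀ p ∈ closedStrip T,
    (1 + p.1) ^ 4 * ‖iteratedFDerivWithin ℝ j f (closedStrip T) p‖ ≤ C

/-- The derivative of `f` in the direction `v` on the half-strip. -/
def stripDeriv (T : ℝ) (v : ℝ × ℝ) (f : ℝ × ℝ → ℂ) (p : ℝ × ℝ) : ℂ :=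
  fderivWithin ℝ f (closedStrip T) p v

/-- The derivative in `x` on the half-strip. -/
abbrev dX (T : ℝ) (f : ℝ × ℝ → ℂ) : ℝ × ℝ → ℂ := stripDeriv T (1, 0) f

/-- The derivative in `t` on the half-strip. -/
abbrev dT (T : ℝ) (f : ℝ × ℝ → ℂ) : ℝ × ℝ → ℂ := stripDeriv T (0, 1) f

section

variable {T : ℝ} {n : ℕ} {f : ℝ × ℝ → ℂ}

lemma uniqueDiffOn_closedStrip (hT : 0 < T) : UniqueDiffOn ℝ (closedStrip T) :=
  (uniqueDiffOn_Ici 0).prod (uniqueDiffOn_Icc hT)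

lemma StripReg.mono {m : ℕ} (h : StripReg T n f) (hm : m ≤ n) : StripReg T m f :=
  ⟨h.contDiffOn.of_le (by exact_mod_cast hm), fun j hj => h.decay j (hj.trans hm)⟩

lemma StripReg.deriv (hT : 0 < T) (h : StripReg T (n + 1) f) (v : ℝ × ℝ) :
    StripReg T n (stripDeriv T v f) := by
  have hc : ContDiffOn ℝ n (fderivWithin ℝ f (closedStrip T)) (closedStrip T) :=
    h.contDiffOn.fderivWithin (uniqueDiffOn_closedStrip hT) (by exact_mod_cast le_rfl)
  refine ⟨hc.clm_apply contDiffOn_const, fun j hj => ?_⟩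
  obtain ⟨C, hC⟩ := h.decay (j + 1) (by omega)
  refine ⟨‖v‖ * C, fun p hp => ?_⟩
  have h1 := norm_iteratedFDerivWithin_clm_apply_const (c := v) (hc p hp)
    (uniqueDiffOn_closedStrip hT) hp (n := j) (by exact_mod_cast hj)
  rw [norm_iteratedFDerivWithin_fderivWithin (uniqueDiffOn_closedStrip hT) hp] at h1
  have hp0 : 0 ≤ p.1 := hp.1
  calc _ ≤ (1 + p.1) ^ 4 * (‖v‖ * ‖iteratedFDerivWithin ℝ (j + 1) f (closedStrip T) p‖) := by
        apply mul_le_mul_of_nonneg_left h1; positivity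
    _ = ‖v‖ * ((1 + p.1) ^ 4 * ‖iteratedFDerivWithin ℝ (j + 1) f (closedStrip T) p‖) := by ring
    _ ≤ _ := mul_le_mul_of_nonneg_left (hC p hp) (norm_nonneg _)

lemma StripReg.bound (h : StripReg T n f) :
    ∃ C, ∀ x t, 0 ≤ x → t ∈ Icc 0 T → ‖f (x, t)‖ ≤ C / (1 + x) ^ 4 := by
  obtain ⟨C, hC⟩ := h.decay 0 (Nat.zero_le _)
  refine ⟨C, fun x t hx ht => ?_⟩
  have := hC (x, t) ⟨hx, ht⟩
  rw [norm_iteratedFDerivWithin_zero] at this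
  rw [le_div_iff₀ (by positivity), mul_comm]
  exact this

lemma StripReg.continuousOn (h : StripReg T n f) : ContinuousOn f (closedStrip T) :=
  h.contDiffOn.continuousOn

lemma StripReg.hasFDerivWithinAt (h : StripReg T (n + 1) f) {p : ℝ × ℝ}
    (hp : p ∈ closedStrip T) :
    HasFDerivWithinAt f (fderivWithin ℝ f (closedStrip T) p) (closedStrip T) p :=
  (h.contDiffOn.differentiableOn (by simp) p hp).hasFDerivWithinAt

lemma StripReg.hasDerivWithinAt_x (h : StripReg T (n + 1) f) {x t : ℝ} (hx : 0 ≤ x)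
    (ht : t ∈ Icc 0 T) : HasDerivWithinAt (fun x => f (x, t)) (dX T f (x, t)) (Ici 0) x := by
  have h1 : HasDerivWithinAt (fun x : ℝ => (x, t)) (1, 0) (Ici 0) x :=
    (hasDerivWithinAt_id x _).prodMk (hasDerivWithinAt_const x _ t)
  have h2 : (x, t) ∈ closedStrip T := ⟨hx, ht⟩
  exact (h.hasFDerivWithinAt h2).comp_hasDerivWithinAt x h1
    fun y hy => show (y, t) ∈ closedStrip T from ⟨hy, ht⟩

lemma StripReg.hasDerivWithinAt_t (h : StripReg T (n + 1) f) {x t : ℝ} (hx : 0 ≤ x)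
    (ht : t ∈ Icc 0 T) : HasDerivWithinAt (fun t => f (x, t)) (dT T f (x, t)) (Icc 0 T) t := by
  have h1 : HasDerivWithinAt (fun t : ℝ => (x, t)) (0, 1) (Icc 0 T) t :=
    (hasDerivWithinAt_const t _ x).prodMk (hasDerivWithinAt_id t _)
  have h2 : (x, t) ∈ closedStrip T := ⟨hx, ht⟩
  exact (h.hasFDerivWithinAt h2).comp_hasDerivWithinAt t h1
    fun y hy => show (x, y) ∈ closedStrip T from ⟨hx, hy⟩

lemma StripReg.hasDerivAt_x (h : StripReg T (n + 1) f) {x t : ℝ} (hx : 0 < x)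
    (ht : t ∈ Icc 0 T) : HasDerivAt (fun x => f (x, t)) (dX T f (x, t)) x :=
  (h.hasDerivWithinAt_x hx.le ht).hasDerivAt (Ici_mem_nhds hx)

lemma StripReg.hasDerivAt_t (h : StripReg T (n + 1) f) {x t : ℝ} (hx : 0 ≤ x)
    (ht : t ∈ Ioo 0 T) : HasDerivAt (fun t => f (x, t)) (dT T f (x, t)) t :=
  (h.hasDerivWithinAt_t hx (Ioo_subset_Icc_self ht)).hasDerivAt (Icc_mem_nhds ht.1 ht.2)

lemma StripReg.iteratedDeriv_two (hT : 0 < T) (h : StripReg T (n + 2) f) {x t : ℝ} (hx : 0 < x)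
    (ht : t ∈ Icc 0 T) : iteratedDeriv 2 (fun x => f (x, t)) x = dX T (dX T f) (x, t) := by
  rw [iteratedDeriv_succ, iteratedDeriv_one]
  have h1 : _root_.deriv (fun x => f (x, t)) =ᶠ[𝓝 x] fun x => dX T f (x, t) := by
    filter_upwards [Ioi_mem_nhds hx] with y hy
    exact (h.hasDerivAt_x hy ht).deriv
  rw [h1.deriv_eq]
  exact ((h.deriv hT (1, 0)).hasDerivAt_x hx ht).deriv

lemma StripReg.contDiffOn_boundary (h : StripReg T n f) :
    ContDiffOn ℝ n (fun t => f (0, t)) (Icc 0 T) :=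
  h.contDiffOn.comp (contDiff_const.prodMk contDiff_id).contDiffOn
    fun _ ht => ⟨self_mem_Ici, ht⟩

lemma SmoothDecaying.stripReg {u : ℝ → ℝ → ℂ} (h : SmoothDecaying 4 T u) :
    StripReg T 4 fun p => u p.1 p.2 :=
  ⟨h.contDiffOn, h.decay⟩

end

end

noncomputable section

/-! ### Columns of the eigenfunction normalized at `x = ∞` -/

/-- A pair of potentials on the half-line with decay `O((1+x)⁻⁴)`. -/
structure DecayPair (u v : ℝ → ℂ) (M : ℝ) : Prop where
  cont_left : ContinuousOn u (Ici 0)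
  cont_right : ContinuousOn v (Ici 0)
  bound_left : ∀ x, 0 ≤ x → ‖u x‖ ≤ M / (1 + x) ^ 4
  bound_right : ∀ x, 0 ≤ x → ‖v x‖ ≤ M / (1 + x) ^ 4

/-- The third unit vector. -/
def e₃ : Fin 3 → ℂ := fun i => (1 : Matrix (Fin 3) (Fin 3) ℂ) i 2

@[simp] lemma e₃_zero : e₃ 0 = 0 := by simp [e₃]
@[simp] lemma e₃_one : e₃ 1 = 0 := by simp [e₃]
@[simp] lemma e₃_two : e₃ 2 = 1 := by simp [e₃]

/-- A kernel of the form `-c_i(x-y) e^{(l_i-l₃)(x-y)} V₁(y)`. -/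
def spaceKernel (c : Fin 3 → ℝ → ℂ) (u v : ℝ → ℂ) (k : ℂ) (x y : ℝ) : Matrix (Fin 3) (Fin 3) ℂ :=
  fun i j => -(c i (x - y) * Complex.exp ((l k i - l k 2) * ((x - y : ℝ) : ℂ)) *
    V₁ (u (max y 0)) (v (max y 0)) i j)

section

variable {u v : ℝ → ℂ} {M : ℝ}

lemma DecayPair.nonneg (h : DecayPair u v M) : 0 ≤ M := by
  have := (norm_nonneg _).trans (h.bound_left 0 le_rfl)
  norm_num at this; exact this

lemma norm_V₁_le {a b : ℂ} {C : ℝ} (ha : ‖a‖ ≤ C) (hb : ‖b‖ ≤ C) (i j : Fin 3) :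
    ‖V₁ a b i j‖ ≤ C := by
  have hC : 0 ≤ C := (norm_nonneg _).trans ha
  fin_cases i <;> fin_cases j <;> simpa [V₁]

lemma continuousOn_V₁ {s : Set ℝ} (hu : ContinuousOn u s) (hv : ContinuousOn v s) (i j : Fin 3) :
    ContinuousOn (fun y => V₁ (u y) (v y) i j) s := by
  fin_cases i <;> fin_cases j <;> simp [V₁] <;> first | assumption | exact continuousOn_const

lemma DecayPair.continuous_V₁ (h : DecayPair u v M) (i j : Fin 3) :
    Continuous fun y => V₁ (u (max y 0)) (v (max y 0)) i j :=
  (continuousOn_V₁ h.cont_left h.cont_right i j).comp_continuous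
    (by fun_prop : Continuous fun y : ℝ => max y 0) fun y => le_max_right y 0

lemma exp_decay {k : ℂ} (hk : k ∈ closedSector) (i : Fin 3) {r : ℝ} (hr : r ≤ 0) :
    ((l k i - l k 2) * (r : ℂ)).re ≤ 0 := by
  rw [Complex.re_mul_ofReal, Complex.sub_re]
  exact mul_nonpos_of_nonneg_of_nonpos (sub_nonneg.2 (hk i)) hr

lemma norm_exp_decay {k : ℂ} (hk : k ∈ closedSector) (i : Fin 3) {r : ℝ} (hr : r ≤ 0) :
    ‖Complex.exp ((l k i - l k 2) * (r : ℂ))‖ ≤ 1 := by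
  rw [Complex.norm_exp]
  exact Real.exp_le_one_iff.2 (exp_decay hk i hr)

/-- In the sector every exponential is bounded for `x < y`. Of the four powers of decay of the
potentials, two pay for the growth of `c` and two are left for integrability. Constant `c` gives the
kernel itself, linear `c` its derivative in `k`. -/
lemma DecayPair.isVolterraKernel (h : DecayPair u v M) {k : ℂ} (hk : k ∈ closedSector)
    {c : Fin 3 → ℝ → ℂ} {a : ℝ} (hc : ∀ i, Continuous (c i))
    (hca : ∀ i r, r ≤ 0 → ‖c i r‖ ≤ a * (1 + |r|) ^ 2) :
    IsVolterraKernel (spaceKernel c u v k) (a * M) := by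
  refine ⟨fun x i j => ?_, fun y i j => ?_, fun x y hx hy i j => ?_⟩
  · have := h.continuous_V₁ i j
    have hc' := hc i
    unfold spaceKernel
    exact Continuous.measurable (by fun_prop)
  · have hc' := hc i
    unfold spaceKernel
    fun_prop
  · have hy0 : 0 ≤ y := hx.trans hy.le
    have hr : x - y ≤ 0 := by linarith
    have hM := h.nonneg
    have ha : 0 ≤ a := by
      have := (norm_nonneg _).trans (hca 0 0 le_rfl)
      simpa using this
    have h1 := hca i (x - y) hr
    have h2 := norm_exp_decay hk i hr
    have h3 := norm_V₁_le (h.bound_left y hy0) (h.bound_right y hy0) i j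
    have h4 : (1 + |x - y|) ≤ 1 + y := by rw [abs_of_nonpos hr]; linarith
    rw [spaceKernel, norm_neg, norm_mul, norm_mul, max_eq_left hy0]
    calc _ ≤ (a * (1 + |x - y|) ^ 2) * 1 * (M / (1 + y) ^ 4) := by gcongr
      _ ≤ (a * (1 + y) ^ 2) * 1 * (M / (1 + y) ^ 4) := by gcongr
      _ = _ := by field_simp

lemma DecayPair.isVolterraKernel_one (h : DecayPair u v M) {k : ℂ} (hk : k ∈ closedSector) :
    IsVolterraKernel (spaceKernel (fun _ _ => 1) u v k) M := by
  have := h.isVolterraKernel hk (c := fun _ _ => 1) (a := 1) (fun _ => continuous_const)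
    (fun i r _ => by
      rw [norm_one, one_mul]
      exact one_le_pow₀ (by linarith [abs_nonneg r]))
  rwa [one_mul] at this

/-- Solutions of the Volterra equation for the third space column, extended to the whole line. -/
def IsSpaceSol (u v : ℝ → ℂ) (k : ℂ) (w : ℝ → Fin 3 → ℂ) : Prop :=
  IsBC w ∧ ∀ x, w x = e₃ + volterraOp (spaceKernel (fun _ _ => 1) u v k) w x

/-- The third space column. -/
def spaceSol (u v : ℝ → ℂ) (k : ℂ) : ℝ → Fin 3 → ℂ := Classical.epsilon (IsSpaceSol u v k)

lemma DecayPair.spaceSol_spec (h : DecayPair u v M) {k : ℂ} (hk : k ∈ closedSector) :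
    IsSpaceSol u v k (spaceSol u v k) :=
  Classical.epsilon_spec (exists_volterra_solution (h.isVolterraKernel_one hk) (IsBC.const e₃))

lemma DecayPair.spaceSol_unique (h : DecayPair u v M) {k : ℂ} (hk : k ∈ closedSector)
    {w : ℝ → Fin 3 → ℂ} (hw : IsSpaceSol u v k w) : w = spaceSol u v k :=
  volterra_solution_unique (h.isVolterraKernel_one hk) hw.1 (h.spaceSol_spec hk).1 hw.2
    (h.spaceSol_spec hk).2

lemma spaceKernel_one_mulVec (k : ℂ) {x y : ℝ} (hy : 0 ≤ y) (f : Fin 3 → ℂ) (i : Fin 3) :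
    (spaceKernel (fun _ _ => 1) u v k x y).mulVec f i =
      -(Complex.exp ((l k i - l k 2) * ((x - y : ℝ) : ℂ)) * (V₁ (u y) (v y)).mulVec f i) := by
  simp only [Matrix.mulVec, dotProduct, Fin.sum_univ_three, spaceKernel, max_eq_left hy]
  ring

lemma volterraOp_spaceKernel_one (k : ℂ) (f : ℝ → Fin 3 → ℂ) {x : ℝ} (hx : 0 ≤ x) (i : Fin 3) :
    volterraOp (spaceKernel (fun _ _ => 1) u v k) f x i =
      -∫ y in Ioi x, Complex.exp ((l k i - l k 2) * ((x - y : ℝ) : ℂ)) *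
        (V₁ (u y) (v y)).mulVec (f y) i := by
  rw [volterraOp, max_eq_left hx, ← integral_neg]
  exact setIntegral_congr_fun measurableSet_Ioi fun y hy =>
    spaceKernel_one_mulVec k (hx.trans (mem_Ioi.1 hy).le) _ _

/-- Only values on `[0,∞)` enter the operator, so a function known there may be extended to the line
by a constant. -/
lemma volterraOp_max (N : ℝ → ℝ → Matrix (Fin 3) (Fin 3) ℂ) (f : ℝ → Fin 3 → ℂ) (x : ℝ) :
    volterraOp N (fun y => f (max y 0)) x = volterraOp N f (max x 0) := by
  ext i
  rw [volterraOp, volterraOp, max_eq_left (le_max_right x 0)]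
  refine setIntegral_congr_fun measurableSet_Ioi fun y hy => ?_
  have hy0 : 0 ≤ y := (le_max_right x 0).trans (mem_Ioi.1 hy).le
  simp only [max_eq_left hy0]

lemma IsSpaceSol.isSpaceColumn {k : ℂ} {w : ℝ → Fin 3 → ℂ} (h : IsSpaceSol u v k w) :
    IsSpaceColumn u v 2 k w := by
  obtain ⟨⟨hc, B, hB⟩, he⟩ := h
  refine ⟨hc.continuousOn, ⟨B, fun x _ => hB x⟩, fun x hx i => ?_⟩
  have := congrFun (he x) i
  rw [Pi.add_apply, volterraOp_spaceKernel_one k w hx i, ← sub_eq_add_neg] at this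
  exact this

lemma IsSpaceColumn.isSpaceSol {q₀ r₀ : ℝ → ℂ} {k : ℂ} {w : ℝ → Fin 3 → ℂ}
    (h : IsSpaceColumn q₀ r₀ 2 k w) (hu : EqOn q₀ u (Ici 0)) (hv : EqOn r₀ v (Ici 0)) :
    IsSpaceSol u v k fun x => w (max x 0) := by
  obtain ⟨hc, ⟨B, hB⟩, he⟩ := h
  refine ⟨⟨hc.comp_continuous (by fun_prop) fun x => le_max_right x 0, B,
    fun x => hB _ (le_max_right x 0)⟩, fun x => ?_⟩
  ext i
  have hx := le_max_right x 0
  rw [Pi.add_apply, volterraOp_max, volterraOp_spaceKernel_one k w hx i, ← sub_eq_add_neg]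
  refine (he _ hx i).trans ?_
  congr 1
  refine setIntegral_congr_fun measurableSet_Ioi fun y hy => ?_
  have hy0 : y ∈ Ici (0 : ℝ) := hx.trans (mem_Ioi.1 hy).le
  simp only [hu hy0, hv hy0]

/-- The function chosen in the definition of `s` is arbitrary for negative `x`. Frozen there at its
value at `0`, it is the unique bounded solution on the line, so its value at `0` does not depend on
the choice. -/
lemma DecayPair.s_eq (h : DecayPair u v M) {q₀ r₀ : ℝ → ℂ} (hu : EqOn q₀ u (Ici 0))
    (hv : EqOn r₀ v (Ici 0)) {k : ℂ} (hk : k ∈ closedSector) (i : Fin 3) :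
    s q₀ r₀ i 2 k = spaceSol u v k 0 i := by
  have hex : ∃ w, IsSpaceColumn q₀ r₀ 2 k w := by
    obtain ⟨hc, hB, he⟩ := (h.spaceSol_spec hk).isSpaceColumn
    refine ⟨_, hc, hB, fun x hx i => ?_⟩
    rw [he x hx i]
    congr 1
    refine setIntegral_congr_fun measurableSet_Ioi fun y hy => ?_
    have hy0 : y ∈ Ici (0 : ℝ) := (mem_Ici.1 hx).trans (mem_Ioi.1 hy).le
    simp only [hu hy0, hv hy0]
  have h1 := h.spaceSol_unique hk ((Classical.epsilon_spec hex).isSpaceSol hu hv)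
  have h2 := congrFun (congrFun h1 0) i
  simp only [max_self] at h2
  exact h2

/-! ### Holomorphy of the space column in `k` -/

lemma convex_re_nonpos : Convex ℝ {z : ℂ | z.re ≤ 0} := convex_halfSpace_re_le 0

/-- The left half-plane is convex and the second derivative of the exponential is bounded by one on
it. -/
lemma norm_exp_taylor {a b : ℂ} (ha : a.re ≤ 0) (hb : b.re ≤ 0) :
    ‖Complex.exp b - Complex.exp a - (b - a) * Complex.exp a‖ ≤ ‖b - a‖ ^ 2 := by
  have := taylor_two (f := Complex.exp) (f' := Complex.exp) (f'' := Complex.exp) (C := 1)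
    convex_re_nonpos (fun p _ => (Complex.hasDerivAt_exp p).hasDerivWithinAt)
    (fun p _ => (Complex.hasDerivAt_exp p).hasDerivWithinAt)
    (fun p hp => by rw [Complex.norm_exp]; exact Real.exp_le_one_iff.2 hp) ha hb
  simpa using this

lemma norm_Jdiag (i : Fin 3) : ‖Jdiag i‖ = 1 := by
  fin_cases i <;> simp [Jdiag, norm_ω]

lemma l_sub (k : ℂ) (i : Fin 3) : l k i - l k 2 = k * (Jdiag i - Jdiag 2) := by
  simp only [l]; ring

lemma norm_Jdiag_sub (i : Fin 3) : ‖Jdiag i - Jdiag 2‖ ≤ 2 := by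
  refine (norm_sub_le _ _).trans ?_
  rw [norm_Jdiag, norm_Jdiag]; norm_num

/-- The third space column is holomorphic in `k`, up to the boundary of the sector. -/
lemma DecayPair.differentiableOn_spaceSol (h : DecayPair u v M) (x : ℝ) (i : Fin 3) :
    DifferentiableOn ℂ (fun k => spaceSol u v k x i) closedSector := by
  intro k hk
  have hM := h.nonneg
  let c : Fin 3 → ℝ → ℂ := fun i r => (Jdiag i - Jdiag 2) * (r : ℂ)
  have h₀ := (h.isVolterraKernel_one hk).mono (by linarith : M ≤ 4 * M)
  have h' : IsVolterraKernel (spaceKernel c u v k) (4 * M) := by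
    refine h.isVolterraKernel hk (fun i => by fun_prop) (fun i r _ => ?_)
    simp only [c]
    rw [norm_mul, Complex.norm_real, Real.norm_eq_abs]
    have h1 := norm_Jdiag_sub i
    have h2 := abs_nonneg r
    have h3 := mul_le_mul_of_nonneg_right h1 h2
    nlinarith
  -- The increment of `k` is the small parameter. The remainder of the exponential is at most `(2
  -- |k₁ - k| (1+y))²`, which costs two powers of decay and the factor `4` in `4 * M`.
  obtain ⟨f', -, -, C, hC⟩ := volterra_taylor h₀ h' (h.spaceSol_spec hk).1 (h.spaceSol_spec hk).2
  have hd : HasDerivWithinAt (fun k => spaceSol u v k x) (f' x) closedSector k := by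
    refine hasDerivWithinAt_of_quadratic (C := C) fun k₁ hk₁ hk₁' => ?_
    refine hC (k₁ - k) _ _ hk₁' ((h.isVolterraKernel_one hk₁).mono (by linarith))
      (h.spaceSol_spec hk₁).1 (h.spaceSol_spec hk₁).2 (fun x y hx hy i j => ?_) x
    have hy0 : 0 ≤ y := hx.trans hy.le
    have hr : x - y ≤ 0 := by linarith
    have h1 := norm_exp_taylor (exp_decay hk i hr) (exp_decay hk₁ i hr)
    have h3 := norm_V₁_le (h.bound_left y hy0) (h.bound_right y hy0) i j
    have e1 : (l k₁ i - l k₁ 2) * ((x - y : ℝ) : ℂ) - (l k i - l k 2) * ((x - y : ℝ) : ℂ) =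
        (k₁ - k) * ((Jdiag i - Jdiag 2) * ((x - y : ℝ) : ℂ)) := by
      rw [l_sub, l_sub]; ring
    have e2 : ‖(k₁ - k) * ((Jdiag i - Jdiag 2) * ((x - y : ℝ) : ℂ))‖ ≤
        ‖k₁ - k‖ * (2 * (1 + y)) := by
      rw [norm_mul, norm_mul, Complex.norm_real, Real.norm_eq_abs, abs_of_nonpos hr]
      exact mul_le_mul_of_nonneg_left (mul_le_mul (norm_Jdiag_sub i) (by linarith) (by linarith)
        zero_le_two) (norm_nonneg _)
    rw [e1] at h1
    have e3 : spaceKernel (fun _ _ => 1) u v k₁ x y i j - spaceKernel (fun _ _ => 1) u v k x y i j -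
        (k₁ - k) * spaceKernel c u v k x y i j =
        -((Complex.exp ((l k₁ i - l k₁ 2) * ((x - y : ℝ) : ℂ)) -
          Complex.exp ((l k i - l k 2) * ((x - y : ℝ) : ℂ)) -
          (k₁ - k) * ((Jdiag i - Jdiag 2) * ((x - y : ℝ) : ℂ)) *
            Complex.exp ((l k i - l k 2) * ((x - y : ℝ) : ℂ))) *
          V₁ (u (max y 0)) (v (max y 0)) i j) := by
      simp only [spaceKernel, c]; ring
    rw [e3, norm_neg, norm_mul, max_eq_left hy0]
    calc _ ≤ (‖k₁ - k‖ * (2 * (1 + y))) ^ 2 * (M / (1 + y) ^ 4) := by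
          gcongr
          exact h1.trans (by gcongr)
      _ = _ := by field_simp; ring
  have := (hasDerivWithinAt_pi.1 hd) i
  exact this.differentiableWithinAt

/-! ### The differential equation in `x` -/

lemma hasDerivAt_integral_Ioi {G : ℝ → ℂ} (hG : ContinuousOn G (Ici 0))
    (hi : IntegrableOn G (Ioi 0)) {x : ℝ} (hx : 0 < x) :
    HasDerivAt (fun x => ∫ y in Ioi x, G y) (-G x) x := by
  have h1 : ∀ᶠ y in 𝓝 x, (∫ t in Ioi (0 : ℝ), G t) - ∫ t in (0 : ℝ)..y, G t =
      ∫ t in Ioi y, G t := by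
    filter_upwards [Ioi_mem_nhds hx] with y hy
    have h2 := intervalIntegral.integral_Ioi_sub_Ioi hi hy.le
    rw [← h2]; ring
  have hcx : ContinuousAt G x := hG.continuousAt (Ici_mem_nhds hx)
  have h3 : HasDerivAt (fun y => ∫ t in (0 : ℝ)..y, G t) (G x) x := by
    refine intervalIntegral.integral_hasDerivAt_right ?_ ?_ hcx
    · rw [intervalIntegrable_iff_integrableOn_Ioc_of_le hx.le]
      exact hi.mono_set Ioc_subset_Ioi_self
    · exact ContinuousOn.stronglyMeasurableAtFilter isOpen_Ioi (hG.mono Ioi_subset_Ici_self) x hx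
  exact (h3.const_sub _).congr_of_eventuallyEq (h1.mono fun y hy => hy.symm)

lemma DecayPair.integrableOn_mulVec (h : DecayPair u v M) {f : ℝ → Fin 3 → ℂ} (hf : IsBC f)
    (i : Fin 3) : IntegrableOn (fun y => (V₁ (u y) (v y)).mulVec (f y) i) (Ioi 0) := by
  obtain ⟨hc, B, hB⟩ := hf
  have hcont : ContinuousOn (fun y => (V₁ (u y) (v y)).mulVec (f y) i) (Ioi 0) := by
    simp only [Matrix.mulVec, dotProduct]
    refine continuousOn_finsetSum _ fun j _ => ?_
    exact ((continuousOn_V₁ h.cont_left h.cont_right i j).mono Ioi_subset_Ici_self).mul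
      ((continuous_apply j).comp hc).continuousOn
  refine ((integrableOn_inv_sq le_rfl).const_mul (3 * M * B)).mono'
    (hcont.aestronglyMeasurable measurableSet_Ioi) ?_
  filter_upwards [ae_restrict_mem measurableSet_Ioi] with y hy
  have hy0 : 0 ≤ y := (mem_Ioi.1 hy).le
  refine (norm_mulVec_le (norm_V₁_le (h.bound_left y hy0) (h.bound_right y hy0)) (hB y) i).trans ?_
  have hM := h.nonneg
  have hB0 : 0 ≤ B := (norm_nonneg _).trans (hB 0)
  rw [mul_one_div, mul_div_assoc', div_mul_eq_mul_div]
  apply div_le_div_of_nonneg_left (by positivity) (by positivity)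
  exact pow_le_pow_right₀ (by linarith) (by norm_num)

/-- The kernel factors as `e^{dx} e^{-dy}`, so the product rule applies to an exponential times a
tail integral with integrand independent of `x`. -/
lemma IsSpaceSol.hasDerivAt (h : DecayPair u v M) {k : ℂ} (hk : k ∈ closedSector)
    {w : ℝ → Fin 3 → ℂ} (hw : IsSpaceSol u v k w) {x : ℝ} (hx : 0 < x) (i : Fin 3) :
    HasDerivAt (fun x => w x i)
      ((l k i - l k 2) * w x i + (V₁ (u x) (v x)).mulVec (w x) i) x := by
  set d := l k i - l k 2 with hd
  set F : ℝ → ℂ := fun y => (V₁ (u y) (v y)).mulVec (w y) i with hF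
  have hFi := h.integrableOn_mulVec hw.1 i
  have hFc : ContinuousOn F (Ici 0) := by
    simp only [hF, Matrix.mulVec, dotProduct]
    refine continuousOn_finsetSum _ fun j _ => ?_
    exact (continuousOn_V₁ h.cont_left h.cont_right i j).mul
      ((continuous_apply j).comp hw.1.1).continuousOn
  have hG : IntegrableOn (fun y : ℝ => Complex.exp (-d * (y : ℂ)) * F y) (Ioi 0) := by
    refine Integrable.mono hFi ((by fun_prop : Continuous fun y : ℝ => Complex.exp (-d * (y : ℂ)))
      |>.aestronglyMeasurable.mul hFi.aestronglyMeasurable) ?_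
    filter_upwards [ae_restrict_mem measurableSet_Ioi] with y hy
    have := norm_exp_decay hk i (r := -y) (by linarith [mem_Ioi.1 hy])
    rw [norm_mul]
    have e : -d * (y : ℂ) = d * ((-y : ℝ) : ℂ) := by push_cast; ring
    rw [e]
    exact mul_le_of_le_one_left (norm_nonneg _) this
  have hGc : ContinuousOn (fun y : ℝ => Complex.exp (-d * (y : ℂ)) * F y) (Ici 0) :=
    (by fun_prop : Continuous fun y : ℝ => Complex.exp (-d * (y : ℂ))).continuousOn.mul hFc
  have hwx : ∀ x : ℝ, 0 < x → w x i = e₃ i - Complex.exp (d * (x : ℂ)) *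
      ∫ y : ℝ in Ioi x, Complex.exp (-d * (y : ℂ)) * F y := fun x hx => by
    have := congrFun (hw.2 x) i
    rw [Pi.add_apply, volterraOp_spaceKernel_one k w hx.le i, ← sub_eq_add_neg] at this
    rw [this, ← integral_const_mul]
    congr 1
    refine setIntegral_congr_fun measurableSet_Ioi fun y _ => ?_
    rw [← mul_assoc, ← Complex.exp_add]
    congr 2
    push_cast; ring
  have hexp : HasDerivAt (fun x : ℝ => Complex.exp (d * (x : ℂ)))
      (Complex.exp (d * (x : ℂ)) * (d * 1)) x :=
    (((hasDerivAt_id x).ofReal_comp).const_mul d).cexp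
  have h1 := (hexp.mul (hasDerivAt_integral_Ioi hGc hG hx)).const_sub (e₃ i)
  have h2 := h1.congr_of_eventuallyEq (f₁ := fun x => w x i)
    (by filter_upwards [Ioi_mem_nhds hx] with y hy; exact hwx y hy)
  refine h2.congr_deriv ?_
  have h3 := hwx x hx
  -- The constant term creates no inhomogeneity: `d` vanishes for the third entry and `e₃` vanishes
  -- in the other two.
  have h4 : d * e₃ i = 0 := by
    fin_cases i <;> simp [hd]
  have h5 : Complex.exp (d * (x : ℂ)) * Complex.exp (-d * (x : ℂ)) = 1 := by
    rw [← Complex.exp_add]; simp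
  rw [h3]
  linear_combination F x * h5 - h4

lemma IsSpaceSol.tendsto (h : DecayPair u v M) {k : ℂ} (hk : k ∈ closedSector)
    {w : ℝ → Fin 3 → ℂ} (hw : IsSpaceSol u v k w) : Tendsto w atTop (𝓝 e₃) := by
  have h1 := (tendsto_volterraOp (h.isVolterraKernel_one hk) hw.1).const_add e₃
  rw [add_zero] at h1
  exact h1.congr fun x => (hw.2 x).symm

/-- A solution of `y' = d y + F` that vanishes at `∞`, with `0 ≤ Re d`, is given by an integral
from `∞`. -/
lemma eq_integral_of_ode {d : ℂ} (hd : 0 ≤ d.re) {y F : ℝ → ℂ} (hy : ContinuousOn y (Ici 0))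
    (hy' : ∀ x, 0 < x → HasDerivAt y (d * y x + F x) x) (hF : IntegrableOn F (Ioi 0))
    (hlim : Tendsto y atTop (𝓝 0)) {x : ℝ} (hx : 0 ≤ x) :
    y x = -∫ t in Ioi x, Complex.exp (d * ((x - t : ℝ) : ℂ)) * F t := by
  have hn : ∀ t : ℝ, x ≤ t → ‖Complex.exp (d * ((x - t : ℝ) : ℂ))‖ ≤ 1 := fun t ht => by
    rw [Complex.norm_exp, Complex.re_mul_ofReal]
    exact Real.exp_le_one_iff.2 (mul_nonpos_of_nonneg_of_nonpos hd (by linarith))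
  have hexp : ∀ t : ℝ, HasDerivAt (fun t : ℝ => Complex.exp (d * ((x - t : ℝ) : ℂ)))
      (Complex.exp (d * ((x - t : ℝ) : ℂ)) * (d * ((-1 : ℝ) : ℂ))) t := fun t =>
    ((((hasDerivAt_id t).const_sub x).ofReal_comp).const_mul d).cexp
  have hec : Continuous fun t : ℝ => Complex.exp (d * ((x - t : ℝ) : ℂ)) := by fun_prop
  -- The integrand is the derivative of `e^{d(x-t)} y(t)`, which tends to zero at infinity because
  -- `0 ≤ Re d`.
  have h1 : ∫ t in Ioi x, Complex.exp (d * ((x - t : ℝ) : ℂ)) * F t =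
      0 - Complex.exp (d * ((x - x : ℝ) : ℂ)) * y x := by
    refine integral_Ioi_of_hasDerivAt_of_tendsto
      (f := fun t => Complex.exp (d * ((x - t : ℝ) : ℂ)) * y t) ?_ ?_ ?_ ?_
    · exact (hec.continuousOn.mul (hy.mono (Ici_subset_Ici.2 hx))) x self_mem_Ici
    · intro t ht
      have := (hexp t).mul (hy' t (hx.trans_lt ht))
      refine this.congr_deriv ?_
      push_cast; ring
    · refine Integrable.mono (hF.mono_set (Ioi_subset_Ioi hx)) (hec.aestronglyMeasurable.mul
        (hF.mono_set (Ioi_subset_Ioi hx)).aestronglyMeasurable) ?_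
      filter_upwards [ae_restrict_mem measurableSet_Ioi] with t ht
      rw [norm_mul]
      exact mul_le_of_le_one_left (norm_nonneg _) (hn t (mem_Ioi.1 ht).le)
    · refine squeeze_zero_norm' ?_ (tendsto_zero_iff_norm_tendsto_zero.1 hlim)
      filter_upwards [eventually_ge_atTop x] with t ht
      rw [norm_mul]
      exact mul_le_of_le_one_left (norm_nonneg _) (hn t ht)
  rw [h1]; simp

end

end

noncomputable section

/-! ### The `t`-evolution of the space columns -/


lemma V₁_mulVec_zero (q r : ℂ) (w : Fin 3 → ℂ) : (V₁ q r).mulVec w 0 = q * w 1 + r * w 2 := by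
  simp [V₁, Matrix.mulVec, dotProduct, Fin.sum_univ_three]

lemma V₁_mulVec_one (q r : ℂ) (w : Fin 3 → ℂ) : (V₁ q r).mulVec w 1 = r * w 0 + q * w 2 := by
  simp [V₁, Matrix.mulVec, dotProduct, Fin.sum_univ_three]

lemma V₁_mulVec_two (q r : ℂ) (w : Fin 3 → ℂ) : (V₁ q r).mulVec w 2 = q * w 0 + r * w 1 := by
  simp [V₁, Matrix.mulVec, dotProduct, Fin.sum_univ_three]

lemma V₂_mulVec_zero (k q r q' r' : ℂ) (w : Fin 3 → ℂ) : (V₂ k q r q' r').mulVec w 0 =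
    (k * ω * q + (2 * ω + 1) / 3 * q' - r ^ 2) * w 1 +
      (k * ω ^ 2 * r - (2 * ω + 1) / 3 * r' - q ^ 2) * w 2 := by
  simp [V₂, Matrix.mulVec, dotProduct, Fin.sum_univ_three, I_div_sqrt3]; ring

lemma V₂_mulVec_one (k q r q' r' : ℂ) (w : Fin 3 → ℂ) : (V₂ k q r q' r').mulVec w 1 =
    (k * ω * r - (2 * ω + 1) / 3 * r' - q ^ 2) * w 0 +
      (k * q + (2 * ω + 1) / 3 * q' - r ^ 2) * w 2 := by
  simp [V₂, Matrix.mulVec, dotProduct, Fin.sum_univ_three, I_div_sqrt3]; ring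

lemma V₂_mulVec_two (k q r q' r' : ℂ) (w : Fin 3 → ℂ) : (V₂ k q r q' r').mulVec w 2 =
    (k * ω ^ 2 * q + (2 * ω + 1) / 3 * q' - r ^ 2) * w 0 +
      (k * r - (2 * ω + 1) / 3 * r' - q ^ 2) * w 1 := by
  simp [V₂, Matrix.mulVec, dotProduct, Fin.sum_univ_three, I_div_sqrt3]; ring

/-- The `t`-part of the Lax pair applied to a vector. -/
def laxB (k q r q' r' : ℂ) (w : Fin 3 → ℂ) (i : Fin 3) : ℂ :=
  (z k i - z k 2) * w i + (V₂ k q r q' r').mulVec w i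


/-- Zero curvature in vector form, with `eq` and `er` the two evolution equations. The last term is
what differentiating the `x`-part in `t` produces, so `laxB` of a space column satisfies the same
equation as its time derivative. Each row is a polynomial identity modulo `ω² + ω + 1 = 0`. -/
lemma hasDerivAt_laxB {k : ℂ} {q r q' r' : ℝ → ℂ} {w : ℝ → Fin 3 → ℂ} {q'' r'' qt rt : ℂ} {x : ℝ}
    (hq : HasDerivAt q (q' x) x) (hr : HasDerivAt r (r' x) x) (hq' : HasDerivAt q' q'' x)
    (hr' : HasDerivAt r' r'' x) (eq : qt = (2 * ω + 1) / 3 * q'' - 2 * r x * r' x)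
    (er : rt = -((2 * ω + 1) / 3) * r'' - 2 * q x * q' x)
    (hw : ∀ i, HasDerivAt (fun x => w x i)
      ((l k i - l k 2) * w x i + (V₁ (q x) (r x)).mulVec (w x) i) x) (i : Fin 3) :
    HasDerivAt (fun x => laxB k (q x) (r x) (q' x) (r' x) (w x) i)
      ((l k i - l k 2) * laxB k (q x) (r x) (q' x) (r' x) (w x) i +
        ((V₁ (q x) (r x)).mulVec (laxB k (q x) (r x) (q' x) (r' x) (w x)) i +
          (V₁ qt rt).mulVec (w x) i)) x := by
  have w0 := hw 0
  have w1 := hw 1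
  have w2 := hw 2
  have hω := ω_sq
  have a₁ := fun a : ℂ => ((hq.const_mul a).add (hq'.const_mul ((2 * ω + 1) / 3))).sub (hr.fun_pow 2)
  have a₂ := fun a : ℂ => ((hr.const_mul a).sub (hr'.const_mul ((2 * ω + 1) / 3))).sub (hq.fun_pow 2)
  subst eq er
  fin_cases i
  · have h := (w0.const_mul (z k 0 - z k 2)).add (((a₁ (k * ω)).mul w1).add
      ((a₂ (k * ω ^ 2)).mul w2))
    simp only [Fin.zero_eta, laxB, V₂_mulVec_zero]
    refine h.congr_deriv ?_
    simp only [V₁_mulVec_zero, V₁_mulVec_one, V₁_mulVec_two, laxB, V₂_mulVec_one, V₂_mulVec_two,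
      l_zero, l_one, l_two, z_zero, z_one, z_two, Pi.add_apply, Pi.sub_apply]
    clear h a₁ a₂ hw w0 w1 w2 hq hr hq' hr'
    grind
  · have h := (w1.const_mul (z k 1 - z k 2)).add (((a₂ (k * ω)).mul w0).add ((a₁ k).mul w2))
    simp only [Fin.mk_one, laxB, V₂_mulVec_one]
    refine h.congr_deriv ?_
    simp only [V₁_mulVec_zero, V₁_mulVec_one, V₁_mulVec_two, laxB, V₂_mulVec_zero, V₂_mulVec_two,
      l_zero, l_one, l_two, z_zero, z_one, z_two, Pi.add_apply, Pi.sub_apply]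
    clear h a₁ a₂ hw w0 w1 w2 hq hr hq' hr'
    grind
  · have h := (w2.const_mul (z k 2 - z k 2)).add (((a₁ (k * ω ^ 2)).mul w0).add ((a₂ k).mul w1))
    simp only [Fin.reduceFinMk, laxB, V₂_mulVec_two]
    refine h.congr_deriv ?_
    simp only [V₁_mulVec_zero, V₁_mulVec_one, V₁_mulVec_two, laxB, V₂_mulVec_zero, V₂_mulVec_one,
      l_zero, l_one, l_two, z_zero, z_one, z_two, Pi.add_apply, Pi.sub_apply]
    clear h a₁ a₂ hw w0 w1 w2 hq hr hq' hr'
    grind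

/-- A solution of the system in the half-strip, smooth and decaying. -/
structure LaxData (T : ℝ) (f g : ℝ × ℝ → ℂ) : Prop where
  pos : 0 < T
  reg_left : StripReg T 4 f
  reg_right : StripReg T 4 g
  pde_left : ∀ x t, 0 < x → t ∈ Ioo 0 T → dT T f (x, t) =
    (2 * ω + 1) / 3 * dX T (dX T f) (x, t) - 2 * g (x, t) * dX T g (x, t)
  pde_right : ∀ x t, 0 < x → t ∈ Ioo 0 T → dT T g (x, t) =
    -((2 * ω + 1) / 3) * dX T (dX T g) (x, t) - 2 * f (x, t) * dX T f (x, t)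

lemma StripReg.decayPair {T : ℝ} {n : ℕ} {f g : ℝ × ℝ → ℂ} (hf : StripReg T n f)
    (hg : StripReg T n g) : ∃ M, ∀ t ∈ Icc 0 T,
      DecayPair (fun x => f (x, t)) (fun x => g (x, t)) M := by
  obtain ⟨A, hA⟩ := hf.bound
  obtain ⟨B, hB⟩ := hg.bound
  have hc : ∀ t ∈ Icc 0 T, ContinuousOn (fun x : ℝ => (x, t)) (Ici 0) ∧
      MapsTo (fun x : ℝ => (x, t)) (Ici 0) (closedStrip T) := fun t ht =>
    ⟨by fun_prop, fun x hx => ⟨hx, ht⟩⟩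
  refine ⟨max A B, fun t ht => ⟨hf.continuousOn.comp (hc t ht).1 (hc t ht).2,
    hg.continuousOn.comp (hc t ht).1 (hc t ht).2, fun x hx => ?_, fun x hx => ?_⟩⟩
  · exact (hA x t hx ht).trans (by gcongr; exact le_max_left _ _)
  · exact (hB x t hx ht).trans (by gcongr; exact le_max_right _ _)

/-- The third space column at time `t`. -/
def stripSol (f g : ℝ × ℝ → ℂ) (k : ℂ) (t : ℝ) : ℝ → Fin 3 → ℂ :=
  spaceSol (fun x => f (x, t)) (fun x => g (x, t)) k

section

variable {T : ℝ} {f g : ℝ × ℝ → ℂ}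

lemma norm_V₁_taylor_le {a b c a' b' c' : ℂ} {C : ℝ} (d : ℂ) (h : ‖a - b - d * c‖ ≤ C)
    (h' : ‖a' - b' - d * c'‖ ≤ C) (i j : Fin 3) :
    ‖V₁ a a' i j - V₁ b b' i j - d * V₁ c c' i j‖ ≤ C := by
  have e : V₁ a a' i j - V₁ b b' i j - d * V₁ c c' i j =
      V₁ (a - b - d * c) (a' - b' - d * c') i j := by
    fin_cases i <;> fin_cases j <;> simp [V₁]
  rw [e]
  exact norm_V₁_le h h' i j

lemma StripReg.taylor_t {n : ℕ} (hT : 0 < T) (hf : StripReg T (n + 2) f) :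
    ∃ M, ∀ x t t', 0 ≤ x → t ∈ Icc 0 T → t' ∈ Icc 0 T →
      ‖f (x, t') - f (x, t) - ((t' - t : ℝ) : ℂ) * dT T f (x, t)‖ ≤
        M / (1 + x) ^ 4 * |t' - t| ^ 2 := by
  obtain ⟨M, hM⟩ := ((hf.deriv hT (0, 1)).deriv hT (0, 1)).bound
  refine ⟨M, fun x t t' hx ht ht' => ?_⟩
  have := taylor_two (f := fun t => f (x, t)) (f' := fun t => dT T f (x, t))
    (f'' := fun t => dT T (dT T f) (x, t)) (convex_Icc 0 T)
    (fun p hp => hf.hasDerivWithinAt_t hx hp)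
    (fun p hp => (hf.deriv hT (0, 1)).hasDerivWithinAt_t hx hp)
    (fun p hp => hM x p hx hp) ht ht'
  simpa [Complex.real_smul] using this

/-- The space column is differentiable in `t`, and its derivative solves the differentiated
Volterra equation. -/
lemma LaxData.hasDerivWithinAt_stripSol (h : LaxData T f g) {k : ℂ} (hk : k ∈ closedSector)
    {t : ℝ} (ht : t ∈ Icc 0 T) :
    ∃ w' : ℝ → Fin 3 → ℂ, IsBC w' ∧
      (∀ x, w' x = volterraOp (spaceKernel (fun _ _ => 1) (fun x => dT T f (x, t))
          (fun x => dT T g (x, t)) k) (stripSol f g k t) x +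
        volterraOp (spaceKernel (fun _ _ => 1) (fun x => f (x, t)) (fun x => g (x, t)) k) w' x) ∧
      ∀ x, HasDerivWithinAt (fun t => stripSol f g k t x) (w' x) (Icc 0 T) t := by
  obtain ⟨M₀, hM₀⟩ := h.reg_left.decayPair h.reg_right
  obtain ⟨M₁, hM₁⟩ := (h.reg_left.deriv h.pos (0, 1)).decayPair (h.reg_right.deriv h.pos (0, 1))
  obtain ⟨M₂, hM₂⟩ := h.reg_left.taylor_t h.pos
  obtain ⟨M₃, hM₃⟩ := h.reg_right.taylor_t h.pos
  set M := max (max M₀ M₁) (max M₂ M₃) with hM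
  have m₀ : M₀ ≤ M := (le_max_left _ _).trans (le_max_left _ _)
  have m₁ : M₁ ≤ M := (le_max_right _ _).trans (le_max_left _ _)
  have m₂ : M₂ ≤ M := (le_max_left _ _).trans (le_max_right _ _)
  have m₃ : M₃ ≤ M := (le_max_right _ _).trans (le_max_right _ _)
  have hM0 : 0 ≤ M := (hM₀ t ht).nonneg.trans m₀
  -- Here the small parameter is `t' - t`. The kernel is linear in the potentials, so Taylor's
  -- formula for the potentials in time is all that is needed.
  obtain ⟨w', hw', ew', C, hC⟩ := volterra_taylor (((hM₀ t ht).isVolterraKernel_one hk).mono m₀)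
    (((hM₁ t ht).isVolterraKernel_one hk).mono m₁) ((hM₀ t ht).spaceSol_spec hk).1
    ((hM₀ t ht).spaceSol_spec hk).2
  refine ⟨w', hw', ew', fun x => hasDerivWithinAt_of_quadratic (C := C) fun t' ht' hd => ?_⟩
  have hn : ‖((t' - t : ℝ) : ℂ)‖ = ‖t' - t‖ := Complex.norm_real _
  have key := hC ((t' - t : ℝ) : ℂ) _ _ (by rwa [hn])
    (((hM₀ t' ht').isVolterraKernel_one hk).mono m₀) ((hM₀ t' ht').spaceSol_spec hk).1
    ((hM₀ t' ht').spaceSol_spec hk).2 (fun x y hx hy i j => by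
      have hy0 : 0 ≤ y := hx.trans hy.le
      have h1 : ‖f (y, t') - f (y, t) - ((t' - t : ℝ) : ℂ) * dT T f (y, t)‖ ≤
          M / (1 + y) ^ 4 * |t' - t| ^ 2 := (hM₂ y t t' hy0 ht ht').trans (by gcongr)
      have h2 : ‖g (y, t') - g (y, t) - ((t' - t : ℝ) : ℂ) * dT T g (y, t)‖ ≤
          M / (1 + y) ^ 4 * |t' - t| ^ 2 := (hM₃ y t t' hy0 ht ht').trans (by gcongr)
      have h3 := norm_V₁_taylor_le _ h1 h2 i j
      have h4 := norm_exp_decay hk i (r := x - y) (by linarith)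
      have e : spaceKernel (fun _ _ => 1) (fun x => f (x, t')) (fun x => g (x, t')) k x y i j -
          spaceKernel (fun _ _ => 1) (fun x => f (x, t)) (fun x => g (x, t)) k x y i j -
          ((t' - t : ℝ) : ℂ) * spaceKernel (fun _ _ => 1) (fun x => dT T f (x, t))
            (fun x => dT T g (x, t)) k x y i j =
          -(Complex.exp ((l k i - l k 2) * ((x - y : ℝ) : ℂ)) *
            (V₁ (f (y, t')) (g (y, t')) i j - V₁ (f (y, t)) (g (y, t)) i j -
            ((t' - t : ℝ) : ℂ) * V₁ (dT T f (y, t)) (dT T g (y, t)) i j)) := by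
        simp only [spaceKernel, max_eq_left hy0]; ring
      rw [e, norm_neg, norm_mul, hn, Real.norm_eq_abs]
      calc _ ≤ 1 * (M / (1 + y) ^ 4 * |t' - t| ^ 2) := by gcongr
        _ = M * |t' - t| ^ 2 / (1 + y) ^ 4 := by ring
        _ ≤ _ := by
          apply div_le_div_of_nonneg_left (by positivity) (by positivity)
          exact pow_le_pow_right₀ (by linarith) (by norm_num)) x
  rw [hn] at key
  have e : (t' - t) • w' x = ((t' - t : ℝ) : ℂ) • w' x := (Complex.coe_smul _ _).symm
  rw [e]
  exact key

lemma continuousOn_laxB {k : ℂ} {s : Set ℝ} {q r q' r' : ℝ → ℂ} {w : ℝ → Fin 3 → ℂ}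
    (hq : ContinuousOn q s) (hr : ContinuousOn r s) (hq' : ContinuousOn q' s)
    (hr' : ContinuousOn r' s) (hw : ContinuousOn w s) :
    ContinuousOn (fun x => laxB k (q x) (r x) (q' x) (r' x) (w x)) s := by
  have hw' : ∀ i, ContinuousOn (fun x => w x i) s := fun i =>
    (continuous_apply i).comp_continuousOn hw
  have h0 := hw' 0
  have h1 := hw' 1
  have h2 := hw' 2
  refine continuousOn_pi.2 fun i => ?_
  fin_cases i <;> simp only [Fin.zero_eta, Fin.mk_one, Fin.reduceFinMk, laxB, V₂_mulVec_zero,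
    V₂_mulVec_one, V₂_mulVec_two] <;> fun_prop

/-- The diagonal term kills `e₃`, whose only nonzero entry meets `z₃ - z₃`; everything else vanishes
with the potentials. -/
lemma tendsto_laxB {k : ℂ} {q r q' r' : ℝ → ℂ} {w : ℝ → Fin 3 → ℂ}
    (hq : Tendsto q atTop (𝓝 0)) (hr : Tendsto r atTop (𝓝 0)) (hq' : Tendsto q' atTop (𝓝 0))
    (hr' : Tendsto r' atTop (𝓝 0)) (hw : Tendsto w atTop (𝓝 e₃)) :
    Tendsto (fun x => laxB k (q x) (r x) (q' x) (r' x) (w x)) atTop (𝓝 0) := by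
  have hcont : Continuous fun p : (ℂ × ℂ) × (ℂ × ℂ) × (Fin 3 → ℂ) =>
      laxB k p.1.1 p.1.2 p.2.1.1 p.2.1.2 p.2.2 := by
    refine continuous_pi fun i => ?_
    fin_cases i <;> simp only [Fin.zero_eta, Fin.mk_one, Fin.reduceFinMk, laxB, V₂_mulVec_zero,
      V₂_mulVec_one, V₂_mulVec_two] <;> fun_prop
  have h1 := (hcont.tendsto ((0, 0), (0, 0), e₃)).comp
    ((hq.prodMk_nhds hr).prodMk_nhds ((hq'.prodMk_nhds hr').prodMk_nhds hw))
  have h2 : laxB k 0 0 0 0 e₃ = 0 := by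
    ext i
    fin_cases i <;> simp [laxB, V₂_mulVec_zero, V₂_mulVec_one, V₂_mulVec_two]
  simp only [h2] at h1
  exact h1

lemma tendsto_zero_of_decay {u : ℝ → ℂ} {M : ℝ} (h : ∀ x, 0 ≤ x → ‖u x‖ ≤ M / (1 + x) ^ 4) :
    Tendsto u atTop (𝓝 0) := by
  refine squeeze_zero_norm' (a := fun x : ℝ => M / (1 + x) ^ 4) ?_ ?_
  · filter_upwards [eventually_ge_atTop 0] with x hx using h x hx
  · refine Tendsto.div_atTop tendsto_const_nhds ?_
    exact (tendsto_pow_atTop (by norm_num)).comp (tendsto_atTop_add_const_left _ 1 tendsto_id)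

/-- The space column at the boundary satisfies the `t`-part of the Lax pair. -/
lemma LaxData.hasDerivAt_stripSol_zero (h : LaxData T f g) {k : ℂ} (hk : k ∈ closedSector)
    {t : ℝ} (ht : t ∈ Ioo 0 T) :
    HasDerivAt (fun t => stripSol f g k t 0)
      (laxB k (f (0, t)) (g (0, t)) (dX T f (0, t)) (dX T g (0, t)) (stripSol f g k t 0)) t := by
  have ht' := Ioo_subset_Icc_self ht
  obtain ⟨w', hw', ew', hd⟩ := h.hasDerivWithinAt_stripSol hk ht'
  obtain ⟨M₀, hM₀⟩ := h.reg_left.decayPair h.reg_right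
  obtain ⟨M₁, hM₁⟩ := (h.reg_left.deriv h.pos (0, 1)).decayPair (h.reg_right.deriv h.pos (0, 1))
  obtain ⟨M₂, hM₂⟩ := (h.reg_left.deriv h.pos (1, 0)).decayPair (h.reg_right.deriv h.pos (1, 0))
  have d₀ := hM₀ t ht'
  have d₁ := hM₁ t ht'
  have d₂ := hM₂ t ht'
  have hw := d₀.spaceSol_spec hk
  set w := spaceSol (fun x => f (x, t)) (fun x => g (x, t)) k with hwdef
  set U : ℝ → Fin 3 → ℂ := fun x => laxB k (f (x, t)) (g (x, t)) (dX T f (x, t)) (dX T g (x, t))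
    (w x) with hU
  have hUc : ContinuousOn U (Ici 0) := continuousOn_laxB d₀.cont_left d₀.cont_right d₂.cont_left
    d₂.cont_right hw.1.1.continuousOn
  have hUlim : Tendsto U atTop (𝓝 0) := tendsto_laxB (tendsto_zero_of_decay d₀.bound_left)
    (tendsto_zero_of_decay d₀.bound_right) (tendsto_zero_of_decay d₂.bound_left)
    (tendsto_zero_of_decay d₂.bound_right) (hw.tendsto d₀ hk)
  have hUBC : IsBC fun x => U (max x 0) := by
    have hc : Continuous fun x => U (max x 0) :=
      hUc.comp_continuous (by fun_prop) fun x => le_max_right x 0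
    refine ⟨hc, ?_⟩
    obtain ⟨R, hR⟩ := eventually_atTop.1 (hUlim.norm.eventually_le_const
      (show ‖(0 : Fin 3 → ℂ)‖ < 1 by simp))
    obtain ⟨C, hC⟩ := isCompact_Icc.exists_bound_of_continuousOn (s := Icc 0 (max R 0))
      (hUc.mono fun x hx => hx.1)
    refine ⟨max C 1, fun x => ?_⟩
    rcases le_total (max x 0) (max R 0) with hx | hx
    · exact (hC _ ⟨le_max_right _ _, hx⟩).trans (le_max_left _ _)
    · exact (hR _ ((le_max_left _ _).trans hx)).trans (le_max_right _ _)
  have hUd : ∀ x, 0 < x → ∀ i, HasDerivAt (fun x => U x i)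
      ((l k i - l k 2) * U x i + ((V₁ (f (x, t)) (g (x, t))).mulVec (U x) i +
        (V₁ (dT T f (x, t)) (dT T g (x, t))).mulVec (w x) i)) x := fun x hx i =>
    hasDerivAt_laxB (q := fun x => f (x, t)) (r := fun x => g (x, t)) (q' := fun x => dX T f (x, t))
      (r' := fun x => dX T g (x, t)) (h.reg_left.hasDerivAt_x hx ht')
      (h.reg_right.hasDerivAt_x hx ht') ((h.reg_left.deriv h.pos (1, 0)).hasDerivAt_x hx ht')
      ((h.reg_right.deriv h.pos (1, 0)).hasDerivAt_x hx ht') (h.pde_left x t hx ht)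
      (h.pde_right x t hx ht) (fun i => hw.hasDerivAt d₀ hk hx i) i
  have i₁ := fun i => d₁.integrableOn_mulVec hw.1 i
  have i₀ : ∀ i, IntegrableOn (fun y => (V₁ (f (y, t)) (g (y, t))).mulVec (U y) i) (Ioi 0) :=
    fun i => (d₀.integrableOn_mulVec hUBC i).congr_fun (fun y hy => by
      simp only [max_eq_left (mem_Ioi.1 hy).le]) measurableSet_Ioi
  -- The zero curvature equation, integrated from infinity where `U` vanishes, is the Volterra
  -- equation satisfied by the time derivative `w'`. Uniqueness of bounded solutions then identifies
  -- `U` with `w'`.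
  have hUe : ∀ x, U (max x 0) = volterraOp (spaceKernel (fun _ _ => 1) (fun x => dT T f (x, t))
          (fun x => dT T g (x, t)) k) w x +
        volterraOp (spaceKernel (fun _ _ => 1) (fun x => f (x, t)) (fun x => g (x, t)) k)
          (fun x => U (max x 0)) x := by
    intro x
    ext i
    have hx := le_max_right x 0
    have h1 := eq_integral_of_ode (d := l k i - l k 2) (y := fun x => U x i)
      (F := fun x => (V₁ (f (x, t)) (g (x, t))).mulVec (U x) i +
        (V₁ (dT T f (x, t)) (dT T g (x, t))).mulVec (w x) i)
      (by rw [Complex.sub_re]; exact sub_nonneg.2 (hk i))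
      ((continuous_apply i).comp_continuousOn hUc) (fun x hx => hUd x hx i)
      ((i₀ i).add (i₁ i)) (by simpa using (tendsto_pi_nhds.1 hUlim) i) hx
    have hw2 : volterraOp (spaceKernel (fun _ _ => 1) (fun x => dT T f (x, t))
          (fun x => dT T g (x, t)) k) w x = volterraOp (spaceKernel (fun _ _ => 1)
            (fun x => dT T f (x, t)) (fun x => dT T g (x, t)) k) w (max x 0) := by
      unfold volterraOp; rw [max_eq_left hx]
    rw [h1, Pi.add_apply, hw2, volterraOp_max, volterraOp_spaceKernel_one k _ hx,
      volterraOp_spaceKernel_one k _ hx, ← neg_add, add_comm (∫ _ in _, _), ← integral_add]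
    · simp only [mul_add]
    · have := (d₀.isVolterraKernel_one hk).integrable hUBC hx i
      refine (this.neg.congr_fun (fun y hy => ?_) measurableSet_Ioi)
      have hy0 : 0 ≤ y := hx.trans (mem_Ioi.1 hy).le
      simp only [Pi.neg_apply, spaceKernel_one_mulVec k hy0, neg_neg, max_eq_left hy0]
    · have := (d₁.isVolterraKernel_one hk).integrable hw.1 hx i
      refine (this.neg.congr_fun (fun y hy => ?_) measurableSet_Ioi)
      have hy0 : 0 ≤ y := hx.trans (mem_Ioi.1 hy).le
      simp only [Pi.neg_apply, spaceKernel_one_mulVec k hy0, neg_neg]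
  have heq := volterra_solution_unique (d₀.isVolterraKernel_one hk) hw' hUBC ew' hUe
  have := (hd 0).hasDerivAt (Icc_mem_nhds ht.1 ht.2)
  rw [heq] at this
  simp only [max_self] at this
  exact this

lemma LaxData.continuousOn_stripSol_zero (h : LaxData T f g) {k : ℂ} (hk : k ∈ closedSector) :
    ContinuousOn (fun t => stripSol f g k t 0) (Icc 0 T) := fun _ ht => by
  obtain ⟨w', -, -, hd⟩ := h.hasDerivWithinAt_stripSol hk ht
  exact (hd 0).continuousWithinAt

end

end

noncomputable section

/-! ### Large `k` asymptotics of the space columns -/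

/-- `1/(ω-1)`. -/
def αc : ℂ := -(2 + ω) / 3

/-- `1/(ω-ω²)`. -/
def βc : ℂ := -(2 * ω + 1) / 3

section

variable {ι : Type*}

/-- A family of functions on the half-line, bounded uniformly. -/
def UBdd (F : ι → ℝ → ℂ) : Prop := ∃ C, ∀ i x, 0 ≤ x → ‖F i x‖ ≤ C

/-- A family of functions on the half-line which is `O((1+x)⁻⁴)` uniformly. -/
def UDec (F : ι → ℝ → ℂ) : Prop := ∃ C, ∀ i x, 0 ≤ x → ‖F i x‖ ≤ C / (1 + x) ^ 4

lemma UDec.uBdd {F : ι → ℝ → ℂ} (h : UDec F) : UBdd F := by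
  obtain ⟨C, hC⟩ := h
  refine ⟨C, fun i x hx => (hC i x hx).trans ?_⟩
  have h0 : 0 ≤ C := by simpa using (norm_nonneg _).trans (hC i 0 le_rfl)
  exact div_le_self h0 (one_le_pow₀ (by linarith))

lemma UDec.add {F G : ι → ℝ → ℂ} (hF : UDec F) (hG : UDec G) : UDec fun i x => F i x + G i x := by
  obtain ⟨A, hA⟩ := hF
  obtain ⟨B, hB⟩ := hG
  refine ⟨A + B, fun i x hx => (norm_add_le _ _).trans ?_⟩
  rw [add_div]
  exact add_le_add (hA i x hx) (hB i x hx)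

lemma UDec.mul {F G : ι → ℝ → ℂ} (hF : UDec F) (hG : UBdd G) : UDec fun i x => F i x * G i x := by
  obtain ⟨A, hA⟩ := hF
  obtain ⟨B, hB⟩ := hG
  refine ⟨A * B, fun i x hx => ?_⟩
  have hA0 : 0 ≤ A / (1 + x) ^ 4 := (norm_nonneg _).trans (hA i x hx)
  rw [norm_mul, mul_div_right_comm]
  exact mul_le_mul (hA i x hx) (hB i x hx) (norm_nonneg _) hA0

lemma UDec.const_mul {F : ι → ℝ → ℂ} (c : ℂ) (hF : UDec F) : UDec fun i x => c * F i x := by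
  obtain ⟨A, hA⟩ := hF
  refine ⟨‖c‖ * A, fun i x hx => ?_⟩
  rw [norm_mul, mul_div_assoc]
  exact mul_le_mul_of_nonneg_left (hA i x hx) (norm_nonneg _)

lemma UDec.sub {F G : ι → ℝ → ℂ} (hF : UDec F) (hG : UDec G) : UDec fun i x => F i x - G i x := by
  simpa [sub_eq_add_neg] using hF.add (hG.const_mul (-1))

/-- The antiderivative taken is minus the tail integral, the one that vanishes at infinity. Freezing
`F` for negative `x` makes the fundamental theorem of calculus applicable at every point. -/
lemma exists_antideriv {F : ι → ℝ → ℂ} (hF : UDec F) (hc : ∀ i, ContinuousOn (F i) (Ici 0)) :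
    ∃ G : ι → ℝ → ℂ, UBdd G ∧ (∀ i, ContinuousOn (G i) (Ici 0)) ∧
      (∀ i, Tendsto (G i) atTop (𝓝 0)) ∧ ∀ i x, 0 < x → HasDerivAt (G i) (F i x) x := by
  obtain ⟨C, hC⟩ := hF
  have hcm : ∀ i, Continuous fun x => F i (max x 0) := fun i =>
    (hc i).comp_continuous (by fun_prop) fun x => le_max_right x 0
  have hint : ∀ i, IntegrableOn (fun x => F i (max x 0)) (Ioi 0) := fun i => by
    refine ((integrableOn_inv_sq le_rfl).const_mul C).mono'
      (hcm i).aestronglyMeasurable ?_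
    filter_upwards [ae_restrict_mem measurableSet_Ioi] with y hy
    have hy0 : 0 ≤ y := (mem_Ioi.1 hy).le
    have h0 : 0 ≤ C := by simpa using (norm_nonneg _).trans (hC i 0 le_rfl)
    rw [max_eq_left hy0, mul_one_div]
    refine (hC i y hy0).trans (div_le_div_of_nonneg_left h0 (by positivity) ?_)
    exact pow_le_pow_right₀ (by linarith) (by norm_num)
  have hder : ∀ i x, HasDerivAt (fun x => (∫ y in (0 : ℝ)..x, F i (max y 0)) -
      ∫ y in Ioi 0, F i (max y 0)) (F i (max x 0)) x := fun i x =>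
    (intervalIntegral.integral_hasDerivAt_right ((hcm i).intervalIntegrable _ _)
      ((hcm i).stronglyMeasurableAtFilter _ _) (hcm i).continuousAt).sub_const _
  refine ⟨fun i x => (∫ y in (0 : ℝ)..x, F i (max y 0)) - ∫ y in Ioi 0, F i (max y 0),
    ⟨C * ∫ y in Ioi (0 : ℝ), 1 / (1 + y) ^ 2, fun i x hx => ?_⟩,
    fun i x _ => (hder i x).continuousAt.continuousWithinAt, fun i => ?_, fun i x hx => ?_⟩
  · have h0 : 0 ≤ C := by simpa using (norm_nonneg _).trans (hC i 0 le_rfl)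
    have h1 := intervalIntegral.integral_Ioi_sub_Ioi (hint i) hx
    have h2 : (∫ y in (0 : ℝ)..x, F i (max y 0)) - ∫ y in Ioi 0, F i (max y 0) =
        -∫ y in Ioi x, F i (max y 0) := by rw [← h1]; ring
    beta_reduce
    rw [h2, norm_neg, ← integral_const_mul]
    refine (norm_integral_le_of_norm_le ((integrableOn_inv_sq hx).const_mul C) ?_).trans ?_
    · filter_upwards [ae_restrict_mem measurableSet_Ioi] with y hy
      have hy0 : 0 ≤ y := hx.trans (mem_Ioi.1 hy).le
      rw [max_eq_left hy0, mul_one_div]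
      refine (hC i y hy0).trans (div_le_div_of_nonneg_left h0 (by positivity) ?_)
      exact pow_le_pow_right₀ (by linarith) (by norm_num)
    · refine setIntegral_mono_set ((integrableOn_inv_sq le_rfl).const_mul C) ?_
        (Ioi_subset_Ioi hx).eventuallyLE
      exact Eventually.of_forall fun y => by simp only [Pi.zero_apply]; positivity
  · have := (intervalIntegral_tendsto_integral_Ioi 0 (hint i) tendsto_id).sub_const
      (∫ y in Ioi 0, F i (max y 0))
    simpa using this
  · have := hder i x
    rwa [max_eq_left hx.le] at this

lemma UDec.tendsto {F : ι → ℝ → ℂ} (hF : UDec F) (i : ι) : Tendsto (F i) atTop (𝓝 0) := by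
  obtain ⟨C, hC⟩ := hF
  exact tendsto_zero_of_decay (hC i)

/-- If `p` solves the `x`-part of the Lax pair up to an error `E = O(ε (1+x)⁻⁴)` and has the correct
limit, it is `O(ε)`-close to the space column. -/
lemma DecayPair.norm_spaceSol_sub_le {u v : ℝ → ℂ} {M : ℝ} (h : DecayPair u v M) {k : ℂ}
    (hk : k ∈ closedSector) {p E : ℝ → Fin 3 → ℂ} {ε : ℝ}
    (hp : ∀ x, 0 < x → ∀ i, HasDerivAt (fun x => p x i)
      ((l k i - l k 2) * p x i + (V₁ (u x) (v x)).mulVec (p x) i + E x i) x)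
    (hpc : ContinuousOn p (Ici 0)) (hlim : Tendsto p atTop (𝓝 e₃))
    (hE : ∀ x, 0 ≤ x → ∀ i, ‖E x i‖ ≤ ε / (1 + x) ^ 4) (hEc : ∀ i, ContinuousOn (fun x => E x i) (Ici 0)) :
    ∀ i, ‖spaceSol u v k 0 i - p 0 i‖ ≤
      2 * Real.exp (6 * M + 1) * (∫ y in Ioi (0 : ℝ), 1 / (1 + y) ^ 2) * ε := by
  have hw := h.spaceSol_spec hk
  set w := spaceSol u v k
  have hε : 0 ≤ ε := by
    have := (norm_nonneg _).trans (hE 0 le_rfl 0)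
    simpa using this
  have hEi : ∀ i, IntegrableOn (fun x => E x i) (Ioi 0) := fun i => by
    refine ((integrableOn_inv_sq le_rfl).const_mul ε).mono'
      (((hEc i).mono Ioi_subset_Ici_self).aestronglyMeasurable measurableSet_Ioi) ?_
    filter_upwards [ae_restrict_mem measurableSet_Ioi] with y hy
    have hy0 : 0 ≤ y := (mem_Ioi.1 hy).le
    rw [mul_one_div]
    refine (hE y hy0 i).trans (div_le_div_of_nonneg_left hε (by positivity) ?_)
    exact pow_le_pow_right₀ (by linarith) (by norm_num)
  set Y : ℝ → Fin 3 → ℂ := fun x => w x - p x with hY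
  have hYc : ContinuousOn Y (Ici 0) := hw.1.1.continuousOn.sub hpc
  have hYlim : Tendsto Y atTop (𝓝 0) := by
    simpa using (hw.tendsto h hk).sub hlim
  have hYBC : IsBC fun x => Y (max x 0) := by
    refine ⟨hYc.comp_continuous (by fun_prop) fun x => le_max_right x 0, ?_⟩
    obtain ⟨R, hR⟩ := eventually_atTop.1 (hYlim.norm.eventually_le_const
      (show ‖(0 : Fin 3 → ℂ)‖ < 1 by simp))
    obtain ⟨C, hC⟩ := isCompact_Icc.exists_bound_of_continuousOn (s := Icc 0 (max R 0))
      (hYc.mono fun x hx => hx.1)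
    refine ⟨max C 1, fun x => ?_⟩
    rcases le_total (max x 0) (max R 0) with hx | hx
    · exact (hC _ ⟨le_max_right _ _, hx⟩).trans (le_max_left _ _)
    · exact (hR _ ((le_max_left _ _).trans hx)).trans (le_max_right _ _)
  have iY : ∀ i, IntegrableOn (fun y => (V₁ (u y) (v y)).mulVec (Y y) i) (Ioi 0) :=
    fun i => (h.integrableOn_mulVec hYBC i).congr_fun (fun y hy => by
      simp only [max_eq_left (mem_Ioi.1 hy).le]) measurableSet_Ioi
  have hYd : ∀ x, 0 < x → ∀ i, HasDerivAt (fun x => Y x i)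
      ((l k i - l k 2) * Y x i + ((V₁ (u x) (v x)).mulVec (Y x) i - E x i)) x := fun x hx i => by
    refine ((hw.hasDerivAt h hk hx i).sub (hp x hx i)).congr_deriv ?_
    simp only [hY, Matrix.mulVec_sub, Pi.sub_apply]
    ring
  -- The difference `Y` of exact and approximate column solves the Volterra equation with this
  -- source, and the source is `O(ε)` since the exponentials are bounded in the sector.
  let g : ℝ → Fin 3 → ℂ := fun x i => ∫ y in Ioi (max x 0),
    Complex.exp ((l k i - l k 2) * ((max x 0 - y : ℝ) : ℂ)) * E y i
  have hgi : ∀ x : ℝ, 0 ≤ x → ∀ i, IntegrableOn (fun y : ℝ =>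
      Complex.exp ((l k i - l k 2) * ((x - y : ℝ) : ℂ)) * E y i) (Ioi x) := fun x hx i => by
    refine Integrable.mono ((hEi i).mono_set (Ioi_subset_Ioi hx))
      ((by fun_prop : Continuous fun y : ℝ => Complex.exp ((l k i - l k 2) * ((x - y : ℝ) : ℂ)))
      |>.aestronglyMeasurable.mul ((hEi i).mono_set (Ioi_subset_Ioi hx)).aestronglyMeasurable) ?_
    filter_upwards [ae_restrict_mem measurableSet_Ioi] with y hy
    rw [norm_mul]
    exact mul_le_of_le_one_left (norm_nonneg _) (norm_exp_decay hk i (by linarith [mem_Ioi.1 hy]))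
  have hge : ∀ x, Y (max x 0) = g x +
      volterraOp (spaceKernel (fun _ _ => 1) u v k) (fun x => Y (max x 0)) x := by
    intro x
    ext i
    have hx := le_max_right x 0
    have h1 := eq_integral_of_ode (d := l k i - l k 2) (y := fun x => Y x i)
      (F := fun x => (V₁ (u x) (v x)).mulVec (Y x) i - E x i)
      (by rw [Complex.sub_re]; exact sub_nonneg.2 (hk i))
      ((continuous_apply i).comp_continuousOn hYc) (fun x hx => hYd x hx i)
      ((iY i).sub (hEi i)) (by simpa using (tendsto_pi_nhds.1 hYlim) i) hx
    have i1 : IntegrableOn (fun y : ℝ => Complex.exp ((l k i - l k 2) * ((max x 0 - y : ℝ) : ℂ)) *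
        (V₁ (u y) (v y)).mulVec (Y y) i) (Ioi (max x 0)) := by
      have := (h.isVolterraKernel_one hk).integrable hYBC hx i
      refine (this.neg.congr_fun (fun y hy => ?_) measurableSet_Ioi)
      have hy0 : 0 ≤ y := hx.trans (mem_Ioi.1 hy).le
      simp only [Pi.neg_apply, spaceKernel_one_mulVec k hy0, neg_neg, max_eq_left hy0]
    have h2 := integral_sub i1 (hgi _ hx i)
    simp only [← mul_sub] at h2
    rw [h1, Pi.add_apply, volterraOp_max, volterraOp_spaceKernel_one k _ hx, h2]
    simp only [g]
    ring
  have hI : 0 ≤ ∫ y in Ioi (0 : ℝ), 1 / (1 + y) ^ 2 :=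
    integral_nonneg fun y => by positivity
  have hgb : ∀ x, ‖g x‖ ≤ ε * ∫ y in Ioi (0 : ℝ), 1 / (1 + y) ^ 2 := fun x => by
    refine (pi_norm_le_iff_of_nonneg (by positivity)).2 fun i => ?_
    have hx := le_max_right x 0
    rw [← integral_const_mul]
    refine (norm_integral_le_of_norm_le ((integrableOn_inv_sq hx).const_mul ε) ?_).trans ?_
    · filter_upwards [ae_restrict_mem measurableSet_Ioi] with y hy
      have hy0 : 0 ≤ y := hx.trans (mem_Ioi.1 hy).le
      rw [norm_mul, mul_one_div]
      refine (mul_le_of_le_one_left (norm_nonneg _)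
        (norm_exp_decay hk i (by linarith [mem_Ioi.1 hy]))).trans ?_
      refine (hE y hy0 i).trans (div_le_div_of_nonneg_left hε (by positivity) ?_)
      exact pow_le_pow_right₀ (by linarith) (by norm_num)
    · refine setIntegral_mono_set ((integrableOn_inv_sq le_rfl).const_mul ε) ?_
        (Ioi_subset_Ioi hx).eventuallyLE
      exact Eventually.of_forall fun y => by simp only [Pi.zero_apply]; positivity
  intro i
  have := norm_volterra_solution_le (h.isVolterraKernel_one hk) hYBC hgb hge 0
  simp only [max_self] at this
  refine ((norm_le_pi_norm (Y 0) i).trans this).trans (le_of_eq ?_)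
  ring

end

end

/-! ### Formal expansion of the space column in powers of `1/k` -/

noncomputable section

section

variable {ι : Type*}

/-- `F` is a family of functions continuous on `[0,∞)` with derivatives `F'` on `(0,∞)`. -/
structure UDiff (F F' : ι → ℝ → ℂ) : Prop where
  cont : ∀ i, ContinuousOn (F i) (Ici 0)
  deriv : ∀ i x, 0 < x → HasDerivAt (F i) (F' i x) x

lemma UDiff.add {F F' G G' : ι → ℝ → ℂ} (hF : UDiff F F') (hG : UDiff G G') :
    UDiff (fun i x => F i x + G i x) (fun i x => F' i x + G' i x) :=
  ⟨fun i => (hF.cont i).add (hG.cont i), fun i x hx => (hF.deriv i x hx).add (hG.deriv i x hx)⟩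

lemma UDiff.sub {F F' G G' : ι → ℝ → ℂ} (hF : UDiff F F') (hG : UDiff G G') :
    UDiff (fun i x => F i x - G i x) (fun i x => F' i x - G' i x) :=
  ⟨fun i => (hF.cont i).sub (hG.cont i), fun i x hx => (hF.deriv i x hx).sub (hG.deriv i x hx)⟩

lemma UDiff.mul {F F' G G' : ι → ℝ → ℂ} (hF : UDiff F F') (hG : UDiff G G') :
    UDiff (fun i x => F i x * G i x) (fun i x => F' i x * G i x + F i x * G' i x) :=
  ⟨fun i => (hF.cont i).mul (hG.cont i), fun i x hx => (hF.deriv i x hx).mul (hG.deriv i x hx)⟩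

lemma UDiff.const_mul {F F' : ι → ℝ → ℂ} (c : ℂ) (hF : UDiff F F') :
    UDiff (fun i x => c * F i x) (fun i x => c * F' i x) :=
  ⟨fun i => continuousOn_const.mul (hF.cont i), fun i x hx => (hF.deriv i x hx).const_mul c⟩

/-- A family of pairs of potentials with three derivatives, all `O((1+x)⁻⁴)` uniformly. -/
structure PotJet (q q₁ q₂ q₃ r r₁ r₂ r₃ : ι → ℝ → ℂ) : Prop where
  dq : UDiff q q₁
  dq₁ : UDiff q₁ q₂
  dq₂ : UDiff q₂ q₃
  cq₃ : ∀ i, ContinuousOn (q₃ i) (Ici 0)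
  dr : UDiff r r₁
  dr₁ : UDiff r₁ r₂
  dr₂ : UDiff r₂ r₃
  cr₃ : ∀ i, ContinuousOn (r₃ i) (Ici 0)
  bq : UDec q
  bq₁ : UDec q₁
  bq₂ : UDec q₂
  bq₃ : UDec q₃
  br : UDec r
  br₁ : UDec r₁
  br₂ : UDec r₂
  br₃ : UDec r₃

/-- Coefficients of a third-order approximate column, with remainder coefficients `R`. -/
lemma PotJet.exists_formal {q q₁ q₂ q₃ r r₁ r₂ r₃ : ι → ℝ → ℂ}
    (h : PotJet q q₁ q₂ q₃ r r₁ r₂ r₃) :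
    ∃ m m₂ A₀ A₁ B₀ B₁ A₀' A₁' B₀' B₁' : ι → ℝ → ℂ,
      UBdd m ∧ UBdd m₂ ∧ UBdd A₀ ∧ UBdd A₁ ∧ UBdd B₀ ∧ UBdd B₁ ∧
      (∀ i, Tendsto (m i) atTop (𝓝 0)) ∧ (∀ i, Tendsto (m₂ i) atTop (𝓝 0)) ∧
      (∀ i, Tendsto (A₀ i) atTop (𝓝 0)) ∧ (∀ i, Tendsto (A₁ i) atTop (𝓝 0)) ∧
      (∀ i, Tendsto (B₀ i) atTop (𝓝 0)) ∧ (∀ i, Tendsto (B₁ i) atTop (𝓝 0)) ∧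
      UDiff m (fun i x => (αc + βc) * (q i x * r i x)) ∧
      UDiff m₂ (fun i x => q i x * A₀ i x + r i x * A₁ i x) ∧
      UDiff A₀ A₀' ∧ UDiff A₁ A₁' ∧ UDiff B₀ B₀' ∧ UDiff B₁ B₁' ∧
      (∀ i x, A₀ i x = -αc * (αc * r₁ i x - (βc * (q i x * q i x) + r i x * m i x))) ∧
      (∀ i x, A₁ i x = -βc * (βc * q₁ i x - (αc * (r i x * r i x) + q i x * m i x))) ∧
      (∀ i x, B₀ i x = -αc * (A₀' i x - (q i x * A₁ i x + r i x * m₂ i x))) ∧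
      (∀ i x, B₁ i x = -βc * (A₁' i x - (r i x * A₀ i x + q i x * m₂ i x))) ∧
      UDec (fun i x => B₀' i x - q i x * B₁ i x) ∧ UDec (fun i x => B₁' i x - r i x * B₀ i x) ∧
      UDec (fun i x => q i x * B₀ i x + r i x * B₁ i x) ∧
      (∀ i, ContinuousOn (fun x => B₀' i x - q i x * B₁ i x) (Ici 0)) ∧
      (∀ i, ContinuousOn (fun x => B₁' i x - r i x * B₀ i x) (Ici 0)) := by
  have hμ : UDec fun i x => (αc + βc) * (q i x * r i x) := (h.bq.mul h.br.uBdd).const_mul _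
  have dμ := (h.dq.mul h.dr).const_mul (αc + βc)
  have hμ' := ((h.bq₁.mul h.br.uBdd).add (h.bq.mul h.br₁.uBdd)).const_mul (αc + βc)
  -- The first two entries are found algebraically at each order, but the third only through its
  -- derivative. The limit `e₃` at infinity fixes the constant, so `m`, and later `m₂`, are tail
  -- integrals.
  obtain ⟨m, bm, cm, lm, hm⟩ := exists_antideriv hμ dμ.cont
  have dm : UDiff m _ := ⟨cm, hm⟩
  -- second order
  have dA₀ := ((h.dr₁.const_mul αc).sub (((h.dq.mul h.dq).const_mul βc).add
    (h.dr.mul dm))).const_mul (-αc)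
  have dA₁ := ((h.dq₁.const_mul βc).sub (((h.dr.mul h.dr).const_mul αc).add
    (h.dq.mul dm))).const_mul (-βc)
  have bA₀ := ((h.br₁.const_mul αc).sub (((h.bq.mul h.bq.uBdd).const_mul βc).add
    (h.br.mul bm))).const_mul (-αc)
  have bA₁ := ((h.bq₁.const_mul βc).sub (((h.br.mul h.br.uBdd).const_mul αc).add
    (h.bq.mul bm))).const_mul (-βc)
  have bA₀' := ((h.br₂.const_mul αc).sub ((((h.bq₁.mul h.bq.uBdd).add
    (h.bq.mul h.bq₁.uBdd)).const_mul βc).add ((h.br₁.mul bm).add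
      (h.br.mul hμ.uBdd)))).const_mul (-αc)
  have bA₁' := ((h.bq₂.const_mul βc).sub ((((h.br₁.mul h.br.uBdd).add
    (h.br.mul h.br₁.uBdd)).const_mul αc).add ((h.bq₁.mul bm).add
      (h.bq.mul hμ.uBdd)))).const_mul (-βc)
  have ddA₀ := ((h.dr₂.const_mul αc).sub ((((h.dq₁.mul h.dq).add
    (h.dq.mul h.dq₁)).const_mul βc).add ((h.dr₁.mul dm).add
      (h.dr.mul dμ)))).const_mul (-αc)
  have ddA₁ := ((h.dq₂.const_mul βc).sub ((((h.dr₁.mul h.dr).add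
    (h.dr.mul h.dr₁)).const_mul αc).add ((h.dq₁.mul dm).add
      (h.dq.mul dμ)))).const_mul (-βc)
  -- The derivative of the third-order coefficient contains the second derivative of the
  -- second-order one; this is where third derivatives of the potentials enter.
  have bA₀'' := ((h.br₃.const_mul αc).sub (((((h.bq₂.mul h.bq.uBdd).add
    (h.bq₁.mul h.bq₁.uBdd)).add ((h.bq₁.mul h.bq₁.uBdd).add
    (h.bq.mul h.bq₂.uBdd))).const_mul βc).add (((h.br₂.mul bm).add (h.br₁.mul hμ.uBdd)).add
      ((h.br₁.mul hμ.uBdd).add (h.br.mul hμ'.uBdd))))).const_mul (-αc)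
  have bA₁'' := ((h.bq₃.const_mul βc).sub (((((h.br₂.mul h.br.uBdd).add
    (h.br₁.mul h.br₁.uBdd)).add ((h.br₁.mul h.br₁.uBdd).add
    (h.br.mul h.br₂.uBdd))).const_mul αc).add (((h.bq₂.mul bm).add (h.bq₁.mul hμ.uBdd)).add
      ((h.bq₁.mul hμ.uBdd).add (h.bq.mul hμ'.uBdd))))).const_mul (-βc)
  have bν := (h.bq.mul bA₀.uBdd).add (h.br.mul bA₁.uBdd)
  have dν := (h.dq.mul dA₀).add (h.dr.mul dA₁)
  obtain ⟨m₂, bm₂, cm₂, lm₂, hm₂⟩ := exists_antideriv bν dν.cont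
  have dm₂ : UDiff m₂ _ := ⟨cm₂, hm₂⟩
  -- third order
  have dB₀ := (ddA₀.sub ((h.dq.mul dA₁).add (h.dr.mul dm₂))).const_mul (-αc)
  have dB₁ := (ddA₁.sub ((h.dr.mul dA₀).add (h.dq.mul dm₂))).const_mul (-βc)
  have bB₀ := (bA₀'.sub ((h.bq.mul bA₁.uBdd).add (h.br.mul bm₂))).const_mul (-αc)
  have bB₁ := (bA₁'.sub ((h.br.mul bA₀.uBdd).add (h.bq.mul bm₂))).const_mul (-βc)
  have bB₀' := (bA₀''.sub (((h.bq₁.mul bA₁.uBdd).add (h.bq.mul bA₁'.uBdd)).add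
    ((h.br₁.mul bm₂).add (h.br.mul bν.uBdd)))).const_mul (-αc)
  have bB₁' := (bA₁''.sub (((h.br₁.mul bA₀.uBdd).add (h.br.mul bA₀'.uBdd)).add
    ((h.bq₁.mul bm₂).add (h.bq.mul bν.uBdd)))).const_mul (-βc)
  refine ⟨m, m₂, _, _, _, _, _, _, _, _, bm, bm₂, bA₀.uBdd, bA₁.uBdd, bB₀.uBdd, bB₁.uBdd, lm, lm₂,
    bA₀.tendsto, bA₁.tendsto, bB₀.tendsto, bB₁.tendsto, dm, dm₂, dA₀, dA₁, dB₀, dB₁,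
    fun _ _ => rfl, fun _ _ => rfl, fun _ _ => rfl, fun _ _ => rfl,
    bB₀'.sub (h.bq.mul bB₁.uBdd), bB₁'.sub (h.br.mul bB₀.uBdd),
    (h.bq.mul bB₀.uBdd).add (h.br.mul bB₁.uBdd), ?_, ?_⟩
  all_goals
    intro i
    have c0 := h.dq.cont i
    have c1 := h.dq₁.cont i
    have c2 := h.dq₂.cont i
    have c3 := h.cq₃ i
    have e0 := h.dr.cont i
    have e1 := h.dr₁.cont i
    have e2 := h.dr₂.cont i
    have e3 := h.cr₃ i
    have f0 := cm i
    have f1 := cm₂ i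
    fun_prop

end

end

/-! ### Accuracy of the truncated expansion -/

noncomputable section

section

variable {ι : Type*}

lemma UDec.bound_le {F : ι → ℝ → ℂ} (h : UDec F) :
    ∃ C, 0 ≤ C ∧ ∀ C', C ≤ C' → ∀ i x, 0 ≤ x → ‖F i x‖ ≤ C' / (1 + x) ^ 4 := by
  obtain ⟨C, hC⟩ := h
  refine ⟨max C 0, le_max_right _ _, fun C' hC' i x hx => (hC i x hx).trans ?_⟩
  have := (le_max_left C 0).trans hC'
  gcongr

lemma UBdd.bound_le {F : ι → ℝ → ℂ} (h : UBdd F) :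
    ∃ C, 0 ≤ C ∧ ∀ C', C ≤ C' → ∀ i x, 0 ≤ x → ‖F i x‖ ≤ C' := by
  obtain ⟨C, hC⟩ := h
  exact ⟨max C 0, le_max_right _ _, fun C' hC' i x hx =>
    (hC i x hx).trans ((le_max_left C 0).trans hC')⟩

lemma PotJet.decayPair {q q₁ q₂ q₃ r r₁ r₂ r₃ : ι → ℝ → ℂ}
    (h : PotJet q q₁ q₂ q₃ r r₁ r₂ r₃) : ∃ M, 0 ≤ M ∧ ∀ i, DecayPair (q i) (r i) M := by
  obtain ⟨A, hA0, hA⟩ := h.bq.bound_le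
  obtain ⟨B, hB0, hB⟩ := h.br.bound_le
  exact ⟨max A B, hA0.trans (le_max_left _ _), fun i => ⟨h.dq.cont i, h.dr.cont i,
    hA _ (le_max_left _ _) i, hB _ (le_max_right _ _) i⟩⟩

/-- The coefficients are chosen so that the orders `1`, `κ` and `κ²` of the first row of the
`x`-part balance, since `αc` inverts `ω - 1`; only a `κ³` term survives. -/
lemma formal_identity_zero {k κ q r A₀ A₁ B₀ B₁ m m₂ r₁ A₀' B₀' : ℂ} (hk : k * κ = 1)
    (hA₀ : A₀ = -αc * (αc * r₁ - (βc * (q * q) + r * m)))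
    (hB₀ : B₀ = -αc * (A₀' - (q * A₁ + r * m₂))) :
    αc * r₁ * κ + A₀' * κ ^ 2 + B₀' * κ ^ 3 =
      (k - k * ω) * (αc * r * κ + A₀ * κ ^ 2 + B₀ * κ ^ 3) +
        (q * (βc * q * κ + A₁ * κ ^ 2 + B₁ * κ ^ 3) + r * (1 + m * κ + m₂ * κ ^ 2)) +
        κ ^ 3 * (B₀' - q * B₁) := by
  have hω := ω_sq
  have e : (1 - ω) * αc = -1 := by rw [αc]; grind
  have e₀ : (1 - ω) * A₀ = αc * r₁ - (βc * (q * q) + r * m) := by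
    rw [hA₀]; linear_combination (-(αc * r₁ - (βc * (q * q) + r * m))) * e
  have e₁ : (1 - ω) * B₀ = A₀' - (q * A₁ + r * m₂) := by
    rw [hB₀]; linear_combination (-(A₀' - (q * A₁ + r * m₂))) * e
  linear_combination (-k * κ * r) * e - k * κ ^ 2 * e₀ - k * κ ^ 3 * e₁ +
    (r - κ * (αc * r₁ - (βc * (q * q) + r * m)) - κ ^ 2 * (A₀' - (q * A₁ + r * m₂))) * hk

/-- The same balance in the second row, where `βc` inverts `ω - ω²`. -/
lemma formal_identity_one {k κ q r A₀ A₁ B₀ B₁ m m₂ q₁ A₁' B₁' : ℂ} (hk : k * κ = 1)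
    (hA₁ : A₁ = -βc * (βc * q₁ - (αc * (r * r) + q * m)))
    (hB₁ : B₁ = -βc * (A₁' - (r * A₀ + q * m₂))) :
    βc * q₁ * κ + A₁' * κ ^ 2 + B₁' * κ ^ 3 =
      (k * ω ^ 2 - k * ω) * (βc * q * κ + A₁ * κ ^ 2 + B₁ * κ ^ 3) +
        (r * (αc * r * κ + A₀ * κ ^ 2 + B₀ * κ ^ 3) + q * (1 + m * κ + m₂ * κ ^ 2)) +
        κ ^ 3 * (B₁' - r * B₀) := by
  have hω := ω_sq
  have e : (ω ^ 2 - ω) * βc = -1 := by rw [βc]; grind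
  have e₀ : (ω ^ 2 - ω) * A₁ = βc * q₁ - (αc * (r * r) + q * m) := by
    rw [hA₁]; linear_combination (-(βc * q₁ - (αc * (r * r) + q * m))) * e
  have e₁ : (ω ^ 2 - ω) * B₁ = A₁' - (r * A₀ + q * m₂) := by
    rw [hB₁]; linear_combination (-(A₁' - (r * A₀ + q * m₂))) * e
  linear_combination (-k * κ * q) * e - k * κ ^ 2 * e₀ - k * κ ^ 3 * e₁ +
    (q - κ * (βc * q₁ - (αc * (r * r) + q * m)) - κ ^ 2 * (A₁' - (r * A₀ + q * m₂))) * hk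

/-- Asymptotics of the space columns at `x = 0` as `k → ∞`, uniformly in the family. -/
lemma PotJet.asymptotics {q q₁ q₂ q₃ r r₁ r₂ r₃ : ι → ℝ → ℂ}
    (h : PotJet q q₁ q₂ q₃ r r₁ r₂ r₃) :
    ∃ (m : ι → ℂ) (C : ℝ), 0 ≤ C ∧ (∀ i, ‖m i‖ ≤ C) ∧ ∀ i, ∀ k ∈ closedSector, 1 ≤ ‖k‖ →
      ‖spaceSol (q i) (r i) k 0 0 - (αc * r i 0 * k⁻¹ +
        -αc * (αc * r₁ i 0 - (βc * (q i 0 * q i 0) + r i 0 * m i)) * k⁻¹ ^ 2)‖ ≤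
          C * ‖k‖⁻¹ ^ 3 ∧
      ‖spaceSol (q i) (r i) k 0 1 - (βc * q i 0 * k⁻¹ +
        -βc * (βc * q₁ i 0 - (αc * (r i 0 * r i 0) + q i 0 * m i)) * k⁻¹ ^ 2)‖ ≤
          C * ‖k‖⁻¹ ^ 3 ∧
      ‖spaceSol (q i) (r i) k 0 2 - (1 + m i * k⁻¹)‖ ≤ C * ‖k‖⁻¹ ^ 2 := by
  obtain ⟨m, m₂, A₀, A₁, B₀, B₁, A₀', A₁', B₀', B₁', bm, bm₂, bA₀, bA₁, bB₀, bB₁, lm, lm₂, lA₀, lA₁,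
    lB₀, lB₁, dm, dm₂, dA₀, dA₁, dB₀, dB₁, eA₀, eA₁, eB₀, eB₁, R₀, R₁, R₂, c₀, c₁⟩ := h.exists_formal
  obtain ⟨M, hM0, hM⟩ := h.decayPair
  obtain ⟨D₀, hD₀, hR₀⟩ := R₀.bound_le
  obtain ⟨D₁, hD₁, hR₁⟩ := R₁.bound_le
  obtain ⟨D₂, hD₂, hR₂⟩ := R₂.bound_le
  obtain ⟨F₀, hF₀, hB₀⟩ := bB₀.bound_le
  obtain ⟨F₁, hF₁, hB₁⟩ := bB₁.bound_le
  obtain ⟨F₂, hF₂, hm₂⟩ := bm₂.bound_le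
  obtain ⟨F₃, hF₃, hm⟩ := bm.bound_le
  set D := D₀ + D₁ + D₂ with hD
  set K := 2 * Real.exp (6 * M + 1) * (∫ y in Ioi (0 : ℝ), 1 / (1 + y) ^ 2) with hK
  have hI : 0 ≤ ∫ y in Ioi (0 : ℝ), 1 / (1 + y) ^ 2 := integral_nonneg fun y => by positivity
  have hK0 : 0 ≤ K := by positivity
  refine ⟨fun i => m i 0, K * D + F₀ + F₁ + F₂ + F₃, by positivity, fun i => ?_, ?_⟩
  · exact (hm F₃ le_rfl i 0 le_rfl).trans (by
      have : 0 ≤ K * D := by positivity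
      linarith)
  intro i k hk hk1
  have hk0 : k ≠ 0 := by rintro rfl; norm_num at hk1
  set κ := k⁻¹ with hκ
  have hkκ : k * κ = 1 := mul_inv_cancel₀ hk0
  have hκn : ‖κ‖ = ‖k‖⁻¹ := norm_inv k
  have hκ1 : ‖k‖⁻¹ ≤ 1 := inv_le_one_of_one_le₀ hk1
  have hκ0 : 0 ≤ ‖k‖⁻¹ := by positivity
  let p : ℝ → Fin 3 → ℂ := fun x => ![αc * r i x * κ + A₀ i x * κ ^ 2 + B₀ i x * κ ^ 3,
    βc * q i x * κ + A₁ i x * κ ^ 2 + B₁ i x * κ ^ 3, 1 + m i x * κ + m₂ i x * κ ^ 2]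
  let E : ℝ → Fin 3 → ℂ := fun x => ![κ ^ 3 * (B₀' i x - q i x * B₁ i x),
    κ ^ 3 * (B₁' i x - r i x * B₀ i x), κ ^ 3 * -(q i x * B₀ i x + r i x * B₁ i x)]
  -- The approximate column `p` fails the `x`-part by `E = O(k⁻³)` only. The terms with `B₀`, `B₁`
  -- and `m₂`, needed to reach this accuracy, are absorbed into the error afterwards.
  have key := (hM i).norm_spaceSol_sub_le hk (p := p) (E := E) (ε := D * ‖k‖⁻¹ ^ 3) ?_ ?_ ?_ ?_ ?_
  · have k0 := key 0
    have k1 := key 1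
    have k2 := key 2
    simp only [p, Matrix.cons_val_zero, Matrix.cons_val_one, Matrix.cons_val] at k0 k1 k2
    rw [← hK] at k0 k1 k2
    have nκ3 : 0 ≤ ‖k‖⁻¹ ^ 3 := by positivity
    have nκ2 : 0 ≤ ‖k‖⁻¹ ^ 2 := by positivity
    have n32 : ‖k‖⁻¹ ^ 3 ≤ ‖k‖⁻¹ ^ 2 := pow_le_pow_of_le_one hκ0 hκ1 (by norm_num)
    have hKD : 0 ≤ K * D := by positivity
    have b0 : ‖B₀ i 0 * κ ^ 3‖ ≤ F₀ * ‖k‖⁻¹ ^ 3 := by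
      rw [norm_mul, norm_pow, hκn]
      exact mul_le_mul_of_nonneg_right (hB₀ _ le_rfl i 0 le_rfl) nκ3
    have b1 : ‖B₁ i 0 * κ ^ 3‖ ≤ F₁ * ‖k‖⁻¹ ^ 3 := by
      rw [norm_mul, norm_pow, hκn]
      exact mul_le_mul_of_nonneg_right (hB₁ _ le_rfl i 0 le_rfl) nκ3
    have b2 : ‖m₂ i 0 * κ ^ 2‖ ≤ F₂ * ‖k‖⁻¹ ^ 2 := by
      rw [norm_mul, norm_pow, hκn]
      exact mul_le_mul_of_nonneg_right (hm₂ _ le_rfl i 0 le_rfl) nκ2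
    rw [← eA₀, ← eA₁]
    refine ⟨?_, ?_, ?_⟩
    · have e : spaceSol (q i) (r i) k 0 0 - (αc * r i 0 * κ + A₀ i 0 * κ ^ 2) =
        (spaceSol (q i) (r i) k 0 0 - (αc * r i 0 * κ + A₀ i 0 * κ ^ 2 + B₀ i 0 * κ ^ 3)) +
          B₀ i 0 * κ ^ 3 := by ring
      rw [e]
      refine (norm_add_le _ _).trans ((add_le_add k0 b0).trans ?_)
      have : 0 ≤ (F₁ + F₂ + F₃) * ‖k‖⁻¹ ^ 3 := by positivity
      linarith
    · have e : spaceSol (q i) (r i) k 0 1 - (βc * q i 0 * κ + A₁ i 0 * κ ^ 2) =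
        (spaceSol (q i) (r i) k 0 1 - (βc * q i 0 * κ + A₁ i 0 * κ ^ 2 + B₁ i 0 * κ ^ 3)) +
          B₁ i 0 * κ ^ 3 := by ring
      rw [e]
      refine (norm_add_le _ _).trans ((add_le_add k1 b1).trans ?_)
      have : 0 ≤ (F₀ + F₂ + F₃) * ‖k‖⁻¹ ^ 3 := by positivity
      linarith
    · have e : spaceSol (q i) (r i) k 0 2 - (1 + m i 0 * κ) =
        (spaceSol (q i) (r i) k 0 2 - (1 + m i 0 * κ + m₂ i 0 * κ ^ 2)) +
          m₂ i 0 * κ ^ 2 := by ring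
      rw [e]
      refine (norm_add_le _ _).trans ((add_le_add k2 b2).trans ?_)
      have h1 : 0 ≤ (F₀ + F₁ + F₃) * ‖k‖⁻¹ ^ 2 := by positivity
      have h2 := mul_le_mul_of_nonneg_left n32 hKD
      linarith
  · intro x hx j
    fin_cases j
    · have h1 := (((((h.dr.deriv i x hx).const_mul αc).mul_const κ).add
        ((dA₀.deriv i x hx).mul_const (κ ^ 2))).add ((dB₀.deriv i x hx).mul_const (κ ^ 3)))
      have h2 := h1.congr_deriv (formal_identity_zero (B₁ := B₁ i x) (m₂ := m₂ i x) hkκ (eA₀ i x) (eB₀ i x))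
      simp only [Fin.zero_eta, V₁_mulVec_zero, l_zero, l_two]
      exact h2
    · have h1 := (((((h.dq.deriv i x hx).const_mul βc).mul_const κ).add
        ((dA₁.deriv i x hx).mul_const (κ ^ 2))).add ((dB₁.deriv i x hx).mul_const (κ ^ 3)))
      have h2 := h1.congr_deriv (formal_identity_one (B₀ := B₀ i x) (m₂ := m₂ i x) hkκ (eA₁ i x) (eB₁ i x))
      simp only [Fin.mk_one, V₁_mulVec_one, l_one, l_two]
      exact h2
    · have h1 := (((dm.deriv i x hx).mul_const κ).const_add 1).add
        ((dm₂.deriv i x hx).mul_const (κ ^ 2))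
      simp only [Fin.reduceFinMk, V₁_mulVec_two]
      refine h1.congr_deriv ?_
      simp only [p, E, Matrix.cons_val_zero, Matrix.cons_val_one, Matrix.cons_val]
      ring
  · have e0 := h.dq.cont i
    have e1 := h.dr.cont i
    have e2 := dA₀.cont i
    have e3 := dA₁.cont i
    have e4 := dB₀.cont i
    have e5 := dB₁.cont i
    have e6 := dm.cont i
    have e7 := dm₂.cont i
    refine continuousOn_pi.2 fun j => ?_
    fin_cases j <;> simp only [p, Fin.zero_eta, Fin.mk_one, Fin.reduceFinMk, Matrix.cons_val_zero,
      Matrix.cons_val_one, Matrix.cons_val] <;> fun_prop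
  · refine tendsto_pi_nhds.2 fun j => ?_
    have tq := h.bq.tendsto i
    have tr := h.br.tendsto i
    fin_cases j <;> simp only [p, Fin.zero_eta, Fin.mk_one, Fin.reduceFinMk, Matrix.cons_val_zero,
      Matrix.cons_val_one, Matrix.cons_val, e₃_zero, e₃_one, e₃_two]
    · simpa using (((tr.const_mul αc).mul_const κ).add ((lA₀ i).mul_const (κ ^ 2))).add
        ((lB₀ i).mul_const (κ ^ 3))
    · simpa using (((tq.const_mul βc).mul_const κ).add ((lA₁ i).mul_const (κ ^ 2))).add
        ((lB₁ i).mul_const (κ ^ 3))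
    · simpa using (((lm i).mul_const κ).const_add 1).add ((lm₂ i).mul_const (κ ^ 2))
  · intro x hx j
    have n3 : 0 ≤ ‖k‖⁻¹ ^ 3 := by positivity
    have e0 := hR₀ D (by linarith) i x hx
    have e1 := hR₁ D (by linarith) i x hx
    have e2 := hR₂ D (by linarith) i x hx
    have e : D * ‖k‖⁻¹ ^ 3 / (1 + x) ^ 4 = ‖k‖⁻¹ ^ 3 * (D / (1 + x) ^ 4) := by ring
    rw [e]
    fin_cases j <;> simp only [E, Fin.zero_eta, Fin.mk_one, Fin.reduceFinMk, Matrix.cons_val_zero,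
      Matrix.cons_val_one, Matrix.cons_val] <;> rw [norm_mul, norm_pow, hκn]
    · exact mul_le_mul_of_nonneg_left e0 n3
    · exact mul_le_mul_of_nonneg_left e1 n3
    · rw [norm_neg]
      exact mul_le_mul_of_nonneg_left e2 n3
  · intro j
    have e0 := h.dq.cont i
    have e1 := h.dr.cont i
    have e4 := dB₀.cont i
    have e5 := dB₁.cont i
    have e6 := c₀ i
    have e7 := c₁ i
    fin_cases j <;> simp only [E, Fin.zero_eta, Fin.mk_one, Fin.reduceFinMk, Matrix.cons_val_zero,
      Matrix.cons_val_one, Matrix.cons_val]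
    · exact continuousOn_const.mul e6
    · exact continuousOn_const.mul e7
    · fun_prop

end

end

noncomputable section

/-! ### Linear differential equations on `[0,T]` -/

section scalar

variable {T : ℝ} {d : ℂ} {y F : ℝ → ℂ}

lemma exp_shift (d : ℂ) (t s : ℝ) : Complex.exp (d * ((t - s : ℝ) : ℂ)) =
    Complex.exp (d * (t : ℂ)) * Complex.exp (-d * (s : ℂ)) := by
  rw [← Complex.exp_add]; congr 1; push_cast; ring

/-- Duhamel's formula, by integrating the derivative of `e^{d(t-t')} y(t')`. The base point may lie
on either side of `t`, as `μ₁` is normalized at `T` and `μ₂` at `0`. -/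
lemma eq_exp_add_integral (hy : ContinuousOn y (Icc 0 T)) (hF : ContinuousOn F (Icc 0 T))
    (hd : ∀ t ∈ Ioo 0 T, HasDerivAt y (d * y t + F t) t) {τ t : ℝ} (hτ : τ ∈ Icc 0 T)
    (ht : t ∈ Icc 0 T) :
    y t = Complex.exp (d * ((t - τ : ℝ) : ℂ)) * y τ +
      ∫ t' in τ..t, Complex.exp (d * ((t - t' : ℝ) : ℂ)) * F t' := by
  have hsub : uIcc τ t ⊆ Icc 0 T := uIcc_subset_Icc hτ ht
  have hexp : ∀ t' : ℝ, HasDerivAt (fun t' : ℝ => Complex.exp (d * ((t - t' : ℝ) : ℂ)))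
      (Complex.exp (d * ((t - t' : ℝ) : ℂ)) * (d * ((-1 : ℝ) : ℂ))) t' := fun t' =>
    ((((hasDerivAt_id t').const_sub t).ofReal_comp).const_mul d).cexp
  have hec : Continuous fun t' : ℝ => Complex.exp (d * ((t - t' : ℝ) : ℂ)) := by fun_prop
  have h1 := intervalIntegral.integral_eq_sub_of_hasDeriv_right
    (f := fun t' : ℝ => Complex.exp (d * ((t - t' : ℝ) : ℂ)) * y t')
    (f' := fun t' : ℝ => Complex.exp (d * ((t - t' : ℝ) : ℂ)) * F t') (a := τ) (b := t)
    (hec.continuousOn.mul (hy.mono hsub)) (fun x hx => by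
      have hx' : x ∈ Ioo 0 T := ⟨(le_min hτ.1 ht.1).trans_lt hx.1,
        hx.2.trans_le (max_le hτ.2 ht.2)⟩
      refine (((hexp x).mul (hd x hx')).congr_deriv ?_).hasDerivWithinAt
      push_cast; ring) (hec.continuousOn.mul (hF.mono hsub)).intervalIntegrable
  rw [h1, sub_self]
  simp

/-- The converse of Duhamel's formula, endpoints included. Composing `F` with the projection onto
`[0,T]` makes the integrand continuous on the whole line. -/
lemma hasDerivWithinAt_of_eq_integral (hF : ContinuousOn F (Icc 0 T)) {τ : ℝ} (hτ : τ ∈ Icc 0 T)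
    {η : ℂ} (h : ∀ t ∈ Icc 0 T, y t = Complex.exp (d * ((t - τ : ℝ) : ℂ)) * η +
      ∫ t' in τ..t, Complex.exp (d * ((t - t' : ℝ) : ℂ)) * F t') {t : ℝ} (ht : t ∈ Icc 0 T) :
    HasDerivWithinAt y (d * y t + F t) (Icc 0 T) t := by
  have hT : (0 : ℝ) ≤ T := ht.1.trans ht.2
  let P : ℝ → ℝ := fun s => projIcc 0 T hT s
  have hP : ∀ s ∈ Icc 0 T, P s = s := fun s hs => by simp [P, projIcc_of_mem hT hs]
  have hPc : Continuous P := continuous_subtype_val.comp continuous_projIcc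
  have hFP : Continuous fun s => F (P s) :=
    hF.comp_continuous hPc fun s => (projIcc 0 T hT s).2
  have hGc : Continuous fun s : ℝ => Complex.exp (-d * (s : ℂ)) * F (P s) :=
    (by fun_prop : Continuous fun s : ℝ => Complex.exp (-d * (s : ℂ))).mul hFP
  have e : ∀ t ∈ Icc 0 T, y t = Complex.exp (d * ((t - τ : ℝ) : ℂ)) * η + Complex.exp (d * (t : ℂ)) *
      ∫ t' in τ..t, Complex.exp (-d * (t' : ℂ)) * F (P t') := fun t ht => by
    rw [h t ht, ← intervalIntegral.integral_const_mul]
    congr 1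
    refine intervalIntegral.integral_congr fun s hs => ?_
    rw [hP s (uIcc_subset_Icc hτ ht hs), exp_shift, mul_assoc]
  have h1 : HasDerivAt (fun t => ∫ t' in τ..t, Complex.exp (-d * (t' : ℂ)) * F (P t'))
      (Complex.exp (-d * (t : ℂ)) * F (P t)) t :=
    intervalIntegral.integral_hasDerivAt_right (hGc.intervalIntegrable _ _)
      (hGc.stronglyMeasurableAtFilter _ _) hGc.continuousAt
  have h2 : HasDerivAt (fun x : ℝ => Complex.exp (d * (x : ℂ)))
      (Complex.exp (d * (t : ℂ)) * (d * 1)) t :=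
    (((hasDerivAt_id t).ofReal_comp).const_mul d).cexp
  have h3 : HasDerivAt (fun t : ℝ => Complex.exp (d * ((t - τ : ℝ) : ℂ)))
      (Complex.exp (d * ((t - τ : ℝ) : ℂ)) * (d * ((1 : ℝ) : ℂ))) t :=
    ((((hasDerivAt_id t).sub_const τ).ofReal_comp).const_mul d).cexp
  have h4 := ((h3.mul_const η).add (h2.mul h1)).hasDerivWithinAt (s := Icc 0 T)
  refine (h4.congr (fun s hs => e s hs) (e t ht)).congr_deriv ?_
  have h5 : Complex.exp (d * (t : ℂ)) * Complex.exp (-d * (t : ℂ)) = 1 := by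
    rw [← Complex.exp_add]; simp
  rw [e t ht, hP t ht]
  push_cast
  linear_combination F t * h5

end scalar

/-- Solutions of `y_i' = d_i y_i + (A y)_i` on `(0,T)`, continuous up to the boundary. -/
structure IsODESol (T : ℝ) (d : Fin 3 → ℂ) (A : ℝ → Matrix (Fin 3) (Fin 3) ℂ)
    (y : ℝ → Fin 3 → ℂ) : Prop where
  cont : ContinuousOn y (Icc 0 T)
  deriv : ∀ t ∈ Ioo 0 T, ∀ i,
    HasDerivAt (fun t => y t i) (d i * y t i + (A t).mulVec (y t) i) t

section

variable {T : ℝ} {d : Fin 3 → ℂ} {A : ℝ → Matrix (Fin 3) (Fin 3) ℂ} {y : ℝ → Fin 3 → ℂ}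

lemma continuousOn_mulVec {s : Set ℝ} (hA : ∀ i j, ContinuousOn (fun t => A t i j) s)
    (hy : ContinuousOn y s) (i : Fin 3) : ContinuousOn (fun t => (A t).mulVec (y t) i) s := by
  simp only [Matrix.mulVec, dotProduct]
  exact continuousOn_finsetSum _ fun j _ => (hA i j).mul
    ((continuous_apply j).comp_continuousOn hy)

lemma IsODESol.eq_integral (h : IsODESol T d A y)
    (hA : ∀ i j, ContinuousOn (fun t => A t i j) (Icc 0 T)) {τ t : ℝ} (hτ : τ ∈ Icc 0 T)
    (ht : t ∈ Icc 0 T) (i : Fin 3) :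
    y t i = Complex.exp (d i * ((t - τ : ℝ) : ℂ)) * y τ i +
      ∫ t' in τ..t, Complex.exp (d i * ((t - t' : ℝ) : ℂ)) * (A t').mulVec (y t') i :=
  eq_exp_add_integral ((continuous_apply i).comp_continuousOn h.cont)
    (continuousOn_mulVec hA h.cont i) (fun t ht => h.deriv t ht i) hτ ht

lemma IsODESol.of_eq_integral (hA : ∀ i j, ContinuousOn (fun t => A t i j) (Icc 0 T))
    (hy : ContinuousOn y (Icc 0 T)) {τ : ℝ} (hτ : τ ∈ Icc 0 T) {η : Fin 3 → ℂ}
    (h : ∀ t ∈ Icc 0 T, ∀ i, y t i = Complex.exp (d i * ((t - τ : ℝ) : ℂ)) * η i +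
      ∫ t' in τ..t, Complex.exp (d i * ((t - t' : ℝ) : ℂ)) * (A t').mulVec (y t') i) :
    IsODESol T d A y :=
  ⟨hy, fun _ ht i => (hasDerivWithinAt_of_eq_integral (continuousOn_mulVec hA hy i) hτ
    (fun s hs => h s hs i) (Ioo_subset_Icc_self ht)).hasDerivAt (Icc_mem_nhds ht.1 ht.2)⟩

lemma IsODESol.hasDerivWithinAt (h : IsODESol T d A y)
    (hA : ∀ i j, ContinuousOn (fun t => A t i j) (Icc 0 T)) {t : ℝ} (ht : t ∈ Icc 0 T)
    (i : Fin 3) :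
    HasDerivWithinAt (fun t => y t i) (d i * y t i + (A t).mulVec (y t) i) (Icc 0 T) t :=
  hasDerivWithinAt_of_eq_integral (continuousOn_mulVec hA h.cont i) (τ := 0)
    ⟨le_rfl, ht.1.trans ht.2⟩ (fun _ hs => h.eq_integral hA ⟨le_rfl, hs.1.trans hs.2⟩ hs i) ht

lemma exists_entry_bound (hA : ∀ i j, ContinuousOn (fun t => A t i j) (Icc 0 T)) :
    ∃ B, 0 ≤ B ∧ ∀ t ∈ Icc 0 T, ∀ i j, ‖A t i j‖ ≤ B := by
  choose B hB using fun i j => isCompact_Icc.exists_bound_of_continuousOn (hA i j)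
  refine ⟨∑ i, ∑ j, |B i j|, Finset.sum_nonneg fun i _ => Finset.sum_nonneg fun j _ => abs_nonneg _,
    fun t ht i j => (hB i j t ht).trans ((le_abs_self _).trans ?_)⟩
  refine (Finset.single_le_sum (f := fun j => |B i j|) (fun j _ => abs_nonneg _)
    (Finset.mem_univ j)).trans ?_
  exact Finset.single_le_sum (f := fun i => ∑ j, |B i j|)
    (fun i _ => Finset.sum_nonneg fun j _ => abs_nonneg _) (Finset.mem_univ i)

/-- The right-hand side is Lipschitz with constant `‖d‖ + 3B` throughout `[0,T]`, so Gronwall's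
inequality applies forward from `0` or backward from `T`, the two normalization points in use. -/
lemma IsODESol.unique {y' : ℝ → Fin 3 → ℂ} (h : IsODESol T d A y) (h' : IsODESol T d A y')
    (hA : ∀ i j, ContinuousOn (fun t => A t i j) (Icc 0 T)) {τ : ℝ} (hτ : τ = 0 ∨ τ = T)
    (e : y τ = y' τ) : EqOn y y' (Icc 0 T) := by
  obtain ⟨B, hB0, hB⟩ := exists_entry_bound hA
  let K : NNReal := ⟨‖d‖ + 3 * B, by positivity⟩
  have hK : (K : ℝ) = ‖d‖ + 3 * B := rfl
  let v : ℝ → (Fin 3 → ℂ) → Fin 3 → ℂ := fun t w i => d i * w i + (A t).mulVec w i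
  have hlip : ∀ t ∈ Icc 0 T, LipschitzOnWith K (v t) univ := by
    intro t ht
    refine LipschitzOnWith.of_dist_le_mul fun w _ w' _ => ?_
    rw [dist_eq_norm, dist_eq_norm]
    refine (pi_norm_le_iff_of_nonneg (mul_nonneg (NNReal.coe_nonneg _) (norm_nonneg _))).2
      fun i => ?_
    have e1 : (v t w - v t w') i = d i * (w - w') i + (A t).mulVec (w - w') i := by
      simp only [v, Pi.sub_apply, Matrix.mulVec_sub]; ring
    rw [e1]
    refine (norm_add_le _ _).trans ?_
    have e2 := norm_mulVec_le (hB t ht) (le_refl ‖w - w'‖) i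
    have e3 : ‖d i * (w - w') i‖ ≤ ‖d‖ * ‖w - w'‖ := by
      rw [norm_mul]
      exact mul_le_mul (norm_le_pi_norm d i) (norm_le_pi_norm _ i) (norm_nonneg _) (norm_nonneg _)
    calc _ ≤ ‖d‖ * ‖w - w'‖ + 3 * B * ‖w - w'‖ := add_le_add e3 e2
      _ = _ := by rw [hK]; ring
  have hder : ∀ {y : ℝ → Fin 3 → ℂ}, IsODESol T d A y → ∀ t ∈ Icc 0 T,
      HasDerivWithinAt y (v t (y t)) (Icc 0 T) t := fun h t ht =>
    hasDerivWithinAt_pi.2 fun i => h.hasDerivWithinAt hA ht i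
  rcases hτ with rfl | rfl
  · have hr : ∀ {y : ℝ → Fin 3 → ℂ}, IsODESol T d A y → ∀ t ∈ Ico 0 T,
        HasDerivWithinAt y (v t (y t)) (Ici t) t := fun h t ht =>
      (hder h t (Ico_subset_Icc_self ht)).mono_of_mem_nhdsWithin
        (mem_of_superset (Icc_mem_nhdsGE ht.2) (Icc_subset_Icc_left ht.1))
    exact ODE_solution_unique_of_mem_Icc_right (s := fun _ => univ) (v := v)
      (fun t ht => hlip t (Ico_subset_Icc_self ht)) h.cont (hr h) (fun _ _ => mem_univ _) h'.cont
      (hr h') (fun _ _ => mem_univ _) e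
  · have hr : ∀ {y : ℝ → Fin 3 → ℂ}, IsODESol τ d A y → ∀ t ∈ Ioc 0 τ,
        HasDerivWithinAt y (v t (y t)) (Iic t) t := fun h t ht =>
      (hder h t (Ioc_subset_Icc_self ht)).mono_of_mem_nhdsWithin
        (mem_of_superset (Icc_mem_nhdsLE ht.1) (Icc_subset_Icc_right ht.2))
    exact ODE_solution_unique_of_mem_Icc_left (s := fun _ => univ) (v := v)
      (fun t ht => hlip t (Ioc_subset_Icc_self ht)) h.cont (hr h) (fun _ _ => mem_univ _) h'.cont
      (hr h') (fun _ _ => mem_univ _) e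

end

end

noncomputable section

/-! ### Linear systems depending quadratically on a parameter -/

/-- The kernel `A(T-y)` on `0 ≤ y ≤ T`, extended by zero. -/
def revKernel (T : ℝ) (A : ℝ → Matrix (Fin 3) (Fin 3) ℂ) : ℝ → ℝ → Matrix (Fin 3) (Fin 3) ℂ :=
  fun _ y => if y ≤ T then A (T - y) else 0

lemma isVolterraKernel_revKernel {T : ℝ} (hT : 0 ≤ T) {A : ℝ → Matrix (Fin 3) (Fin 3) ℂ}
    (hA : ∀ i j, Continuous fun t => A t i j) {B : ℝ} (hB0 : 0 ≤ B)
    (hB : ∀ t ∈ Icc 0 T, ∀ i j, ‖A t i j‖ ≤ B) :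
    IsVolterraKernel (revKernel T A) (B * (1 + T) ^ 2) where
  meas x i j := by
    have : (fun y => revKernel T A x y i j) = fun y => if y ≤ T then A (T - y) i j else 0 := by
      ext y; unfold revKernel; split_ifs <;> rfl
    rw [this]
    exact Measurable.ite measurableSet_Iic ((hA i j).comp (continuous_const.sub continuous_id)).measurable
      measurable_const
  cont y i j := continuous_const
  bound x y hx hy i j := by
    have hy0 : 0 < y := hx.trans_lt hy
    unfold revKernel
    split_ifs with h
    · rw [le_div_iff₀ (by positivity)]
      have := hB (T - y) ⟨by linarith, by linarith⟩ i j
      gcongr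
    · simp only [Matrix.zero_apply, norm_zero]; positivity

/-- Substituting `y = T - s` turns an integral from `0` into a tail integral cut off at `T`, which
brings initial value problems under the half-line theory. -/
lemma volterraOp_revKernel {T : ℝ} (A : ℝ → Matrix (Fin 3) (Fin 3) ℂ) (f : ℝ → Fin 3 → ℂ)
    {t : ℝ} (ht : t ∈ Icc 0 T) (i : Fin 3) :
    volterraOp (revKernel T A) f (T - t) i = ∫ s in (0 : ℝ)..t, (A s).mulVec (f (T - s)) i := by
  have h0 : max (T - t) 0 = T - t := max_eq_left (by linarith [ht.2])
  have h1 : (fun y => (revKernel T A (T - t) y).mulVec (f y) i) =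
      (Iic T).indicator fun y => (A (T - y)).mulVec (f y) i := by
    ext y
    by_cases h : y ≤ T
    · rw [indicator_of_mem (mem_Iic.2 h)]; simp [revKernel, h]
    · rw [indicator_of_notMem (by simpa using h)]; simp [revKernel, h]
  have h2 := intervalIntegral.integral_comp_sub_left (a := 0) (b := t)
    (fun y => (A (T - y)).mulVec (f y) i) T
  simp only [sub_sub_cancel, sub_zero] at h2
  rw [h2, intervalIntegral.integral_of_le (by linarith [ht.1])]
  simp only [volterraOp, h0]
  rw [h1, setIntegral_indicator measurableSet_Iic, Ioi_inter_Iic]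

/-- After time reversal this is a half-line Volterra equation whose kernel is quadratic in `k`. Its
first-order Taylor remainder is exactly `(k' - k)²` times the `A₂` kernel, so `volterra_taylor`
gives complex differentiability at every `k`. -/
theorem exists_quadratic_family {T : ℝ} (hT : 0 ≤ T) {A₀ A₁ A₂ : ℝ → Matrix (Fin 3) (Fin 3) ℂ}
    (h₀ : ∀ i j, Continuous fun t => A₀ t i j) (h₁ : ∀ i j, Continuous fun t => A₁ t i j)
    (h₂ : ∀ i j, Continuous fun t => A₂ t i j) (η : Fin 3 → ℂ) :
    ∃ φ : ℂ → ℝ → Fin 3 → ℂ, (∀ k, Continuous (φ k)) ∧ (∀ k, ∀ t ∈ Icc 0 T, ∀ i, φ k t i = η i +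
      ∫ s in (0 : ℝ)..t, (A₀ s + k • A₁ s + k ^ 2 • A₂ s).mulVec (φ k s) i) ∧
      ∀ t i, Differentiable ℂ fun k => φ k t i := by
  obtain ⟨B₀, hB₀, hA₀⟩ := exists_entry_bound (T := T) fun i j => (h₀ i j).continuousOn
  obtain ⟨B₁, hB₁, hA₁⟩ := exists_entry_bound (T := T) fun i j => (h₁ i j).continuousOn
  obtain ⟨B₂, hB₂, hA₂⟩ := exists_entry_bound (T := T) fun i j => (h₂ i j).continuousOn
  let A : ℂ → ℝ → Matrix (Fin 3) (Fin 3) ℂ := fun k t => A₀ t + k • A₁ t + k ^ 2 • A₂ t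
  have hAc : ∀ k i j, Continuous fun t => A k t i j := fun k i j => by
    simp only [A, Matrix.add_apply, Matrix.smul_apply, smul_eq_mul]
    exact ((h₀ i j).add (continuous_const.mul (h₁ i j))).add (continuous_const.mul (h₂ i j))
  have hAb : ∀ R : ℝ, ∀ k : ℂ, ‖k‖ ≤ R → ∀ t ∈ Icc 0 T, ∀ i j,
      ‖A k t i j‖ ≤ B₀ + R * B₁ + R ^ 2 * B₂ := fun R k hk t ht i j => by
    simp only [A, Matrix.add_apply, Matrix.smul_apply, smul_eq_mul]
    refine norm_add₃_le.trans ?_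
    rw [norm_mul, norm_mul, norm_pow]
    have hR : 0 ≤ R := (norm_nonneg k).trans hk
    have := hA₀ t ht i j; have := hA₁ t ht i j; have := hA₂ t ht i j
    gcongr
  have hAk : ∀ R : ℝ, 0 ≤ R → ∀ k : ℂ, ‖k‖ ≤ R →
      IsVolterraKernel (revKernel T (A k)) ((B₀ + R * B₁ + R ^ 2 * B₂) * (1 + T) ^ 2) :=
    fun R hR k hk => isVolterraKernel_revKernel hT (hAc k) (by positivity) (hAb R k hk)
  choose f hf hfe using fun k =>
    exists_volterra_solution (hAk ‖k‖ (norm_nonneg k) k le_rfl) (IsBC.const η)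
  refine ⟨fun k t => f k (T - t), fun k => (hf k).1.comp (continuous_const.sub continuous_id),
    fun k t ht i => ?_, fun t i k => ?_⟩
  · have := congr_fun (hfe k (T - t)) i
    rw [Pi.add_apply, volterraOp_revKernel _ _ ht] at this
    exact this
  · let M := (B₀ + (‖k‖ + 1) * B₁ + (‖k‖ + 1) ^ 2 * B₂) * (1 + T) ^ 2 +
      (B₁ + 2 * ‖k‖ * B₂) * (1 + T) ^ 2 + B₂ * (1 + T) ^ 2
    have hM₀ : ∀ k' : ℂ, ‖k' - k‖ ≤ 1 → IsVolterraKernel (revKernel T (A k')) M := fun k' hk' => by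
      have : ‖k'‖ ≤ ‖k‖ + 1 := by
        calc ‖k'‖ = ‖k + (k' - k)‖ := by congr 1; ring
          _ ≤ _ := (norm_add_le _ _).trans (by linarith)
      exact (hAk (‖k‖ + 1) (by positivity) k' this).mono (by
        have h1 : 0 ≤ (B₁ + 2 * ‖k‖ * B₂) * (1 + T) ^ 2 := by positivity
        have h2 : 0 ≤ B₂ * (1 + T) ^ 2 := by positivity
        simp only [M]; linarith)
    have h' : IsVolterraKernel (revKernel T fun t => A₁ t + (2 * k) • A₂ t) M := by
      refine (isVolterraKernel_revKernel (B := B₁ + 2 * ‖k‖ * B₂) hT (fun i j => ?_) (by positivity)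
        fun t ht i j => ?_).mono ?_
      · simp only [Matrix.add_apply, Matrix.smul_apply, smul_eq_mul]
        exact (h₁ i j).add (continuous_const.mul (h₂ i j))
      · simp only [Matrix.add_apply, Matrix.smul_apply, smul_eq_mul]
        refine (norm_add_le _ _).trans ?_
        have := hA₁ t ht i j; have := hA₂ t ht i j
        rw [norm_mul, norm_mul, Complex.norm_ofNat]
        gcongr
      · have h1 : 0 ≤ (B₀ + (‖k‖ + 1) * B₁ + (‖k‖ + 1) ^ 2 * B₂) * (1 + T) ^ 2 := by positivity
        have h2 : 0 ≤ B₂ * (1 + T) ^ 2 := by positivity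
        simp only [M]; linarith
    have h2k := isVolterraKernel_revKernel hT h₂ hB₂ hA₂
    obtain ⟨f', -, -, C, hC⟩ := volterra_taylor (hM₀ k (by simp)) h' (hf k) (hfe k)
    have hd : HasDerivWithinAt (fun k => f k (T - t)) (f' (T - t)) univ k := by
      refine hasDerivWithinAt_of_quadratic (C := C) fun k' _ hk' => ?_
      refine hC (k' - k) (revKernel T (A k')) (f k') hk' (hM₀ k' hk') (hf k') (hfe k') ?_ (T - t)
      intro x y hx hy i j
      have e : revKernel T (A k') x y i j - revKernel T (A k) x y i j -
          (k' - k) * revKernel T (fun t => A₁ t + (2 * k) • A₂ t) x y i j =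
          (k' - k) ^ 2 * revKernel T A₂ x y i j := by
        simp only [A, revKernel]
        split_ifs <;> simp; ring
      rw [e, norm_mul, norm_pow]
      refine (mul_le_mul_of_nonneg_left (h2k.bound x y hx hy i j) (by positivity)).trans ?_
      rw [← mul_div_assoc, mul_comm]
      have h1 : B₂ * (1 + T) ^ 2 ≤ M := by
        have h1 : 0 ≤ (B₀ + (‖k‖ + 1) * B₁ + (‖k‖ + 1) ^ 2 * B₂) * (1 + T) ^ 2 := by positivity
        have h2 : 0 ≤ (B₁ + 2 * ‖k‖ * B₂) * (1 + T) ^ 2 := by positivity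
        simp only [M]; linarith
      gcongr
    have hd' : HasDerivAt (fun k => f k (T - t)) (f' (T - t)) k := hasDerivWithinAt_univ.1 hd
    exact (hasDerivAt_pi.1 hd' i).differentiableAt

end

noncomputable section

/-! ### The eigenfunctions on the boundary `x = 0` -/

/-- The coefficient matrix `V₂` at the boundary. -/
def bdryV (b : BoundaryValues) (k : ℂ) (t : ℝ) : Matrix (Fin 3) (Fin 3) ℂ :=
  V₂ k (b.g₀ t) (b.h₀ t) (b.g₁ t) (b.h₁ t)

/-- Boundary values continuous on `[0,T]`. -/
structure ContBdry (T : ℝ) (b : BoundaryValues) : Prop where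
  nonneg : 0 ≤ T
  g₀ : ContinuousOn b.g₀ (Icc 0 T)
  h₀ : ContinuousOn b.h₀ (Icc 0 T)
  g₁ : ContinuousOn b.g₁ (Icc 0 T)
  h₁ : ContinuousOn b.h₁ (Icc 0 T)

variable {T : ℝ} {b : BoundaryValues}

lemma continuousOn_V₂ {S : Set ℝ} {q r q' r' : ℝ → ℂ} (hq : ContinuousOn q S)
    (hr : ContinuousOn r S) (hq' : ContinuousOn q' S) (hr' : ContinuousOn r' S) (k : ℂ)
    (i j : Fin 3) : ContinuousOn (fun t => V₂ k (q t) (r t) (q' t) (r' t) i j) S := by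
  fin_cases i <;> fin_cases j <;> simp [V₂] <;> fun_prop

lemma ContBdry.continuousOn_bdryV (hb : ContBdry T b) (k : ℂ) (i j : Fin 3) :
    ContinuousOn (fun t => bdryV b k t i j) (Icc 0 T) :=
  continuousOn_V₂ hb.g₀ hb.h₀ hb.g₁ hb.h₁ k i j

lemma expHat_apply (d : Fin 3 → ℂ) (X : Matrix (Fin 3) (Fin 3) ℂ) (i j : Fin 3) :
    expHat d X i j = Complex.exp (d i - d j) * X i j := by
  rw [expHat, Matrix.mul_diagonal, Matrix.diagonal_mul, sub_eq_add_neg, Complex.exp_add]; ring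

/-- Conjugation by a diagonal exponential acts entrywise, so the matrix equation decouples into
columns with rates `z_i - z_j`; then Duhamel's formula and its converse apply. The identity matrix
is fixed by the conjugation. -/
lemma isTimeEigenfunction_iff (hb : ContBdry T b) {τ : ℝ} (hτ : τ ∈ Icc 0 T) {k : ℂ}
    {μ : ℝ → Matrix (Fin 3) (Fin 3) ℂ} : IsTimeEigenfunction T b τ k μ ↔
      (∀ j, IsODESol T (fun i => z k i - z k j) (bdryV b k) fun t i => μ t i j) ∧ μ τ = 1 := by
  have hint : ∀ t i j, ∫ t' in τ..t, expHat (fun m => ((t - t' : ℝ) : ℂ) * z k m)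
      (V₂ k (b.g₀ t') (b.h₀ t') (b.g₁ t') (b.h₁ t') * μ t') i j =
      ∫ t' in τ..t, Complex.exp ((z k i - z k j) * ((t - t' : ℝ) : ℂ)) *
        (bdryV b k t').mulVec (fun i => μ t' i j) i := fun t i j => by
    refine intervalIntegral.integral_congr fun t' _ => ?_
    rw [expHat_apply, ← mul_sub, mul_comm (((t - t' : ℝ) : ℂ))]
    rfl
  have hone : ∀ (t : ℝ) i j, Complex.exp ((z k i - z k j) * ((t - τ : ℝ) : ℂ)) *
      (1 : Matrix (Fin 3) (Fin 3) ℂ) i j = (1 : Matrix (Fin 3) (Fin 3) ℂ) i j := fun t i j => by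
    by_cases h : i = j
    · subst h; simp
    · simp [Matrix.one_apply_ne h]
  constructor
  · rintro ⟨hc, he⟩
    refine ⟨fun j => IsODESol.of_eq_integral (hb.continuousOn_bdryV k)
      (continuousOn_pi.2 fun i => hc i j) hτ (η := fun i => (1 : Matrix (Fin 3) (Fin 3) ℂ) i j)
      fun t ht i => ?_, ?_⟩
    · rw [he t ht, hint, hone]
    · ext i j
      rw [he τ hτ, intervalIntegral.integral_same, add_zero]
  · rintro ⟨h, h1⟩
    refine ⟨fun i j => continuousOn_pi.1 (h j).cont i, fun t ht i j => ?_⟩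
    rw [hint, (h j).eq_integral (hb.continuousOn_bdryV k) hτ ht i, h1, hone]

/-- Uniqueness of the column systems identifies the function selected by `Classical.epsilon` with
any explicitly constructed solution on `[0,T]`. -/
lemma timeEigenfunction_eq (hb : ContBdry T b) {τ : ℝ} (hτ : τ = 0 ∨ τ = T) {k : ℂ}
    {μ : ℝ → Matrix (Fin 3) (Fin 3) ℂ} (hμ : IsTimeEigenfunction T b τ k μ) {t : ℝ}
    (ht : t ∈ Icc 0 T) : timeEigenfunction T b τ t k = μ t := by
  have hτ' : τ ∈ Icc 0 T := by
    rcases hτ with rfl | rfl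
    exacts [⟨le_rfl, hb.nonneg⟩, ⟨hb.nonneg, le_rfl⟩]
  have hε : IsTimeEigenfunction T b τ k (Classical.epsilon (IsTimeEigenfunction T b τ k)) :=
    Classical.epsilon_spec ⟨μ, hμ⟩
  obtain ⟨h1, e1⟩ := (isTimeEigenfunction_iff hb hτ').1 hε
  obtain ⟨h2, e2⟩ := (isTimeEigenfunction_iff hb hτ').1 hμ
  ext i j
  exact congr_fun ((h1 j).unique (h2 j) (hb.continuousOn_bdryV k) hτ
    (by ext i; rw [e1, e2]) ht) i

/-- The part of `V₂` that is constant in `k`. -/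
def bdryV₀ (b : BoundaryValues) (t : ℝ) : Matrix (Fin 3) (Fin 3) ℂ := bdryV b 0 t

/-- The coefficient of `k` in `V₂`. -/
def bdryV₁ (b : BoundaryValues) (t : ℝ) : Matrix (Fin 3) (Fin 3) ℂ :=
  !![0, ω * b.g₀ t, ω ^ 2 * b.h₀ t;
     ω * b.h₀ t, 0, b.g₀ t;
     ω ^ 2 * b.g₀ t, b.h₀ t, 0]

lemma bdryV_eq (b : BoundaryValues) (k : ℂ) (t : ℝ) :
    bdryV b k t = bdryV₀ b t + k • bdryV₁ b t := by
  ext i j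
  fin_cases i <;> fin_cases j <;> simp [bdryV₀, bdryV, V₂, bdryV₁] <;> ring

/-- The rates `z_i - z₃` are homogeneous of degree two in `k`. Moved from the exponentials into the
coefficient matrix as `k² D`, they make it a polynomial in `k`, hence the solution entire. -/
lemma exists_timeColumn (hb : ContBdry T b) : ∃ φ : ℂ → ℝ → Fin 3 → ℂ,
    (∀ k, IsODESol T (fun i => z k i - z k 2) (bdryV b k) (φ k)) ∧ (∀ k, φ k 0 = e₃) ∧
      ∀ t i, Differentiable ℂ fun k => φ k t i := by
  let P : ℝ → ℝ := fun s => projIcc 0 T hb.nonneg s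
  have hP : ∀ s ∈ Icc 0 T, P s = s := fun s hs => by simp [P, projIcc_of_mem hb.nonneg hs]
  have hPc : Continuous P := continuous_subtype_val.comp continuous_projIcc
  have hPm : ∀ s, P s ∈ Icc 0 T := fun s => (projIcc 0 T hb.nonneg s).2
  let D : Matrix (Fin 3) (Fin 3) ℂ := Matrix.diagonal fun i => z 1 i - z 1 2
  have h1 : ∀ i j, ContinuousOn (fun t => bdryV₁ b t i j) (Icc 0 T) := fun i j => by
    have := (hb.continuousOn_bdryV 1 i j).sub (hb.continuousOn_bdryV 0 i j)
    refine this.congr fun t _ => ?_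
    simp [bdryV_eq b 1, bdryV₀]
  obtain ⟨φ, hφc, hφ, hd⟩ := exists_quadratic_family (T := T) (A₀ := fun s => bdryV₀ b (P s))
    (A₁ := fun s => bdryV₁ b (P s)) (A₂ := fun _ => D) hb.nonneg
    (fun i j => (hb.continuousOn_bdryV 0 i j).comp_continuous hPc hPm)
    (fun i j => (h1 i j).comp_continuous hPc hPm) (fun i j => continuous_const) e₃
  refine ⟨φ, fun k => ?_, fun k => ?_, hd⟩
  · have hA : ∀ i j, ContinuousOn (fun t => (bdryV b k t +
        Matrix.diagonal fun i => z k i - z k 2) i j) (Icc 0 T) := fun i j => by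
      simp only [Matrix.add_apply]
      exact (hb.continuousOn_bdryV k i j).add continuousOn_const
    have h := IsODESol.of_eq_integral (d := 0) (y := φ k) (τ := 0) (η := e₃) hA
      (hφc k).continuousOn ⟨le_rfl, hb.nonneg⟩ fun t ht i => by
        rw [hφ k t ht i]
        congr 1
        · simp
        · refine intervalIntegral.integral_congr fun s hs => ?_
          rw [hP s (uIcc_subset_Icc ⟨le_rfl, hb.nonneg⟩ ht hs), bdryV_eq]
          have e : k ^ 2 • D = Matrix.diagonal fun i => z k i - z k 2 := by
            rw [← Matrix.diagonal_smul]
            congr 1; ext i; simp [z]; ring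
          simp [e]
    refine ⟨h.cont, fun t ht i => (h.deriv t ht i).congr_deriv ?_⟩
    simp only [Matrix.add_mulVec, Matrix.mulVec_diagonal, Pi.add_apply, Pi.zero_apply]
    ring
  · ext i
    rw [hφ k 0 ⟨le_rfl, hb.nonneg⟩ i]; simp

lemma IsODESol.congr_col {d d' : Fin 3 → ℂ} {A A' : ℝ → Matrix (Fin 3) (Fin 3) ℂ}
    {y : ℝ → Fin 3 → ℂ} (h : IsODESol T d A y) (σ : Equiv.Perm (Fin 3)) (hd : ∀ i, d (σ i) = d' i)
    (hA : ∀ t i j, A t (σ i) (σ j) = A' t i j) : IsODESol T d' A' fun t i => y t (σ i) := by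
  refine ⟨continuousOn_pi.2 fun i => continuousOn_pi.1 h.cont (σ i), fun t ht i => ?_⟩
  refine (h.deriv t ht (σ i)).congr_deriv ?_
  rw [hd]
  congr 1
  simp only [Matrix.mulVec, dotProduct]
  rw [← Equiv.sum_comp σ]
  simp only [hA]

/-- The cyclic symmetry of the Lax pair: replacing `k` by `ωk` amounts to shifting the indices.
Because of it one column of `μ₂` determines the other two. -/
lemma V₂_rotate (k q r q' r' : ℂ) (i j : Fin 3) :
    V₂ (ω * k) q r q' r' (i + 1) (j + 1) = V₂ k q r q' r' i j := by
  have h := ω_cube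
  fin_cases i <;> fin_cases j <;> simp [V₂] <;> grind

lemma z_rotate (k : ℂ) (i : Fin 3) : z (ω * k) (i + 1) = z k i := by
  have h := ω_cube
  fin_cases i <;> simp [z, Jdiag] <;> grind

lemma IsODESol.rotate {k : ℂ} {j : Fin 3} {y : ℝ → Fin 3 → ℂ}
    (h : IsODESol T (fun i => z (ω * k) i - z (ω * k) (j + 1)) (bdryV b (ω * k)) y) :
    IsODESol T (fun i => z k i - z k j) (bdryV b k) fun t i => y t (i + 1) :=
  h.congr_col (Equiv.addRight 1) (fun i => by simp [z_rotate]) fun t i j => V₂_rotate ..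

/-- The fundamental matrix of the `t`-part of the Lax pair whose columns are obtained by rotation
from the family `φ` of third columns. -/
def fundMat (φ : ℂ → ℝ → Fin 3 → ℂ) (k : ℂ) (t : ℝ) : Matrix (Fin 3) (Fin 3) ℂ :=
  !![φ (ω ^ 2 * k) t 2, φ (ω * k) t 1, φ k t 0;
     φ (ω ^ 2 * k) t 0, φ (ω * k) t 2, φ k t 1;
     φ (ω ^ 2 * k) t 1, φ (ω * k) t 0, φ k t 2]

/-- The first and second columns are the third column at `ω²k` and at `ωk`, rotated twice and once
respectively. -/
lemma isTimeEigenfunction_fundMat (hb : ContBdry T b) {φ : ℂ → ℝ → Fin 3 → ℂ}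
    (hφ : ∀ k, IsODESol T (fun i => z k i - z k 2) (bdryV b k) (φ k)) (h0 : ∀ k, φ k 0 = e₃)
    (k : ℂ) : IsTimeEigenfunction T b 0 k (fundMat φ k) := by
  refine (isTimeEigenfunction_iff hb ⟨le_rfl, hb.nonneg⟩).2 ⟨fun j => ?_, ?_⟩
  · fin_cases j
    · have e : (fun t i => fundMat φ k t i 0) = fun t i => φ (ω * (ω * k)) t (i + 1 + 1) := by
        funext t i
        fin_cases i <;> simp [fundMat, pow_two, mul_assoc]
      exact e ▸ ((hφ (ω * (ω * k))).rotate (j := 1)).rotate (j := 0)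
    · have e : (fun t i => fundMat φ k t i 1) = fun t i => φ (ω * k) t (i + 1) := by
        funext t i
        fin_cases i <;> simp [fundMat]
      exact e ▸ (hφ (ω * k)).rotate (j := 1)
    · have e : (fun t i => fundMat φ k t i 2) = φ k := by
        funext t i
        fin_cases i <;> simp [fundMat]
      exact e ▸ hφ k
  · ext i j
    fin_cases i <;> fin_cases j <;> simp [fundMat, h0]

/-- A fundamental matrix applied to the solutions of the diagonal system. -/
lemma IsODESol.mulVec_exp {k : ℂ} {A : ℝ → Matrix (Fin 3) (Fin 3) ℂ}
    {μ : ℝ → Matrix (Fin 3) (Fin 3) ℂ}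
    (h : ∀ j, IsODESol T (fun i => z k i - z k j) A fun t i => μ t i j) (j : Fin 3) (τ : ℝ)
    (v : Fin 3 → ℂ) : IsODESol T (fun i => z k i - z k j) A fun t =>
      (μ t).mulVec fun m => Complex.exp ((z k m - z k j) * ((t - τ : ℝ) : ℂ)) * v m := by
  have hexp : ∀ (d : ℂ) (t : ℝ), HasDerivAt (fun t : ℝ => Complex.exp (d * ((t - τ : ℝ) : ℂ)))
      (Complex.exp (d * ((t - τ : ℝ) : ℂ)) * (d * ((1 : ℝ) : ℂ))) t := fun d t =>
    ((((hasDerivAt_id t).sub_const τ).ofReal_comp).const_mul d).cexp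
  refine ⟨continuousOn_pi.2 fun i => ?_, fun t ht i => ?_⟩
  · refine continuousOn_mulVec (fun i j => continuousOn_pi.1 (h j).cont i) ?_ i
    exact (by fun_prop : Continuous fun (t : ℝ) (m : Fin 3) =>
      Complex.exp ((z k m - z k j) * ((t - τ : ℝ) : ℂ)) * v m).continuousOn
  · have h1 := HasDerivAt.fun_sum (u := Finset.univ) fun m (_ : m ∈ Finset.univ) =>
      ((h m).deriv t ht i).mul ((hexp (z k m - z k j) t).mul_const (v m))
    refine h1.congr_deriv ?_
    simp only [Matrix.mulVec, dotProduct, Fin.sum_univ_three]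
    push_cast
    ring

/-- Liouville's formula: `V₂` has zero diagonal, and in each term of the determinant the rates `z_i
- z_j` sum to zero. -/
lemma det_eq_one (hb : ContBdry T b) {k : ℂ} {μ : ℝ → Matrix (Fin 3) (Fin 3) ℂ}
    (hμ : IsTimeEigenfunction T b 0 k μ) {t : ℝ} (ht : t ∈ Icc 0 T) : (μ t).det = 1 := by
  obtain ⟨h, h0⟩ := (isTimeEigenfunction_iff hb ⟨le_rfl, hb.nonneg⟩).1 hμ
  have hc : ∀ i j, ContinuousOn (fun t => μ t i j) (Icc 0 T) := fun i j =>
    continuousOn_pi.1 (h j).cont i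
  have hdc : ContinuousOn (fun t => (μ t).det) (Icc 0 T) := by
    simp only [Matrix.det_fin_three]
    fun_prop
  have hd : ∀ t ∈ Ioo 0 T, HasDerivAt (fun t => (μ t).det) (0 * (μ t).det + 0) t := fun t ht => by
    have e := fun i j => (h j).deriv t ht i
    simp only [Matrix.det_fin_three]
    refine ((((((((e 0 0).mul (e 1 1)).mul (e 2 2)).sub (((e 0 0).mul (e 1 2)).mul (e 2 1))).sub
      (((e 0 1).mul (e 1 0)).mul (e 2 2))).add (((e 0 1).mul (e 1 2)).mul (e 2 0))).add
      (((e 0 2).mul (e 1 0)).mul (e 2 1))).sub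
      (((e 0 2).mul (e 1 1)).mul (e 2 0))).congr_deriv ?_
    have v0 : bdryV b k t 0 0 = 0 := by simp [bdryV, V₂]
    have v1 : bdryV b k t 1 1 = 0 := by simp [bdryV, V₂]
    have v2 : bdryV b k t 2 2 = 0 := by simp [bdryV, V₂]
    simp only [Matrix.mulVec, dotProduct, Fin.sum_univ_three, v0, v1, v2, Pi.mul_apply]
    ring
  have := eq_exp_add_integral hdc continuousOn_const hd ⟨le_rfl, hb.nonneg⟩ ht
  simpa [h0] using this

/-- `μ₂(t)` times the conjugation by `e^{(t-T)𝓩}` of `μ₂(T)⁻¹` solves the equation and is the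
identity at `T`, so it is `μ₁`; the inverse is the adjugate by `det_eq_one`. The value at `t = 0` is
`S`. -/
lemma S_eq (hb : ContBdry T b) {k : ℂ} {μ : ℝ → Matrix (Fin 3) (Fin 3) ℂ}
    (hμ : IsTimeEigenfunction T b 0 k μ) (i j : Fin 3) :
    S T b k i j = Complex.exp (-((z k i - z k j) * (T : ℂ))) * (μ T).adjugate i j := by
  have hTT : T ∈ Icc 0 T := ⟨hb.nonneg, le_rfl⟩
  have h00 : (0 : ℝ) ∈ Icc 0 T := ⟨le_rfl, hb.nonneg⟩
  obtain ⟨h, h0⟩ := (isTimeEigenfunction_iff hb h00).1 hμ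
  let X : ℝ → Matrix (Fin 3) (Fin 3) ℂ := fun t m j =>
    Complex.exp ((z k m - z k j) * ((t - T : ℝ) : ℂ)) * (μ T).adjugate m j
  have hX : IsTimeEigenfunction T b T k fun t => μ t * X t := by
    refine (isTimeEigenfunction_iff hb hTT).2 ⟨fun j => ?_, ?_⟩
    · exact IsODESol.mulVec_exp h j T fun m => (μ T).adjugate m j
    · have : X T = (μ T).adjugate := by ext i j; simp [X]
      simp only [this, Matrix.mul_adjugate, det_eq_one hb hμ hTT, one_smul]
  rw [S, μ₁, timeEigenfunction_eq hb (Or.inr rfl) hX h00, h0, one_mul]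
  simp only [X]
  congr 2
  push_cast; ring

lemma solvesVolterra_iff (hb : ContBdry T b) {k : ℂ} {φ : ℝ → Fin 3 → ℂ} :
    SolvesVolterra T b k (fun t => φ t 0) (fun t => φ t 1) (fun t => φ t 2) ↔
      IsODESol T (fun i => z k i - z k 2) (bdryV b k) φ ∧ φ 0 = e₃ := by
  have h00 : (0 : ℝ) ∈ Icc 0 T := ⟨le_rfl, hb.nonneg⟩
  have i3 : ∀ x : ℂ, Complex.I * x / (Real.sqrt 3 : ℂ) = (2 * ω + 1) / 3 * x := fun x => by
    rw [← I_div_sqrt3]; ring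
  constructor
  · intro h
    have h' : IsODESol T (fun i => z k i - z k 2) (bdryV b k) φ := by
      refine IsODESol.of_eq_integral (hb.continuousOn_bdryV k) (continuousOn_pi.2 fun i => ?_) h00
        (η := e₃) fun t ht i => ?_
      · fin_cases i
        exacts [h.continuousOn₁, h.continuousOn₂, h.continuousOn₃]
      · fin_cases i
        · simp only [Fin.zero_eta, h.eq₁ t ht, bdryV, V₂_mulVec_zero, e₃_zero, mul_zero, zero_add]
          refine intervalIntegral.integral_congr fun s _ => ?_
          simp only [i3]; ring
        · simp only [Fin.mk_one, h.eq₂ t ht, bdryV, V₂_mulVec_one, e₃_one, mul_zero, zero_add]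
          refine intervalIntegral.integral_congr fun s _ => ?_
          simp only [i3]; ring
        · simp only [Fin.reduceFinMk, h.eq₃ t ht, bdryV, V₂_mulVec_two, e₃_two, sub_self, zero_mul,
            Complex.exp_zero, one_mul]
          congr 1
          refine intervalIntegral.integral_congr fun s _ => ?_
          simp only [i3]; ring
    refine ⟨h', ?_⟩
    ext i
    fin_cases i
    · simpa using h.eq₁ 0 h00
    · simpa using h.eq₂ 0 h00
    · simpa using h.eq₃ 0 h00
  · rintro ⟨h, h0⟩
    have c := fun i => continuousOn_pi.1 h.cont i
    have e := fun t ht i => h.eq_integral (hb.continuousOn_bdryV k) h00 (t := t) ht i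
    refine ⟨c 0, c 1, c 2, fun t ht => ?_, fun t ht => ?_, fun t ht => ?_⟩
    · rw [e t ht 0, h0, e₃_zero, mul_zero, zero_add]
      refine intervalIntegral.integral_congr fun s _ => ?_
      simp only [i3, bdryV, V₂_mulVec_zero]; ring
    · rw [e t ht 1, h0, e₃_one, mul_zero, zero_add]
      refine intervalIntegral.integral_congr fun s _ => ?_
      simp only [i3, bdryV, V₂_mulVec_one]; ring
    · rw [e t ht 2, h0, e₃_two]
      simp only [sub_self, zero_mul, Complex.exp_zero, one_mul]
      congr 1
      refine intervalIntegral.integral_congr fun s _ => ?_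
      simp only [i3, bdryV, V₂_mulVec_two]; ring

/-- The third column of `μ₂(0,t,k)`. -/
def timeCol (T : ℝ) (b : BoundaryValues) (k : ℂ) (t : ℝ) (i : Fin 3) : ℂ := μ₂ T b t k i 2

/-- The basic properties of the third column of `μ₂` and of the matrix `μ₂` itself. -/
theorem ContBdry.timeCol_spec (hb : ContBdry T b) :
    (∀ k, IsODESol T (fun i => z k i - z k 2) (bdryV b k) (timeCol T b k)) ∧
    (∀ k, timeCol T b k 0 = e₃) ∧
    (∀ t ∈ Icc 0 T, ∀ i, Differentiable ℂ fun k => timeCol T b k t i) ∧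
    ∀ k, IsTimeEigenfunction T b 0 k (fundMat (timeCol T b) k) := by
  obtain ⟨φ, h1, h2, h3⟩ := exists_timeColumn hb
  have e : ∀ k, ∀ t ∈ Icc 0 T, timeCol T b k t = φ k t := fun k t ht => by
    ext i
    rw [timeCol, μ₂, timeEigenfunction_eq hb (Or.inl rfl) (isTimeEigenfunction_fundMat hb h1 h2 k) ht]
    fin_cases i <;> simp [fundMat]
  have c1 : ∀ k, IsODESol T (fun i => z k i - z k 2) (bdryV b k) (timeCol T b k) := fun k => by
    refine ⟨(h1 k).cont.congr (e k), fun t ht i => ?_⟩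
    rw [e k t (Ioo_subset_Icc_self ht)]
    refine ((h1 k).deriv t ht i).congr_of_eventuallyEq ?_
    filter_upwards [Icc_mem_nhds ht.1 ht.2] with s hs
    rw [e k s hs]
  have c2 : ∀ k, timeCol T b k 0 = e₃ := fun k => by rw [e k 0 ⟨le_rfl, hb.nonneg⟩, h2]
  refine ⟨c1, c2, fun t ht i => ?_, isTimeEigenfunction_fundMat hb c1 c2⟩
  simp only [fun k => e k t ht]
  exact h3 t i

theorem ContBdry.volterra_unique (hb : ContBdry T b) (k : ℂ) :
    SolvesVolterra T b k (fun t => Φ₁ T b t k) (fun t => Φ₂ T b t k) (fun t => Φ₃ T b t k) ∧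
      ∀ φ₁ φ₂ φ₃ : ℝ → ℂ, SolvesVolterra T b k φ₁ φ₂ φ₃ → ∀ t ∈ Icc 0 T,
        φ₁ t = Φ₁ T b t k ∧ φ₂ t = Φ₂ T b t k ∧ φ₃ t = Φ₃ T b t k := by
  obtain ⟨h1, h2, -, -⟩ := hb.timeCol_spec
  refine ⟨(solvesVolterra_iff hb (φ := timeCol T b k)).2 ⟨h1 k, h2 k⟩, fun φ₁ φ₂ φ₃ h t ht => ?_⟩
  obtain ⟨h3, h4⟩ := (solvesVolterra_iff hb (φ := fun t => ![φ₁ t, φ₂ t, φ₃ t])).1 h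
  have := h3.unique (h1 k) (hb.continuousOn_bdryV k) (Or.inl rfl) (h4.trans (h2 k).symm) ht
  exact ⟨congr_fun this 0, congr_fun this 1, congr_fun this 2⟩

set_option maxHeartbeats 1000000 in
-- Three cofactors of the rotated fundamental matrix suffice: `k ↦ ωk` permutes the `z_i`, so the
-- exponential factors of `S_eq` rotate together with the entries.
theorem ContBdry.S_formula (hb : ContBdry T b) : ∃ A B C : ℂ → ℂ,
    (∀ k, A k = Φ₃ T b T (ω ^ 2 * k) * Φ₃ T b T (ω * k)
      - Φ₁ T b T (ω ^ 2 * k) * Φ₂ T b T (ω * k)) ∧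
    (∀ k, B k = -(Φ₃ T b T (ω ^ 2 * k) * Φ₂ T b T k - Φ₁ T b T (ω ^ 2 * k) * Φ₁ T b T k)
      * Complex.exp ((z k 2 - z k 1) * (T : ℂ))) ∧
    (∀ k, C k = (Φ₂ T b T (ω * k) * Φ₂ T b T k - Φ₃ T b T (ω * k) * Φ₁ T b T k)
      * Complex.exp ((z k 2 - z k 0) * (T : ℂ))) ∧
    ∀ k, S T b k = !![A (ω ^ 2 * k), B (ω * k), C k;
      C (ω ^ 2 * k), A (ω * k), B k; B (ω ^ 2 * k), C (ω * k), A k] := by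
  refine ⟨_, _, _, fun _ => rfl, fun _ => rfl, fun _ => rfl, fun k => ?_⟩
  obtain ⟨-, -, -, h⟩ := hb.timeCol_spec
  have hS := S_eq hb (h k)
  have e1 : ω ^ 2 * (ω ^ 2 * k) = ω * k := by
    linear_combination ω * k * ω_cube
  have e2 : ω * (ω ^ 2 * k) = k := by linear_combination k * ω_cube
  have e3 : ω ^ 2 * (ω * k) = k := by linear_combination k * ω_cube
  have e4 : ω * (ω * k) = ω ^ 2 * k := by ring
  have z1 : ∀ i, z (ω * k) i = z k (i + 2) := fun i => by
    rw [← z_rotate k (i + 2), add_assoc]; simp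
  have z2 : ∀ i, z (ω ^ 2 * k) i = z k (i + 1) := fun i => by
    rw [← e4, ← z_rotate k (i + 1), ← z_rotate (ω * k) (i + 1 + 1)]
    simp [add_assoc]
  ext i j
  rw [hS, Matrix.adjugate_fin_three]
  fin_cases i <;> fin_cases j <;> simp [fundMat, e1, e2, e3, e4, z1, z2, timeCol, Φ₁, Φ₂, Φ₃]
  all_goals
    first
    | ring1
    | (rw [mul_comm]; congr 1
       · ring
       · congr 1; ring)

end

noncomputable section

/-! ### The formal diagonalization of the `t`-part of the Lax pair -/

/-- The diagonal of `J²`. -/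
def sqDiag (i : Fin 3) : ℂ := Jdiag i ^ 2

/-- The inverses of the differences of the entries of `sqDiag`. -/
def commInv : Matrix (Fin 3) (Fin 3) ℂ :=
  !![0, (2 + ω) / 3, (1 - ω) / 3;
     -(2 + ω) / 3, 0, -(2 * ω + 1) / 3;
     -(1 - ω) / 3, (2 * ω + 1) / 3, 0]

/-- The inverse of `X ↦ [J², X]` on off-diagonal matrices, extended by zero. -/
def offDiv (X : Matrix (Fin 3) (Fin 3) ℂ) : Matrix (Fin 3) (Fin 3) ℂ :=
  Matrix.of fun i j => commInv i j * X i j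

lemma offDiv_apply (X : Matrix (Fin 3) (Fin 3) ℂ) (i j : Fin 3) :
    offDiv X i j = commInv i j * X i j := rfl

lemma commInv_mul (i j : Fin 3) :
    (sqDiag i - sqDiag j) * commInv i j = if i = j then 0 else 1 := by
  have h := ω_sq
  have h3 : ω ^ 3 = 1 := ω_cube
  fin_cases i <;> fin_cases j <;> simp [commInv, sqDiag, Jdiag] <;> grind

lemma sqDiag_mul_offDiv (X : Matrix (Fin 3) (Fin 3) ℂ) (i j : Fin 3) :
    (sqDiag i - sqDiag j) * offDiv X i j = if i = j then 0 else X i j := by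
  rw [offDiv_apply, ← mul_assoc, commInv_mul]; split_ifs <;> simp

lemma z_sub_z (k : ℂ) (i : Fin 3) : z k i - z k 2 = -(k ^ 2 * (sqDiag i - sqDiag 2)) := by
  simp only [z, sqDiag]; ring

/-- The derivative of the diagonal part of the first coefficient of the gauge transformation. -/
def gaugeRate (V₁ V₀ : Matrix (Fin 3) (Fin 3) ℂ) (i : Fin 3) : ℂ :=
  -((-offDiv (-offDiv V₁ * V₁ + V₀)) * V₁ + (-offDiv V₁) * V₀) i i

/-- A solvability condition: a commutator with `J²` has zero diagonal, so the order `k⁰` of the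
gauge equation can only be solved if this diagonal vanishes. -/
lemma diag_first (b : BoundaryValues) (d : Fin 3 → ℂ) (t : ℝ) (i : Fin 3) :
    ((-offDiv (bdryV₁ b t) + Matrix.diagonal d) * bdryV₁ b t + bdryV₀ b t) i i = 0 := by
  have h := ω_sq
  fin_cases i <;> simp [Matrix.mul_apply, Fin.sum_univ_three, offDiv, commInv, bdryV₁, bdryV₀,
    bdryV, V₂] <;> grind

/-- At order `1/k` solvability prescribes the derivative of the diagonal part of the first
coefficient. That this rate does not involve the diagonal part `d` itself makes `gaugeDiag` a plain
integral. -/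
lemma gaugeRate_eq (b : BoundaryValues) (d : Fin 3 → ℂ) (t : ℝ) (i : Fin 3) :
    gaugeRate (bdryV₁ b t) (bdryV₀ b t) i =
      -((-offDiv ((-offDiv (bdryV₁ b t) + Matrix.diagonal d) * bdryV₁ b t + bdryV₀ b t)) *
          bdryV₁ b t + (-offDiv (bdryV₁ b t) + Matrix.diagonal d) * bdryV₀ b t) i i := by
  have h := ω_sq
  generalize h0 : bdryV₀ b t = X
  have x0 : X 0 0 = 0 := by simp [← h0, bdryV₀, bdryV, V₂]
  have x1 : X 1 1 = 0 := by simp [← h0, bdryV₀, bdryV, V₂]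
  have x2 : X 2 2 = 0 := by simp [← h0, bdryV₀, bdryV, V₂]
  fin_cases i <;> simp [gaugeRate, Matrix.mul_apply, Fin.sum_univ_three, offDiv, commInv, bdryV₁,
    x0, x1, x2] <;> grind

/-- Entrywise smoothness on `[0,T]`. -/
def MC (T : ℝ) (n : ℕ) (M : ℝ → Matrix (Fin 3) (Fin 3) ℂ) : Prop :=
  ∀ i j, ContDiffOn ℝ n (fun t => M t i j) (Icc 0 T)

/-- The entrywise derivative on `[0,T]`. -/
def mderiv (T : ℝ) (M : ℝ → Matrix (Fin 3) (Fin 3) ℂ) (t : ℝ) : Matrix (Fin 3) (Fin 3) ℂ :=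
  Matrix.of fun i j => derivWithin (fun t => M t i j) (Icc 0 T) t

section

variable {T : ℝ} {n : ℕ} {M M' : ℝ → Matrix (Fin 3) (Fin 3) ℂ}

lemma MC.mono (h : MC T n M) {m : ℕ} (hm : m ≤ n) : MC T m M := fun i j =>
  (h i j).of_le (by exact_mod_cast hm)

lemma MC.add (h : MC T n M) (h' : MC T n M') : MC T n fun t => M t + M' t := fun i j =>
  (h i j).add (h' i j)

lemma MC.neg (h : MC T n M) : MC T n fun t => -M t := fun i j => (h i j).neg

lemma MC.mul (h : MC T n M) (h' : MC T n M') : MC T n fun t => M t * M' t := fun i j => by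
  simp only [Matrix.mul_apply]
  exact ContDiffOn.sum fun l _ => (h i l).mul (h' l j)

lemma MC.offDiv (h : MC T n M) : MC T n fun t => offDiv (M t) := fun i j =>
  contDiffOn_const.mul (h i j)

lemma MC.mderiv (hT : 0 < T) (h : MC T (n + 1) M) : MC T n (mderiv T M) := fun i j =>
  (h i j).derivWithin (uniqueDiffOn_Icc hT) (by norm_cast)

lemma MC.continuousOn (h : MC T n M) (i j : Fin 3) :
    ContinuousOn (fun t => M t i j) (Icc 0 T) := (h i j).continuousOn

lemma MC.hasDerivAt (h : MC T (n + 1) M) {t : ℝ} (ht : t ∈ Ioo 0 T) (i j : Fin 3) :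
    HasDerivAt (fun t => M t i j) (LaxIBV.mderiv T M t i j) t :=
  (((h i j).differentiableOn (by simp) t (Ioo_subset_Icc_self ht)).hasDerivWithinAt).hasDerivAt
    (Icc_mem_nhds ht.1 ht.2)

lemma contDiffOn_primitive (hT : 0 < T) {e : ℝ → ℂ} (he : ContDiffOn ℝ n e (Icc 0 T)) :
    ContDiffOn ℝ (n + 1) (fun t => ∫ s in (0 : ℝ)..t, e s) (Icc 0 T) ∧ ∀ t ∈ Icc 0 T,
      HasDerivWithinAt (fun t => ∫ s in (0 : ℝ)..t, e s) (e t) (Icc 0 T) t := by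
  have hd : ∀ t ∈ Icc 0 T,
      HasDerivWithinAt (fun t => ∫ s in (0 : ℝ)..t, e s) (e t) (Icc 0 T) t := fun t ht => by
    have := hasDerivWithinAt_of_eq_integral (d := 0) (y := fun t => ∫ s in (0 : ℝ)..t, e s)
      (τ := 0) (η := 0) he.continuousOn ⟨le_rfl, hT.le⟩ (by simp) ht
    simpa using this
  refine ⟨?_, hd⟩
  rw [contDiffOn_succ_iff_derivWithin (uniqueDiffOn_Icc hT)]
  refine ⟨fun t ht => (hd t ht).differentiableWithinAt, by simp, ?_⟩
  exact he.congr fun t ht => (hd t ht).derivWithin (uniqueDiffOn_Icc hT t ht)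

end

/-- Twice continuously differentiable boundary values. -/
structure SmoothBdry (T : ℝ) (b : BoundaryValues) : Prop where
  pos : 0 < T
  g₀ : ContDiffOn ℝ 2 b.g₀ (Icc 0 T)
  h₀ : ContDiffOn ℝ 2 b.h₀ (Icc 0 T)
  g₁ : ContDiffOn ℝ 2 b.g₁ (Icc 0 T)
  h₁ : ContDiffOn ℝ 2 b.h₁ (Icc 0 T)

lemma SmoothBdry.contBdry {T : ℝ} {b : BoundaryValues} (h : SmoothBdry T b) : ContBdry T b :=
  ⟨h.pos.le, h.g₀.continuousOn, h.h₀.continuousOn, h.g₁.continuousOn, h.h₁.continuousOn⟩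

section gauge

variable (T : ℝ) (b : BoundaryValues)

/-- The diagonal part of the first coefficient of the gauge transformation. -/
def gaugeDiag (t : ℝ) (i : Fin 3) : ℂ :=
  ∫ s in (0 : ℝ)..t, gaugeRate (bdryV₁ b s) (bdryV₀ b s) i

/-- The coefficient of `k⁻¹` of the gauge transformation. -/
def gauge₁ (t : ℝ) : Matrix (Fin 3) (Fin 3) ℂ :=
  -offDiv (bdryV₁ b t) + Matrix.diagonal (gaugeDiag b t)

/-- The coefficient of `k⁻²` of the gauge transformation. -/
def gauge₂ (t : ℝ) : Matrix (Fin 3) (Fin 3) ℂ :=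
  -offDiv (gauge₁ b t * bdryV₁ b t + bdryV₀ b t)

/-- The coefficient of `k⁻³` of the gauge transformation. -/
def gauge₃ (t : ℝ) : Matrix (Fin 3) (Fin 3) ℂ :=
  -offDiv (mderiv T (gauge₁ b) t + gauge₂ b t * bdryV₁ b t + gauge₁ b t * bdryV₀ b t)

/-- The source of the coefficient of `k⁻⁴` of the gauge transformation. -/
def gaugeSource (t : ℝ) : Matrix (Fin 3) (Fin 3) ℂ :=
  mderiv T (gauge₂ b) t + gauge₃ T b t * bdryV₁ b t + gauge₂ b t * bdryV₀ b t

/-- The coefficient of `k⁻⁴` of the gauge transformation. -/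
def gauge₄ (t : ℝ) : Matrix (Fin 3) (Fin 3) ℂ := -offDiv (gaugeSource T b t)

/-- The gauge transformation that diagonalizes the `t`-part up to terms of order `k⁻²`. -/
def gauge (k : ℂ) (t : ℝ) : Matrix (Fin 3) (Fin 3) ℂ :=
  1 + k⁻¹ • gauge₁ b t + k⁻¹ ^ 2 • gauge₂ b t + k⁻¹ ^ 3 • gauge₃ T b t + k⁻¹ ^ 4 • gauge₄ T b t

/-- The remainder of the gauge transformation. -/
def gaugeErr (k : ℂ) (t : ℝ) : Matrix (Fin 3) (Fin 3) ℂ :=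
  k⁻¹ ^ 2 • Matrix.diagonal (fun i => gaugeSource T b t i i) +
    k⁻¹ ^ 3 • (mderiv T (gauge₃ T b) t + gauge₄ T b t * bdryV₁ b t + gauge₃ T b t * bdryV₀ b t) +
    k⁻¹ ^ 4 • (mderiv T (gauge₄ T b) t + gauge₄ T b t * bdryV₀ b t)

end gauge

section

variable {T : ℝ} {b : BoundaryValues}

lemma SmoothBdry.mc_bdryV (h : SmoothBdry T b) (k : ℂ) : MC T 2 (bdryV b k) := fun i j => by
  have h1 := h.g₀
  have h2 := h.h₀
  have h3 := h.g₁
  have h4 := h.h₁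
  fin_cases i <;> fin_cases j <;> simp [bdryV, V₂] <;> fun_prop

lemma SmoothBdry.mc_bdryV₁ (h : SmoothBdry T b) : MC T 2 (bdryV₁ b) := fun i j => by
  have h1 := h.g₀
  have h2 := h.h₀
  fin_cases i <;> fin_cases j <;> simp [bdryV₁] <;> fun_prop

lemma SmoothBdry.mc_gaugeDiag (h : SmoothBdry T b) :
    MC T 2 (fun t => Matrix.diagonal (gaugeDiag b t)) ∧ ∀ t ∈ Icc 0 T, ∀ i, HasDerivWithinAt
      (fun t => gaugeDiag b t i) (gaugeRate (bdryV₁ b t) (bdryV₀ b t) i) (Icc 0 T) t := by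
  have h1 := h.mc_bdryV₁
  have h0 : MC T 2 (bdryV₀ b) := h.mc_bdryV 0
  have hr : ∀ i, ContDiffOn ℝ 2 (fun s => gaugeRate (bdryV₁ b s) (bdryV₀ b s) i) (Icc 0 T) :=
    fun i => (((((h1.offDiv.neg.mul h1).add h0).offDiv.neg.mul h1).add
      (h1.offDiv.neg.mul h0)).neg) i i
  have hp := fun i => contDiffOn_primitive h.pos (hr i)
  refine ⟨fun i j => ?_, fun t ht i => (hp i).2 t ht⟩
  by_cases hij : i = j
  · subst hij
    simp only [Matrix.diagonal_apply_eq]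
    exact (hp i).1.of_le (by norm_num)
  · simp only [Matrix.diagonal_apply_ne _ hij]
    exact contDiffOn_const

lemma SmoothBdry.mc_gauge₁ (h : SmoothBdry T b) : MC T 2 (gauge₁ b) :=
  h.mc_bdryV₁.offDiv.neg.add h.mc_gaugeDiag.1

lemma SmoothBdry.mc_gauge₂ (h : SmoothBdry T b) : MC T 2 (gauge₂ b) :=
  ((h.mc_gauge₁.mul h.mc_bdryV₁).add (h.mc_bdryV 0)).offDiv.neg

lemma SmoothBdry.mc_gauge₃ (h : SmoothBdry T b) : MC T 1 (gauge₃ T b) :=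
  (((h.mc_gauge₁.mderiv h.pos).add ((h.mc_gauge₂.mul h.mc_bdryV₁).mono one_le_two)).add
    ((h.mc_gauge₁.mul (h.mc_bdryV 0)).mono one_le_two)).offDiv.neg

lemma SmoothBdry.mc_gaugeSource (h : SmoothBdry T b) : MC T 1 (gaugeSource T b) :=
  ((h.mc_gauge₂.mderiv h.pos).add (h.mc_gauge₃.mul (h.mc_bdryV₁.mono one_le_two))).add
    ((h.mc_gauge₂.mul (h.mc_bdryV 0)).mono one_le_two)

lemma SmoothBdry.mc_gauge₄ (h : SmoothBdry T b) : MC T 1 (gauge₄ T b) :=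
  h.mc_gaugeSource.offDiv.neg

/-- The entrywise derivative of the gauge transformation. -/
lemma SmoothBdry.gauge_identity (h : SmoothBdry T b) {k : ℂ} (hk : k ≠ 0) {t : ℝ}
    (ht : t ∈ Icc 0 T) (i j : Fin 3) :
    (k⁻¹ * mderiv T (gauge₁ b) t i j + k⁻¹ ^ 2 * mderiv T (gauge₂ b) t i j +
      k⁻¹ ^ 3 * mderiv T (gauge₃ T b) t i j + k⁻¹ ^ 4 * mderiv T (gauge₄ T b) t i j) +
      k ^ 2 * ((sqDiag i - sqDiag j) * gauge T b k t i j) + (gauge T b k t * bdryV b k t) i j =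
      gaugeErr T b k t i j := by
  have hU := uniqueDiffOn_Icc h.pos t ht
  -- This and the next two identities are the orders `k`, `1` and `1/k` of the gauge equation. Off
  -- the diagonal they hold by the choice of the coefficients; on it by the zero diagonal of
  -- `bdryV₁`, by `diag_first`, and by the choice of `gaugeDiag`.
  have e1 : (sqDiag i - sqDiag j) * gauge₁ b t i j + bdryV₁ b t i j = 0 := by
    have := sqDiag_mul_offDiv (bdryV₁ b t) i j
    simp only [gauge₁, Matrix.add_apply, Matrix.neg_apply, mul_add, mul_neg, this]
    by_cases hij : i = j
    · subst hij
      have : bdryV₁ b t i i = 0 := by fin_cases i <;> simp [bdryV₁]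
      simp [this]
    · simp [hij]
  have e2 : (sqDiag i - sqDiag j) * gauge₂ b t i j + (gauge₁ b t * bdryV₁ b t) i j +
      bdryV₀ b t i j = 0 := by
    have := sqDiag_mul_offDiv (gauge₁ b t * bdryV₁ b t + bdryV₀ b t) i j
    rw [gauge₂, Matrix.neg_apply, mul_neg, this, add_assoc, ← Matrix.add_apply]
    by_cases hij : i = j
    · subst hij
      have := diag_first b (gaugeDiag b t) t i
      rw [if_pos rfl, gauge₁, this]; simp
    · rw [if_neg hij]; ring
  have e3 : mderiv T (gauge₁ b) t i j + (sqDiag i - sqDiag j) * gauge₃ T b t i j +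
      (gauge₂ b t * bdryV₁ b t) i j + (gauge₁ b t * bdryV₀ b t) i j = 0 := by
    have := sqDiag_mul_offDiv
      (mderiv T (gauge₁ b) t + gauge₂ b t * bdryV₁ b t + gauge₁ b t * bdryV₀ b t) i j
    rw [gauge₃, Matrix.neg_apply, mul_neg, this]
    by_cases hij : i = j
    · subst hij
      have e := gaugeRate_eq b (gaugeDiag b t) t i
      have e' : mderiv T (gauge₁ b) t i i = gaugeRate (bdryV₁ b t) (bdryV₀ b t) i := by
        refine HasDerivWithinAt.derivWithin ?_ hU
        refine (h.mc_gaugeDiag.2 t ht i).congr_of_mem (fun s _ => ?_) ht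
        have : commInv i i = 0 := by fin_cases i <;> simp [commInv]
        simp [gauge₁, offDiv_apply, this]
      rw [if_pos rfl, e', e, gauge₂, gauge₁, Matrix.add_apply]; ring
    · rw [if_neg hij]; simp only [Matrix.add_apply]; ring
  -- At order `k⁻²` only the off-diagonal part is removed; the diagonal part stays as the leading
  -- term of `gaugeErr`.
  have e4 : (sqDiag i - sqDiag j) * gauge₄ T b t i j + gaugeSource T b t i j =
      Matrix.diagonal (fun i => gaugeSource T b t i i) i j := by
    rw [gauge₄, Matrix.neg_apply, mul_neg, sqDiag_mul_offDiv]
    by_cases hij : i = j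
    · subst hij; simp
    · simp [hij]
  have e5 : gaugeSource T b t i j = mderiv T (gauge₂ b) t i j + (gauge₃ T b t * bdryV₁ b t) i j +
    (gauge₂ b t * bdryV₀ b t) i j := rfl
  have e6 : (sqDiag i - sqDiag j) * (1 : Matrix (Fin 3) (Fin 3) ℂ) i j = 0 := by
    by_cases hij : i = j
    · subst hij; simp
    · simp [hij]
  rw [bdryV_eq, gaugeErr, gauge]
  simp only [add_mul, mul_add, Matrix.add_apply, Matrix.smul_apply, smul_eq_mul, Matrix.smul_mul,
    Matrix.mul_smul, one_mul, smul_add, ← e4, e5]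
  have hk' : k * k⁻¹ = 1 := mul_inv_cancel₀ hk
  generalize k⁻¹ = κ at *
  have p1 : k ^ 2 * κ = k := by linear_combination k * hk'
  have p2 : k ^ 2 * κ ^ 2 = 1 := by linear_combination (k * κ + 1) * hk'
  have p3 : k * κ ^ 2 = κ := by linear_combination κ * hk'
  linear_combination k * e1 + e2 + κ * e3 + k ^ 2 * e6 +
    (sqDiag i - sqDiag j) * (gauge₁ b t i j * p1 + (gauge₂ b t i j + gauge₃ T b t i j * κ +
      gauge₄ T b t i j * κ ^ 2) * p2) + (gauge₁ b t * bdryV₁ b t) i j * hk' +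
    ((gauge₂ b t * bdryV₁ b t) i j + (gauge₃ T b t * bdryV₁ b t) i j * κ +
      (gauge₄ T b t * bdryV₁ b t) i j * κ ^ 2) * p3

end

end

noncomputable section

/-! ### Large `k` asymptotics of the third column of `μ₂` -/

variable {T : ℝ} {b : BoundaryValues}

lemma SmoothBdry.mc_gauge (h : SmoothBdry T b) (k : ℂ) : MC T 1 (gauge T b k) := fun i j => by
  have h1 := h.mc_gauge₁.mono one_le_two i j
  have h2 := h.mc_gauge₂.mono one_le_two i j
  have h3 := h.mc_gauge₃ i j
  have h4 := h.mc_gauge₄ i j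
  simp only [gauge, Matrix.add_apply, Matrix.smul_apply, smul_eq_mul]
  fun_prop

lemma SmoothBdry.continuousOn_gaugeErr (h : SmoothBdry T b) (i j : Fin 3) :
    ContinuousOn (fun t => gaugeSource T b t i j) (Icc 0 T) ∧
    ContinuousOn (fun t => (mderiv T (gauge₃ T b) t + gauge₄ T b t * bdryV₁ b t +
      gauge₃ T b t * bdryV₀ b t) i j) (Icc 0 T) ∧
    ContinuousOn (fun t => (mderiv T (gauge₄ T b) t + gauge₄ T b t * bdryV₀ b t) i j) (Icc 0 T) := by
  have v1 := h.mc_bdryV₁.mono (zero_le_two)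
  have v0 := (h.mc_bdryV 0).mono (zero_le_two)
  have g3 := h.mc_gauge₃.mono zero_le_one
  have g4 := h.mc_gauge₄.mono zero_le_one
  exact ⟨h.mc_gaugeSource.continuousOn i j,
    (((h.mc_gauge₃.mderiv h.pos).add (g4.mul v1)).add (g3.mul v0)).continuousOn i j,
    ((h.mc_gauge₄.mderiv h.pos).add (g4.mul v0)).continuousOn i j⟩

/-- With `R` the gauge, `R' + k²[J²,R] + R V₂` is the gauge error, so the transformed column keeps
its diagonal rates while the coefficient `V₂`, which grows with `k`, is replaced by a decaying one.
The error still acts on the original column, which avoids inverting `R`. -/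
lemma SmoothBdry.hasDerivAt_gauge (h : SmoothBdry T b) {k : ℂ} (hk : k ≠ 0) {φ : ℝ → Fin 3 → ℂ}
    (hφ : IsODESol T (fun i => z k i - z k 2) (bdryV b k) φ) {t : ℝ} (ht : t ∈ Ioo 0 T)
    (i : Fin 3) : HasDerivAt (fun t => (gauge T b k t).mulVec (φ t) i)
      ((z k i - z k 2) * (gauge T b k t).mulVec (φ t) i + (gaugeErr T b k t).mulVec (φ t) i) t := by
  have hR : ∀ j, HasDerivAt (fun t => gauge T b k t i j) (k⁻¹ * mderiv T (gauge₁ b) t i j +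
      k⁻¹ ^ 2 * mderiv T (gauge₂ b) t i j + k⁻¹ ^ 3 * mderiv T (gauge₃ T b) t i j +
      k⁻¹ ^ 4 * mderiv T (gauge₄ T b) t i j) t := fun j => by
    have h1 := (h.mc_gauge₁.hasDerivAt ht i j).const_mul k⁻¹
    have h2 := (h.mc_gauge₂.hasDerivAt ht i j).const_mul (k⁻¹ ^ 2)
    have h3 := (MC.hasDerivAt (n := 0) h.mc_gauge₃ ht i j).const_mul (k⁻¹ ^ 3)
    have h4 := (MC.hasDerivAt (n := 0) h.mc_gauge₄ ht i j).const_mul (k⁻¹ ^ 4)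
    refine ((((h1.const_add ((1 : Matrix (Fin 3) (Fin 3) ℂ) i j)).add h2).add h3).add h4)
  have hsum := HasDerivAt.fun_sum (u := Finset.univ) fun j (_ : j ∈ Finset.univ) =>
    (hR j).mul (hφ.deriv t ht j)
  refine hsum.congr_deriv ?_
  have e := fun j => (h.gauge_identity hk (Ioo_subset_Icc_self ht) i j).symm
  simp only [Matrix.mulVec, dotProduct, e, z_sub_z, Fin.sum_univ_three, Matrix.mul_apply]
  ring

/-- `offDiv` has no diagonal and `gaugeDiag` starts from zero. The transformed third entry therefore
starts exactly at one and has no `1/k` term. -/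
lemma gauge_zero_two_two (T : ℝ) (b : BoundaryValues) (k : ℂ) : gauge T b k 0 2 2 = 1 := by
  simp [gauge, gauge₁, gauge₂, gauge₃, gauge₄, offDiv, commInv, gaugeDiag]

/-- The region where both exponentials of the third column are bounded. -/
def decayRegion : Set ℂ := {k | ∀ i, (z k i - z k 2).re ≤ 0}

lemma norm_exp_le_one {k : ℂ} (hk : k ∈ decayRegion) (i : Fin 3) {s : ℝ} (hs : 0 ≤ s) :
    ‖Complex.exp ((z k i - z k 2) * (s : ℂ))‖ ≤ 1 := by
  rw [Complex.norm_exp, Complex.re_mul_ofReal]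
  exact Real.exp_le_one_iff.2 (mul_nonpos_of_nonpos_of_nonneg (hk i) hs)

/-- Pairs `(t, k)` with `t ∈ [0,T]` and `k` large in the region of decay. -/
def decaySet (T K : ℝ) : Set (ℝ × ℂ) := {p | p.1 ∈ Icc 0 T ∧ K ≤ ‖p.2‖ ∧ p.2 ∈ decayRegion}

lemma isBigO_one_of_continuousOn {f : ℝ → ℂ} (hf : ContinuousOn f (Icc 0 T)) (K : ℝ) :
    (fun p : ℝ × ℂ => f p.1) =O[𝓟 (decaySet T K)] fun p => p.2⁻¹ ^ 0 := by
  obtain ⟨C, hC⟩ := isCompact_Icc.exists_bound_of_continuousOn hf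
  refine Asymptotics.isBigO_principal.2 ⟨C, fun p hp => ?_⟩
  simpa using hC p.1 hp.1

lemma isBigO_mono_pow {f : ℝ × ℂ → ℂ} {K : ℝ} (hK : 1 ≤ K) {m n : ℕ} (hmn : m ≤ n)
    (h : f =O[𝓟 (decaySet T K)] fun p => p.2⁻¹ ^ n) :
    f =O[𝓟 (decaySet T K)] fun p => p.2⁻¹ ^ m := by
  refine h.trans (Asymptotics.isBigO_principal.2 ⟨1, fun p hp => ?_⟩)
  rw [one_mul, norm_pow, norm_pow, norm_inv]
  exact pow_le_pow_of_le_one (by positivity) (inv_le_one_of_one_le₀ (hK.trans hp.2.1)) hmn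

lemma isBigO_mul_pow {f g : ℝ × ℂ → ℂ} {S : Set (ℝ × ℂ)} {m n l : ℕ}
    (h : f =O[𝓟 S] fun p => p.2⁻¹ ^ n) (h' : g =O[𝓟 S] fun p => p.2⁻¹ ^ m) (e : n + m = l) :
    (fun p => f p * g p) =O[𝓟 S] fun p => p.2⁻¹ ^ l := by
  subst e; simp only [pow_add]; exact h.mul h'

lemma isBigO_integral {K : ℝ} {F : ℝ × ℂ → ℂ} {n : ℕ}
    (h : F =O[𝓟 (decaySet T K)] fun p => p.2⁻¹ ^ n) (i : Fin 3) :
    (fun p : ℝ × ℂ => ∫ s in (0 : ℝ)..p.1,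
      Complex.exp ((z p.2 i - z p.2 2) * ((p.1 - s : ℝ) : ℂ)) * F (s, p.2)) =O[𝓟 (decaySet T K)]
      fun p => p.2⁻¹ ^ n := by
  obtain ⟨C, hC⟩ := Asymptotics.isBigO_principal.1 h
  refine Asymptotics.isBigO_principal.2 ⟨|C| * T, fun p hp => ?_⟩
  have hT : 0 ≤ T := hp.1.1.trans hp.1.2
  have := intervalIntegral.norm_integral_le_of_norm_le_const (a := 0) (b := p.1)
    (C := |C| * ‖p.2⁻¹ ^ n‖) (f := fun s =>
      Complex.exp ((z p.2 i - z p.2 2) * ((p.1 - s : ℝ) : ℂ)) * F (s, p.2)) fun s hs => by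
    rw [uIoc_of_le hp.1.1] at hs
    rw [norm_mul]
    have h1 := norm_exp_le_one hp.2.2 i (s := p.1 - s) (by linarith [hs.2])
    have h2 : ‖F (s, p.2)‖ ≤ |C| * ‖p.2⁻¹ ^ n‖ :=
      (hC (s, p.2) ⟨⟨hs.1.le, hs.2.trans hp.1.2⟩, hp.2⟩).trans
        (mul_le_mul_of_nonneg_right (le_abs_self C) (norm_nonneg _))
    calc _ ≤ 1 * (|C| * ‖p.2⁻¹ ^ n‖) := mul_le_mul h1 h2 (norm_nonneg _) zero_le_one
      _ = _ := one_mul _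
  refine this.trans ?_
  rw [sub_zero, abs_of_nonneg hp.1.1, mul_right_comm]
  gcongr
  exact hp.1.2

lemma SmoothBdry.gauge_eq (h : SmoothBdry T b) {k : ℂ} (hk : k ≠ 0) {φ : ℝ → Fin 3 → ℂ}
    (hφ : IsODESol T (fun i => z k i - z k 2) (bdryV b k) φ) (h0 : φ 0 = e₃) {t : ℝ}
    (ht : t ∈ Icc 0 T) (i : Fin 3) : (gauge T b k t).mulVec (φ t) i =
      Complex.exp ((z k i - z k 2) * (t : ℂ)) * gauge T b k 0 i 2 +
      ∫ s in (0 : ℝ)..t, Complex.exp ((z k i - z k 2) * ((t - s : ℝ) : ℂ)) *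
        (gaugeErr T b k s).mulVec (φ s) i := by
  have hE : ∀ i j, ContinuousOn (fun t => gaugeErr T b k t i j) (Icc 0 T) := fun i j => by
    obtain ⟨h1, h2, h3⟩ := h.continuousOn_gaugeErr i j
    have h1' : ContinuousOn (fun t => Matrix.diagonal (fun i => gaugeSource T b t i i) i j)
        (Icc 0 T) := by
      by_cases hij : i = j
      · subst hij; simpa using h1
      · simpa [Matrix.diagonal_apply_ne _ hij] using continuousOn_const
    exact ((h1'.const_mul _).add (h2.const_mul _)).add (h3.const_mul _)
  have := eq_exp_add_integral (continuousOn_mulVec (fun i j => (h.mc_gauge k).continuousOn i j)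
    hφ.cont i) (continuousOn_mulVec hE hφ.cont i) (fun t ht => h.hasDerivAt_gauge hk hφ ht i)
    ⟨le_rfl, h.pos.le⟩ ht
  rw [this, sub_zero, h0]
  congr 2
  simp [Matrix.mulVec, dotProduct, Fin.sum_univ_three]

lemma SmoothBdry.isBigO_gauge (h : SmoothBdry T b) {K : ℝ} (hK : 1 ≤ K) (i j : Fin 3) :
    (fun p : ℝ × ℂ => (gauge T b p.2 p.1 - 1 - p.2⁻¹ • gauge₁ b p.1 - p.2⁻¹ ^ 2 • gauge₂ b p.1) i j)
      =O[𝓟 (decaySet T K)] fun p => p.2⁻¹ ^ 3 := by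
  have g3 := isBigO_one_of_continuousOn (h.mc_gauge₃.continuousOn i j) K
  have g4 := isBigO_one_of_continuousOn (h.mc_gauge₄.continuousOn i j) K
  have p3 := Asymptotics.isBigO_refl (fun p : ℝ × ℂ => p.2⁻¹ ^ 3) (𝓟 (decaySet T K))
  have p4 := Asymptotics.isBigO_refl (fun p : ℝ × ℂ => p.2⁻¹ ^ 4) (𝓟 (decaySet T K))
  have := (isBigO_mul_pow p3 g3 (l := 3) rfl).add
    (isBigO_mono_pow hK (show 3 ≤ 4 by norm_num) (isBigO_mul_pow p4 g4 (l := 4) rfl))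
  refine this.congr_left fun p => ?_
  simp only [gauge, Matrix.sub_apply, Matrix.add_apply, Matrix.smul_apply, smul_eq_mul]
  ring

lemma SmoothBdry.isBigO_gauge_sub_one (h : SmoothBdry T b) {K : ℝ} (hK : 1 ≤ K) (i j : Fin 3) :
    (fun p : ℝ × ℂ => (gauge T b p.2 p.1 - 1) i j) =O[𝓟 (decaySet T K)] fun p => p.2⁻¹ ^ 1 := by
  have g1 := isBigO_one_of_continuousOn (h.mc_gauge₁.continuousOn i j) K
  have g2 := isBigO_one_of_continuousOn (h.mc_gauge₂.continuousOn i j) K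
  have p1 := Asymptotics.isBigO_refl (fun p : ℝ × ℂ => p.2⁻¹ ^ 1) (𝓟 (decaySet T K))
  have p2 := Asymptotics.isBigO_refl (fun p : ℝ × ℂ => p.2⁻¹ ^ 2) (𝓟 (decaySet T K))
  have := ((isBigO_mono_pow hK (show 1 ≤ 3 by norm_num) (h.isBigO_gauge hK i j)).add
    (isBigO_mul_pow p1 g1 (l := 1) rfl)).add
    (isBigO_mono_pow hK (show 1 ≤ 2 by norm_num) (isBigO_mul_pow p2 g2 (l := 2) rfl))
  refine this.congr_left fun p => ?_
  simp only [Matrix.sub_apply, Matrix.smul_apply, smul_eq_mul]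
  ring

lemma SmoothBdry.isBigO_gaugeErr (h : SmoothBdry T b) {K : ℝ} (hK : 1 ≤ K) (i j : Fin 3) :
    (fun p : ℝ × ℂ => (gaugeErr T b p.2 p.1 -
      p.2⁻¹ ^ 2 • Matrix.diagonal (fun i => gaugeSource T b p.1 i i)) i j)
      =O[𝓟 (decaySet T K)] fun p => p.2⁻¹ ^ 3 := by
  obtain ⟨-, h3, h4⟩ := h.continuousOn_gaugeErr i j
  have g3 := isBigO_one_of_continuousOn h3 K
  have g4 := isBigO_one_of_continuousOn h4 K
  have p3 := Asymptotics.isBigO_refl (fun p : ℝ × ℂ => p.2⁻¹ ^ 3) (𝓟 (decaySet T K))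
  have p4 := Asymptotics.isBigO_refl (fun p : ℝ × ℂ => p.2⁻¹ ^ 4) (𝓟 (decaySet T K))
  have := (isBigO_mul_pow p3 g3 (l := 3) rfl).add
    (isBigO_mono_pow hK (show 3 ≤ 4 by norm_num) (isBigO_mul_pow p4 g4 (l := 4) rfl))
  refine this.congr_left fun p => ?_
  simp only [gaugeErr, Matrix.sub_apply, Matrix.add_apply, Matrix.smul_apply, smul_eq_mul]
  ring

lemma SmoothBdry.isBigO_gaugeErr_two (h : SmoothBdry T b) {K : ℝ} (hK : 1 ≤ K) (i j : Fin 3) :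
    (fun p : ℝ × ℂ => gaugeErr T b p.2 p.1 i j) =O[𝓟 (decaySet T K)] fun p => p.2⁻¹ ^ 2 := by
  have h1 := (h.continuousOn_gaugeErr i j).1
  have h1' : ContinuousOn (fun t => Matrix.diagonal (fun i => gaugeSource T b t i i) i j)
      (Icc 0 T) := by
    by_cases hij : i = j
    · subst hij; simpa using h1
    · simpa [Matrix.diagonal_apply_ne _ hij] using continuousOn_const
  have g := isBigO_one_of_continuousOn h1' K
  have p2 := Asymptotics.isBigO_refl (fun p : ℝ × ℂ => p.2⁻¹ ^ 2) (𝓟 (decaySet T K))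
  refine ((isBigO_mono_pow hK (show 2 ≤ 3 by norm_num) (h.isBigO_gaugeErr hK i j)).add
    (isBigO_mul_pow p2 g (l := 2) rfl)).congr_left fun p => ?_
  simp only [Matrix.sub_apply, Matrix.smul_apply, smul_eq_mul]
  ring

/-- The third column is bounded in the region of decay. -/
lemma SmoothBdry.exists_bound (h : SmoothBdry T b) {φ : ℂ → ℝ → Fin 3 → ℂ}
    (hφ : ∀ k, IsODESol T (fun i => z k i - z k 2) (bdryV b k) (φ k)) (h0 : ∀ k, φ k 0 = e₃) :
    ∃ K, 1 ≤ K ∧ ∀ p ∈ decaySet T K, ‖φ p.2 p.1‖ ≤ 3 := by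
  choose A hA using fun i j => Asymptotics.isBigO_principal.1 (h.isBigO_gauge_sub_one le_rfl i j)
  choose B hB using fun i j => Asymptotics.isBigO_principal.1 (h.isBigO_gaugeErr_two le_rfl i j)
  let M := ∑ i, ∑ j, (|A i j| + |B i j|)
  have hM0 : 0 ≤ M := Finset.sum_nonneg fun i _ => Finset.sum_nonneg fun j _ => by positivity
  have hM : ∀ i j, |A i j| + |B i j| ≤ M := fun i j =>
    (Finset.single_le_sum (f := fun j => |A i j| + |B i j|) (fun j _ => by positivity)
      (Finset.mem_univ j)).trans
    (Finset.single_le_sum (f := fun i => ∑ j, (|A i j| + |B i j|))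
      (fun i _ => Finset.sum_nonneg fun j _ => by positivity) (Finset.mem_univ i))
  have hT := h.pos
  -- Beyond this threshold `(M/|k|)(4 + 3T) ≤ 1/2`, and the a priori inequality for the maximum `N`
  -- becomes `N ≤ 3/2 + N/2`, whence the bound `3`.
  refine ⟨1 + 2 * M * (4 + 3 * T), by nlinarith [mul_nonneg hM0 hT.le], ?_⟩
  rintro ⟨t, k⟩ ⟨ht, hk, hkD⟩
  have hk1 : 1 ≤ ‖k‖ := le_trans (by nlinarith [mul_nonneg hM0 hT.le]) hk
  have hk0 : k ≠ 0 := norm_pos_iff.1 (by linarith)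
  have hS : ∀ s ∈ Icc 0 T, (s, k) ∈ decaySet T 1 := fun s hs => ⟨hs, hk1, hkD⟩
  set x := ‖k‖⁻¹ with hx
  have hx0 : 0 ≤ x := by positivity
  have hx1 : x ≤ 1 := inv_le_one_of_one_le₀ hk1
  have hxM : M * x * (4 + 3 * T) ≤ 1 / 2 := by
    have h1 : x * ‖k‖ = 1 := inv_mul_cancel₀ (by positivity)
    have h2 : x * (1 + 2 * M * (4 + 3 * T)) ≤ x * ‖k‖ := mul_le_mul_of_nonneg_left hk hx0
    nlinarith
  obtain ⟨s₀, hs₀, hmax⟩ := isCompact_Icc.exists_isMaxOn (nonempty_Icc.2 hT.le) (hφ k).cont.norm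
  set N := ‖φ k s₀‖ with hN
  have hNt : ∀ s ∈ Icc 0 T, ‖φ k s‖ ≤ N := fun s hs => hmax hs
  have hN0 : 0 ≤ N := norm_nonneg _
  have hA' : ∀ s ∈ Icc 0 T, ∀ i j, ‖(gauge T b k s - 1) i j‖ ≤ M * x := fun s hs i j => by
    refine (hA i j (s, k) (hS s hs)).trans ?_
    rw [pow_one, norm_inv]
    have := le_abs_self (A i j); have := abs_nonneg (B i j); have := hM i j
    exact mul_le_mul_of_nonneg_right (by linarith) hx0
  have hB' : ∀ s ∈ Icc 0 T, ∀ i j, ‖gaugeErr T b k s i j‖ ≤ M * x := fun s hs i j => by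
    refine (hB i j (s, k) (hS s hs)).trans ?_
    rw [norm_pow, norm_inv]
    have := le_abs_self (B i j); have := abs_nonneg (A i j); have := hM i j
    calc B i j * x ^ 2 ≤ M * x ^ 2 := mul_le_mul_of_nonneg_right (by linarith) (by positivity)
      _ ≤ M * x := mul_le_mul_of_nonneg_left (by nlinarith) hM0
  -- At a maximum point write `φ = Rφ - (R - 1)φ`, with `R` the gauge. The second term is
  -- `O(N/|k|)`, and the integral formula bounds the first by the initial value plus an error of the
  -- same kind.
  have key : ∀ i, ‖φ k s₀ i‖ ≤ 3 * (M * x) * N + (1 + M * x) + 3 * (M * x) * N * T := fun i => by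
    have e := h.gauge_eq hk0 (hφ k) (h0 k) hs₀ i
    have e1 : φ k s₀ i = (gauge T b k s₀).mulVec (φ k s₀) i -
        (gauge T b k s₀ - 1).mulVec (φ k s₀) i := by
      simp [Matrix.sub_mulVec]
    have n1 := norm_mulVec_le (hA' s₀ hs₀) (hNt s₀ hs₀) i
    have n2 : ‖gauge T b k 0 i 2‖ ≤ 1 + M * x := by
      have e2 : gauge T b k 0 i 2 = (1 : Matrix (Fin 3) (Fin 3) ℂ) i 2 + (gauge T b k 0 - 1) i 2 := by
        simp
      rw [e2]
      refine (norm_add_le _ _).trans (add_le_add ?_ (hA' 0 ⟨le_rfl, hT.le⟩ i 2))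
      rw [Matrix.one_apply]; split_ifs <;> simp
    have n3 := norm_exp_le_one hkD i hs₀.1
    have n4 := intervalIntegral.norm_integral_le_of_norm_le_const (a := 0) (b := s₀)
      (C := 3 * (M * x) * N) (f := fun s => Complex.exp ((z k i - z k 2) * ((s₀ - s : ℝ) : ℂ)) *
        (gaugeErr T b k s).mulVec (φ k s) i) fun s hs => by
      rw [uIoc_of_le hs₀.1] at hs
      have hs' : s ∈ Icc 0 T := ⟨hs.1.le, hs.2.trans hs₀.2⟩
      rw [norm_mul]
      have h1 := norm_exp_le_one hkD i (s := s₀ - s) (by linarith [hs.2])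
      have h2 := norm_mulVec_le (hB' s hs') (hNt s hs') i
      calc _ ≤ 1 * (3 * (M * x) * N) := mul_le_mul h1 h2 (norm_nonneg _) zero_le_one
        _ = _ := one_mul _
    rw [sub_zero, abs_of_nonneg hs₀.1] at n4
    have n5 : 3 * (M * x) * N * s₀ ≤ 3 * (M * x) * N * T :=
      mul_le_mul_of_nonneg_left hs₀.2 (by positivity)
    have n6 : ‖Complex.exp ((z k i - z k 2) * (s₀ : ℂ)) * gauge T b k 0 i 2‖ ≤ 1 + M * x := by
      rw [norm_mul]
      calc _ ≤ 1 * (1 + M * x) := mul_le_mul n3 n2 (norm_nonneg _) zero_le_one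
        _ = _ := one_mul _
    rw [e1, e]
    refine (norm_sub_le _ _).trans ?_
    have n7 := norm_add_le (Complex.exp ((z k i - z k 2) * (s₀ : ℂ)) * gauge T b k 0 i 2)
      (∫ s in (0 : ℝ)..s₀, Complex.exp ((z k i - z k 2) * ((s₀ - s : ℝ) : ℂ)) *
        (gaugeErr T b k s).mulVec (φ k s) i)
    linarith
  have hMx : 0 ≤ M * x := by positivity
  have hNb : N ≤ 3 * (M * x) * N + (1 + M * x) + 3 * (M * x) * N * T :=
    (pi_norm_le_iff_of_nonneg (by positivity)).2 key
  refine (hNt t ht).trans ?_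
  have : M * x * (3 + 3 * T) * N ≤ 1 / 2 * N :=
    mul_le_mul_of_nonneg_right (by nlinarith) hN0
  have : M * x ≤ 1 / 2 := by nlinarith [mul_nonneg hMx hT.le]
  nlinarith

end

/-! ### Second-order expansion of the time column -/

noncomputable section

variable {T : ℝ} {b : BoundaryValues}

/-- The sum of the moduli of the two exponentials of the third column. -/
def expSum (t : ℝ) (k : ℂ) : ℝ :=
  ‖Complex.exp ((z k 0 - z k 2) * (t : ℂ))‖ + ‖Complex.exp ((z k 1 - z k 2) * (t : ℂ))‖

/-- The error scale `|k|⁻ⁿ + |k|⁻¹ (|e^{(z₁-z₃)t}| + |e^{(z₂-z₃)t}|)`. -/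
def errScale (n : ℕ) (p : ℝ × ℂ) : ℝ := ‖p.2‖⁻¹ ^ n + ‖p.2‖⁻¹ * expSum p.1 p.2

lemma errScale_nonneg (n : ℕ) (p : ℝ × ℂ) : 0 ≤ errScale n p := by
  unfold errScale expSum; positivity

lemma isBigO_errScale (n : ℕ) (S : Set (ℝ × ℂ)) :
    (fun p : ℝ × ℂ => p.2⁻¹ ^ n) =O[𝓟 S] errScale n := by
  refine Asymptotics.isBigO_principal.2 ⟨1, fun p _ => ?_⟩
  rw [Real.norm_of_nonneg (errScale_nonneg n p), one_mul, norm_pow, norm_inv]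
  unfold errScale expSum
  have : 0 ≤ ‖p.2‖⁻¹ * (‖Complex.exp ((z p.2 0 - z p.2 2) * (p.1 : ℂ))‖ +
    ‖Complex.exp ((z p.2 1 - z p.2 2) * (p.1 : ℂ))‖) := by positivity
  linarith

/-- The factor `1/k` improves the algebraic part by one order; the exponential part already carries
a `1/k` and keeps its form. -/
lemma isBigO_mul_errScale {K : ℝ} (hK : 1 ≤ K) {f g : ℝ × ℂ → ℂ} {n : ℕ}
    (hf : f =O[𝓟 (decaySet T K)] fun p => p.2⁻¹ ^ 1)
    (hg : g =O[𝓟 (decaySet T K)] errScale n) :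
    (fun p => f p * g p) =O[𝓟 (decaySet T K)] errScale (n + 1) := by
  refine (hf.norm_right.mul hg).trans (Asymptotics.isBigO_principal.2 ⟨1, fun p hp => ?_⟩)
  have h1 : ‖p.2‖⁻¹ ≤ 1 := inv_le_one_of_one_le₀ (hK.trans hp.2.1)
  have h0 : 0 ≤ ‖p.2‖⁻¹ := by positivity
  have h2 : 0 ≤ expSum p.1 p.2 := by unfold expSum; positivity
  rw [one_mul, norm_mul, norm_norm, Real.norm_of_nonneg (errScale_nonneg _ _), pow_one, norm_inv,
    Real.norm_of_nonneg (errScale_nonneg _ _), errScale, errScale, mul_add, pow_succ']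
  gcongr
  nlinarith [mul_nonneg h0 h2]

/-- The large `k` behaviour of the third column of `μ₂` in the region of decay. -/
theorem SmoothBdry.asymptotics (h : SmoothBdry T b) {φ : ℂ → ℝ → Fin 3 → ℂ}
    (hφ : ∀ k, IsODESol T (fun i => z k i - z k 2) (bdryV b k) (φ k)) (h0 : ∀ k, φ k 0 = e₃) :
    ∃ K, 1 ≤ K ∧
      (fun p : ℝ × ℂ => φ p.2 p.1 2 - (1 - gauge₁ b p.1 2 2 * p.2⁻¹)) =O[𝓟 (decaySet T K)]
        (fun p => p.2⁻¹ ^ 2) ∧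
      ∀ j : Fin 3, j ≠ 2 → (fun p : ℝ × ℂ => φ p.2 p.1 j - (-gauge₁ b p.1 j 2 * p.2⁻¹ +
        (gauge₁ b p.1 j 2 * gauge₁ b p.1 2 2 + gauge₁ b p.1 j 0 * gauge₁ b p.1 0 2 +
          gauge₁ b p.1 j 1 * gauge₁ b p.1 1 2 - gauge₂ b p.1 j 2) * p.2⁻¹ ^ 2))
        =O[𝓟 (decaySet T K)] errScale 3 := by
  obtain ⟨K, hK, hb⟩ := h.exists_bound hφ h0
  refine ⟨K, hK, ?_⟩
  set F := 𝓟 (decaySet T K) with hF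
  have hk0 : ∀ p ∈ decaySet T K, p.2 ≠ 0 := fun p hp =>
    norm_pos_iff.1 (by linarith [hp.2.1])
  have y1 : (fun p : ℝ × ℂ => p.2⁻¹) =O[F] fun p => p.2⁻¹ ^ 1 := by
    simpa using Asymptotics.isBigO_refl (fun p : ℝ × ℂ => p.2⁻¹) F
  have y2 := Asymptotics.isBigO_refl (fun p : ℝ × ℂ => p.2⁻¹ ^ 2) F
  have hφ0 : ∀ i, (fun p : ℝ × ℂ => φ p.2 p.1 i) =O[F] fun p => p.2⁻¹ ^ 0 := fun i =>
    Asymptotics.isBigO_principal.2 ⟨3, fun p hp => by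
      simpa using (norm_le_pi_norm (φ p.2 p.1) i).trans (hb p hp)⟩
  have hg1 : ∀ i j, (fun p : ℝ × ℂ => gauge₁ b p.1 i j) =O[F] fun p => p.2⁻¹ ^ 0 := fun i j =>
    isBigO_one_of_continuousOn (h.mc_gauge₁.continuousOn i j) K
  have hg2 : ∀ i j, (fun p : ℝ × ℂ => gauge₂ b p.1 i j) =O[F] fun p => p.2⁻¹ ^ 0 := fun i j =>
    isBigO_one_of_continuousOn (h.mc_gauge₂.continuousOn i j) K
  have hG := h.isBigO_gauge_sub_one (K := K) hK
  have hG3 := h.isBigO_gauge (K := K) hK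
  have hE := h.isBigO_gaugeErr_two (K := K) hK
  have hE3 := h.isBigO_gaugeErr (K := K) hK
  -- the transformed column
  let χ : Fin 3 → ℝ × ℂ → ℂ := fun i p => (gauge T b p.2 p.1).mulVec (φ p.2 p.1) i
  let Ex : Fin 3 → ℝ × ℂ → ℂ := fun i p => Complex.exp ((z p.2 i - z p.2 2) * (p.1 : ℂ))
  have hχ : ∀ i, ∀ p ∈ decaySet T K, χ i p = Ex i p * gauge T b p.2 0 i 2 +
      ∫ s in (0 : ℝ)..p.1, Complex.exp ((z p.2 i - z p.2 2) * ((p.1 - s : ℝ) : ℂ)) *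
        (gaugeErr T b p.2 s).mulVec (φ p.2 s) i := fun i p hp =>
    h.gauge_eq (hk0 p hp) (hφ p.2) (h0 p.2) hp.1 i
  have hEx : ∀ i, Ex i =O[F] fun p => p.2⁻¹ ^ 0 := fun i =>
    Asymptotics.isBigO_principal.2 ⟨1, fun p hp => by
      simp only [pow_zero, norm_one, mul_one]
      exact norm_exp_le_one hp.2.2 i hp.1.1⟩
  have hR0 : ∀ i, i ≠ 2 → (fun p : ℝ × ℂ => gauge T b p.2 0 i 2) =O[F] fun p => p.2⁻¹ ^ 1 :=
    fun i hi => by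
    obtain ⟨C, hC⟩ := Asymptotics.isBigO_principal.1 (hG i 2)
    refine Asymptotics.isBigO_principal.2 ⟨C, fun p hp => ?_⟩
    have := hC (0, p.2) ⟨⟨le_rfl, h.pos.le⟩, hp.2⟩
    simpa [Matrix.one_apply_ne hi] using this
  have hχφ : ∀ i, (fun p : ℝ × ℂ => χ i p - φ p.2 p.1 i) =O[F] fun p => p.2⁻¹ ^ 1 := fun i => by
    have := ((isBigO_mul_pow (hG i 0) (hφ0 0) (l := 1) rfl).add
      (isBigO_mul_pow (hG i 1) (hφ0 1) (l := 1) rfl)).add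
      (isBigO_mul_pow (hG i 2) (hφ0 2) (l := 1) rfl)
    refine this.congr_left fun p => ?_
    have e : χ i p - φ p.2 p.1 i = (gauge T b p.2 p.1 - 1).mulVec (φ p.2 p.1) i := by
      simp [χ, Matrix.sub_mulVec]
    rw [e]; simp only [Matrix.mulVec, dotProduct, Fin.sum_univ_three]
  have hEφ : ∀ i, (fun p : ℝ × ℂ => (gaugeErr T b p.2 p.1).mulVec (φ p.2 p.1) i) =O[F]
      fun p => p.2⁻¹ ^ 2 := fun i => by
    have := ((isBigO_mul_pow (hE i 0) (hφ0 0) (l := 2) rfl).add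
      (isBigO_mul_pow (hE i 1) (hφ0 1) (l := 2) rfl)).add
      (isBigO_mul_pow (hE i 2) (hφ0 2) (l := 2) rfl)
    refine this.congr_left fun p => ?_
    simp only [Matrix.mulVec, dotProduct, Fin.sum_univ_three]
  -- In the third row the exponential is one and the initial value is one, so only the integral of
  -- the `O(k⁻²)` error is left.
  have hχ2 : (fun p => χ 2 p - 1) =O[F] fun p => p.2⁻¹ ^ 2 := by
    refine (isBigO_integral (hEφ 2) 2).congr' ?_ EventuallyEq.rfl
    refine eventually_principal.2 fun p hp => ?_
    simp only [hχ 2 p hp, gauge_zero_two_two]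
    simp [Ex]
  have hφ2 : (fun p : ℝ × ℂ => φ p.2 p.1 2 - 1) =O[F] fun p => p.2⁻¹ ^ 1 :=
    ((isBigO_mono_pow hK one_le_two hχ2).sub (hχφ 2)).congr_left fun p => by ring
  have hφj : ∀ j, j ≠ 2 → (fun p : ℝ × ℂ => φ p.2 p.1 j) =O[F] fun p => p.2⁻¹ ^ 1 := fun j hj => by
    have h1 : χ j =O[F] fun p => p.2⁻¹ ^ 1 := by
      refine ((isBigO_mul_pow (hEx j) (hR0 j hj) (l := 1) rfl).add
        (isBigO_mono_pow hK one_le_two (isBigO_integral (hEφ j) j))).congr' ?_ EventuallyEq.rfl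
      exact eventually_principal.2 fun p hp => (hχ j p hp).symm
    exact (h1.sub (hχφ j)).congr_left fun p => by ring
  -- The `k⁻²` part of the error is diagonal, so in row `j` it multiplies `φ_j = O(1/k)` and not the
  -- third entry, which is of order one. This gains the missing power.
  have hEφ3 : ∀ j, j ≠ 2 → (fun p : ℝ × ℂ => (gaugeErr T b p.2 p.1).mulVec (φ p.2 p.1) j) =O[F]
      fun p => p.2⁻¹ ^ 3 := fun j hj => by
    have g := isBigO_one_of_continuousOn (h.continuousOn_gaugeErr j j).1 K
    have := (((isBigO_mul_pow (hE3 j 0) (hφ0 0) (l := 3) rfl).add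
      (isBigO_mul_pow (hE3 j 1) (hφ0 1) (l := 3) rfl)).add
      (isBigO_mul_pow (hE3 j 2) (hφ0 2) (l := 3) rfl)).add
      (isBigO_mul_pow y2 (isBigO_mul_pow g (hφj j hj) (l := 1) rfl) (l := 3) rfl)
    refine this.congr_left fun p => ?_
    fin_cases j <;> simp [Matrix.mulVec, dotProduct, Fin.sum_univ_three] <;> ring
  -- The initial value of the gauge is `O(1/k)` off the diagonal and is transported by the
  -- exponential; this is the origin of the exponential term in `errScale`.
  have hχj : ∀ j, j ≠ 2 → χ j =O[F] errScale 3 := fun j hj => by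
    have h1 : (fun p => gauge T b p.2 0 j 2 * Ex j p) =O[F] errScale 3 := by
      refine ((hR0 j hj).mul (Asymptotics.isBigO_refl (Ex j) F)).trans
        (Asymptotics.isBigO_principal.2 ⟨1, fun p _ => ?_⟩)
      rw [one_mul, norm_mul, Real.norm_of_nonneg (errScale_nonneg _ _), pow_one, norm_inv]
      unfold errScale
      have : ‖Ex j p‖ ≤ expSum p.1 p.2 := by
        unfold expSum
        fin_cases j
        · exact le_add_of_nonneg_right (norm_nonneg _)
        · exact le_add_of_nonneg_left (norm_nonneg _)
        · exact absurd rfl hj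
      have := mul_le_mul_of_nonneg_left this (inv_nonneg.2 (norm_nonneg p.2))
      have : 0 ≤ ‖p.2‖⁻¹ ^ 3 := by positivity
      linarith
    refine (h1.add ((isBigO_integral (hEφ3 j hj) j).trans (isBigO_errScale 3 _))).congr' ?_
      EventuallyEq.rfl
    refine eventually_principal.2 fun p hp => ?_
    simp only [hχ j p hp]; ring
  have hP2 : (fun p : ℝ × ℂ => φ p.2 p.1 2 - (1 - gauge₁ b p.1 2 2 * p.2⁻¹)) =O[F]
      fun p => p.2⁻¹ ^ 2 := by
    have t1 := isBigO_mul_pow y1 (isBigO_mul_pow (hg1 2 0) (hφj 0 (by decide)) (l := 1) rfl)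
      (l := 2) rfl
    have t2 := isBigO_mul_pow y1 (isBigO_mul_pow (hg1 2 1) (hφj 1 (by decide)) (l := 1) rfl)
      (l := 2) rfl
    have t3 := isBigO_mul_pow y1 (isBigO_mul_pow (hg1 2 2) hφ2 (l := 1) rfl) (l := 2) rfl
    have t4 := fun l => isBigO_mul_pow (isBigO_mul_pow y2 (hg2 2 l) (l := 2) rfl) (hφ0 l) (l := 2) rfl
    have t5 := fun l => isBigO_mono_pow hK (show 2 ≤ 3 by norm_num)
      (isBigO_mul_pow (hG3 2 l) (hφ0 l) (l := 3) rfl)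
    refine ((((((hχ2.sub t1).sub t2).sub t3).sub ((t4 0).add ((t4 1).add (t4 2)))).sub
      ((t5 0).add ((t5 1).add (t5 2))))).congr_left fun p => ?_
    simp only [χ, Matrix.mulVec, dotProduct, Fin.sum_univ_three, Matrix.sub_apply,
      Matrix.smul_apply, smul_eq_mul, Matrix.one_apply_eq, ne_eq, Fin.reduceEq, not_false_eq_true,
      Matrix.one_apply_ne]
    ring
  refine ⟨hP2, ?_⟩
  -- Bootstrap: `φ = χ - (R - 1)φ` with the approximation already known on the right gains one
  -- order. A further pass below yields the second-order coefficient, the entry of `R₁² - R₂` of the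
  -- inverse gauge.
  have hw : ∀ j, j ≠ 2 → (fun p : ℝ × ℂ => φ p.2 p.1 j + gauge₁ b p.1 j 2 * p.2⁻¹) =O[F]
      errScale 2 := fun j hj => by
    have m : errScale 3 =O[F] errScale 2 := Asymptotics.isBigO_principal.2 ⟨1, fun p hp => by
      rw [Real.norm_of_nonneg (errScale_nonneg _ _), Real.norm_of_nonneg (errScale_nonneg _ _),
        one_mul]
      exact add_le_add_left (pow_le_pow_of_le_one (by positivity)
        (inv_le_one_of_one_le₀ (hK.trans hp.2.1)) (by norm_num)) _⟩
    have t1 := isBigO_mul_pow y1 (isBigO_mul_pow (hg1 j 0) (hφj 0 (by decide)) (l := 1) rfl)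
      (l := 2) rfl
    have t2 := isBigO_mul_pow y1 (isBigO_mul_pow (hg1 j 1) (hφj 1 (by decide)) (l := 1) rfl)
      (l := 2) rfl
    have t3 := isBigO_mul_pow y1 (isBigO_mul_pow (hg1 j 2) hφ2 (l := 1) rfl) (l := 2) rfl
    have t4 := fun l => isBigO_mul_pow (isBigO_mul_pow y2 (hg2 j l) (l := 2) rfl) (hφ0 l) (l := 2) rfl
    have t5 := fun l => isBigO_mono_pow hK (show 2 ≤ 3 by norm_num)
      (isBigO_mul_pow (hG3 j l) (hφ0 l) (l := 3) rfl)
    have t6 := ((((t1.add t2).add t3).add ((t4 0).add ((t4 1).add (t4 2)))).add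
      ((t5 0).add ((t5 1).add (t5 2)))).trans (isBigO_errScale 2 _)
    refine (((hχj j hj).trans m).sub t6).congr_left fun p => ?_
    fin_cases j
    · simp [χ, Matrix.mulVec, dotProduct, Fin.sum_univ_three]; ring
    · simp [χ, Matrix.mulVec, dotProduct, Fin.sum_univ_three]; ring
    · exact absurd rfl hj
  intro j hj
  have s1 := fun l => isBigO_mul_errScale hK (isBigO_mul_pow y1 (hg1 j l) (l := 1) rfl)
    (n := 2) (g := fun p => φ p.2 p.1 l + gauge₁ b p.1 l 2 * p.2⁻¹)
  have s2 := isBigO_mul_pow (isBigO_mul_pow y1 (hg1 j 2) (l := 1) rfl) hP2 (l := 3) rfl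
  have s3 := fun l hl => isBigO_mul_pow (isBigO_mul_pow y2 (hg2 j l) (l := 2) rfl) (hφj l hl)
    (l := 3) rfl
  have s4 := isBigO_mul_pow (isBigO_mul_pow y2 (hg2 j 2) (l := 2) rfl) hφ2 (l := 3) rfl
  have s5 := fun l => isBigO_mul_pow (hG3 j l) (hφ0 l) (l := 3) rfl
  have s6 := ((((s2.add (s3 0 (by decide))).add (s3 1 (by decide))).add s4).add
    (((s5 0).add (s5 1)).add (s5 2))).trans (isBigO_errScale 3 _)
  refine ((((hχj j hj).sub (s1 0 (hw 0 (by decide)))).sub (s1 1 (hw 1 (by decide)))).sub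
    s6).congr_left fun p => ?_
  fin_cases j
  · simp [χ, Matrix.mulVec, dotProduct, Fin.sum_univ_three]; ring
  · simp [χ, Matrix.mulVec, dotProduct, Fin.sum_univ_three]; ring
  · exact absurd rfl hj

end

noncomputable section

/-! ### Matching the space and time asymptotics -/

/-- A solution in the half-strip together with its boundary values. -/
structure LaxBdry (T : ℝ) (f g : ℝ × ℝ → ℂ) (b : BoundaryValues) : Prop where
  data : LaxData T f g
  g₀ : ∀ t ∈ Icc 0 T, b.g₀ t = f (0, t)
  h₀ : ∀ t ∈ Icc 0 T, b.h₀ t = g (0, t)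
  g₁ : ∀ t ∈ Icc 0 T, b.g₁ t = dX T f (0, t)
  h₁ : ∀ t ∈ Icc 0 T, b.h₁ t = dX T g (0, t)

variable {T : ℝ} {f g : ℝ × ℝ → ℂ} {b : BoundaryValues}

lemma LaxBdry.smoothBdry (h : LaxBdry T f g b) : SmoothBdry T b := by
  have hT := h.data.pos
  have r0 := h.data.reg_left.mono (show 2 ≤ 4 by norm_num)
  have r1 := h.data.reg_right.mono (show 2 ≤ 4 by norm_num)
  have r2 := (h.data.reg_left.deriv hT (1, 0)).mono (show 2 ≤ 3 by norm_num)
  have r3 := (h.data.reg_right.deriv hT (1, 0)).mono (show 2 ≤ 3 by norm_num)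
  exact ⟨hT, r0.contDiffOn_boundary.congr h.g₀, r1.contDiffOn_boundary.congr h.h₀,
    r2.contDiffOn_boundary.congr h.g₁, r3.contDiffOn_boundary.congr h.h₁⟩

lemma LaxBdry.isODESol (h : LaxBdry T f g b) {k : ℂ} (hk : k ∈ closedSector) :
    IsODESol T (fun i => z k i - z k 2) (bdryV b k) fun t => stripSol f g k t 0 := by
  refine ⟨h.data.continuousOn_stripSol_zero hk, fun t ht i => ?_⟩
  have ht' := Ioo_subset_Icc_self ht
  have := hasDerivAt_pi.1 (h.data.hasDerivAt_stripSol_zero hk ht) i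
  rw [bdryV, h.g₀ t ht', h.h₀ t ht', h.g₁ t ht', h.h₁ t ht']
  exact this

lemma StripReg.uDec (h : StripReg T 0 f) :
    UDec fun (i : Icc (0 : ℝ) T) x => f (x, (i : ℝ)) := by
  obtain ⟨C, hC⟩ := h.bound
  exact ⟨C, fun i x hx => hC x i hx i.2⟩

lemma StripReg.uDiff {n : ℕ} (h : StripReg T (n + 1) f) :
    UDiff (fun (i : Icc (0 : ℝ) T) x => f (x, (i : ℝ))) fun i x => dX T f (x, (i : ℝ)) :=
  ⟨fun i => h.continuousOn.comp (by fun_prop) fun x hx => ⟨hx, i.2⟩,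
    fun i _ hx => h.hasDerivAt_x hx i.2⟩

lemma LaxData.space_asymptotics (h : LaxData T f g) : ∃ m : ℝ → ℂ, ∃ C, 0 ≤ C ∧ (∀ t ∈ Icc 0 T, ‖m t‖ ≤ C) ∧
    ∀ t ∈ Icc 0 T, ∀ k ∈ closedSector, 1 ≤ ‖k‖ →
      ‖stripSol f g k t 0 0 - (αc * g (0, t) * k⁻¹ + -αc * (αc * dX T g (0, t) -
        (βc * (f (0, t) * f (0, t)) + g (0, t) * m t)) * k⁻¹ ^ 2)‖ ≤ C * ‖k‖⁻¹ ^ 3 ∧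
      ‖stripSol f g k t 0 1 - (βc * f (0, t) * k⁻¹ + -βc * (βc * dX T f (0, t) -
        (αc * (g (0, t) * g (0, t)) + f (0, t) * m t)) * k⁻¹ ^ 2)‖ ≤ C * ‖k‖⁻¹ ^ 3 ∧
      ‖stripSol f g k t 0 2 - (1 + m t * k⁻¹)‖ ≤ C * ‖k‖⁻¹ ^ 2 := by
  have hT := h.pos
  have q0 := h.reg_left
  have q1 : StripReg T 3 (dX T f) := q0.deriv hT (1, 0)
  have q2 : StripReg T 2 (dX T (dX T f)) := q1.deriv hT (1, 0)
  have q3 : StripReg T 1 (dX T (dX T (dX T f))) := q2.deriv hT (1, 0)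
  have r0 := h.reg_right
  have r1 : StripReg T 3 (dX T g) := r0.deriv hT (1, 0)
  have r2 : StripReg T 2 (dX T (dX T g)) := r1.deriv hT (1, 0)
  have r3 : StripReg T 1 (dX T (dX T (dX T g))) := r2.deriv hT (1, 0)
  have hc : ∀ {n : ℕ} {u : ℝ × ℝ → ℂ}, StripReg T n u → ∀ i : Icc (0 : ℝ) T,
      ContinuousOn (fun x => u (x, (i : ℝ))) (Ici 0) := fun h i =>
    h.continuousOn.comp (by fun_prop) fun x hx => ⟨hx, i.2⟩
  have J : PotJet (ι := Icc (0 : ℝ) T) (fun i x => f (x, (i : ℝ))) (fun i x => dX T f (x, (i : ℝ)))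
      (fun i x => dX T (dX T f) (x, (i : ℝ))) (fun i x => dX T (dX T (dX T f)) (x, (i : ℝ)))
      (fun i x => g (x, (i : ℝ))) (fun i x => dX T g (x, (i : ℝ)))
      (fun i x => dX T (dX T g) (x, (i : ℝ))) (fun i x => dX T (dX T (dX T g)) (x, (i : ℝ))) :=
    { dq := q0.uDiff
      dq₁ := q1.uDiff
      dq₂ := q2.uDiff
      cq₃ := hc q3
      dr := r0.uDiff
      dr₁ := r1.uDiff
      dr₂ := r2.uDiff
      cr₃ := hc r3
      bq := (q0.mono (Nat.zero_le _)).uDec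
      bq₁ := (q1.mono (Nat.zero_le _)).uDec
      bq₂ := (q2.mono (Nat.zero_le _)).uDec
      bq₃ := (q3.mono (Nat.zero_le _)).uDec
      br := (r0.mono (Nat.zero_le _)).uDec
      br₁ := (r1.mono (Nat.zero_le _)).uDec
      br₂ := (r2.mono (Nat.zero_le _)).uDec
      br₃ := (r3.mono (Nat.zero_le _)).uDec }
  obtain ⟨m, C, hC0, hm, hC⟩ := J.asymptotics
  refine ⟨fun t => m (projIcc 0 T hT.le t), C, hC0, fun t _ => hm _, fun t ht k hk hk1 => ?_⟩
  have := hC ⟨t, ht⟩ k hk hk1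
  simp only [projIcc_of_mem hT.le ht]
  exact this

/-- The coefficient of `k⁻¹` of the third entry. -/
def thirdCoeff (b : BoundaryValues) (t : ℝ) : ℂ := -gaugeDiag b t 2

/-- The coefficient of `k⁻¹` of the first entry. -/
def firstLead (b : BoundaryValues) (t : ℝ) : ℂ := αc * b.h₀ t

/-- The coefficient of `k⁻¹` of the second entry. -/
def secondLead (b : BoundaryValues) (t : ℝ) : ℂ := βc * b.g₀ t

/-- The coefficient of `k⁻²` of the first entry, given that of `k⁻¹` of the third entry. -/
def firstSub (b : BoundaryValues) (m : ℂ) (t : ℝ) : ℂ :=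
  -αc * (αc * b.h₁ t - (βc * (b.g₀ t * b.g₀ t) + b.h₀ t * m))

/-- The coefficient of `k⁻²` of the second entry, given that of `k⁻¹` of the third entry. -/
def secondSub (b : BoundaryValues) (m : ℂ) (t : ℝ) : ℂ :=
  -βc * (βc * b.g₁ t - (αc * (b.h₀ t * b.h₀ t) + b.g₀ t * m))

/-- The expansion of the inverse gauge, `-R₁` and `R₁² - R₂`, coincides with the formal series
obtained from the `x`-part once the coefficient of the third entry is matched. -/
lemma gauge_coeffs (b : BoundaryValues) (t : ℝ) :
    -gauge₁ b t 2 2 = thirdCoeff b t ∧ -gauge₁ b t 0 2 = firstLead b t ∧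
    -gauge₁ b t 1 2 = secondLead b t ∧
    gauge₁ b t 0 2 * gauge₁ b t 2 2 + gauge₁ b t 0 0 * gauge₁ b t 0 2 +
      gauge₁ b t 0 1 * gauge₁ b t 1 2 - gauge₂ b t 0 2 = firstSub b (thirdCoeff b t) t ∧
    gauge₁ b t 1 2 * gauge₁ b t 2 2 + gauge₁ b t 1 0 * gauge₁ b t 0 2 +
      gauge₁ b t 1 1 * gauge₁ b t 1 2 - gauge₂ b t 1 2 = secondSub b (thirdCoeff b t) t := by
  have h := ω_sq
  refine ⟨?_, ?_, ?_, ?_, ?_⟩ <;>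
    simp [gauge₁, gauge₂, offDiv, commInv, bdryV₁, bdryV₀, bdryV, V₂, thirdCoeff, firstLead,
      secondLead, firstSub, secondSub, αc, βc, Matrix.mul_apply, Fin.sum_univ_three,
      I_div_sqrt3] <;> grind

/-- Orders `1` and `1/k` of the third row of `V₂` applied to the formal column. The first identity
also explains why the second does not depend on `m`, which enters with the leading coefficients as
factor. -/
lemma gaugeRate_two (b : BoundaryValues) (m : ℂ) (s : ℝ) :
    bdryV₁ b s 2 0 * firstLead b s + bdryV₁ b s 2 1 * secondLead b s = 0 ∧
    bdryV₁ b s 2 0 * firstSub b m s + bdryV₁ b s 2 1 * secondSub b m s +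
      bdryV₀ b s 2 0 * firstLead b s + bdryV₀ b s 2 1 * secondLead b s =
      -gaugeRate (bdryV₁ b s) (bdryV₀ b s) 2 := by
  have h := ω_sq
  refine ⟨?_, ?_⟩ <;>
    simp [gaugeRate, offDiv, commInv, bdryV₁, bdryV₀, bdryV, V₂, firstLead,
      secondLead, firstSub, secondSub, αc, βc, Matrix.mul_apply, Fin.sum_univ_three,
      I_div_sqrt3] <;> grind

lemma bdryV_mulVec_two (b : BoundaryValues) (m : ℂ) (s : ℝ) {k : ℂ} (hk : k ≠ 0) (w : Fin 3 → ℂ) :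
    (bdryV b k s).mulVec w 2 = -gaugeRate (bdryV₁ b s) (bdryV₀ b s) 2 * k⁻¹ +
      (bdryV b k s 2 0 * (w 0 - (firstLead b s * k⁻¹ + firstSub b m s * k⁻¹ ^ 2)) +
       bdryV b k s 2 1 * (w 1 - (secondLead b s * k⁻¹ + secondSub b m s * k⁻¹ ^ 2)) +
       (bdryV₀ b s 2 0 * firstSub b m s + bdryV₀ b s 2 1 * secondSub b m s) * k⁻¹ ^ 2) := by
  obtain ⟨h1, h2⟩ := gaugeRate_two b m s
  have hk' : k * k⁻¹ = 1 := mul_inv_cancel₀ hk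
  have h22 : bdryV b k s 2 2 = 0 := by simp [bdryV, V₂]
  rw [← h2]
  simp only [Matrix.mulVec, dotProduct, Fin.sum_univ_three, h22]
  simp only [bdryV_eq b k, Matrix.add_apply, Matrix.smul_apply, smul_eq_mul]
  generalize k⁻¹ = κ at *
  linear_combination k * κ * h1 + (bdryV₁ b s 2 0 * firstSub b m s +
    bdryV₁ b s 2 1 * secondSub b m s) * κ * hk'

/-- The expansions of the space column on the boundary in terms of the boundary values. -/
lemma LaxBdry.space_asymptotics (h : LaxBdry T f g b) : ∃ m : ℝ → ℂ, ∃ C, 0 ≤ C ∧ (∀ t ∈ Icc 0 T, ‖m t‖ ≤ C) ∧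
    ∀ t ∈ Icc 0 T, ∀ k ∈ closedSector, 1 ≤ ‖k‖ →
      ‖stripSol f g k t 0 0 - (firstLead b t * k⁻¹ + firstSub b (m t) t * k⁻¹ ^ 2)‖ ≤
        C * ‖k‖⁻¹ ^ 3 ∧
      ‖stripSol f g k t 0 1 - (secondLead b t * k⁻¹ + secondSub b (m t) t * k⁻¹ ^ 2)‖ ≤
        C * ‖k‖⁻¹ ^ 3 ∧
      ‖stripSol f g k t 0 2 - (1 + m t * k⁻¹)‖ ≤ C * ‖k‖⁻¹ ^ 2 := by
  obtain ⟨m, C, hC0, hm, hC⟩ := h.data.space_asymptotics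
  refine ⟨m, C, hC0, hm, fun t ht k hk hk1 => ?_⟩
  have := hC t ht k hk hk1
  simp only [firstLead, firstSub, secondLead, secondSub, h.g₀ t ht, h.h₀ t ht, h.g₁ t ht, h.h₁ t ht]
  exact this

lemma ofReal_mem_closedSector {R : ℝ} (hR : 0 ≤ R) : (R : ℂ) ∈ closedSector := by
  intro i
  fin_cases i <;> simp [ω_sq, ω_re] <;> linarith

/-- The increments of the coefficient of `k⁻¹` of the third entry agree for the space column and
for the third column of `μ₂`. -/
lemma LaxBdry.thirdCoeff_eq (h : LaxBdry T f g b) {m : ℝ → ℂ} {C : ℝ} (hC0 : 0 ≤ C)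
    (hm : ∀ t ∈ Icc 0 T, ‖m t‖ ≤ C) (hC : ∀ t ∈ Icc 0 T, ∀ k ∈ closedSector, 1 ≤ ‖k‖ →
      ‖stripSol f g k t 0 0 - (firstLead b t * k⁻¹ + firstSub b (m t) t * k⁻¹ ^ 2)‖ ≤
        C * ‖k‖⁻¹ ^ 3 ∧
      ‖stripSol f g k t 0 1 - (secondLead b t * k⁻¹ + secondSub b (m t) t * k⁻¹ ^ 2)‖ ≤
        C * ‖k‖⁻¹ ^ 3 ∧
      ‖stripSol f g k t 0 2 - (1 + m t * k⁻¹)‖ ≤ C * ‖k‖⁻¹ ^ 2) {t : ℝ} (ht : t ∈ Icc 0 T) :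
    m t = m 0 + thirdCoeff b t := by
  have hs := h.smoothBdry
  have hb := hs.contBdry
  have h00 : (0 : ℝ) ∈ Icc 0 T := ⟨le_rfl, hs.pos.le⟩
  obtain ⟨B₀, hB₀, hV₀⟩ := exists_entry_bound (hb.continuousOn_bdryV 0)
  obtain ⟨B₁, hB₁, hV₁⟩ := exists_entry_bound hs.mc_bdryV₁.continuousOn
  have cg := hb.g₀
  have ch := hb.h₀
  have cg' := hb.g₁
  have ch' := hb.h₁
  have cV := fun i j => hb.continuousOn_bdryV 0 i j
  have cu : ContinuousOn (fun s => bdryV₀ b s 2 0 * firstSub b 0 s +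
      bdryV₀ b s 2 1 * secondSub b 0 s) (Icc 0 T) :=
    ((cV 2 0).mul (by unfold firstSub; fun_prop)).add ((cV 2 1).mul (by unfold secondSub; fun_prop))
  have cv : ContinuousOn (fun s => bdryV₀ b s 2 0 * firstLead b s +
      bdryV₀ b s 2 1 * secondLead b s) (Icc 0 T) :=
    ((cV 2 0).mul (by unfold firstLead; fun_prop)).add
      ((cV 2 1).mul (by unfold secondLead; fun_prop))
  obtain ⟨U, hU⟩ := isCompact_Icc.exists_bound_of_continuousOn cu
  obtain ⟨V, hV⟩ := isCompact_Icc.exists_bound_of_continuousOn cv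
  have hV0 : 0 ≤ V := (norm_nonneg _).trans (hV 0 h00)
  let D := 2 * ((B₀ + B₁) * C) + (U + C * V)
  have hrate : ContinuousOn (fun s => -gaugeRate (bdryV₁ b s) (bdryV₀ b s) 2) (Icc 0 T) := by
    refine ContinuousOn.congr ?_ fun s _ => (gaugeRate_two b 0 s).2.symm
    have c1 := fun i j => hs.mc_bdryV₁.continuousOn i j
    exact ((((c1 2 0).mul (by unfold firstSub; fun_prop)).add
      ((c1 2 1).mul (by unfold secondSub; fun_prop))).add
      ((cV 2 0).mul (by unfold firstLead; fun_prop))).add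
      ((cV 2 1).mul (by unfold secondLead; fun_prop))
  have hsub : uIcc 0 t ⊆ Icc 0 T := uIcc_subset_Icc h00 ht
  -- The third row of the `t`-part has no exponential. Integrated in time along real `k = R`, it
  -- compares the `1/k` coefficients at times `0` and `t` up to `O(1/R)`.
  have key : ∀ R : ℝ, 1 ≤ R → ‖m t - (m 0 + thirdCoeff b t)‖ ≤ (2 * C + D * T) / R := by
    intro R hR
    have hR0 : 0 < R := by linarith
    have hk : (R : ℂ) ∈ closedSector := ofReal_mem_closedSector hR0.le
    have hn : ‖(R : ℂ)‖ = R := by rw [Complex.norm_real, Real.norm_of_nonneg hR0.le]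
    have hk1 : 1 ≤ ‖(R : ℂ)‖ := by rw [hn]; exact hR
    have hk0 : (R : ℂ) ≠ 0 := Complex.ofReal_ne_zero.2 hR0.ne'
    have hode := h.isODESol hk
    have e := hode.eq_integral (hb.continuousOn_bdryV _) h00 ht 2
    simp only [sub_self, zero_mul, Complex.exp_zero, one_mul] at e
    have hcont := continuousOn_mulVec (hb.continuousOn_bdryV (R : ℂ)) hode.cont 2
    have hi1 : IntervalIntegrable (fun s => (bdryV b (R : ℂ) s).mulVec (stripSol f g R s 0) 2)
        volume 0 t := (hcont.mono hsub).intervalIntegrable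
    have hi2 : IntervalIntegrable (fun s => -gaugeRate (bdryV₁ b s) (bdryV₀ b s) 2 * (R : ℂ)⁻¹)
        volume 0 t := ((hrate.mono hsub).mul continuousOn_const).intervalIntegrable
    have e2 : ∫ s in (0 : ℝ)..t, -gaugeRate (bdryV₁ b s) (bdryV₀ b s) 2 * (R : ℂ)⁻¹ =
        thirdCoeff b t * (R : ℂ)⁻¹ := by
      rw [intervalIntegral.integral_mul_const, intervalIntegral.integral_neg]; rfl
    have hx0 : 0 ≤ R⁻¹ := by positivity
    have hx1 : R⁻¹ * R = 1 := inv_mul_cancel₀ hR0.ne'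
    have hbd := intervalIntegral.norm_integral_le_of_norm_le_const (a := 0) (b := t)
      (C := D * R⁻¹ ^ 2) (f := fun s => (bdryV b (R : ℂ) s).mulVec (stripSol f g R s 0) 2 -
        -gaugeRate (bdryV₁ b s) (bdryV₀ b s) 2 * (R : ℂ)⁻¹) fun s hs' => by
      rw [uIoc_of_le ht.1] at hs'
      have hs' : s ∈ Icc 0 T := ⟨hs'.1.le, hs'.2.trans ht.2⟩
      obtain ⟨a1, a2, -⟩ := hC s hs' R hk hk1
      rw [hn] at a1 a2
      rw [bdryV_mulVec_two b (m s) s hk0, add_sub_cancel_left]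
      have b1 : ∀ j, ‖bdryV b (R : ℂ) s 2 j‖ ≤ (B₀ + B₁) * R := fun j => by
        rw [bdryV_eq, Matrix.add_apply, Matrix.smul_apply, smul_eq_mul]
        refine (norm_add_le _ _).trans ?_
        rw [norm_mul, hn]
        have := hV₀ s hs' 2 j
        have := hV₁ s hs' 2 j
        have : ‖bdryV₀ b s 2 j‖ ≤ B₀ := hV₀ s hs' 2 j
        nlinarith
      -- The second-order coefficients are affine in `m` with the leading coefficients as slopes.
      -- This separates `m`, for which only a bound is available here, from continuous functions of
      -- time.
      have b2 : bdryV₀ b s 2 0 * firstSub b (m s) s + bdryV₀ b s 2 1 * secondSub b (m s) s =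
          (bdryV₀ b s 2 0 * firstSub b 0 s + bdryV₀ b s 2 1 * secondSub b 0 s) +
          m s * (bdryV₀ b s 2 0 * firstLead b s + bdryV₀ b s 2 1 * secondLead b s) := by
        unfold firstSub secondSub firstLead secondLead; ring
      have b3 : ‖bdryV₀ b s 2 0 * firstSub b (m s) s + bdryV₀ b s 2 1 * secondSub b (m s) s‖ ≤
          U + C * V := by
        rw [b2]
        refine (norm_add_le _ _).trans (add_le_add (hU s hs') ?_)
        rw [norm_mul]
        exact mul_le_mul (hm s hs') (hV s hs') (norm_nonneg _) hC0
      refine norm_add₃_le.trans ?_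
      rw [norm_mul, norm_mul, norm_mul, norm_pow, norm_inv, hn]
      have c1 := mul_le_mul (b1 0) a1 (norm_nonneg _) (by positivity)
      have c2 := mul_le_mul (b1 1) a2 (norm_nonneg _) (by positivity)
      have c3 := mul_le_mul_of_nonneg_right b3 (sq_nonneg R⁻¹)
      have c4 : (B₀ + B₁) * R * (C * R⁻¹ ^ 3) = (B₀ + B₁) * C * R⁻¹ ^ 2 := by
        linear_combination (B₀ + B₁) * C * R⁻¹ ^ 2 * hx1
      rw [c4] at c1 c2
      simp only [D]
      linarith
    rw [intervalIntegral.integral_sub hi1 hi2, e2, sub_zero, abs_of_nonneg ht.1] at hbd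
    obtain ⟨-, -, f1⟩ := hC t ht R hk hk1
    obtain ⟨-, -, f0⟩ := hC 0 h00 R hk hk1
    rw [hn] at f1 f0
    have e3 : (m t - (m 0 + thirdCoeff b t)) * (R : ℂ)⁻¹ =
        ((∫ s in (0 : ℝ)..t, (bdryV b (R : ℂ) s).mulVec (stripSol f g R s 0) 2) -
          thirdCoeff b t * (R : ℂ)⁻¹) - (stripSol f g R t 0 2 - (1 + m t * (R : ℂ)⁻¹)) +
        (stripSol f g R 0 0 2 - (1 + m 0 * (R : ℂ)⁻¹)) := by
      rw [e]; ring
    have e4 : ‖(m t - (m 0 + thirdCoeff b t)) * (R : ℂ)⁻¹‖ ≤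
        D * R⁻¹ ^ 2 * t + C * R⁻¹ ^ 2 + C * R⁻¹ ^ 2 := by
      rw [e3]
      exact (norm_add_le _ _).trans (add_le_add ((norm_sub_le _ _).trans (add_le_add hbd f1)) f0)
    rw [norm_mul, norm_inv, hn] at e4
    have hD : 0 ≤ D := by
      have := (norm_nonneg _).trans (hU 0 h00)
      positivity
    rw [div_eq_mul_inv]
    have e5 : D * R⁻¹ ^ 2 * t ≤ D * R⁻¹ ^ 2 * T := mul_le_mul_of_nonneg_left ht.2 (by positivity)
    refine le_of_mul_le_mul_right ?_ (inv_pos.2 hR0)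
    linarith
  have hlim : Tendsto (fun R : ℝ => (2 * C + D * T) / R) atTop (𝓝 0) :=
    tendsto_const_nhds.div_atTop tendsto_id
  have := ge_of_tendsto hlim ((eventually_ge_atTop 1).mono key)
  exact sub_eq_zero.1 (norm_le_zero_iff.1 this)

end

noncomputable section

/-! ### Contour integrals over the boundary of a sector -/

/-- The point with polar coordinates `(ρ, θ)`. -/
def polar (ρ θ : ℝ) : ℂ := (ρ : ℂ) * Complex.exp ((θ : ℂ) * Complex.I)

/-- The integral of `f` over the segment of length `R` from the origin at angle `θ`. -/
def rayInt (f : ℂ → ℂ) (θ R : ℝ) : ℂ :=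
  ∫ ρ in (0 : ℝ)..R, f (polar ρ θ) * Complex.exp ((θ : ℂ) * Complex.I)

/-- The integral of `f` over the arc of radius `R` from angle `a` to angle `b`. -/
def arcInt (f : ℂ → ℂ) (a b R : ℝ) : ℂ :=
  ∫ θ in a..b, f (polar R θ) * (polar R θ * Complex.I)

/-- The closed sector `{a ≤ arg k ≤ b}`. -/
def sector (a b : ℝ) : Set ℂ := {k | ∃ ρ θ : ℝ, 0 ≤ ρ ∧ θ ∈ Icc a b ∧ k = polar ρ θ}

lemma continuous_polar_left (θ : ℝ) : Continuous fun ρ => polar ρ θ := by unfold polar; fun_prop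

lemma continuous_polar_right (ρ : ℝ) : Continuous fun θ => polar ρ θ := by unfold polar; fun_prop

lemma norm_polar {ρ : ℝ} (hρ : 0 ≤ ρ) (θ : ℝ) : ‖polar ρ θ‖ = ρ := by
  rw [polar, norm_mul, Complex.norm_exp_ofReal_mul_I, mul_one, Complex.norm_real,
    Real.norm_of_nonneg hρ]

lemma exp_log_polar {ρ : ℝ} (hρ : 0 < ρ) (θ : ℝ) :
    Complex.exp ((Real.log ρ : ℂ) + (θ : ℂ) * Complex.I) = polar ρ θ := by
  rw [Complex.exp_add, polar, ← Complex.ofReal_exp, Real.exp_log hρ]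

lemma exp_mem_sector {a b : ℝ} {ζ : ℂ} (h : ζ.im ∈ Icc a b) : Complex.exp ζ ∈ sector a b := by
  refine ⟨Real.exp ζ.re, ζ.im, (Real.exp_pos _).le, h, ?_⟩
  rw [polar, Complex.ofReal_exp, ← Complex.exp_add, Complex.re_add_im]

lemma polar_mem_sector {a b ρ θ : ℝ} (hρ : 0 ≤ ρ) (hθ : θ ∈ Icc a b) : polar ρ θ ∈ sector a b :=
  ⟨ρ, θ, hρ, hθ, rfl⟩

section sectorCauchy

variable {f : ℂ → ℂ} {a b : ℝ}

lemma continuousOn_ray (hf : ContinuousOn f (sector a b)) {θ : ℝ} (hθ : θ ∈ Icc a b) :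
    ContinuousOn (fun ρ : ℝ => f (polar ρ θ) * Complex.exp ((θ : ℂ) * Complex.I)) (Ici 0) :=
  (hf.comp (continuous_polar_left θ).continuousOn fun _ hρ => polar_mem_sector hρ hθ).mul
    continuousOn_const

lemma continuousOn_arc (hf : ContinuousOn f (sector a b)) {R : ℝ} (hR : 0 ≤ R) :
    ContinuousOn (fun θ : ℝ => f (polar R θ)) (Icc a b) :=
  hf.comp (continuous_polar_right R).continuousOn fun _ hθ => polar_mem_sector hR hθ

lemma integral_exp_ray (hf : ContinuousOn f (sector a b)) {θ ε R : ℝ} (hθ : θ ∈ Icc a b)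
    (hε : 0 < ε) (hR : 0 < R) :
    ∫ x in Real.log ε..Real.log R, f (Complex.exp ((x : ℂ) + (θ : ℂ) * Complex.I)) *
      Complex.exp ((x : ℂ) + (θ : ℂ) * Complex.I) = rayInt f θ R - rayInt f θ ε := by
  have hc := continuousOn_ray hf hθ
  have hi : ∀ r : ℝ, 0 ≤ r → IntervalIntegrable (fun ρ : ℝ => f (polar ρ θ) *
      Complex.exp ((θ : ℂ) * Complex.I)) volume 0 r := fun r hr =>
    (hc.mono (by rw [uIcc_of_le hr]; exact fun x hx => hx.1)).intervalIntegrable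
  rw [rayInt, rayInt, intervalIntegral.integral_interval_sub_left (hi R hR.le) (hi ε hε.le)]
  have := intervalIntegral.integral_deriv_smul_comp' (a := Real.log ε) (b := Real.log R)
    (f := Real.exp) (f' := Real.exp)
    (g := fun ρ : ℝ => f (polar ρ θ) * Complex.exp ((θ : ℂ) * Complex.I))
    (fun x _ => Real.hasDerivAt_exp x) Real.continuous_exp.continuousOn
    (hc.mono (by rintro _ ⟨x, -, rfl⟩; exact (Real.exp_pos x).le))
  rw [Real.exp_log hε, Real.exp_log hR] at this
  rw [← this]
  refine intervalIntegral.integral_congr fun x _ => ?_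
  simp only [Function.comp, polar, Complex.exp_add, Complex.real_smul, Complex.ofReal_exp]
  ring

/-- Cauchy's theorem in a sector. The exponential maps a rectangle onto the part of the sector with
`ε ≤ |k| ≤ R`; what lies inside radius `ε` contributes `O(ε)`. -/
theorem rayInt_sub_rayInt (hab : a ≤ b) (hf : DifferentiableOn ℂ f (sector a b)) {R : ℝ}
    (hR : 0 < R) : rayInt f b R - rayInt f a R = arcInt f a b R := by
  have hc := hf.continuousOn
  have ha : a ∈ Icc a b := ⟨le_rfl, hab⟩
  have hb : b ∈ Icc a b := ⟨hab, le_rfl⟩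
  have key : ∀ ε, 0 < ε → rayInt f b R - rayInt f a R - arcInt f a b R =
      rayInt f b ε - rayInt f a ε - arcInt f a b ε := by
    intro ε hε
    have hm : MapsTo Complex.exp (uIcc (Real.log ε) (Real.log R) ×ℂ Icc a b) (sector a b) :=
      fun ζ hζ => exp_mem_sector hζ.2
    have h := Complex.integral_boundary_rect_eq_zero_of_continuousOn_of_differentiableOn
      (fun ζ => f (Complex.exp ζ) * Complex.exp ζ) ⟨Real.log ε, a⟩ ⟨Real.log R, b⟩
      (by
        rw [uIcc_of_le hab]
        exact (hc.comp Complex.continuous_exp.continuousOn hm).mul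
          Complex.continuous_exp.continuousOn)
      (by
        rw [min_eq_left hab, max_eq_right hab]
        refine (hf.comp Complex.differentiable_exp.differentiableOn fun ζ hζ =>
          exp_mem_sector (Ioo_subset_Icc_self hζ.2)).mul
          Complex.differentiable_exp.differentiableOn)
    simp only [integral_exp_ray hc ha hε hR, integral_exp_ray hc hb hε hR, exp_log_polar hR,
      exp_log_polar hε, smul_eq_mul] at h
    have e : ∀ r, Complex.I * ∫ y in a..b, f (polar r y) * polar r y = arcInt f a b r := fun r => by
      rw [arcInt, ← intervalIntegral.integral_const_mul]
      exact intervalIntegral.integral_congr fun y _ => by ring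
    rw [e, e] at h
    linear_combination -h
  obtain ⟨C, hC⟩ := (isCompact_Icc (a := (0 : ℝ)) (b := 1)).prod (isCompact_Icc (a := a) (b := b))
    |>.exists_bound_of_continuousOn (f := fun p : ℝ × ℝ => f (polar p.1 p.2))
      (hc.comp (by unfold polar; fun_prop) fun p hp => polar_mem_sector hp.1.1 hp.2)
  have hC0 : 0 ≤ C := (norm_nonneg _).trans (hC (0, a) ⟨⟨le_rfl, zero_le_one⟩, ha⟩)
  have hray : ∀ θ ∈ Icc a b, ∀ ε ∈ Ioc (0 : ℝ) 1, ‖rayInt f θ ε‖ ≤ C * ε := fun θ hθ ε hε => by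
    have := intervalIntegral.norm_integral_le_of_norm_le_const (a := 0) (b := ε) (C := C)
      (f := fun ρ : ℝ => f (polar ρ θ) * Complex.exp ((θ : ℂ) * Complex.I)) fun ρ hρ => by
      rw [uIoc_of_le hε.1.le] at hρ
      rw [norm_mul, Complex.norm_exp_ofReal_mul_I, mul_one]
      exact hC (ρ, θ) ⟨⟨hρ.1.le, hρ.2.trans hε.2⟩, hθ⟩
    rwa [sub_zero, abs_of_pos hε.1] at this
  have harc : ∀ ε ∈ Ioc (0 : ℝ) 1, ‖arcInt f a b ε‖ ≤ C * ε * (b - a) := fun ε hε => by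
    have := intervalIntegral.norm_integral_le_of_norm_le_const (a := a) (b := b) (C := C * ε)
      (f := fun θ : ℝ => f (polar ε θ) * (polar ε θ * Complex.I)) fun θ hθ => by
      rw [uIoc_of_le hab] at hθ
      rw [norm_mul, norm_mul, Complex.norm_I, mul_one, norm_polar hε.1.le]
      exact mul_le_mul_of_nonneg_right (hC (ε, θ) ⟨⟨hε.1.le, hε.2⟩, Ioc_subset_Icc_self hθ⟩)
        hε.1.le
    rwa [abs_of_nonneg (sub_nonneg.2 hab)] at this
  have hbd : ∀ᶠ ε in 𝓝[>] (0 : ℝ), ‖rayInt f b R - rayInt f a R - arcInt f a b R‖ ≤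
      (C + C + C * (b - a)) * ε := by
    filter_upwards [Ioc_mem_nhdsGT (zero_lt_one' ℝ)] with ε hε
    rw [key ε hε.1]
    have h1 := hray b hb ε hε
    have h2 := hray a ha ε hε
    have h3 := harc ε hε
    refine (norm_sub_le _ _).trans ?_
    have := norm_sub_le (rayInt f b ε) (rayInt f a ε)
    linarith
  have hlim : Tendsto (fun ε : ℝ => (C + C + C * (b - a)) * ε) (𝓝[>] 0) (𝓝 0) := by
    have : Tendsto (fun ε : ℝ => (C + C + C * (b - a)) * ε) (𝓝 0)
        (𝓝 ((C + C + C * (b - a)) * 0)) := (continuous_const.mul continuous_id).tendsto _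
    rw [mul_zero] at this
    exact this.mono_left nhdsWithin_le_nhds
  have := ge_of_tendsto hlim hbd
  exact sub_eq_zero.1 (norm_le_zero_iff.1 this)

end sectorCauchy

lemma integral_exp_le {r α a b : ℝ} (hr : 0 < r) (hα : α ≤ a) :
    ∫ θ in a..b, Real.exp (-r * (θ - α)) ≤ 1 / r := by
  have h : ∀ θ : ℝ, HasDerivAt (fun θ => -(Real.exp (-r * (θ - α)) / r))
      (Real.exp (-r * (θ - α))) θ := fun θ => by
    have := ((((hasDerivAt_id θ).sub_const α).const_mul (-r)).exp.div_const r).neg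
    refine this.congr_deriv ?_
    field_simp; simp
  rw [intervalIntegral.integral_eq_sub_of_hasDerivAt (fun θ _ => h θ)
    (Continuous.intervalIntegrable (by fun_prop) _ _)]
  have h1 : Real.exp (-r * (a - α)) ≤ 1 := Real.exp_le_one_iff.2 (by nlinarith)
  have h2 := div_le_div_of_nonneg_right h1 hr.le
  have h3 : 0 ≤ Real.exp (-r * (b - α)) / r := by positivity
  linarith

lemma integral_exp_le' {r β a b : ℝ} (hr : 0 < r) (hβ : b ≤ β) :
    ∫ θ in a..b, Real.exp (-r * (β - θ)) ≤ 1 / r := by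
  have := intervalIntegral.integral_comp_neg (a := a) (b := b)
    (fun θ => Real.exp (-r * (θ - (-β))))
  simp only [sub_neg_eq_add, neg_add_eq_sub] at this
  rw [this]
  have := integral_exp_le (r := r) (α := -β) (a := -b) (b := -a) hr (by linarith)
  simpa using this

/-- The error on arcs near the boundary of the region of decay. -/
def wedgeErr (c α β R θ : ℝ) : ℝ :=
  R⁻¹ ^ 2 + Real.exp (-(c * R ^ 2) * (θ - α)) + Real.exp (-(c * R ^ 2) * (β - θ))

/-- The term `A/k` contributes `iA` per unit of angle. The exponential errors are not uniformly
small up to the edges, but as in Jordan's lemma they integrate over the angle to `O(R⁻²)`, which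
beats the factor `R` from the arc length. -/
theorem tendsto_arcInt {f : ℂ → ℂ} {A : ℂ} {C c K α β a b : ℝ} (hc : 0 < c) (hα : α ≤ a)
    (hab : a ≤ b) (hβ : b ≤ β) (hf : ContinuousOn f (sector a b)) (hC : 0 ≤ C)
    (h : ∀ R, K ≤ R → ∀ θ ∈ Icc a b, ‖f (polar R θ) - A * (polar R θ)⁻¹‖ ≤ C * wedgeErr c α β R θ) :
    Tendsto (arcInt f a b) atTop (𝓝 (Complex.I * A * ((b : ℂ) - a))) := by
  have hlim : Tendsto (fun R : ℝ => C * ((b - a) + 2 / c) * R⁻¹) atTop (𝓝 0) := by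
    simpa using tendsto_inv_atTop_zero.const_mul (C * ((b - a) + 2 / c))
  rw [tendsto_iff_norm_sub_tendsto_zero]
  refine squeeze_zero' (Eventually.of_forall fun _ => norm_nonneg _) ?_ hlim
  filter_upwards [eventually_ge_atTop K, eventually_gt_atTop 0] with R hK hR
  have hp0 : ∀ θ, polar R θ ≠ 0 := fun θ => norm_pos_iff.1 (by rw [norm_polar hR.le]; exact hR)
  have hfc := continuousOn_arc hf hR.le
  have hpc := continuous_polar_right R
  have e : arcInt f a b R - Complex.I * A * ((b : ℂ) - a) =
      ∫ θ in a..b, (f (polar R θ) - A * (polar R θ)⁻¹) * (polar R θ * Complex.I) := by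
    have e1 : Complex.I * A * ((b : ℂ) - a) = ∫ _ in a..b, Complex.I * A := by
      rw [intervalIntegral.integral_const, Complex.real_smul]; push_cast; ring
    rw [e1, arcInt, ← intervalIntegral.integral_sub]
    · refine intervalIntegral.integral_congr fun θ _ => ?_
      have := hp0 θ
      field_simp
    · refine ContinuousOn.intervalIntegrable ?_
      rw [uIcc_of_le hab]
      exact hfc.mul (hpc.mul continuous_const).continuousOn
    · exact intervalIntegrable_const
  have hr : 0 < c * R ^ 2 := by positivity
  have i1 : IntervalIntegrable (fun θ : ℝ => Real.exp (-(c * R ^ 2) * (θ - α))) volume a b :=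
    Continuous.intervalIntegrable (by fun_prop) _ _
  have i2 : IntervalIntegrable (fun θ : ℝ => Real.exp (-(c * R ^ 2) * (β - θ))) volume a b :=
    Continuous.intervalIntegrable (by fun_prop) _ _
  have hW : ∫ θ in a..b, wedgeErr c α β R θ ≤ R⁻¹ ^ 2 * (b - a) + 1 / (c * R ^ 2) +
      1 / (c * R ^ 2) := by
    unfold wedgeErr
    rw [intervalIntegral.integral_add (intervalIntegrable_const.add i1) i2,
      intervalIntegral.integral_add intervalIntegrable_const i1, intervalIntegral.integral_const,
      smul_eq_mul, mul_comm]
    exact add_le_add (add_le_add le_rfl (integral_exp_le hr hα)) (integral_exp_le' hr hβ)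
  rw [e]
  refine (intervalIntegral.norm_integral_le_of_norm_le (g := fun θ => C * R * wedgeErr c α β R θ)
    hab (Eventually.of_forall fun θ hθ => ?_) ?_).trans ?_
  · rw [norm_mul, norm_mul, Complex.norm_I, mul_one, norm_polar hR.le, mul_right_comm]
    exact mul_le_mul_of_nonneg_right (h R hK θ (Ioc_subset_Icc_self hθ)) hR.le
  · refine Continuous.intervalIntegrable ?_ _ _
    unfold wedgeErr; fun_prop
  · rw [intervalIntegral.integral_const_mul]
    refine (mul_le_mul_of_nonneg_left hW (by positivity)).trans (le_of_eq ?_)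
    field_simp
    ring

end

/-! ### Convergence of the integrals over the boundary of the sector -/

noncomputable section

lemma exp_zero_angle : Complex.exp (((0 : ℝ) : ℂ) * Complex.I) = 1 := by simp

lemma exp_two_pi_div_three : Complex.exp (((2 * Real.pi / 3 : ℝ) : ℂ) * Complex.I) = ω := by
  rw [ω]; congr 1; push_cast; ring

lemma exp_neg_pi_div_three : Complex.exp (((-(Real.pi / 3) : ℝ) : ℂ) * Complex.I) = -ω := by
  have : Complex.exp (((-(Real.pi / 3) : ℝ) : ℂ) * Complex.I) =
      Complex.exp (((2 * Real.pi / 3 : ℝ) : ℂ) * Complex.I) * Complex.exp (-(Real.pi * Complex.I)) := by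
    rw [← Complex.exp_add]; congr 1; push_cast; ring
  rw [this, exp_two_pi_div_three, Complex.exp_neg_pi_mul_I, mul_neg_one]

lemma polar_re (ρ θ : ℝ) : (polar ρ θ).re = ρ * Real.cos θ := by
  rw [polar, Complex.re_ofReal_mul, Complex.exp_ofReal_mul_I_re]

lemma polar_im (ρ θ : ℝ) : (polar ρ θ).im = ρ * Real.sin θ := by
  rw [polar, Complex.im_ofReal_mul, Complex.exp_ofReal_mul_I_im]

lemma sector_subset_closedSector : sector 0 (2 * Real.pi / 3) ⊆ closedSector := by
  rintro _ ⟨ρ, θ, hρ, hθ, rfl⟩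
  have hπ := Real.pi_pos
  have h1 : 0 ≤ Real.sin θ := Real.sin_nonneg_of_nonneg_of_le_pi hθ.1 (by linarith [hθ.2])
  have h2 : 0 ≤ Real.sin (θ + Real.pi / 3) :=
    Real.sin_nonneg_of_nonneg_of_le_pi (by linarith [hθ.1]) (by linarith [hθ.2])
  rw [Real.sin_add, Real.sin_pi_div_three, Real.cos_pi_div_three] at h2
  have h3 : Real.sqrt 3 * Real.sqrt 3 = 3 := Real.mul_self_sqrt (by norm_num)
  have h4 : 0 ≤ Real.sqrt 3 := Real.sqrt_nonneg 3
  have e1 := mul_nonneg hρ (mul_nonneg h4 h1)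
  have e2 := mul_nonneg hρ (mul_nonneg h4 h2)
  intro i
  fin_cases i <;> simp [ω_sq, ω_re, ω_im, polar_re, polar_im]
  · linear_combination e2 + (ρ * Real.cos θ / 2) * h3
  · linear_combination e1

/-- The contour integral in terms of integrals over rays. -/
lemma hasContourIntegral_iff {f : ℂ → ℂ} {c : ℂ}
    (h1 : ContinuousOn (fun ρ : ℝ => f (-(ρ : ℂ))) (Ici 0))
    (h2 : ContinuousOn (fun ρ : ℝ => f (-ω * (ρ : ℂ))) (Ici 0)) :
    HasContourIntegral f c ↔ Tendsto (fun R => ω * (∫ ρ in (0 : ℝ)..R, f (-ω * (ρ : ℂ))) -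
      ∫ ρ in (0 : ℝ)..R, f (-(ρ : ℂ))) atTop (𝓝 c) := by
  have hi : ∀ {g : ℝ → ℂ}, ContinuousOn g (Ici 0) → ∀ R : ℝ, 0 < R →
      IntervalIntegrable g volume 0 R := fun hg R hR =>
    (hg.mono (by rw [uIcc_of_le hR.le]; exact fun x hx => hx.1)).intervalIntegrable
  have e : (fun R : ℝ => -(∫ ρ in (0 : ℝ)..R, f (-ω * (ρ : ℂ)) * (-ω)) +
      ∫ ρ in (0 : ℝ)..R, f (-(ρ : ℂ)) * (-1)) = fun R =>
      ω * (∫ ρ in (0 : ℝ)..R, f (-ω * (ρ : ℂ))) - ∫ ρ in (0 : ℝ)..R, f (-(ρ : ℂ)) := by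
    ext R
    rw [intervalIntegral.integral_mul_const, intervalIntegral.integral_mul_const]; ring
  rw [HasContourIntegral, e]
  exact ⟨fun h => h.2.2, fun h => ⟨hi h1, hi h2, h⟩⟩

/-- The substitution `k ↦ -k` carries the contour to the boundary of the sector where `F(-k)` is
holomorphic. Cauchy's theorem replaces the rays by an arc of angle `2π/3`, on which only the `1/k`
term survives. -/
lemma hasContourIntegral_of_sector {F : ℂ → ℂ} {A : ℂ} {C K : ℝ}
    (hF : DifferentiableOn ℂ (fun k => F (-k)) closedSector)
    (h : ∀ k ∈ closedSector, K ≤ ‖k‖ → ‖F (-k) + A * k⁻¹‖ ≤ C * ‖k‖⁻¹ ^ 2) :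
    HasContourIntegral F (-(2 * Real.pi * Complex.I / 3 * A)) := by
  have hF' := hF.mono sector_subset_closedSector
  have hπ := Real.pi_pos
  have h0 : (0 : ℝ) ∈ Icc 0 (2 * Real.pi / 3) := ⟨le_rfl, by positivity⟩
  have h1 : 2 * Real.pi / 3 ∈ Icc 0 (2 * Real.pi / 3) := ⟨by positivity, le_rfl⟩
  have c0 := continuousOn_ray hF'.continuousOn h0
  have c1 := continuousOn_ray hF'.continuousOn h1
  simp only [polar, exp_zero_angle, exp_two_pi_div_three, mul_one] at c0 c1
  have hω := ω_ne
  rw [hasContourIntegral_iff c0]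
  · have hC0 : 0 ≤ |C| := abs_nonneg C
    have ht := tendsto_arcInt (f := fun k => F (-k)) (A := -A) (C := |C|) (c := 1) (K := max K 0)
      (a := 0) (b := 2 * Real.pi / 3) (α := 0) (β := 2 * Real.pi / 3) one_pos le_rfl h1.1 le_rfl
      hF'.continuousOn hC0 fun R hR θ hθ => by
        have hR0 : 0 ≤ R := (le_max_right _ _).trans hR
        have := h (polar R θ) (sector_subset_closedSector (polar_mem_sector hR0 hθ))
          (by rw [norm_polar hR0]; exact (le_max_left _ _).trans hR)
        rw [norm_polar hR0] at this
        rw [neg_mul, sub_neg_eq_add]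
        refine this.trans ((mul_le_mul_of_nonneg_right (le_abs_self C) (by positivity)).trans
          (mul_le_mul_of_nonneg_left ?_ hC0))
        unfold wedgeErr
        have := Real.exp_nonneg (-(1 * R ^ 2) * (θ - 0))
        have := Real.exp_nonneg (-(1 * R ^ 2) * (2 * Real.pi / 3 - θ))
        linarith
    have e : Complex.I * -A * (((2 * Real.pi / 3 : ℝ) : ℂ) - (0 : ℝ)) =
        -(2 * Real.pi * Complex.I / 3 * A) := by push_cast; ring
    rw [e] at ht
    refine ht.congr' ?_
    filter_upwards [eventually_gt_atTop 0] with R hR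
    rw [← rayInt_sub_rayInt h1.1 hF' hR]
    simp only [rayInt, polar, exp_zero_angle, exp_two_pi_div_three, mul_one]
    rw [intervalIntegral.integral_mul_const, mul_comm]
    congr 2
    exact intervalIntegral.integral_congr fun ρ _ => by ring_nf
  · have : (fun ρ : ℝ => F (-ω * (ρ : ℂ))) = fun ρ : ℝ => F (-(ρ * ω)) * ω * ω⁻¹ := by
      ext ρ; rw [mul_assoc, mul_inv_cancel₀ hω, mul_one]; ring_nf
    rw [this]
    exact c1.mul continuousOn_const

lemma exp_neg_le_inv {x : ℝ} (hx : 0 < x) : Real.exp (-x) ≤ x⁻¹ := by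
  rw [Real.exp_neg]
  exact inv_anti₀ hx (by linarith [Real.add_one_le_exp x])

/-- Convergence of contour integrals of entire functions by rotation of the contour. -/
theorem exists_hasContourIntegral {h : ℂ → ℂ} (hd : Differentiable ℂ h) {A : ℂ} {C c K : ℝ}
    (hc : 0 < c) (hC : 0 ≤ C)
    (hp : ∀ R, K ≤ R → ∀ θ ∈ Icc (-(Real.pi / 3)) 0,
      ‖h (polar R θ) - A * (polar R θ)⁻¹‖ ≤ C * wedgeErr c (-(Real.pi / 3)) 0 R θ)
    (hm : ∀ R, K ≤ R → ∀ θ ∈ Icc (-(Real.pi / 3)) 0,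
      ‖h (-polar R θ) + A * (polar R θ)⁻¹‖ ≤ C * wedgeErr c (-(Real.pi / 3)) 0 R θ) :
    ∃ X, HasContourIntegral (fun k => h (-k)) X ∧
      HasContourIntegral h (X + 2 * Real.pi * Complex.I / 3 * A) := by
  have hπ := Real.pi_pos
  have hd' : Differentiable ℂ fun k => h (-k) := hd.comp differentiable_neg
  set μ : ℝ := -(Real.pi / 6) with hμ
  have a1 : -(Real.pi / 3) ≤ μ := by rw [hμ]; linarith
  have a2 : μ ≤ 0 := by rw [hμ]; linarith
  have I1 : Icc (-(Real.pi / 3)) μ ⊆ Icc (-(Real.pi / 3)) 0 := Icc_subset_Icc_right a2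
  have I2 : Icc μ 0 ⊆ Icc (-(Real.pi / 3)) 0 := Icc_subset_Icc_left a1
  have hm' : ∀ R, K ≤ R → ∀ θ ∈ Icc (-(Real.pi / 3)) 0,
      ‖h (-polar R θ) - -A * (polar R θ)⁻¹‖ ≤ C * wedgeErr c (-(Real.pi / 3)) 0 R θ :=
    fun R hR θ hθ => by rw [neg_mul, sub_neg_eq_add]; exact hm R hR θ hθ
  have p1 := tendsto_arcInt hc le_rfl a1 a2 hd.continuous.continuousOn hC
    fun R hR θ hθ => hp R hR θ (I1 hθ)
  have p2 := tendsto_arcInt hc a1 a2 le_rfl hd.continuous.continuousOn hC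
    fun R hR θ hθ => hp R hR θ (I2 hθ)
  have m1 := tendsto_arcInt (f := fun k => h (-k)) hc le_rfl a1 a2 hd'.continuous.continuousOn hC
    fun R hR θ hθ => hm' R hR θ (I1 hθ)
  have m2 := tendsto_arcInt (f := fun k => h (-k)) hc a1 a2 le_rfl hd'.continuous.continuousOn hC
    fun R hR θ hθ => hm' R hR θ (I2 hθ)
  -- the middle rays
  let u : ℂ := Complex.exp ((μ : ℂ) * Complex.I)
  have hu : ‖u‖ = 1 := Complex.norm_exp_ofReal_mul_I μ
  -- On the middle rays both exponentials are Gaussian small, and the terms `A/k` of `h(k)` and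
  -- `h(-k)` cancel. The sum is therefore `O(ρ⁻²)` and integrable.
  let M : ℝ → ℂ := fun ρ => h (polar ρ μ) * u + h (-polar ρ μ) * u
  have cp : Continuous fun ρ => h (polar ρ μ) * u :=
    (hd.continuous.comp (continuous_polar_left μ)).mul continuous_const
  have cm : Continuous fun ρ => h (-polar ρ μ) * u :=
    (hd'.continuous.comp (continuous_polar_left μ)).mul continuous_const
  have hMc : Continuous M := cp.add cm
  let D := 2 * C * (1 + 2 * (c * (Real.pi / 6))⁻¹)
  have hMb : ∀ ρ, max K 1 ≤ ρ → ‖M ρ‖ ≤ D * ρ ^ (-2 : ℝ) := fun ρ hρ => by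
    have hK : K ≤ ρ := (le_max_left _ _).trans hρ
    have hρ0 : 0 < ρ := zero_lt_one.trans_le ((le_max_right _ _).trans hρ)
    have hμm : μ ∈ Icc (-(Real.pi / 3)) 0 := ⟨a1, a2⟩
    have e : M ρ = ((h (polar ρ μ) - A * (polar ρ μ)⁻¹) +
        (h (-polar ρ μ) + A * (polar ρ μ)⁻¹)) * u := by simp only [M]; ring
    rw [e, norm_mul, hu, mul_one]
    refine (norm_add_le _ _).trans ((add_le_add (hp ρ hK μ hμm) (hm ρ hK μ hμm)).trans ?_)
    have w : wedgeErr c (-(Real.pi / 3)) 0 ρ μ ≤ (1 + 2 * (c * (Real.pi / 6))⁻¹) * ρ⁻¹ ^ 2 := by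
      have e1 : -(c * ρ ^ 2) * (μ - -(Real.pi / 3)) = -(c * ρ ^ 2 * (Real.pi / 6)) := by
        rw [hμ]; ring
      have e2 : -(c * ρ ^ 2) * (0 - μ) = -(c * ρ ^ 2 * (Real.pi / 6)) := by rw [hμ]; ring
      have e3 := exp_neg_le_inv (x := c * ρ ^ 2 * (Real.pi / 6)) (by positivity)
      have e4 : (c * ρ ^ 2 * (Real.pi / 6))⁻¹ = (c * (Real.pi / 6))⁻¹ * ρ⁻¹ ^ 2 := by
        field_simp
      rw [wedgeErr, e1, e2]
      rw [e4] at e3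
      linarith
    have e5 : ρ ^ (-2 : ℝ) = ρ⁻¹ ^ 2 := by
      rw [Real.rpow_neg hρ0.le, inv_pow]; norm_cast
    rw [e5]
    have := mul_le_mul_of_nonneg_left w hC
    simp only [D]; linarith
  have hMi : IntegrableOn M (Ioi 0) := by
    have hmax : 0 < max K 1 := zero_lt_one.trans_le (le_max_right _ _)
    rw [← Ioc_union_Ioi_eq_Ioi hmax.le]
    refine (hMc.continuousOn.integrableOn_Icc.mono_set Ioc_subset_Icc_self).union ?_
    refine ((integrableOn_Ioi_rpow_of_lt (by norm_num : (-2 : ℝ) < -1) hmax).const_mul D).mono'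
      hMc.aestronglyMeasurable ?_
    filter_upwards [ae_restrict_mem measurableSet_Ioi] with ρ hρ using hMb ρ (le_of_lt hρ)
  have hMlim := intervalIntegral_tendsto_integral_Ioi 0 hMi tendsto_id
  set Y := ∫ ρ in Ioi (0 : ℝ), M ρ with hY
  have hMr : ∀ R, ∫ ρ in (0 : ℝ)..R, M ρ = rayInt h μ R + rayInt (fun k => h (-k)) μ R := fun R => by
    simp only [M, rayInt]
    exact intervalIntegral.integral_add (cp.intervalIntegrable _ _) (cm.intervalIntegrable _ _)
  have hcont : ∀ {g : ℂ → ℂ}, Continuous g → ∀ w : ℂ,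
      ContinuousOn (fun ρ : ℝ => g (w * (ρ : ℂ))) (Ici 0) := fun hg w =>
    (hg.comp (by fun_prop)).continuousOn
  have r0 : ∀ (g : ℂ → ℂ) (R : ℝ), rayInt g 0 R = ∫ ρ in (0 : ℝ)..R, g ρ := fun g R => by
    simp only [rayInt, polar, exp_zero_angle, mul_one]
  have r1 : ∀ (g : ℂ → ℂ) (R : ℝ), rayInt g (-(Real.pi / 3)) R =
      -ω * ∫ ρ in (0 : ℝ)..R, g (-ω * ρ) := fun g R => by
    simp only [rayInt, polar, exp_neg_pi_div_three]
    rw [intervalIntegral.integral_mul_const, mul_comm]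
    congr 1
    exact intervalIntegral.integral_congr fun ρ _ => by ring_nf
  have q1 : ∀ R, 0 < R → rayInt h (-(Real.pi / 3)) R = rayInt h μ R - arcInt h (-(Real.pi / 3)) μ R :=
    fun R hR => by rw [← rayInt_sub_rayInt a1 hd.differentiableOn hR]; ring
  have q2 : ∀ R, 0 < R → rayInt h 0 R = rayInt h μ R + arcInt h μ 0 R :=
    fun R hR => by rw [← rayInt_sub_rayInt a2 hd.differentiableOn hR]; ring
  have q3 : ∀ R, 0 < R → rayInt (fun k => h (-k)) (-(Real.pi / 3)) R =
      rayInt (fun k => h (-k)) μ R - arcInt (fun k => h (-k)) (-(Real.pi / 3)) μ R :=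
    fun R hR => by rw [← rayInt_sub_rayInt a1 hd'.differentiableOn hR]; ring
  have q4 : ∀ R, 0 < R → rayInt (fun k => h (-k)) 0 R =
      rayInt (fun k => h (-k)) μ R + arcInt (fun k => h (-k)) μ 0 R :=
    fun R hR => by rw [← rayInt_sub_rayInt a2 hd'.differentiableOn hR]; ring
  -- Each of the two rays is rotated by `π/6` to a middle ray. The integral `Y` over the middle rays
  -- is the same for `h(k)` and `h(-k)`, while the arcs contribute `πiA/3` with opposite signs.
  refine ⟨-Y - Real.pi * Complex.I / 3 * A, ?_, ?_⟩
  · rw [hasContourIntegral_iff (by simpa using hcont hd'.continuous (-1)) (hcont hd'.continuous _)]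
    have := ((hMlim.add p2).sub m1).neg
    have e : -(Y + Complex.I * A * (((0 : ℝ) : ℂ) - (μ : ℂ)) -
        Complex.I * -A * ((μ : ℂ) - ((-(Real.pi / 3) : ℝ) : ℂ))) =
        -Y - Real.pi * Complex.I / 3 * A := by rw [hμ]; push_cast; ring
    rw [e] at this
    refine this.congr' ?_
    filter_upwards [eventually_gt_atTop 0] with R hR
    have s1 := r1 (fun k => h (-k)) R
    have s2 := r0 h R
    simp only [neg_neg]
    rw [← s2, id, hMr]
    linear_combination -s1 + q3 R hR + q2 R hR
  · rw [hasContourIntegral_iff (by simpa using hcont hd.continuous (-1)) (hcont hd.continuous _)]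
    have := ((hMlim.add m2).sub p1).neg
    have e : -(Y + Complex.I * -A * (((0 : ℝ) : ℂ) - (μ : ℂ)) -
        Complex.I * A * ((μ : ℂ) - ((-(Real.pi / 3) : ℝ) : ℂ))) =
        -Y - Real.pi * Complex.I / 3 * A + 2 * Real.pi * Complex.I / 3 * A := by
      rw [hμ]; push_cast; ring
    rw [e] at this
    refine this.congr' ?_
    filter_upwards [eventually_gt_atTop 0] with R hR
    have s1 := r1 h R
    have s2 := r0 (fun k => h (-k)) R
    rw [← s2, id, hMr]
    linear_combination -s1 + q1 R hR + q4 R hR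

end

/-! ### The wedges of decay, and operations on contour integrals -/

noncomputable section

lemma div_four_le_sin {x : ℝ} (h0 : 0 ≤ x) (h1 : x ≤ 2 * Real.pi / 3) : x / 4 ≤ Real.sin x := by
  have hπ := Real.pi_pos
  have h3 := Real.pi_gt_three
  have h4 := Real.pi_le_four
  rcases le_total x (Real.pi / 2) with h | h
  · refine le_trans ?_ (Real.mul_le_sin h0 h)
    rw [div_mul_eq_mul_div, le_div_iff₀ hπ]
    nlinarith
  · rw [← Real.sin_pi_sub]
    refine le_trans ?_ (Real.mul_le_sin (by linarith) (by linarith))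
    rw [div_mul_eq_mul_div, le_div_iff₀ hπ]
    nlinarith

lemma polar_sq (R θ : ℝ) : polar R θ ^ 2 = polar (R ^ 2) (2 * θ) := by
  rw [polar, polar, mul_pow, ← Complex.exp_nat_mul]; push_cast; ring_nf

lemma z_sub_re_zero (R θ : ℝ) : (z (polar R θ) 0 - z (polar R θ) 2).re =
    -(Real.sqrt 3 * R ^ 2 * Real.sin (2 * (θ + Real.pi / 3))) := by
  have h3 : Real.sqrt 3 * Real.sqrt 3 = 3 := Real.mul_self_sqrt (by norm_num)
  have e : Real.sin (2 * (θ + Real.pi / 3)) =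
      Real.sqrt 3 / 2 * Real.cos (2 * θ) - 1 / 2 * Real.sin (2 * θ) := by
    have : 2 * (θ + Real.pi / 3) = Real.pi - (Real.pi / 3 - 2 * θ) := by ring
    rw [this, Real.sin_pi_sub, Real.sin_sub, Real.sin_pi_div_three, Real.cos_pi_div_three]
  rw [z_zero, z_two, polar_sq, ω_sq, e]
  simp [polar_re, polar_im, ω_re, ω_im]
  linear_combination (R ^ 2 * Real.cos (2 * θ) / 2) * h3

lemma z_sub_re_one (R θ : ℝ) : (z (polar R θ) 1 - z (polar R θ) 2).re =
    -(Real.sqrt 3 * R ^ 2 * Real.sin (2 * -θ)) := by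
  rw [z_one, z_two, polar_sq, ω_sq, mul_neg, Real.sin_neg]
  simp [polar_re, polar_im, ω_re, ω_im]
  ring

/-- Each exponent degenerates at one edge only, the first at `-π/3` and the second at `0`. The
Jordan-type inequality `sin x ≥ x/4` on `[0, 2π/3]` gives a linear rate in the distance to that
edge. -/
lemma wedge_bounds {R θ : ℝ} (hθ : θ ∈ Icc (-(Real.pi / 3)) 0) :
    (z (polar R θ) 0 - z (polar R θ) 2).re ≤ -(R ^ 2 / 2 * (θ - -(Real.pi / 3))) ∧
    (z (polar R θ) 1 - z (polar R θ) 2).re ≤ -(R ^ 2 / 2 * (0 - θ)) := by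
  have hs : 1 ≤ Real.sqrt 3 := Real.one_le_sqrt.2 (by norm_num)
  have hR := sq_nonneg R
  have key : ∀ x, 0 ≤ x → x ≤ Real.pi / 3 →
      R ^ 2 / 2 * x ≤ Real.sqrt 3 * R ^ 2 * Real.sin (2 * x) := fun x h0 h1 => by
    have h2 := div_four_le_sin (x := 2 * x) (by linarith) (by linarith)
    have h3 : R ^ 2 * (2 * x / 4) ≤ R ^ 2 * Real.sin (2 * x) := mul_le_mul_of_nonneg_left h2 hR
    have h4 : 0 ≤ R ^ 2 * Real.sin (2 * x) := le_trans (by positivity) h3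
    nlinarith
  have h1 := key (θ + Real.pi / 3) (by linarith [hθ.1]) (by linarith [hθ.2])
  have h2 := key (-θ) (by linarith [hθ.2]) (by linarith [hθ.1])
  rw [z_sub_re_zero, z_sub_re_one]
  constructor <;> linarith

lemma z_neg (k : ℂ) : z (-k) = z k := by ext i; simp [z]

lemma polar_mem_decayRegion {R θ : ℝ} (hθ : θ ∈ Icc (-(Real.pi / 3)) 0) :
    polar R θ ∈ decayRegion := by
  obtain ⟨h0, h1⟩ := wedge_bounds (R := R) hθ
  have e0 : 0 ≤ R ^ 2 / 2 * (θ - -(Real.pi / 3)) := mul_nonneg (by positivity) (by linarith [hθ.1])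
  have e1 : 0 ≤ R ^ 2 / 2 * (0 - θ) := mul_nonneg (by positivity) (by linarith [hθ.2])
  intro i
  fin_cases i
  · exact h0.trans (by linarith)
  · exact h1.trans (by linarith)
  · simp

/-- Positive time turns the bounds on the exponents into Gaussian decay in `R` with rate `t/2` per
unit of angle. -/
lemma expSum_polar_le {t R θ : ℝ} (ht : 0 < t) (hθ : θ ∈ Icc (-(Real.pi / 3)) 0) :
    R⁻¹ ^ 2 + expSum t (polar R θ) ≤ wedgeErr (t / 2) (-(Real.pi / 3)) 0 R θ := by
  obtain ⟨h0, h1⟩ := wedge_bounds (R := R) hθ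
  rw [expSum, wedgeErr, Complex.norm_exp, Complex.norm_exp, Complex.re_mul_ofReal,
    Complex.re_mul_ofReal, add_assoc]
  have m0 := mul_le_mul_of_nonneg_right h0 ht.le
  have m1 := mul_le_mul_of_nonneg_right h1 ht.le
  exact add_le_add le_rfl (add_le_add (Real.exp_le_exp.2 (by linarith))
    (Real.exp_le_exp.2 (by linarith)))

/-- Existence of contour integrals of entire functions decaying in the region of decay. -/
theorem exists_hasContourIntegral_of_decay {h : ℂ → ℂ} (hd : Differentiable ℂ h) {A : ℂ}
    {C K t : ℝ} (ht : 0 < t) (hC : 0 ≤ C)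
    (hb : ∀ k ∈ decayRegion, K ≤ ‖k‖ → ‖h k - A * k⁻¹‖ ≤ C * (‖k‖⁻¹ ^ 2 + expSum t k)) :
    ∃ X, HasContourIntegral (fun k => h (-k)) X ∧
      HasContourIntegral h (X + 2 * Real.pi * Complex.I / 3 * A) := by
  refine exists_hasContourIntegral hd (c := t / 2) (K := max K 0) (by positivity) hC
    (fun R hR θ hθ => ?_) fun R hR θ hθ => ?_
  · have hR0 : 0 ≤ R := (le_max_right _ _).trans hR
    have := hb _ (polar_mem_decayRegion (R := R) hθ)
      (by rw [norm_polar hR0]; exact (le_max_left _ _).trans hR)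
    rw [norm_polar hR0] at this
    exact this.trans (mul_le_mul_of_nonneg_left (expSum_polar_le ht hθ) hC)
  · have hR0 : 0 ≤ R := (le_max_right _ _).trans hR
    have hm : -polar R θ ∈ decayRegion := fun i => by
      rw [z_neg]; exact polar_mem_decayRegion hθ i
    have := hb _ hm (by rw [norm_neg, norm_polar hR0]; exact (le_max_left _ _).trans hR)
    rw [norm_neg, norm_polar hR0, inv_neg, mul_neg, sub_neg_eq_add, expSum, z_neg, ← expSum] at this
    exact this.trans (mul_le_mul_of_nonneg_left (expSum_polar_le ht hθ) hC)

/-- Contour integrals depend only on the values on the boundary of the sector. -/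
lemma HasContourIntegral.congr {f f' : ℂ → ℂ} {c : ℂ} (h : HasContourIntegral f c)
    (e : ∀ k, -k ∈ closedSector → f k = f' k) : HasContourIntegral f' c := by
  have e1 : ∀ ρ : ℝ, 0 ≤ ρ → f (-(ρ : ℂ)) = f' (-(ρ : ℂ)) := fun ρ hρ =>
    e _ (by rw [neg_neg]; exact ofReal_mem_closedSector hρ)
  have e2 : ∀ ρ : ℝ, 0 ≤ ρ → f (-ω * (ρ : ℂ)) = f' (-ω * (ρ : ℂ)) := fun ρ hρ => by
    refine e _ (sector_subset_closedSector ⟨ρ, 2 * Real.pi / 3, hρ, ⟨by positivity, le_rfl⟩, ?_⟩)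
    rw [polar, exp_two_pi_div_three]; ring
  have i1 : ∀ R : ℝ, 0 < R → EqOn (fun ρ : ℝ => f (-(ρ : ℂ))) (fun ρ => f' (-(ρ : ℂ))) (uIoc 0 R) :=
    fun R hR ρ hρ => by rw [uIoc_of_le hR.le] at hρ; exact e1 ρ hρ.1.le
  have i2 : ∀ R : ℝ, 0 < R →
      EqOn (fun ρ : ℝ => f (-ω * (ρ : ℂ))) (fun ρ => f' (-ω * (ρ : ℂ))) (uIoc 0 R) :=
    fun R hR ρ hρ => by rw [uIoc_of_le hR.le] at hρ; exact e2 ρ hρ.1.le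
  refine ⟨fun R hR => (h.1 R hR).congr (i1 R hR), fun R hR => (h.2.1 R hR).congr (i2 R hR),
    h.2.2.congr' ?_⟩
  filter_upwards [eventually_gt_atTop 0] with R hR
  congr 1
  · congr 1
    refine intervalIntegral.integral_congr fun ρ hρ => ?_
    rw [uIcc_of_le hR.le] at hρ
    simp only [e2 ρ hρ.1]
  · refine intervalIntegral.integral_congr fun ρ hρ => ?_
    rw [uIcc_of_le hR.le] at hρ
    simp only [e1 ρ hρ.1]

lemma HasContourIntegral.add {f f' : ℂ → ℂ} {c c' : ℂ} (h : HasContourIntegral f c)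
    (h' : HasContourIntegral f' c') : HasContourIntegral (fun k => f k + f' k) (c + c') := by
  refine ⟨fun R hR => (h.1 R hR).add (h'.1 R hR), fun R hR => (h.2.1 R hR).add (h'.2.1 R hR),
    (h.2.2.add h'.2.2).congr' ?_⟩
  filter_upwards [eventually_gt_atTop 0] with R hR
  simp only [intervalIntegral.integral_mul_const]
  rw [intervalIntegral.integral_add (h.1 R hR) (h'.1 R hR),
    intervalIntegral.integral_add (h.2.1 R hR) (h'.2.1 R hR)]
  ring

lemma HasContourIntegral.neg {f : ℂ → ℂ} {c : ℂ} (h : HasContourIntegral f c) :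
    HasContourIntegral (fun k => -f k) (-c) := by
  refine ⟨fun R hR => (h.1 R hR).neg, fun R hR => (h.2.1 R hR).neg, h.2.2.neg.congr fun R => ?_⟩
  simp only [intervalIntegral.integral_mul_const, intervalIntegral.integral_neg]
  ring

end

noncomputable section

/-! ### The global relation and the unknown boundary values -/

variable {T : ℝ} {f g : ℝ × ℝ → ℂ} {b : BoundaryValues}

/-- The hypotheses on the initial data: they are the values of the solution at `t = 0`, and `s₃₃`
has no zeros. -/
structure InitialData (f g : ℝ × ℝ → ℂ) (q₀ r₀ : ℝ → ℂ) : Prop where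
  left : ∀ x, 0 ≤ x → f (x, 0) = q₀ x
  right : ∀ x, 0 ≤ x → g (x, 0) = r₀ x
  ne_zero : ∀ k ∈ closedSector, s q₀ r₀ 2 2 k ≠ 0

variable {q₀ r₀ : ℝ → ℂ}

lemma InitialData.s_eq (hi : InitialData f g q₀ r₀) (h : LaxData T f g) {k : ℂ}
    (hk : k ∈ closedSector) (i : Fin 3) : s q₀ r₀ i 2 k = stripSol f g k 0 0 i := by
  obtain ⟨M, hM⟩ := h.reg_left.decayPair h.reg_right
  exact (hM 0 ⟨le_rfl, h.pos.le⟩).s_eq (fun x hx => (hi.left x hx).symm)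
    (fun x hx => (hi.right x hx).symm) hk i

lemma LaxData.differentiableOn_stripSol (h : LaxData T f g) {t : ℝ} (ht : t ∈ Icc 0 T)
    (i : Fin 3) : DifferentiableOn ℂ (fun k => stripSol f g k t 0 i) closedSector := by
  obtain ⟨M, hM⟩ := h.reg_left.decayPair h.reg_right
  exact (hM t ht).differentiableOn_spaceSol 0 i

/-- The global relation. -/
theorem LaxBdry.global_relation (h : LaxBdry T f g b) {k : ℂ} (hk : k ∈ closedSector) {t : ℝ}
    (ht : t ∈ Icc 0 T) : stripSol f g k t 0 = (fundMat (timeCol T b) k t).mulVec fun m =>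
      Complex.exp ((z k m - z k 2) * (t : ℂ)) * stripSol f g k 0 0 m := by
  have hb := h.smoothBdry.contBdry
  obtain ⟨-, -, -, h4⟩ := hb.timeCol_spec
  obtain ⟨h5, h6⟩ := (isTimeEigenfunction_iff hb ⟨le_rfl, hb.nonneg⟩).1 (h4 k)
  have := (h.isODESol hk).unique (IsODESol.mulVec_exp h5 2 0 (stripSol f g k 0 0))
    (hb.continuousOn_bdryV k) (Or.inl rfl) (by rw [h6]; simp) ht
  simpa using this

/-- The first row of the global relation at `-k`, divided by `s₃₃(-k)`: the third column of `μ₂`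
contributes `Φ₁(t,-k)`, and the first two, expressed by rotation, make up `G₁`. -/
lemma InitialData.G₁_eq (hi : InitialData f g q₀ r₀) (h : LaxBdry T f g b) {k : ℂ}
    (hk : -k ∈ closedSector) {t : ℝ} (ht : t ∈ Icc 0 T) : G₁ T q₀ r₀ b t k =
      stripSol f g (-k) t 0 0 / s q₀ r₀ 2 2 (-k) - timeCol T b (-k) t 0 := by
  have hs := hi.ne_zero _ hk
  have := congr_fun (h.global_relation hk ht) 0
  simp only [Matrix.mulVec, dotProduct, Fin.sum_univ_three, ← hi.s_eq h.data hk, z_neg] at this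
  rw [this, G₁]
  field_simp
  simp [fundMat, timeCol, Φ₃, Φ₂]
  ring

lemma InitialData.G₂_eq (hi : InitialData f g q₀ r₀) (h : LaxBdry T f g b) {k : ℂ}
    (hk : -k ∈ closedSector) {t : ℝ} (ht : t ∈ Icc 0 T) : G₂ T q₀ r₀ b t k =
      stripSol f g (-k) t 0 1 / s q₀ r₀ 2 2 (-k) - timeCol T b (-k) t 1 := by
  have hs := hi.ne_zero _ hk
  have := congr_fun (h.global_relation hk ht) 1
  simp only [Matrix.mulVec, dotProduct, Fin.sum_univ_three, ← hi.s_eq h.data hk, z_neg] at this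
  rw [this, G₂]
  field_simp
  simp [fundMat, timeCol, Φ₃, Φ₁]
  ring

/-- Division of asymptotic expansions. -/
lemma norm_div_sub_le {c σ a β m κ : ℂ} {C : ℝ} (hC : 0 ≤ C) (hκ : ‖κ‖ ≤ 1)
    (hc : ‖c - (a * κ + β * κ ^ 2)‖ ≤ C * ‖κ‖ ^ 3) (hσ : ‖σ - (1 + m * κ)‖ ≤ C * ‖κ‖ ^ 2)
    (hκ' : ‖κ‖ * (2 * (‖m‖ + C)) ≤ 1) :
    ‖c / σ - (a * κ + (β - a * m) * κ ^ 2)‖ ≤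
      2 * (C + ‖β - a * m‖ * ‖m‖ + (‖a‖ + ‖β - a * m‖) * C) * ‖κ‖ ^ 3 := by
  set δ := β - a * m with hδ
  set x := ‖κ‖ with hx
  have hx0 : 0 ≤ x := norm_nonneg _
  have h1 : 1 / 2 ≤ ‖σ‖ := by
    have e : (1 : ℂ) = σ - (σ - (1 + m * κ)) - m * κ := by ring
    have n : (1 : ℝ) ≤ ‖σ‖ + C * x ^ 2 + ‖m‖ * x := by
      calc (1 : ℝ) = ‖σ - (σ - (1 + m * κ)) - m * κ‖ := by rw [← e, norm_one]
        _ ≤ ‖σ‖ + ‖σ - (1 + m * κ)‖ + ‖m * κ‖ :=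
          (norm_sub_le _ _).trans (add_le_add (norm_sub_le _ _) le_rfl)
        _ ≤ _ := by rw [norm_mul]; gcongr
    have : C * x ^ 2 ≤ C * x := mul_le_mul_of_nonneg_left (by nlinarith) hC
    linarith
  have h0 : σ ≠ 0 := norm_pos_iff.1 (by linarith)
  have e : c / σ - (a * κ + δ * κ ^ 2) = ((c - (a * κ + β * κ ^ 2)) - δ * m * κ ^ 3 -
      (a * κ + δ * κ ^ 2) * (σ - (1 + m * κ))) / σ := by
    rw [eq_div_iff h0, sub_mul, div_mul_cancel₀ _ h0, hδ]; ring
  have n1 : ‖a * κ + δ * κ ^ 2‖ ≤ (‖a‖ + ‖δ‖) * x := by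
    refine (norm_add_le _ _).trans ?_
    rw [norm_mul, norm_mul, norm_pow]
    have : ‖δ‖ * x ^ 2 ≤ ‖δ‖ * x := mul_le_mul_of_nonneg_left (by nlinarith) (norm_nonneg _)
    linarith
  have n2 : ‖(c - (a * κ + β * κ ^ 2)) - δ * m * κ ^ 3 -
      (a * κ + δ * κ ^ 2) * (σ - (1 + m * κ))‖ ≤
      (C + ‖δ‖ * ‖m‖ + (‖a‖ + ‖δ‖) * C) * x ^ 3 := by
    refine (norm_sub_le _ _).trans ?_
    have n3 := norm_sub_le (c - (a * κ + β * κ ^ 2)) (δ * m * κ ^ 3)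
    rw [norm_mul (δ * m), norm_mul δ, norm_pow] at n3
    have n4 := mul_le_mul n1 hσ (norm_nonneg _) (by positivity)
    rw [norm_mul]
    linarith
  rw [e, norm_div, div_le_iff₀ (by linarith)]
  refine n2.trans ?_
  have : 0 ≤ (C + ‖δ‖ * ‖m‖ + (‖a‖ + ‖δ‖) * C) * x ^ 3 := by positivity
  nlinarith

/-- Expansion of the quotient of the space column by `s₃₃`. -/
theorem InitialData.ratio_asymptotics (hi : InitialData f g q₀ r₀) (h : LaxBdry T f g b) {t : ℝ}
    (ht : t ∈ Icc 0 T) : ∃ C K, 1 ≤ K ∧ ∀ k ∈ closedSector, K ≤ ‖k‖ →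
      ‖stripSol f g k t 0 0 / s q₀ r₀ 2 2 k -
        (firstLead b t * k⁻¹ + firstSub b (thirdCoeff b t) t * k⁻¹ ^ 2)‖ ≤ C * ‖k‖⁻¹ ^ 3 ∧
      ‖stripSol f g k t 0 1 / s q₀ r₀ 2 2 k -
        (secondLead b t * k⁻¹ + secondSub b (thirdCoeff b t) t * k⁻¹ ^ 2)‖ ≤ C * ‖k‖⁻¹ ^ 3 := by
  obtain ⟨m, C, hC0, hm, hC⟩ := h.space_asymptotics
  have hmt := h.thirdCoeff_eq hC0 hm hC ht
  -- Dividing by `1 + m(0)/k + ⋯` subtracts `m(0)` times the leading coefficient. As the second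
  -- coefficient is affine in `m` with that slope, `m(t)` is replaced by its increment and the
  -- nonlocal constant disappears.
  have e1 : firstSub b (thirdCoeff b t) t = firstSub b (m t) t - firstLead b t * m 0 := by
    rw [hmt]; unfold firstSub firstLead; ring
  have e2 : secondSub b (thirdCoeff b t) t = secondSub b (m t) t - secondLead b t * m 0 := by
    rw [hmt]; unfold secondSub secondLead; ring
  rw [e1, e2]
  let D : ℂ → ℂ → ℝ := fun a β => 2 * (C + ‖β - a * m 0‖ * ‖m 0‖ + (‖a‖ + ‖β - a * m 0‖) * C)
  have hK0 : 0 ≤ 2 * (‖m 0‖ + C) := by positivity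
  refine ⟨max (D (firstLead b t) (firstSub b (m t) t)) (D (secondLead b t) (secondSub b (m t) t)),
    1 + 2 * (‖m 0‖ + C), by linarith, fun k hk hkK => ?_⟩
  have hk1 : 1 ≤ ‖k‖ := by linarith
  have hx1 : ‖k‖⁻¹ ≤ 1 := inv_le_one_of_one_le₀ hk1
  have hxK : ‖k‖⁻¹ * (2 * (‖m 0‖ + C)) ≤ 1 := by
    rw [inv_mul_le_iff₀ (by linarith), mul_one]; linarith
  rw [← norm_inv] at hx1 hxK
  obtain ⟨a1, a2, -⟩ := hC t ht k hk hk1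
  obtain ⟨-, -, a3⟩ := hC 0 ⟨le_rfl, h.data.pos.le⟩ k hk hk1
  rw [← hi.s_eq h.data hk] at a3
  rw [← norm_inv] at a1 a2 a3 ⊢
  exact ⟨(norm_div_sub_le hC0 hx1 a1 a3 hxK).trans
      (mul_le_mul_of_nonneg_right (le_max_left _ _) (by positivity)),
    (norm_div_sub_le hC0 hx1 a2 a3 hxK).trans
      (mul_le_mul_of_nonneg_right (le_max_right _ _) (by positivity))⟩

/-- The expansions of the third column of `μ₂` at a fixed time. -/
theorem SmoothBdry.timeCol_asymptotics (h : SmoothBdry T b) {t : ℝ} (ht : t ∈ Icc 0 T) :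
    ∃ C K, 0 ≤ C ∧ 1 ≤ K ∧ ∀ k ∈ decayRegion, K ≤ ‖k‖ →
      ‖timeCol T b k t 0 - (firstLead b t * k⁻¹ + firstSub b (thirdCoeff b t) t * k⁻¹ ^ 2)‖ ≤
        C * (‖k‖⁻¹ ^ 3 + ‖k‖⁻¹ * expSum t k) ∧
      ‖timeCol T b k t 1 - (secondLead b t * k⁻¹ + secondSub b (thirdCoeff b t) t * k⁻¹ ^ 2)‖ ≤
        C * (‖k‖⁻¹ ^ 3 + ‖k‖⁻¹ * expSum t k) ∧
      ‖timeCol T b k t 2 - (1 + thirdCoeff b t * k⁻¹)‖ ≤ C * ‖k‖⁻¹ ^ 2 := by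
  obtain ⟨s1, s2, -, -⟩ := h.contBdry.timeCol_spec
  obtain ⟨K, hK, h2, hj⟩ := h.asymptotics s1 s2
  obtain ⟨A, hA⟩ := Asymptotics.isBigO_principal.1 h2
  obtain ⟨B₀, hB₀⟩ := Asymptotics.isBigO_principal.1 (hj 0 (by decide))
  obtain ⟨B₁, hB₁⟩ := Asymptotics.isBigO_principal.1 (hj 1 (by decide))
  obtain ⟨g1, g2, g3, g4, g5⟩ := gauge_coeffs b t
  refine ⟨|A| + |B₀| + |B₁|, K, by positivity, hK, fun k hk hkK => ?_⟩
  have hp : (t, k) ∈ decaySet T K := ⟨ht, hkK, hk⟩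
  have n0 : ∀ {B : ℝ}, |B| ≤ |A| + |B₀| + |B₁| → B ≤ |A| + |B₀| + |B₁| := (le_abs_self _).trans
  have f0 := hB₀ _ hp
  have f1 := hB₁ _ hp
  have f2 := hA _ hp
  simp only [Real.norm_of_nonneg (errScale_nonneg _ _), g2, g3, g4, g5] at f0 f1
  have a0 := abs_nonneg A; have a1 := abs_nonneg B₀; have a2 := abs_nonneg B₁
  refine ⟨f0.trans (mul_le_mul_of_nonneg_right (n0 (by linarith)) (errScale_nonneg 3 (t, k))),
    f1.trans (mul_le_mul_of_nonneg_right (n0 (by linarith)) (errScale_nonneg 3 (t, k))), ?_⟩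
  rw [norm_pow, norm_inv] at f2
  rw [← g1, neg_mul, ← sub_eq_add_neg]
  exact f2.trans (mul_le_mul_of_nonneg_right (n0 (by linarith)) (by positivity))

/-- Prepares the two integrands, `w` for the Dirichlet values and `k w - a` for the Neumann values.
The factor `1/k` in front of the exponential error is just enough to allow the multiplication by
`k`. -/
lemma norm_sub_lead_le {w a β k : ℂ} {C E : ℝ} (hC : 0 ≤ C) (hE : 0 ≤ E) (hk : 1 ≤ ‖k‖)
    (h : ‖w - (a * k⁻¹ + β * k⁻¹ ^ 2)‖ ≤ C * (‖k‖⁻¹ ^ 3 + ‖k‖⁻¹ * E)) :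
    ‖w - a * k⁻¹‖ ≤ (C + ‖β‖) * (‖k‖⁻¹ ^ 2 + E) ∧
    ‖(k * w - a) - β * k⁻¹‖ ≤ (C + ‖β‖) * (‖k‖⁻¹ ^ 2 + E) := by
  have hk0 : k ≠ 0 := norm_pos_iff.1 (by linarith)
  set x := ‖k‖⁻¹ with hx
  have hx0 : 0 ≤ x := by positivity
  have hx1 : x ≤ 1 := inv_le_one_of_one_le₀ hk
  have hkx : ‖k‖ * x = 1 := mul_inv_cancel₀ (by positivity)
  have hβ := norm_nonneg β
  constructor
  · have e : w - a * k⁻¹ = (w - (a * k⁻¹ + β * k⁻¹ ^ 2)) + β * k⁻¹ ^ 2 := by ring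
    rw [e]
    refine (norm_add_le _ _).trans ?_
    rw [norm_mul, norm_pow, norm_inv]
    have h1 : C * (x ^ 3 + x * E) ≤ C * (x ^ 2 + E) := by
      refine mul_le_mul_of_nonneg_left (add_le_add ?_ ?_) hC
      · exact pow_le_pow_of_le_one hx0 hx1 (by norm_num)
      · exact mul_le_of_le_one_left hE hx1
    have h2 : ‖β‖ * x ^ 2 ≤ ‖β‖ * (x ^ 2 + E) := mul_le_mul_of_nonneg_left (by linarith) hβ
    linarith
  · have e : (k * w - a) - β * k⁻¹ = k * (w - (a * k⁻¹ + β * k⁻¹ ^ 2)) := by field_simp; ring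
    rw [e, norm_mul]
    have h1 := mul_le_mul_of_nonneg_left h (norm_nonneg k)
    have h2 : ‖k‖ * (C * (x ^ 3 + x * E)) = C * (x ^ 2 + E) := by
      linear_combination C * (x ^ 2 + E) * hkx
    have h3 : 0 ≤ ‖β‖ * (x ^ 2 + E) := by positivity
    linarith

lemma expSum_nonneg (t : ℝ) (k : ℂ) : 0 ≤ expSum t k := by unfold expSum; positivity

/-- The contour integrals that determine the coefficients `a` and `β` of the expansion of an entry
`φ` of the third column of `μ₂`, given the entry `c` of the space column. -/
theorem exists_contour_integrals {φ c G σ : ℂ → ℂ} {a β : ℂ} {C C' K K' t : ℝ} (ht : 0 < t)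
    (hφ : Differentiable ℂ φ) (hc : DifferentiableOn ℂ c closedSector)
    (hσ : DifferentiableOn ℂ σ closedSector) (hσ0 : ∀ k ∈ closedSector, σ k ≠ 0) (hC : 0 ≤ C)
    (hK : 1 ≤ K) (hK' : 1 ≤ K')
    (hφa : ∀ k ∈ decayRegion, K ≤ ‖k‖ →
      ‖φ k - (a * k⁻¹ + β * k⁻¹ ^ 2)‖ ≤ C * (‖k‖⁻¹ ^ 3 + ‖k‖⁻¹ * expSum t k))
    (hca : ∀ k ∈ closedSector, K' ≤ ‖k‖ →
      ‖c k / σ k - (a * k⁻¹ + β * k⁻¹ ^ 2)‖ ≤ C' * ‖k‖⁻¹ ^ 3)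
    (hG : ∀ k, -k ∈ closedSector → G k = c (-k) / σ (-k) - φ (-k)) :
    (∃ I K, HasContourIntegral (fun k => k * oddPart φ k - 2 * a) I ∧
      HasContourIntegral (fun k => k * G k) K ∧ I - 2 * K = 2 * Real.pi * Complex.I * β) ∧
    ∃ I K, HasContourIntegral (evenPart φ) I ∧ HasContourIntegral G K ∧
      I + 2 * K = 2 * Real.pi * Complex.I * a := by
  have hE := expSum_nonneg t
  have hr : DifferentiableOn ℂ (fun k => c k / σ k) closedSector := hc.div hσ hσ0
  have hB : 0 ≤ C + ‖β‖ := by positivity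
  have hC'a : 0 ≤ |C'| := abs_nonneg C'
  have hca' : ∀ k ∈ closedSector, K' ≤ ‖k‖ →
      ‖c k / σ k - (a * k⁻¹ + β * k⁻¹ ^ 2)‖ ≤ |C'| * (‖k‖⁻¹ ^ 3 + ‖k‖⁻¹ * 0) := fun k hk hkK => by
    rw [mul_zero, add_zero]
    exact (hca k hk hkK).trans (mul_le_mul_of_nonneg_right (le_abs_self _) (by positivity))
  constructor
  -- With `h = kφ - a`, the odd-part integrand is `h(k) + h(-k)`, and on the contour `kG = F +
  -- h(-k)`. In `I - 2K` the unknown `X` cancels, leaving `2πiβ/3` from `h` and `4πiβ/3` from `F`.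
  · obtain ⟨X, hX, hX'⟩ := exists_hasContourIntegral_of_decay (h := fun k => k * φ k - a) (A := β)
      ((differentiable_id.mul hφ).sub_const a) ht hB (K := K) fun k hk hkK =>
        (norm_sub_lead_le hC (hE k) (hK.trans hkK) (hφa k hk hkK)).2
    have hF := hasContourIntegral_of_sector (F := fun k => k * (c (-k) / σ (-k)) + a) (A := β)
      (C := |C'| + ‖β‖) (K := K') (by
        simp only [neg_neg]
        exact (differentiable_neg.differentiableOn.mul hr).add_const a) fun k hk hkK => by
        have := (norm_sub_lead_le hC'a le_rfl (hK'.trans hkK) (hca' k hk hkK)).2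
        rw [add_zero] at this
        rw [neg_neg, ← norm_neg, show -(-k * (c k / σ k) + a + β * k⁻¹) =
          k * (c k / σ k) - a - β * k⁻¹ by ring]
        exact this
    refine ⟨_, _, (hX'.add hX).congr fun k _ => ?_, (hF.add hX).congr fun k hk => ?_, ?_⟩
    · simp only [oddPart]; ring
    · rw [hG k hk]; ring
    · ring
  -- Here `G = F - φ(-k)`, so `X` cancels in `I + 2K` instead, leaving the shares `2πia/3` and
  -- `4πia/3`.
  · obtain ⟨X, hX, hX'⟩ := exists_hasContourIntegral_of_decay (A := a) hφ ht hB (K := K)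
      fun k hk hkK => (norm_sub_lead_le hC (hE k) (hK.trans hkK) (hφa k hk hkK)).1
    have hF := hasContourIntegral_of_sector (F := fun k => c (-k) / σ (-k)) (A := -a)
      (C := |C'| + ‖β‖) (K := K') (by simpa only [neg_neg] using hr) fun k hk hkK => by
        have := (norm_sub_lead_le hC'a le_rfl (hK'.trans hkK) (hca' k hk hkK)).1
        rw [add_zero] at this
        rw [neg_neg, neg_mul, ← sub_eq_add_neg]
        exact this
    refine ⟨_, _, (hX'.add hX).congr fun k _ => ?_, (hF.add hX.neg).congr fun k hk => ?_, ?_⟩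
    · simp only [evenPart]
    · rw [hG k hk]; ring
    · ring

/-- Subtracting the limit `1` does not change the odd part, and the unknown value common to `φ(k) -
1` and `φ(-k) - 1` cancels in their difference. -/
theorem exists_contour_integral_odd {φ : ℂ → ℂ} {m : ℂ} {C K t : ℝ} (ht : 0 < t)
    (hφ : Differentiable ℂ φ) (hC : 0 ≤ C)
    (h : ∀ k ∈ decayRegion, K ≤ ‖k‖ → ‖φ k - (1 + m * k⁻¹)‖ ≤ C * ‖k‖⁻¹ ^ 2) :
    HasContourIntegral (oddPart φ) (2 * Real.pi * Complex.I / 3 * m) := by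
  obtain ⟨X, hX, hX'⟩ := exists_hasContourIntegral_of_decay (h := fun k => φ k - 1) (A := m)
    (hφ.sub_const 1) ht hC (K := K) fun k hk hkK => by
      have e : φ k - 1 - m * k⁻¹ = φ k - (1 + m * k⁻¹) := by ring
      rw [e]
      refine (h k hk hkK).trans (mul_le_mul_of_nonneg_left ?_ hC)
      linarith [expSum_nonneg t k]
  have := hX'.add hX.neg
  rw [show X + 2 * Real.pi * Complex.I / 3 * m + -X = 2 * Real.pi * Complex.I / 3 * m by ring] at this
  refine this.congr fun k _ => ?_
  simp only [oddPart]; ring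

end

/-! ### Solving for the unknown boundary values -/

noncomputable section

variable {T : ℝ} {f g : ℝ × ℝ → ℂ} {b : BoundaryValues} {q₀ r₀ : ℝ → ℂ}

lemma pi_ne : (Real.pi : ℂ) ≠ 0 := Complex.ofReal_ne_zero.2 Real.pi_ne_zero

lemma one_div_I_mul_sqrt3 : 1 / (Complex.I * (Real.sqrt 3 : ℂ)) = βc := by
  rw [I_mul_sqrt3, βc, div_eq_iff]
  · linear_combination (4 / 3 : ℂ) * ω_sq
  · rw [← I_mul_sqrt3]; exact mul_ne_zero Complex.I_ne_zero sqrt3_ne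

/-- The representations of the unknown boundary values. -/
theorem LaxBdry.boundary_values (h : LaxBdry T f g b) (hi : InitialData f g q₀ r₀) {t : ℝ}
    (ht : t ∈ Ioo 0 T) : (∃ I₁ I₂ I₃ K₁ K₂ : ℂ,
        HasContourIntegral (fun k => k * oddPart (Φ₂ T b t) k
          - 2 * b.g₀ t / (Complex.I * (Real.sqrt 3 : ℂ))) I₂ ∧
        HasContourIntegral (fun k => k * oddPart (Φ₁ T b t) k
          + 2 * ω * b.h₀ t / (Complex.I * (Real.sqrt 3 : ℂ))) I₁ ∧
        HasContourIntegral (oddPart (Φ₃ T b t)) I₃ ∧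
        HasContourIntegral (fun k => k * G₂ T q₀ r₀ b t k) K₂ ∧
        HasContourIntegral (fun k => k * G₁ T q₀ r₀ b t k) K₁ ∧
        b.g₁ t = 3 / (2 * (Real.pi : ℂ) * Complex.I) * I₂ - ω * b.h₀ t ^ 2
          + 3 * (Real.sqrt 3 : ℂ) * b.g₀ t / (2 * (Real.pi : ℂ)) * I₃
          - 3 / ((Real.pi : ℂ) * Complex.I) * K₂ ∧
        b.h₁ t = 3 * ω / (2 * (Real.pi : ℂ) * Complex.I) * I₁
          - ω ^ 2 * b.g₀ t ^ 2
          - 3 * (Real.sqrt 3 : ℂ) * ω ^ 2 * b.h₀ t / (2 * (Real.pi : ℂ)) * I₃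
          - 3 * ω / ((Real.pi : ℂ) * Complex.I) * K₁) ∧
      (∃ I₁ I₂ K₁ K₂ : ℂ,
        HasContourIntegral (evenPart (Φ₂ T b t)) I₂ ∧
        HasContourIntegral (evenPart (Φ₁ T b t)) I₁ ∧
        HasContourIntegral (G₂ T q₀ r₀ b t) K₂ ∧
        HasContourIntegral (G₁ T q₀ r₀ b t) K₁ ∧
        b.g₀ t = (Real.sqrt 3 : ℂ) / (2 * (Real.pi : ℂ)) * I₂
          + (Real.sqrt 3 : ℂ) / (Real.pi : ℂ) * K₂ ∧
        b.h₀ t = -(ω ^ 2 * (Real.sqrt 3 : ℂ) / (2 * (Real.pi : ℂ))) * I₁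
          - ω ^ 2 * (Real.sqrt 3 : ℂ) / (Real.pi : ℂ) * K₁) := by
  have ht' := Ioo_subset_Icc_self ht
  have hs := h.smoothBdry
  obtain ⟨-, -, hd, -⟩ := hs.contBdry.timeCol_spec
  obtain ⟨C, K, hC, hK, hφ⟩ := hs.timeCol_asymptotics ht'
  obtain ⟨C', K', hK', hc⟩ := hi.ratio_asymptotics h ht'
  have hσ : DifferentiableOn ℂ (fun k => s q₀ r₀ 2 2 k) closedSector :=
    (h.data.differentiableOn_stripSol ⟨le_rfl, h.data.pos.le⟩ 2).congr fun k hk =>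
      hi.s_eq h.data hk 2
  obtain ⟨⟨I₁, K₁, i1, k1, e1⟩, J₁, L₁, j1, l1, d1⟩ := exists_contour_integrals
    (G := G₁ T q₀ r₀ b t) (C' := C') ht.1 (hd t ht' 0) (h.data.differentiableOn_stripSol ht' 0) hσ
    hi.ne_zero hC hK hK' (fun k hk hkK => (hφ k hk hkK).1) (fun k hk hkK => (hc k hk hkK).1)
    fun k hk => hi.G₁_eq h hk ht'
  obtain ⟨⟨I₂, K₂, i2, k2, e2⟩, J₂, L₂, j2, l2, d2⟩ := exists_contour_integrals
    (G := G₂ T q₀ r₀ b t) (C' := C') ht.1 (hd t ht' 1) (h.data.differentiableOn_stripSol ht' 1) hσ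
    hi.ne_zero hC hK hK' (fun k hk hkK => (hφ k hk hkK).2.1) (fun k hk hkK => (hc k hk hkK).2)
    fun k hk => hi.G₂_eq h hk ht'
  have i3 := exists_contour_integral_odd (t := t) ht.1 (hd t ht' 2) hC
    fun k hk hkK => (hφ k hk hkK).2.2
  have hπ := pi_ne
  have hI := Complex.I_ne_zero
  have hI2 := Complex.I_sq
  have hω := ω_sq
  have ha : αc = -ω * βc := by unfold αc βc; linear_combination (-2 / 3 : ℂ) * ω_sq
  have nu : ∀ {I K w c : ℂ}, I - 2 * K = 2 * Real.pi * Complex.I * w →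
      3 * c / (2 * (Real.pi : ℂ) * Complex.I) * I - 3 * c / ((Real.pi : ℂ) * Complex.I) * K =
        3 * c * w := fun {I K w c} e => by
    have : 3 * c / (2 * (Real.pi : ℂ) * Complex.I) * I - 3 * c / ((Real.pi : ℂ) * Complex.I) * K =
        3 * c / (2 * (Real.pi : ℂ) * Complex.I) * (I - 2 * K) := by field_simp
    rw [this, e]; field_simp
  have di : ∀ {I K w c : ℂ}, I + 2 * K = 2 * Real.pi * Complex.I * w →
      c * (Real.sqrt 3 : ℂ) / (2 * (Real.pi : ℂ)) * I + c * (Real.sqrt 3 : ℂ) / (Real.pi : ℂ) * K =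
        c * ((2 * ω + 1) * w) := fun {I K w c} e => by
    have : c * (Real.sqrt 3 : ℂ) / (2 * (Real.pi : ℂ)) * I +
        c * (Real.sqrt 3 : ℂ) / (Real.pi : ℂ) * K =
        c * (Real.sqrt 3 : ℂ) / (2 * (Real.pi : ℂ)) * (I + 2 * K) := by field_simp
    rw [this, e, ← I_mul_sqrt3]; field_simp
  have th : ∀ c m : ℂ, 3 * (Real.sqrt 3 : ℂ) * c / (2 * (Real.pi : ℂ)) *
      (2 * Real.pi * Complex.I / 3 * m) = (2 * ω + 1) * c * m := fun c m => by
    rw [← I_mul_sqrt3]; field_simp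
  refine ⟨⟨I₁, I₂, _, K₁, K₂, ?_, ?_, i3, k2, k1, ?_, ?_⟩,
    J₁, J₂, L₁, L₂, j2, j1, l2, l1, ?_, ?_⟩
  · refine i2.congr fun k _ => congr_arg₂ _ rfl ?_
    rw [secondLead, ← one_div_I_mul_sqrt3]; ring
  · refine i1.congr fun k _ => ?_
    rw [firstLead, ha, ← one_div_I_mul_sqrt3, sub_eq_add_neg]
    exact congr_arg₂ _ rfl (by ring)
  -- Since `βc² = -1/3`, the second coefficient is `g₁/3` plus terms in the Dirichlet values and
  -- `thirdCoeff`, and the latter is supplied by the integral of the odd part of `Φ₃`.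
  · have p : b.g₁ t = 3 * 1 * secondSub b (thirdCoeff b t) t - ω * b.h₀ t ^ 2 +
        (2 * ω + 1) * b.g₀ t * thirdCoeff b t := by
      unfold secondSub αc βc; grind
    have n := nu (c := 1) e2
    rw [mul_one] at n
    linear_combination p - n - th (b.g₀ t) (thirdCoeff b t)
  · have p : b.h₁ t = 3 * ω * firstSub b (thirdCoeff b t) t - ω ^ 2 * b.g₀ t ^ 2 -
        (2 * ω + 1) * (ω ^ 2 * b.h₀ t) * thirdCoeff b t := by
      unfold firstSub αc βc; grind
    linear_combination p - nu (c := ω) e1 + th (ω ^ 2 * b.h₀ t) (thirdCoeff b t)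
  · have p : b.g₀ t = 1 * ((2 * ω + 1) * secondLead b t) := by
      unfold secondLead βc; grind
    linear_combination p - di (c := 1) d2
  · have p : b.h₀ t = -ω ^ 2 * ((2 * ω + 1) * firstLead b t) := by
      unfold firstLead αc; grind
    linear_combination p - di (c := -ω ^ 2) d1

end

end LaxIBV

/-! ### From a smooth decaying solution to the Lax data -/

theorem theorem5p1 :
    ∃ N : ℕ, ∀ (T : ℝ) (q r : ℝ → ℝ → ℂ) (q₀ r₀ : SchwartzMap ℝ ℂ) (b : LaxIBV.BoundaryValues),
      0 < T →
      LaxIBV.SmoothDecaying N T q → LaxIBV.SmoothDecaying N T r →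
      LaxIBV.SolvesSystem T q r →
      (∀ x : ℝ, 0 ≤ x → q x 0 = q₀ x ∧ r x 0 = r₀ x) →
      (∀ t ∈ Set.Icc 0 T, q 0 t = b.g₀ t ∧ r 0 t = b.h₀ t) →
      (∀ t ∈ Set.Icc 0 T, HasDerivWithinAt (fun x => q x t) (b.g₁ t) (Set.Ici 0) 0 ∧
        HasDerivWithinAt (fun x => r x t) (b.h₁ t) (Set.Ici 0) 0) →
      (∀ k ∈ LaxIBV.closedSector, LaxIBV.s q₀ r₀ 2 2 k ≠ 0) →
      -- `Φ₁, Φ₂, Φ₃` are the unique solution of the Volterra system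
      (∀ k : ℂ,
        LaxIBV.SolvesVolterra T b k (fun t => LaxIBV.Φ₁ T b t k) (fun t => LaxIBV.Φ₂ T b t k)
          (fun t => LaxIBV.Φ₃ T b t k) ∧
        ∀ φ₁ φ₂ φ₃ : ℝ → ℂ, LaxIBV.SolvesVolterra T b k φ₁ φ₂ φ₃ → ∀ t ∈ Set.Icc 0 T,
          φ₁ t = LaxIBV.Φ₁ T b t k ∧ φ₂ t = LaxIBV.Φ₂ T b t k ∧ φ₃ t = LaxIBV.Φ₃ T b t k) ∧
      -- the expression for `S(k)`
      (∃ A B C : ℂ → ℂ,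
        (∀ k, A k = LaxIBV.Φ₃ T b T (LaxIBV.ω ^ 2 * k) * LaxIBV.Φ₃ T b T (LaxIBV.ω * k)
          - LaxIBV.Φ₁ T b T (LaxIBV.ω ^ 2 * k) * LaxIBV.Φ₂ T b T (LaxIBV.ω * k)) ∧
        (∀ k, B k = -(LaxIBV.Φ₃ T b T (LaxIBV.ω ^ 2 * k) * LaxIBV.Φ₂ T b T k
            - LaxIBV.Φ₁ T b T (LaxIBV.ω ^ 2 * k) * LaxIBV.Φ₁ T b T k)
          * Complex.exp ((LaxIBV.z k 2 - LaxIBV.z k 1) * (T : ℂ))) ∧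
        (∀ k, C k = (LaxIBV.Φ₂ T b T (LaxIBV.ω * k) * LaxIBV.Φ₂ T b T k
            - LaxIBV.Φ₃ T b T (LaxIBV.ω * k) * LaxIBV.Φ₁ T b T k)
          * Complex.exp ((LaxIBV.z k 2 - LaxIBV.z k 0) * (T : ℂ))) ∧
        ∀ k, LaxIBV.S T b k =
          !![A (LaxIBV.ω ^ 2 * k), B (LaxIBV.ω * k), C k;
             C (LaxIBV.ω ^ 2 * k), A (LaxIBV.ω * k), B k;
             B (LaxIBV.ω ^ 2 * k), C (LaxIBV.ω * k), A k]) ∧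
      -- (a) the Neumann values for the Dirichlet problem
      (∀ t ∈ Set.Ioo 0 T, ∃ I₁ I₂ I₃ K₁ K₂ : ℂ,
        LaxIBV.HasContourIntegral (fun k => k * LaxIBV.oddPart (LaxIBV.Φ₂ T b t) k
          - 2 * b.g₀ t / (Complex.I * (Real.sqrt 3 : ℂ))) I₂ ∧
        LaxIBV.HasContourIntegral (fun k => k * LaxIBV.oddPart (LaxIBV.Φ₁ T b t) k
          + 2 * LaxIBV.ω * b.h₀ t / (Complex.I * (Real.sqrt 3 : ℂ))) I₁ ∧
        LaxIBV.HasContourIntegral (LaxIBV.oddPart (LaxIBV.Φ₃ T b t)) I₃ ∧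
        LaxIBV.HasContourIntegral (fun k => k * LaxIBV.G₂ T q₀ r₀ b t k) K₂ ∧
        LaxIBV.HasContourIntegral (fun k => k * LaxIBV.G₁ T q₀ r₀ b t k) K₁ ∧
        b.g₁ t = 3 / (2 * (Real.pi : ℂ) * Complex.I) * I₂ - LaxIBV.ω * b.h₀ t ^ 2
          + 3 * (Real.sqrt 3 : ℂ) * b.g₀ t / (2 * (Real.pi : ℂ)) * I₃
          - 3 / ((Real.pi : ℂ) * Complex.I) * K₂ ∧
        b.h₁ t = 3 * LaxIBV.ω / (2 * (Real.pi : ℂ) * Complex.I) * I₁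
          - LaxIBV.ω ^ 2 * b.g₀ t ^ 2
          - 3 * (Real.sqrt 3 : ℂ) * LaxIBV.ω ^ 2 * b.h₀ t / (2 * (Real.pi : ℂ)) * I₃
          - 3 * LaxIBV.ω / ((Real.pi : ℂ) * Complex.I) * K₁) ∧
      -- (b) the Dirichlet values for the Neumann problem
      (∀ t ∈ Set.Ioo 0 T, ∃ I₁ I₂ K₁ K₂ : ℂ,
        LaxIBV.HasContourIntegral (LaxIBV.evenPart (LaxIBV.Φ₂ T b t)) I₂ ∧
        LaxIBV.HasContourIntegral (LaxIBV.evenPart (LaxIBV.Φ₁ T b t)) I₁ ∧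
        LaxIBV.HasContourIntegral (LaxIBV.G₂ T q₀ r₀ b t) K₂ ∧
        LaxIBV.HasContourIntegral (LaxIBV.G₁ T q₀ r₀ b t) K₁ ∧
        b.g₀ t = (Real.sqrt 3 : ℂ) / (2 * (Real.pi : ℂ)) * I₂
          + (Real.sqrt 3 : ℂ) / (Real.pi : ℂ) * K₂ ∧
        b.h₀ t = -(LaxIBV.ω ^ 2 * (Real.sqrt 3 : ℂ) / (2 * (Real.pi : ℂ))) * I₁
          - LaxIBV.ω ^ 2 * (Real.sqrt 3 : ℂ) / (Real.pi : ℂ) * K₁) := by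
  -- Order four covers both needs: three `x`-derivatives of the potentials for the expansion in
  -- `1/k`, and decay `(1+x)⁻⁴` for the variation of the kernels in `k`.
  refine ⟨4, fun T q r q₀ r₀ b hT hq hr hsys hinit hD hN hs => ?_⟩
  have hf := hq.stripReg
  have hg := hr.stripReg
  have hc : 1 / (Real.sqrt 3 : ℂ) = -Complex.I * ((2 * LaxIBV.ω + 1) / 3) := by
    rw [← LaxIBV.I_div_sqrt3, neg_mul, mul_div_assoc', Complex.I_mul_I, neg_div, neg_neg]
  have hdata : LaxIBV.LaxData T (fun p => q p.1 p.2) fun p => r p.1 p.2 := by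
    refine ⟨hT, hf, hg, fun x t hx ht => ?_, fun x t hx ht => ?_⟩
    all_goals
      have ht' := Ioo_subset_Icc_self ht
      obtain ⟨h1, h2⟩ := hsys x t hx ht.1 ht.2
      rw [(hf.hasDerivAt_t hx.le ht).deriv, hf.iteratedDeriv_two hT hx ht',
        (hg.hasDerivAt_x hx ht').deriv, hc] at h1
      rw [(hg.hasDerivAt_t hx.le ht).deriv, hg.iteratedDeriv_two hT hx ht',
        (hf.hasDerivAt_x hx ht').deriv, hc] at h2
    · refine mul_left_cancel₀ Complex.I_ne_zero ?_
      linear_combination h1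
    · refine mul_left_cancel₀ Complex.I_ne_zero ?_
      linear_combination h2
  have huniq := uniqueDiffWithinAt_Ici (0 : ℝ)
  have hb : LaxIBV.LaxBdry T (fun p => q p.1 p.2) (fun p => r p.1 p.2) b :=
    { data := hdata
      g₀ := fun t ht => (hD t ht).1.symm
      h₀ := fun t ht => (hD t ht).2.symm
      g₁ := fun t ht => huniq.eq_deriv _ (hN t ht).1 (hf.hasDerivWithinAt_x le_rfl ht)
      h₁ := fun t ht => huniq.eq_deriv _ (hN t ht).2 (hg.hasDerivWithinAt_x le_rfl ht) }
  have hi : LaxIBV.InitialData (fun p => q p.1 p.2) (fun p => r p.1 p.2) q₀ r₀ :=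
    ⟨fun x hx => (hinit x hx).1, fun x hx => (hinit x hx).2, hs⟩
  have hcont := hb.smoothBdry.contBdry
  exact ⟨hcont.volterra_unique, hcont.S_formula, fun t ht => (hb.boundary_values hi ht).1,
    fun t ht => (hb.boundary_values hi ht).2⟩
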